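/- Consider the external-memory model: a computer has a constant number of processor registers, a fast memory of $M$ words, and an external memory of unlimited size divided into blocks of $B \ge 1$ words, where $M \ge 2B$. The processor operates only on registers and fast memory, free of charge; an IO is the transfer of one block between fast and external memory. Let $$\mathrm{Sort}(n) = \Big\lceil \frac nB \Big\rceil \cdot \max\Big(1, \log_{M/B} \frac nB\Big)$$ (for $n \ge M$ this is $\Theta\big(\frac nB \log_{M/B} \frac nB\big)$). An XML document with $N$ nodes is given in external memory as the sequence of its start tags (each carrying a label that fits in a word) and end tags, one word per tag. A word holds a natural number below $W$, where $W \ge K\,(N+M)$ for a suitable absolute constant $K$. The document tree has the elements as nodes, identified by their position in document order, and an edge from each parent to each of its children. Two nodes are backward bisimilar if they are bisimilar (related by a relation under which related nodes have equal labels and every child of either one is related to a child of the other) in the tree with all edges reversed. The 1-index consists of the partition of the nodes into backward-bisimilarity classes, together with the index graph whose nodes are the classes, each with the common label of its members, and which has an edge from class $A$ to class $B$ if and only if the tree has an edge from a node of $A$ to a node of $B$. **Theorem.** There is a single program, independent of the document and of $M$, $B$ and $W$, that computes the 1-index of every XML document with $N$ nodes in $O(\mathrm{Sort}(N))$ IOs,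 with an absolute constant in the $O$: it terminates with the list of all pairs (node, class), ordered by class, the labels of the classes, and the list of the edges of the index graph stored in external memory. -/

import Mathlib

/-! ### Labeled graphs and backward bisimilarity -/

/-- A graph with a directed edge relation (`Adj m n`: `n` is a child of `m`) and node labels. -/
structure LabeledGraph (V : Type) where
  Adj : V → V → Prop
  label : V → ℕ

namespace LabeledGraph

/-- The same graph with all edges reversed. -/
def reverse {V : Type} (G : LabeledGraph V) : LabeledGraph V where
  Adj := fun m n => G.Adj n m
  label := G.label

/-- `R` is a bisimulation between `G₁` and `G₂`. -/
def IsBisimulation {V₁ V₂ : Type} (G₁ : LabeledGraph V₁) (G₂ : LabeledGraph V₂)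
    (R : V₁ → V₂ → Prop) : Prop :=
  ∀ n₁ n₂, R n₁ n₂ →
    G₁.label n₁ = G₂.label n₂ ∧
    (∀ m₁, G₁.Adj n₁ m₁ → ∃ m₂, G₂.Adj n₂ m₂ ∧ R m₁ m₂) ∧
    (∀ m₂, G₂.Adj n₂ m₂ → ∃ m₁, G₁.Adj n₁ m₁ ∧ R m₁ m₂)

/-- Bisimilarity of nodes. On finite acyclic graphs this is the unique relation that satisfies
the recursive characterization "same label, and the children match up to bisimilarity". -/
def Bisimilar {V₁ V₂ : Type} (G₁ : LabeledGraph V₁) (G₂ : LabeledGraph V₂)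
    (n₁ : V₁) (n₂ : V₂) : Prop :=
  ∃ R, IsBisimulation G₁ G₂ R ∧ R n₁ n₂

/-- Backward bisimilarity: bisimilarity after reversing all edges. -/
def BackwardBisimilar {V : Type} (G : LabeledGraph V) (m n : V) : Prop :=
  Bisimilar G.reverse G.reverse m n

end LabeledGraph

/-- The 1-index of a graph: the backward bisimilarity classes, numbered `0, …, k - 1`, with their
members listed class by class, and the index graph on the classes, in which a class carries the
label of its members and there is an edge from class `a` to class `b` if and only if the original
graph has an edge from a member of `a` to a member of `b`. -/
structure OneIndex {V : Type} (G : LabeledGraph V) where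
  /-- the number of classes -/
  k : ℕ
  /-- the class of a node -/
  cls : V → Fin k
  cls_surjective : Function.Surjective cls
  cls_eq_iff : ∀ u v, cls u = cls v ↔ G.BackwardBisimilar u v
  /-- all pairs (node, its class), each once, ordered by class -/
  extents : List (V × Fin k)
  extents_nodup : extents.Nodup
  mem_extents : ∀ v c, (v, c) ∈ extents ↔ cls v = c
  extents_sorted : extents.Pairwise (fun p q => p.2 ≤ q.2)
  /-- the labels of the classes -/
  label : Fin k → ℕ
  label_cls : ∀ v, label (cls v) = G.label v
  /-- the edges of the index graph, each once -/
  edges : List (Fin k × Fin k)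
  edges_nodup : edges.Nodup
  mem_edges : ∀ a b, (a, b) ∈ edges ↔ ∃ u v, G.Adj u v ∧ cls u = a ∧ cls v = b

/-! ### XML documents -/

/-- A finite sequence of XML elements: `elem l c r` is an element with label `l` and
content `c`, followed by its further siblings `r`. -/
inductive XMLForest where
  | nil : XMLForest
  | elem (label : ℕ) (content rest : XMLForest) : XMLForest

namespace XMLForest

/-- The number of elements. -/
def size : XMLForest → ℕ
  | nil => 0
  | elem _ c r => 1 + c.size + r.size

/-- The labels of the elements in document order (the order of the start tags). -/
def labels : XMLForest → List ℕ
  | nil => []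
  | elem l c r => l :: (c.labels ++ r.labels)

/-- The parents of the elements in document order, where the elements are numbered consecutively
in document order from `i` on and `p` is the parent of the top-level elements. -/
def parents (p : Option ℕ) (i : ℕ) : XMLForest → List (Option ℕ)
  | nil => []
  | elem _ c r => p :: (parents (some i) (i + 1) c ++ parents p (i + 1 + c.size) r)

/-- The sequence of tags, one unit of data (word) per tag: a start tag with label `l` is
represented by `l + 1`, an end tag by `0`. -/
def tags : XMLForest → List ℕ
  | nil => []
  | elem l c r => (l + 1) :: (c.tags ++ 0 :: r.tags)

end XMLForest

/-- An XML document: a single root element. -/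
structure XMLDocument where
  rootLabel : ℕ
  content : XMLForest

namespace XMLDocument

/-- The document as a one-element sequence. -/
def toForest (D : XMLDocument) : XMLForest := .elem D.rootLabel D.content .nil

/-- The number `N` of nodes of the document tree. -/
def size (D : XMLDocument) : ℕ := D.toForest.size

/-- The labels of the nodes in document order. -/
def labels (D : XMLDocument) : List ℕ := D.toForest.labels

/-- The document as it is stored: its tags, in order. -/
def tags (D : XMLDocument) : List ℕ := D.toForest.tags

/-- The document tree. Nodes are identified by their position in document order,
edges lead from parents to children. -/
def graph (D : XMLDocument) : LabeledGraph (Fin D.size) where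
  Adj := fun m n => (D.toForest.parents none 0)[(n : ℕ)]? = some (some (m : ℕ))
  label := fun n => D.labels.getD n 0

end XMLDocument

/-! ### The external-memory machine -/

namespace ExtMem

/-- The parameters of the machine: the size `M` of the fast memory and the block size `B`, both
in words, and the number `W` of distinct words (a word is a natural number below `W`). -/
structure Params where
  M : ℕ
  B : ℕ
  W : ℕ

/-- A configuration: the processor registers, the fast memory, and the external memory, whose
block number `b` consists of the cells `b * B, …, b * B + B - 1`. A program names its registers
explicitly, so it uses only a constant number of them. -/
structure State where
  reg : ℕ → ℕ
  mem : ℕ → ℕ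
  ext : ℕ → ℕ

/-- Expressions that the processor can evaluate. They cannot refer to external memory. -/
inductive Expr where
  | const (n : ℕ) : Expr
  | reg (r : ℕ) : Expr
  | mem (addr : Expr) : Expr
  | add (a b : Expr) : Expr
  | sub (a b : Expr) : Expr
  | mul (a b : Expr) : Expr
  | div (a b : Expr) : Expr
  | mod (a b : Expr) : Expr
  | lt (a b : Expr) : Expr
  | eq (a b : Expr) : Expr

/-- The value of an expression; comparisons yield `1` or `0`. Cells of fast memory from address
`M` on can never be changed and hold `0` throughout. -/
def Expr.eval (s : State) : Expr → ℕ
  | const n => n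
  | reg r => s.reg r
  | mem a => s.mem (a.eval s)
  | add a b => a.eval s + b.eval s
  | sub a b => a.eval s - b.eval s
  | mul a b => a.eval s * b.eval s
  | div a b => a.eval s / b.eval s
  | mod a b => a.eval s % b.eval s
  | lt a b => if a.eval s < b.eval s then 1 else 0
  | eq a b => if a.eval s = b.eval s then 1 else 0

/-- Programs. A program is a fixed finite text, independent of the input and of `M`, `B`, `W`. -/
inductive Prog where
  | skip : Prog
  /-- set register `r` to the value of `e` -/
  | assign (r : ℕ) (e : Expr) : Prog
  /-- set the fast-memory cell with address `addr` to the value of `e` -/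
  | store (addr e : Expr) : Prog
  /-- an IO: copy external block number `blk` to fast memory, from address `addr` on -/
  | readBlock (blk addr : Expr) : Prog
  /-- an IO: copy `B` cells of fast memory, from address `addr` on, to external block `blk` -/
  | writeBlock (blk addr : Expr) : Prog
  | seq (p q : Prog) : Prog
  | ite (c : Expr) (p q : Prog) : Prog
  | while (c : Expr) (p : Prog) : Prog

/-- Change one register. -/
def State.setReg (s : State) (r v : ℕ) : State :=
  { s with reg := Function.update s.reg r v }

/-- Change one cell of fast memory; no effect outside the fast memory. -/
def State.setMem (m : Params) (s : State) (a v : ℕ) : State :=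
  { s with mem := fun i => if i = a ∧ i < m.M then v else s.mem i }

/-- Transfer external block `b` to the fast-memory cells `a, …, a + B - 1`. -/
def State.load (m : Params) (s : State) (b a : ℕ) : State :=
  { s with mem := fun i =>
      if a ≤ i ∧ i < a + m.B ∧ i < m.M then s.ext (b * m.B + (i - a)) else s.mem i }

/-- Transfer the fast-memory cells `a, …, a + B - 1` to external block `b`. -/
def State.save (m : Params) (s : State) (b a : ℕ) : State :=
  { s with ext := fun i =>
      if b * m.B ≤ i ∧ i < b * m.B + m.B then s.mem (a + (i - b * m.B)) else s.ext i }

/-- `Exec m p s t n`: on the machine with parameters `m`, program `p` started in configuration `s`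
terminates in configuration `t` after exactly `n` IOs. Stored values and block numbers are reduced
to words. Each block transfer costs one IO; the operations of the processor are free. -/
inductive Exec (m : Params) : Prog → State → State → ℕ → Prop where
  | skip (s : State) : Exec m .skip s s 0
  | assign (r : ℕ) (e : Expr) (s : State) :
      Exec m (.assign r e) s (s.setReg r (e.eval s % m.W)) 0
  | store (addr e : Expr) (s : State) :
      Exec m (.store addr e) s (s.setMem m (addr.eval s) (e.eval s % m.W)) 0
  | readBlock (blk addr : Expr) (s : State) :
      Exec m (.readBlock blk addr) s (s.load m (blk.eval s % m.W) (addr.eval s)) 1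
  | writeBlock (blk addr : Expr) (s : State) :
      Exec m (.writeBlock blk addr) s (s.save m (blk.eval s % m.W) (addr.eval s)) 1
  | seq {p q : Prog} {s t u : State} {i j : ℕ} :
      Exec m p s t i → Exec m q t u j → Exec m (.seq p q) s u (i + j)
  | ite_true {c : Expr} {p q : Prog} {s t : State} {i : ℕ} :
      c.eval s ≠ 0 → Exec m p s t i → Exec m (.ite c p q) s t i
  | ite_false {c : Expr} {p q : Prog} {s t : State} {i : ℕ} :
      c.eval s = 0 → Exec m q s t i → Exec m (.ite c p q) s t i
  | while_true {c : Expr} {p : Prog} {s t u : State} {i j : ℕ} :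
      c.eval s ≠ 0 → Exec m p s t i → Exec m (.while c p) t u j →
      Exec m (.while c p) s u (i + j)
  | while_false {c : Expr} {p : Prog} {s : State} :
      c.eval s = 0 → Exec m (.while c p) s s 0

/-- The initial configuration on a given input: the input is stored consecutively in external
memory from cell `0` on, registers `0`, `1`, `2` hold `M`, `B` and the length of the input, and
everything else is `0`. -/
def initial (m : Params) (input : List ℕ) : State where
  reg := fun r => if r = 0 then m.M else if r = 1 then m.B else if r = 2 then input.length else 0
  mem := fun _ => 0
  ext := fun i => input.getD i 0

/-- The list `L` is stored consecutively in external memory, from the beginning of block `b` on. -/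
def State.StoresAt (m : Params) (s : State) (b : ℕ) (L : List ℕ) : Prop :=
  ∀ (i : ℕ) (h : i < L.length), s.ext (b * m.B + i) = L[i]

/-- A 1-index (of a graph whose nodes are numbered) is stored in external memory as three files:
the records (node, class), the labels of the classes, and the records (class, class) of the edges
of the index graph. Registers `0`, `1`, `2` hold the numbers of the blocks at which the files
start, register `3` holds the number of classes, and register `4` the number of edges. -/
def State.StoresOneIndex (m : Params) (s : State) {n : ℕ} {G : LabeledGraph (Fin n)}
    (I : OneIndex G) : Prop :=
  s.StoresAt m (s.reg 0) (I.extents.flatMap fun p => [(p.1 : ℕ), (p.2 : ℕ)]) ∧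
  s.StoresAt m (s.reg 1) (List.ofFn I.label) ∧
  s.StoresAt m (s.reg 2) (I.edges.flatMap fun p => [(p.1 : ℕ), (p.2 : ℕ)]) ∧
  s.reg 3 = I.k ∧
  s.reg 4 = I.edges.length

/-- `Sort(n) = (n / B) * log_{M / B} (n / B)`, with the number of blocks rounded up and the
logarithm replaced by `1` where it is smaller, so that it is meaningful for small `n` too. -/
noncomputable def sortIOs (m : Params) (n : ℕ) : ℝ :=
  (⌈(n : ℝ) / m.B⌉₊ : ℝ) * max 1 (Real.logb ((m.M : ℝ) / m.B) ((n : ℝ) / m.B))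

end ExtMem

/-!
In a tree, two nodes are backward bisimilar if and only if they have equal labels and either both
are roots, or their parents are backward bisimilar. So the classes can be found level by level: the
class of a node is determined by its *key*, which consists of the class of its parent and its label
(`XMLDocument.cl_eq_iff_backwardBisimilar`).

*The algorithm* (`VProg.index`). A scan of the tags yields the records (depth, node, label), which
are sorted. Then the levels are processed from the top. The nodes of a level, and those of the level
above together with their classes, are both given in document order, and the parent of a node is the
last node before it in the level above; hence a simultaneous scan of the two files finds the keys.
When the records (class of the parent, label, node) are sorted, nodes of one class are adjacent; a
scan assigns the classes and appends to the three files of the index, which thereby are ordered by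
class. Each class but that of the root has exactly one incoming edge, which is written when the
class is opened. Finally the level is sorted back into document order. The invariant is
`PartialIndex`: the files hold the 1-index of the part of the tree that has been processed.

*The cost.* There may be as many levels as nodes, so a level of `n` nodes has to be processed in a
number of IOs proportional to `⌊n / b⌋`, not `⌈n / b⌉`, where `b` is the number of records in a
line. For this reason programs are written for a virtual machine (`VProg`) whose files are accessed
through slots that keep their current line: levels that are shorter than a line cost nothing, and
scans in which the file position only moves forward cost the number of lines passed. The sum of
`⌊n / b⌋` over the levels is at most `⌊N / b⌋`, and `wp_sort`, a merge sort that merges `K` runs at a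
time, transfers `O(⌊n / b⌋ * (1 + log_K (n / b)))` lines.

*The translation* (`reach_compile`). The slots are kept in the fast memory, and a line transfer is
implemented with at most twelve IOs, amortised with a potential of eight for each slot in use, which
pays for writing the line back. To be able to merge many runs, as many slots as possible are used if
`M / B` is large; if it is bounded, sixteen slots suffice, and lines are shorter than blocks by a
constant factor. If in addition `B` is bounded too, the slots may not fit into the fast memory, and
a constant number of registers is used in addition (`fm`). A virtual machine with `b` at least a
constant fraction of `B`, and with `K` at least a constant power of `M / B`, makes `O(sortIOs N)`
line transfers (`exists_rounds`).
-/

namespace ExtMem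

/-! ### A virtual machine with cached files -/

/-- Expressions of the virtual machine: arithmetic on its variables. -/
inductive VExpr where
  | const (n : ℕ) : VExpr
  | var (x : ℕ) : VExpr
  | add (a b : VExpr) : VExpr
  | sub (a b : VExpr) : VExpr
  | mul (a b : VExpr) : VExpr
  | div (a b : VExpr) : VExpr
  | mod (a b : VExpr) : VExpr
  | lt (a b : VExpr) : VExpr
  | eq (a b : VExpr) : VExpr

namespace VExpr

/-- The value of an expression under a valuation of the variables. -/
def eval (r : ℕ → ℕ) : VExpr → ℕ
  | const n => n
  | var x => r x
  | add a b => a.eval r + b.eval r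
  | sub a b => a.eval r - b.eval r
  | mul a b => a.eval r * b.eval r
  | div a b => a.eval r / b.eval r
  | mod a b => a.eval r % b.eval r
  | lt a b => if a.eval r < b.eval r then 1 else 0
  | eq a b => if a.eval r = b.eval r then 1 else 0

instance : Add VExpr := ⟨add⟩
instance : Sub VExpr := ⟨sub⟩
instance : Mul VExpr := ⟨mul⟩
instance : Div VExpr := ⟨div⟩
instance (n : ℕ) : OfNat VExpr n := ⟨const n⟩

/-- The minimum of two expressions. -/
def min (a b : VExpr) : VExpr := a * lt a b + b * (1 - lt a b)

variable (r : ℕ → ℕ) (a b : VExpr)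

@[simp] theorem eval_ofNat (n : ℕ) : (ofNat(n) : VExpr).eval r = n := (rfl)
@[simp] theorem eval_var (x : ℕ) : (var x).eval r = r x := (rfl)
@[simp] theorem eval_add : (a + b).eval r = a.eval r + b.eval r := (rfl)
@[simp] theorem eval_sub : (a - b).eval r = a.eval r - b.eval r := (rfl)
@[simp] theorem eval_mul : (a * b).eval r = a.eval r * b.eval r := (rfl)
@[simp] theorem eval_div : (a / b).eval r = a.eval r / b.eval r := (rfl)
@[simp] theorem eval_lt : (lt a b).eval r = if a.eval r < b.eval r then 1 else 0 := (rfl)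
@[simp] theorem eval_eq : (eq a b).eval r = if a.eval r = b.eval r then 1 else 0 := (rfl)

@[simp] theorem eval_min : (min a b).eval r = Min.min (a.eval r) (b.eval r) := by
  simp only [min, eval_add, eval_mul, eval_sub, eval_lt]
  split_ifs with h
  · rw [min_eq_left h.le]; simp
  · rw [min_eq_right (not_lt.mp h)]; simp

/-- Variables: the value is a word whenever all variables hold words. -/
def IsVar : VExpr → Prop
  | var _ => True
  | _ => False

end VExpr

/-- Programs of the virtual machine. Its external memory is organised in files `0, …, 7`, which are
arrays of words. Words are accessed through slots, each of which can hold one line of a file: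
`none` stands for the slot that belongs to the file, `some e` for the free slot `8 + e`. -/
inductive VProg where
  | skip : VProg
  | assign (x : ℕ) (e : VExpr) : VProg
  /-- read the word of local memory at index `e` -/
  | auxGet (x : ℕ) (e : VExpr) : VProg
  /-- write variable `x` to the word of local memory at index `e` -/
  | auxSet (e : VExpr) (x : ℕ) : VProg
  /-- set variable `x` to word `i` of file `f` -/
  | get (x f : ℕ) (σ : Option VExpr) (i : VExpr) : VProg
  /-- set word `i` of file `f` to the value of variable `x` -/
  | put (f : ℕ) (σ : Option VExpr) (i : VExpr) (x : ℕ) : VProg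
  | seq (p q : VProg) : VProg
  | ite (c : VExpr) (p q : VProg) : VProg
  | while (c : VExpr) (p : VProg) : VProg

/-- The slot used by an access to file `f`. -/
def slotOf (r : ℕ → ℕ) (f : ℕ) : Option VExpr → ℕ
  | none => f
  | some e => 8 + e.eval r

@[simp] theorem slotOf_none (r : ℕ → ℕ) (f : ℕ) : slotOf r f none = f := (rfl)
@[simp] theorem slotOf_some (r : ℕ → ℕ) (f : ℕ) (e : VExpr) :
    slotOf r f (some e) = 8 + e.eval r := (rfl)

/-- A configuration of the virtual machine: the variables, the local memory, the contents of the
files, the lines (file, number) that the slots hold, and the number of line transfers so far. -/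
structure VState where
  reg : ℕ → ℕ
  aux : ℕ → ℕ
  file : ℕ → ℕ → ℕ
  tag : ℕ → Option (ℕ × ℕ)
  cost : ℕ

/-- The parameters of the virtual machine: words are below `W`, there are `S` slots, a line consists
of `3 * b` words, and the words `0, …, cap - 1` of each file can be accessed. -/
structure VParams where
  W : ℕ
  S : ℕ
  b : ℕ
  cap : ℕ

namespace VState

/-- Set variable `x` to `v`. -/
def setReg (s : VState) (x v : ℕ) : VState := { s with reg := Function.update s.reg x v }

/-- Set a word of local memory. -/
def setAux (s : VState) (j v : ℕ) : VState := { s with aux := Function.update s.aux j v }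

/-- Set word `i` of file `f` to `v`. -/
def setFile (s : VState) (f i v : ℕ) : VState :=
  { s with file := Function.update s.file f (Function.update (s.file f) i v) }

/-- Bring line `l` of file `f` into slot `σ`; it is removed from all other slots. -/
def touch (s : VState) (σ f l : ℕ) : VState :=
  { s with
    tag := fun τ => if τ = σ then some (f, l) else if s.tag τ = some (f, l) then none else s.tag τ
    cost := s.cost + if s.tag σ = some (f, l) then 0 else 1 }

variable (s : VState) (x v j f i σ l : ℕ)

@[simp] theorem setReg_reg : (s.setReg x v).reg = Function.update s.reg x v := rfl
@[simp] theorem setReg_aux : (s.setReg x v).aux = s.aux := rfl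
@[simp] theorem setReg_file : (s.setReg x v).file = s.file := rfl
@[simp] theorem setReg_tag : (s.setReg x v).tag = s.tag := rfl
@[simp] theorem setReg_cost : (s.setReg x v).cost = s.cost := rfl
@[simp] theorem setAux_reg : (s.setAux x v).reg = s.reg := rfl
@[simp] theorem setAux_aux : (s.setAux x v).aux = Function.update s.aux x v := rfl
@[simp] theorem setAux_file : (s.setAux x v).file = s.file := rfl
@[simp] theorem setAux_tag : (s.setAux x v).tag = s.tag := rfl
@[simp] theorem setAux_cost : (s.setAux x v).cost = s.cost := rfl
@[simp] theorem setFile_reg : (s.setFile f i v).reg = s.reg := rfl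
@[simp] theorem setFile_aux : (s.setFile f i v).aux = s.aux := rfl
@[simp] theorem setFile_file : (s.setFile f i v).file =
    Function.update s.file f (Function.update (s.file f) i v) := rfl
@[simp] theorem setFile_tag : (s.setFile f i v).tag = s.tag := rfl
@[simp] theorem setFile_cost : (s.setFile f i v).cost = s.cost := rfl
@[simp] theorem touch_reg : (s.touch σ f l).reg = s.reg := rfl
@[simp] theorem touch_aux : (s.touch σ f l).aux = s.aux := rfl
@[simp] theorem touch_file : (s.touch σ f l).file = s.file := rfl
theorem touch_tag (τ : ℕ) : (s.touch σ f l).tag τ =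
    if τ = σ then some (f, l) else if s.tag τ = some (f, l) then none else s.tag τ := rfl
@[simp] theorem touch_tag_self : (s.touch σ f l).tag σ = some (f, l) := by simp [touch_tag]
theorem touch_cost : (s.touch σ f l).cost =
    s.cost + if s.tag σ = some (f, l) then 0 else 1 := rfl

theorem touch_cost_le : (s.touch σ f l).cost ≤ s.cost + 1 := by
  rw [touch_cost]; split_ifs <;> omega

/-- No line is held by two slots. -/
def TagsDistinct : Prop := ∀ σ τ p, s.tag σ = some p → s.tag τ = some p → σ = τ

theorem TagsDistinct.touch {s : VState} (h : s.TagsDistinct) (σ f l : ℕ) :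
    (s.touch σ f l).TagsDistinct := by
  intro τ ρ p
  simp only [touch_tag]
  have := h τ ρ
  split_ifs <;> simp_all
  · rintro rfl h'; simp_all
  · rintro h' rfl; simp_all
  · exact this _ _

/-- An access to a line that is already in the slot changes nothing. -/
theorem touch_of_tag (hd : s.TagsDistinct) (h : s.tag σ = some (f, l)) : s.touch σ f l = s := by
  have : (s.touch σ f l).tag = s.tag := by
    funext τ
    rw [touch_tag]
    split_ifs with h1 h2
    · rw [h1, h]
    · exact absurd (hd _ _ _ h2 h) h1
    · rfl
  have h2 : (s.touch σ f l).cost = s.cost := by simp [touch_cost, h]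
  cases s
  simp_all [touch]

end VState

open VState

/-- `wp P p Q s`: started in configuration `s`, program `p` respects the limits given by the
parameters `P` and terminates in a configuration that satisfies `Q`. -/
def wp (P : VParams) : VProg → (VState → Prop) → VState → Prop
  | .skip, Q, s => Q s
  | .assign x e, Q, s => (e.eval s.reg < P.W ∨ e.IsVar) ∧ Q (s.setReg x (e.eval s.reg))
  | .auxGet x e, Q, s => e.eval s.reg < P.S ∧ Q (s.setReg x (s.aux (e.eval s.reg)))
  | .auxSet e x, Q, s => e.eval s.reg < P.S ∧ Q (s.setAux (e.eval s.reg) (s.reg x))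
  | .get x f σ i, Q, s => f < 8 ∧ slotOf s.reg f σ < P.S ∧ i.eval s.reg < P.cap ∧
      Q ((s.touch (slotOf s.reg f σ) f (i.eval s.reg / (3 * P.b))).setReg x
        (s.file f (i.eval s.reg)))
  | .put f σ i x, Q, s => f < 8 ∧ slotOf s.reg f σ < P.S ∧ i.eval s.reg < P.cap ∧
      Q ((s.touch (slotOf s.reg f σ) f (i.eval s.reg / (3 * P.b))).setFile f (i.eval s.reg)
        (s.reg x))
  | .seq p q, Q, s => wp P p (wp P q Q) s
  | .ite c p q, Q, s => (c.eval s.reg ≠ 0 → wp P p Q s) ∧ (c.eval s.reg = 0 → wp P q Q s)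
  | .while c p, Q, s => ∃ n : ℕ, Nat.rec (motive := fun _ => VState → Prop)
      (fun s => c.eval s.reg = 0 ∧ Q s)
      (fun _ ih s => (c.eval s.reg = 0 ∧ Q s) ∨ (c.eval s.reg ≠ 0 ∧ wp P p ih s)) n s

variable {P : VParams} {p q : VProg} {Q Q' : VState → Prop} {s t : VState}

theorem wp_mono (h : wp P p Q s) (hQ : ∀ t, Q t → Q' t) : wp P p Q' s := by
  induction p generalizing Q Q' s with
  | skip => exact hQ _ h
  | assign x e => exact ⟨h.1, hQ _ h.2⟩
  | auxGet x e => exact ⟨h.1, hQ _ h.2⟩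
  | auxSet x e => exact ⟨h.1, hQ _ h.2⟩
  | get x f σ i => exact ⟨h.1, h.2.1, h.2.2.1, hQ _ h.2.2.2⟩
  | put x f σ i => exact ⟨h.1, h.2.1, h.2.2.1, hQ _ h.2.2.2⟩
  | seq p q ihp ihq => exact ihp h fun t ht => ihq ht hQ
  | ite c p q ihp ihq => exact ⟨fun hc => ihp (h.1 hc) hQ, fun hc => ihq (h.2 hc) hQ⟩
  | _ c p ih =>
    obtain ⟨n, hn⟩ := h
    refine ⟨n, ?_⟩
    induction n generalizing s with
    | zero => exact ⟨hn.1, hQ _ hn.2⟩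
    | succ n ihn =>
      rcases hn with hn | hn
      · exact Or.inl ⟨hn.1, hQ _ hn.2⟩
      · exact Or.inr ⟨hn.1, ih hn.2 fun t ht => ihn ht⟩

/-- The rule for loops: `I n` is an invariant, and the number `n` decreases in every iteration. -/
theorem wp_while {c : VExpr} (I : ℕ → VState → Prop)
    (hstep : ∀ n s, I n s → c.eval s.reg ≠ 0 → wp P p (fun t => ∃ k < n, I k t) s)
    (hexit : ∀ n s, I n s → c.eval s.reg = 0 → Q s) (n : ℕ) (h : I n s) :
    wp P (.while c p) Q s := by
  suffices H : ∀ n s, (∃ k ≤ n, I k s) → Nat.rec (motive := fun _ => VState → Prop)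
      (fun s => c.eval s.reg = 0 ∧ Q s)
      (fun _ ih s => (c.eval s.reg = 0 ∧ Q s) ∨ (c.eval s.reg ≠ 0 ∧ wp P p ih s)) n s from
    ⟨n, H n s ⟨n, le_rfl, h⟩⟩
  intro n
  induction n with
  | zero =>
    rintro s ⟨k, hk, hI⟩
    obtain rfl : k = 0 := by omega
    by_cases hc : c.eval s.reg = 0
    · exact ⟨hc, hexit _ _ hI hc⟩
    · exfalso
      -- a loop body cannot reach an impossible configuration
      have hf : ∀ (p : VProg) (s : VState), ¬ wp P p (fun _ => False) s := by
        intro p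
        induction p with
        | skip => exact fun s h => h
        | assign x e => exact fun s h => h.2
        | auxGet x e => exact fun s h => h.2
        | auxSet x e => exact fun s h => h.2
        | get x f σ i => exact fun s h => h.2.2.2
        | put x f σ i => exact fun s h => h.2.2.2
        | seq p q ihp ihq => exact fun s h => ihp s (wp_mono h fun t ht => ihq t ht)
        | ite c p q ihp ihq =>
          intro s h
          by_cases hc : c.eval s.reg = 0
          · exact ihq s (h.2 hc)
          · exact ihp s (h.1 hc)
        | _ c p ih =>
          rintro s ⟨n, hn⟩
          induction n generalizing s with
          | zero => exact hn.2
          | succ n ihn =>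
            rcases hn with hn | hn
            · exact hn.2
            · exact ih s (wp_mono hn.2 fun t ht => ihn t ht)
      exact hf p s (wp_mono (hstep 0 s hI hc) fun t ⟨k, hk, _⟩ => by omega)
  | succ n ih =>
    rintro s ⟨k, hk, hI⟩
    by_cases hc : c.eval s.reg = 0
    · exact Or.inl ⟨hc, hexit _ _ hI hc⟩
    · exact Or.inr ⟨hc, wp_mono (hstep k s hI hc) fun t ⟨j, hj, hI'⟩ => ih t ⟨j, by omega, hI'⟩⟩

/-! ### What a program leaves unchanged -/

namespace VProg

/-- Whether a program assigns to variable `x`. -/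
def writes (x : ℕ) : VProg → Bool
  | assign y _ | auxGet y _ | get y _ _ _ => y == x
  | seq p q | ite _ p q => p.writes x || q.writes x
  | .while _ p => p.writes x
  | _ => false

/-- Whether a program accesses file `f`. -/
def uses (f : ℕ) : VProg → Bool
  | get _ g _ _ | put g _ _ _ => g == f
  | seq p q | ite _ p q => p.uses f || q.uses f
  | .while _ p => p.uses f
  | _ => false

/-- Whether a program writes to file `f`. -/
def changes (f : ℕ) : VProg → Bool
  | put g _ _ _ => g == f
  | seq p q | ite _ p q => p.changes f || q.changes f
  | .while _ p => p.changes f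
  | _ => false

/-- `for x = 0, …, e - 1 do p`; the bound is evaluated before every iteration. -/
def forTo (x : ℕ) (e : VExpr) (p : VProg) : VProg :=
  .seq (.assign x 0) (.while (.lt (.var x) e) (.seq p (.assign x (.var x + 1))))

end VProg

/-- What holds between the configurations before and after an execution of `p`, by the text of `p`
alone. -/
structure Frame (p : VProg) (s t : VState) : Prop where
  reg : ∀ x, p.writes x = false → t.reg x = s.reg x
  file : ∀ f, p.changes f = false → t.file f = s.file f
  tag : ∀ f, f < 8 → p.uses f = false → ∀ l, s.tag f = some (f, l) → t.tag f = some (f, l)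
  distinct : s.TagsDistinct → t.TagsDistinct

theorem Frame.refl (p : VProg) (s : VState) : Frame p s s :=
  ⟨fun _ _ => rfl, fun _ _ => rfl, fun _ _ _ _ h => h, id⟩

theorem Frame.trans {p q r : VProg} {s t u : VState} (h : Frame p s t) (h' : Frame q t u)
    (hw : ∀ x, r.writes x = false → p.writes x = false ∧ q.writes x = false)
    (hc : ∀ x, r.changes x = false → p.changes x = false ∧ q.changes x = false)
    (hu : ∀ x, r.uses x = false → p.uses x = false ∧ q.uses x = false) : Frame r s u where
  reg x hx := (h'.reg x (hw x hx).2).trans (h.reg x (hw x hx).1)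
  file x hx := (h'.file x (hc x hx).2).trans (h.file x (hc x hx).1)
  tag f hf hx l hl := h'.tag f hf (hu f hx).2 l (h.tag f hf (hu f hx).1 l hl)
  distinct hd := h'.distinct (h.distinct hd)

theorem Frame.weaken {p r : VProg} {s t : VState} (h : Frame p s t)
    (hw : ∀ x, r.writes x = false → p.writes x = false)
    (hc : ∀ x, r.changes x = false → p.changes x = false)
    (hu : ∀ x, r.uses x = false → p.uses x = false) : Frame r s t :=
  ⟨fun x hx => h.reg x (hw x hx), fun x hx => h.file x (hc x hx),
    fun f hf hx => h.tag f hf (hu f hx), h.distinct⟩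

theorem touch_frame_tag {s : VState} {σ g l : ℕ} {o : Option VExpr} {r : ℕ → ℕ}
    (hσ : σ = slotOf r g o) {f : ℕ} (hf : f < 8) (hfg : g ≠ f) {k : ℕ}
    (h : s.tag f = some (f, k)) : (s.touch σ g l).tag f = some (f, k) := by
  have h1 : f ≠ σ := by
    cases o <;> simp at hσ <;> omega
  rw [touch_tag, if_neg h1, h, if_neg]
  simp only [Option.some.injEq, Prod.mk.injEq, not_and]
  intro h2; exact absurd h2.symm hfg

/-- Every specification can be strengthened by the frame of the program, because the frame can be
read off the text of the program. -/
theorem wp_frame (h : wp P p Q s) : wp P p (fun t => Q t ∧ Frame p s t) s := by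
  induction p generalizing Q s with
  | skip => exact ⟨h, Frame.refl _ _⟩
  | assign x e =>
    refine ⟨h.1, h.2, ⟨fun y hy => ?_, fun _ _ => rfl, fun _ _ _ _ h => h, id⟩⟩
    simp only [VProg.writes, beq_eq_false_iff_ne] at hy
    simp [Function.update_of_ne hy.symm]
  | auxGet x e =>
    refine ⟨h.1, h.2, ⟨fun y hy => ?_, fun _ _ => rfl, fun _ _ _ _ h => h, id⟩⟩
    simp only [VProg.writes, beq_eq_false_iff_ne] at hy
    simp [Function.update_of_ne hy.symm]
  | auxSet x e => exact ⟨h.1, h.2, ⟨fun y hy => rfl, fun _ _ => rfl, fun _ _ _ _ h => h, id⟩⟩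
  | get x f σ i =>
    refine ⟨h.1, h.2.1, h.2.2.1, h.2.2.2, ⟨fun y hy => ?_, fun _ _ => rfl, ?_, fun hd =>
      TagsDistinct.touch hd _ _ _⟩⟩
    · simp only [VProg.writes, beq_eq_false_iff_ne] at hy
      simp [Function.update_of_ne hy.symm]
    · intro g hg hu l hl
      simp only [VProg.uses, beq_eq_false_iff_ne] at hu
      exact touch_frame_tag rfl hg hu hl
  | put f σ i x =>
    refine ⟨h.1, h.2.1, h.2.2.1, h.2.2.2, ⟨fun y hy => rfl, fun g hg => ?_, ?_, fun hd =>
      TagsDistinct.touch hd _ _ _⟩⟩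
    · simp only [VProg.changes, beq_eq_false_iff_ne] at hg
      simp [Function.update_of_ne hg.symm]
    · intro g hg hu l hl
      simp only [VProg.uses, beq_eq_false_iff_ne] at hu
      exact touch_frame_tag rfl hg hu hl
  | seq p q ihp ihq =>
    refine wp_mono (p := p) (ihp h) fun t ht => wp_mono (p := q) (ihq ht.1) fun u hu => ⟨hu.1, ?_⟩
    exact ht.2.trans hu.2 (by simp [VProg.writes]) (by simp [VProg.changes])
      (by simp [VProg.uses])
  | ite c p q ihp ihq =>
    refine ⟨fun hc => wp_mono (ihp (h.1 hc)) fun t ht => ⟨ht.1, ht.2.weaken ?_ ?_ ?_⟩,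
      fun hc => wp_mono (ihq (h.2 hc)) fun t ht => ⟨ht.1, ht.2.weaken ?_ ?_ ?_⟩⟩ <;>
    simp +contextual [VProg.writes, VProg.changes, VProg.uses]
  | _ c p ih =>
    obtain ⟨n, hn⟩ := h
    refine ⟨n, ?_⟩
    induction n generalizing s with
    | zero => exact ⟨hn.1, hn.2, Frame.refl _ _⟩
    | succ n ihn =>
      rcases hn with hn | hn
      · exact Or.inl ⟨hn.1, hn.2, Frame.refl _ _⟩
      · refine Or.inr ⟨hn.1, wp_mono (ih hn.2) fun t ht => ?_⟩
        have := ihn ht.1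
        clear ihn hn
        -- the frame of the first iteration is passed through the remaining ones
        have key : ∀ n u, (Frame (.while c p) s u) →
            Nat.rec (motive := fun _ => VState → Prop)
            (fun v => c.eval v.reg = 0 ∧ (Q v ∧ Frame (.while c p) u v))
            (fun _ ih v => (c.eval v.reg = 0 ∧ (Q v ∧ Frame (.while c p) u v)) ∨
              (c.eval v.reg ≠ 0 ∧ wp P p ih v)) n t →
            Nat.rec (motive := fun _ => VState → Prop)
            (fun v => c.eval v.reg = 0 ∧ (Q v ∧ Frame (.while c p) s v))
            (fun _ ih v => (c.eval v.reg = 0 ∧ (Q v ∧ Frame (.while c p) s v)) ∨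
              (c.eval v.reg ≠ 0 ∧ wp P p ih v)) n t := by
          intro n u hu
          generalize t = t
          induction n generalizing t with
          | zero => exact fun h => ⟨h.1, h.2.1, hu.trans h.2.2 (by simp) (by simp) (by simp)⟩
          | succ n ihn =>
            rintro (h | h)
            · exact Or.inl ⟨h.1, h.2.1, hu.trans h.2.2 (by simp) (by simp) (by simp)⟩
            · exact Or.inr ⟨h.1, wp_mono h.2 fun v hv => ihn _ hv⟩
        exact key n t (ht.2.weaken (by simp [VProg.writes]) (by simp [VProg.changes])
          (by simp [VProg.uses])) this

/-- The rule of consequence, with the frame of the program. -/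
theorem wp_conseq (h : wp P p Q s) (hQ : ∀ t, Q t → Frame p s t → Q' t) : wp P p Q' s :=
  wp_mono (wp_frame h) fun t ht => hQ t ht.1 ht.2

/-- The rule for counting loops: `I k` holds before iteration `k`. -/
theorem wp_for {x : ℕ} {e : VExpr} (N : ℕ) (I : ℕ → VState → Prop)
    (hN : N < P.W) (h0 : I 0 (s.setReg x 0))
    (hbound : ∀ k s, k ≤ N → s.reg x = k → I k s → e.eval s.reg = N)
    (hstep : ∀ k s, k < N → s.reg x = k → I k s →
      wp P p (fun t => t.reg x = k ∧ I (k + 1) (t.setReg x (k + 1))) s)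
    (hexit : ∀ s, s.reg x = N → I N s → Q s) :
    wp P (VProg.forTo x e p) Q s := by
  refine ⟨Or.inl (by simp; omega), ?_⟩
  refine wp_while (fun n s => ∃ k, k ≤ N ∧ n = N - k ∧ s.reg x = k ∧ I k s) ?_ ?_ N
    ⟨0, by omega, rfl, by simp, h0⟩
  · rintro n s ⟨k, hk, rfl, hx, hI⟩ hc
    have hb := hbound k s hk hx hI
    simp only [VExpr.eval_lt, VExpr.eval_var, hx, hb, ne_eq, ite_eq_right_iff, one_ne_zero,
      imp_false, not_not] at hc
    refine wp_mono (p := p) (hstep k s hc hx hI) fun t ht =>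
      ⟨Or.inl ?_, N - (k + 1), by omega, k + 1, hc, rfl, ?_, ?_⟩
    · simp [ht.1]; omega
    · simp [ht.1]
    · simpa [ht.1] using ht.2
  · rintro n s ⟨k, hk, rfl, hx, hI⟩ hc
    have hb := hbound k s hk hx hI
    simp only [VExpr.eval_lt, VExpr.eval_var, hx, hb, ite_eq_right_iff, one_ne_zero,
      imp_false, not_lt] at hc
    obtain rfl : k = N := by omega
    exact hexit s hx hI

end ExtMem

namespace ExtMem

/-! ### Total correctness of machine programs -/

namespace Expr

instance : Add Expr := ⟨add⟩
instance : Sub Expr := ⟨sub⟩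
instance : Mul Expr := ⟨mul⟩
instance : Div Expr := ⟨div⟩
instance : Mod Expr := ⟨mod⟩
instance (n : ℕ) : OfNat Expr n := ⟨const n⟩

variable (s : State) (a b : Expr)

@[simp] theorem eval_const (n : ℕ) : (const n).eval s = n := (rfl)
@[simp] theorem eval_ofNat (n : ℕ) : (ofNat(n) : Expr).eval s = n := (rfl)
@[simp] theorem eval_reg (x : ℕ) : (reg x).eval s = s.reg x := (rfl)
@[simp] theorem eval_mem : (mem a).eval s = s.mem (a.eval s) := (rfl)
@[simp] theorem eval_add : (a + b).eval s = a.eval s + b.eval s := (rfl)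
@[simp] theorem eval_sub : (a - b).eval s = a.eval s - b.eval s := (rfl)
@[simp] theorem eval_mul : (a * b).eval s = a.eval s * b.eval s := (rfl)
@[simp] theorem eval_div : (a / b).eval s = a.eval s / b.eval s := (rfl)
@[simp] theorem eval_mod : (a % b).eval s = a.eval s % b.eval s := (rfl)
@[simp] theorem eval_lt : (lt a b).eval s = if a.eval s < b.eval s then 1 else 0 := (rfl)
@[simp] theorem eval_eq : (eq a b).eval s = if a.eval s = b.eval s then 1 else 0 := (rfl)

end Expr

@[simp] theorem State.setReg_reg (s : State) (r v : ℕ) :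
    (s.setReg r v).reg = Function.update s.reg r v := rfl
@[simp] theorem State.setReg_mem (s : State) (r v : ℕ) : (s.setReg r v).mem = s.mem := rfl
@[simp] theorem State.setReg_ext (s : State) (r v : ℕ) : (s.setReg r v).ext = s.ext := rfl
@[simp] theorem State.setMem_reg (m : Params) (s : State) (r v : ℕ) :
    (s.setMem m r v).reg = s.reg := rfl
theorem State.setMem_mem (m : Params) (s : State) (r v i : ℕ) :
    (s.setMem m r v).mem i = if i = r ∧ i < m.M then v else s.mem i := rfl
@[simp] theorem State.setMem_ext (m : Params) (s : State) (r v : ℕ) :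
    (s.setMem m r v).ext = s.ext := rfl
@[simp] theorem State.load_reg (m : Params) (s : State) (b a : ℕ) :
    (s.load m b a).reg = s.reg := rfl
theorem State.load_mem (m : Params) (s : State) (b a i : ℕ) : (s.load m b a).mem i =
    if a ≤ i ∧ i < a + m.B ∧ i < m.M then s.ext (b * m.B + (i - a)) else s.mem i := rfl
@[simp] theorem State.load_ext (m : Params) (s : State) (b a : ℕ) :
    (s.load m b a).ext = s.ext := rfl
@[simp] theorem State.save_reg (m : Params) (s : State) (b a : ℕ) :
    (s.save m b a).reg = s.reg := rfl
@[simp] theorem State.save_mem (m : Params) (s : State) (b a : ℕ) :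
    (s.save m b a).mem = s.mem := rfl
theorem State.save_ext (m : Params) (s : State) (b a i : ℕ) : (s.save m b a).ext i =
    if b * m.B ≤ i ∧ i < b * m.B + m.B then s.mem (a + (i - b * m.B)) else s.ext i := rfl

/-- Started in `s`, program `p` terminates in a configuration `t` after `n` IOs with `Q t n`. -/
def Reach (m : Params) (p : Prog) (Q : State → ℕ → Prop) (s : State) : Prop :=
  ∃ t n, Exec m p s t n ∧ Q t n

section Reach

variable {m : Params} {p q : Prog} {Q Q' : State → ℕ → Prop} {s : State}

theorem Reach.mono (h : Reach m p Q s) (hQ : ∀ t n, Q t n → Q' t n) : Reach m p Q' s :=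
  let ⟨t, n, he, hq⟩ := h
  ⟨t, n, he, hQ t n hq⟩

theorem reach_skip (h : Q s 0) : Reach m .skip Q s := ⟨s, 0, .skip s, h⟩

theorem reach_assign {r : ℕ} {e : Expr} (hW : e.eval s < m.W) (h : Q (s.setReg r (e.eval s)) 0) :
    Reach m (.assign r e) Q s :=
  ⟨_, 0, .assign r e s, by rwa [Nat.mod_eq_of_lt hW]⟩

theorem reach_store {a e : Expr} (hW : e.eval s < m.W)
    (h : Q (s.setMem m (a.eval s) (e.eval s)) 0) : Reach m (.store a e) Q s :=
  ⟨_, 0, .store a e s, by rwa [Nat.mod_eq_of_lt hW]⟩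

theorem reach_readBlock {a e : Expr} (hW : a.eval s < m.W)
    (h : Q (s.load m (a.eval s) (e.eval s)) 1) : Reach m (.readBlock a e) Q s :=
  ⟨_, 1, .readBlock a e s, by rwa [Nat.mod_eq_of_lt hW]⟩

theorem reach_writeBlock {a e : Expr} (hW : a.eval s < m.W)
    (h : Q (s.save m (a.eval s) (e.eval s)) 1) : Reach m (.writeBlock a e) Q s :=
  ⟨_, 1, .writeBlock a e s, by rwa [Nat.mod_eq_of_lt hW]⟩

theorem reach_seq (h : Reach m p (fun t i => Reach m q (fun u j => Q u (i + j)) t) s) :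
    Reach m (.seq p q) Q s :=
  let ⟨_, _, he, u, _, he', hq⟩ := h
  ⟨u, _, .seq he he', hq⟩

theorem reach_ite {c : Expr} (h1 : c.eval s ≠ 0 → Reach m p Q s)
    (h2 : c.eval s = 0 → Reach m q Q s) : Reach m (.ite c p q) Q s := by
  by_cases hc : c.eval s = 0
  · obtain ⟨t, n, he, hq⟩ := h2 hc
    exact ⟨t, n, .ite_false hc he, hq⟩
  · obtain ⟨t, n, he, hq⟩ := h1 hc
    exact ⟨t, n, .ite_true hc he, hq⟩

/-- The rule for loops: `I n t i` is an invariant of configuration `t` and the number `i` of IOs so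
far; `n` decreases in every iteration. -/
theorem reach_while {c : Expr} (I : ℕ → State → ℕ → Prop)
    (hstep : ∀ n s i, I n s i → c.eval s ≠ 0 → Reach m p (fun t j => ∃ k < n, I k t (i + j)) s)
    (hexit : ∀ n s i, I n s i → c.eval s = 0 → Q s i) (n : ℕ) (h : I n s 0) :
    Reach m (.while c p) Q s := by
  have key : ∀ n s i, I n s i → ∃ t j, Exec m (.while c p) s t j ∧ Q t (i + j) := by
    intro n
    induction n using Nat.strong_induction_on with
    | _ n ih =>
      intro s i hI
      by_cases hc : c.eval s = 0
      · exact ⟨s, 0, .while_false hc, hexit n s i hI hc⟩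
      · obtain ⟨t, j, he, k, hk, hI'⟩ := hstep n s i hI hc
        obtain ⟨u, j', he', hq⟩ := ih k hk t (i + j) hI'
        exact ⟨u, j + j', .while_true hc he he', by rwa [← add_assoc]⟩
  obtain ⟨t, j, he, hq⟩ := key n s 0 h
  exact ⟨t, j, he, by simpa using hq⟩

end Reach

/-! ### Fast memory beyond the buffer for one block -/

/-- The part of the fast memory that is not used as a buffer for block transfers, extended by 96
registers, so that it has room for a constant number of words even if blocks are very small. -/
def fm (m : Params) (s : State) (a : ℕ) : ℕ :=
  if a < 96 then s.reg (20 + a) else s.mem (m.B + (a - 96))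

/-- An expression for register `20 + a` if `a < n`, and `0` otherwise. -/
def selectReg (a : Expr) : ℕ → Expr
  | 0 => 0
  | n + 1 => selectReg a n + .eq a (.const n) * .reg (20 + n)

theorem eval_selectReg (s : State) (a : Expr) (n : ℕ) :
    (selectReg a n).eval s = if a.eval s < n then s.reg (20 + a.eval s) else 0 := by
  induction n with
  | zero => simp [selectReg]
  | succ n ih =>
    simp only [selectReg, Expr.eval_add, ih, Expr.eval_mul, Expr.eval_eq, Expr.eval_const,
      Expr.eval_reg]
    rcases lt_trichotomy (a.eval s) n with h | h | h
    · rw [if_pos h, if_neg h.ne, if_pos (by omega)]; simp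
    · simp [h]
    · rw [if_neg (by omega), if_neg h.ne', if_neg (by omega)]; simp

/-- An expression for a word of `fm`. Register `1` holds the block size. -/
def fmGet (a : Expr) : Expr := selectReg a 96 + (1 - .lt a 96) * .mem (.reg 1 + (a - 96))

theorem eval_fmGet {m : Params} {s : State} (h : s.reg 1 = m.B) (a : Expr) :
    (fmGet a).eval s = fm m s (a.eval s) := by
  simp only [fmGet, Expr.eval_add, eval_selectReg, Expr.eval_mul, Expr.eval_sub, Expr.eval_lt,
    Expr.eval_mem, Expr.eval_reg, Expr.eval_ofNat, fm, h]
  split_ifs <;> simp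

/-- Copy register `13` to register `20 + a`, where `a < n` is the value of register `12`. -/
def setSelectedReg : ℕ → Prog
  | 0 => .skip
  | n + 1 => .seq (setSelectedReg n)
      (.ite (.eq (.reg 12) (.const n)) (.assign (20 + n) (.reg 13)) .skip)

/-- Write register `13` to the word of `fm` whose address is in register `12`. -/
def fmSet : Prog := .seq (setSelectedReg 96)
  (.ite (.lt (.reg 12) 96) .skip (.store (.reg 1 + (.reg 12 - 96)) (.reg 13)))

theorem reach_setSelectedReg {m : Params} {s : State} (hW : s.reg 13 < m.W) (n : ℕ) :
    Reach m (setSelectedReg n) (fun t i => i = 0 ∧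
      t = if s.reg 12 < n then s.setReg (20 + s.reg 12) (s.reg 13) else s) s := by
  induction n with
  | zero => exact reach_skip ⟨rfl, by simp⟩
  | succ n ih =>
    refine reach_seq (ih.mono ?_)
    rintro t i ⟨rfl, rfl⟩
    have h12 : (if s.reg 12 < n then s.setReg (20 + s.reg 12) (s.reg 13) else s).reg 12 =
        s.reg 12 := by
      split_ifs
      · simp only [State.setReg_reg]; rw [Function.update_of_ne]; omega
      · rfl
    have h13 : (if s.reg 12 < n then s.setReg (20 + s.reg 12) (s.reg 13) else s).reg 13 =
        s.reg 13 := by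
      split_ifs
      · simp only [State.setReg_reg]; rw [Function.update_of_ne]; omega
      · rfl
    refine reach_ite (fun hc => ?_) (fun hc => ?_)
    · simp only [Expr.eval_eq, Expr.eval_reg, Expr.eval_const, h12, ne_eq, ite_eq_right_iff,
        one_ne_zero, imp_false, not_not] at hc
      refine reach_assign (by simpa [h13] using hW) ⟨rfl, ?_⟩
      simp only [Expr.eval_reg, h13]
      simp [hc]
    · simp only [Expr.eval_eq, Expr.eval_reg, Expr.eval_const, h12, ite_eq_right_iff,
        one_ne_zero, imp_false] at hc
      refine reach_skip ⟨rfl, ?_⟩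
      by_cases h : s.reg 12 < n
      · rw [if_pos h, if_pos (by omega)]
      · rw [if_neg h, if_neg (by omega)]

/-- `fmSet` changes exactly the word of `fm` that is addressed; registers `12` and `13` keep their
values, and the buffer for block transfers, the cells below `B`, is not touched. -/
theorem reach_fmSet {m : Params} {s : State} {Q : State → ℕ → Prop} {a v : ℕ} (h1 : s.reg 1 = m.B)
    (h12 : s.reg 12 = a) (h13 : s.reg 13 = v) (hW : v < m.W) (ha : a < 96 + (m.M - m.B))
    (hQ : ∀ t : State, (∀ r, r < 20 ∨ 116 ≤ r → t.reg r = s.reg r) →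
      (∀ a', fm m t a' = if a' = a then v else fm m s a') →
      (∀ o < m.B, t.mem o = s.mem o) → t.ext = s.ext → Q t 0) :
    Reach m fmSet Q s := by
  subst h12 h13
  refine reach_seq ((reach_setSelectedReg hW 96).mono ?_)
  rintro t i ⟨rfl, rfl⟩
  by_cases h : s.reg 12 < 96
  · rw [if_pos h]
    have h12 : (s.setReg (20 + s.reg 12) (s.reg 13)).reg 12 = s.reg 12 := by
      simp only [State.setReg_reg]; rw [Function.update_of_ne]; omega
    refine reach_ite (fun _ => reach_skip (hQ _ ?_ ?_ ?_ ?_)) (fun hc => ?_)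
    · intro r hr
      simp only [State.setReg_reg]; rw [Function.update_of_ne]; omega
    · intro a'
      simp only [fm, State.setReg_reg, State.setReg_mem, Function.update_apply]
      split_ifs <;> first | rfl | omega
    · exact fun _ _ => rfl
    · rfl
    · simp [h12, h] at hc
  · rw [if_neg h]
    refine reach_ite (fun hc => ?_) (fun hc => reach_store (by simpa using hW) (hQ _ ?_ ?_ ?_ ?_))
    · simp [h] at hc
    · exact fun _ _ => rfl
    · intro a'
      simp only [fm, State.setMem_reg, State.setMem_mem, Expr.eval_add, Expr.eval_sub,
        Expr.eval_reg, Expr.eval_ofNat, h1]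
      split_ifs <;> first | rfl | omega
    · intro o ho
      simp only [State.setMem_mem, Expr.eval_add, Expr.eval_sub, Expr.eval_reg, Expr.eval_ofNat, h1]
      rw [if_neg]; omega
    · rfl

/-! ### Transfer of lines -/

/-- What relates the parameters of the machine to those of the virtual machine. A file occupies `H`
blocks, and a slot `3 * b + 3` words of `fm`. -/
structure Layout (m : Params) (P : VParams) (H : ℕ) : Prop where
  hW : P.W = m.W
  b_pos : 1 ≤ P.b
  b_le : P.b ≤ m.B
  B_le : m.B ≤ m.M
  slots : P.S * (3 * P.b + 3) ≤ 96 + (m.M - m.B)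
  cap_le : P.cap + 3 * P.b ≤ H
  H_lt : 8 * H + 8 < m.W
  M_lt : 96 + m.M < m.W

/-- The first external cell of line `reg 8` of file `reg 7`. -/
def lineStart : Expr := .reg 7 * .reg 5 * .reg 1 + .reg 8 * .reg 3

/-- Cell number `reg 10` of block `reg 9`. -/
def curCell : Expr := .reg 9 * .reg 1 + .reg 10

/-- Whether the current cell belongs to the current line. -/
def inLine : Expr := (1 - .lt curCell lineStart) * .lt curCell (lineStart + .reg 3)

/-- The place of the current cell in slot `reg 11`. -/
def curAddr : Expr := .reg 11 * (.reg 3 + 3) + 3 + (curCell - lineStart)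

/-- Run `body` on the cells of block `reg 9`. -/
def forCells (body : Prog) : Prog :=
  .seq (.assign 10 0) (.while (.lt (.reg 10) (.reg 1))
    (.seq (.ite inLine body .skip) (.assign 10 (.reg 10 + 1))))

/-- Write the line in slot `reg 11`, which is line `reg 8` of file `reg 7`, to external memory. -/
def saveLine : Prog :=
  .seq (.assign 9 (lineStart / .reg 1)) (.while (.lt (.reg 9 * .reg 1) (lineStart + .reg 3))
    (.seq (.readBlock (.reg 9) 0) (.seq (forCells (.store (.reg 10) (fmGet curAddr)))
      (.seq (.writeBlock (.reg 9) 0) (.assign 9 (.reg 9 + 1))))))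

/-- Read line `reg 8` of file `reg 7` into slot `reg 11`. -/
def loadLine : Prog :=
  .seq (.assign 9 (lineStart / .reg 1)) (.while (.lt (.reg 9 * .reg 1) (lineStart + .reg 3))
    (.seq (.readBlock (.reg 9) 0) (.seq (forCells
      (.seq (.assign 12 curAddr) (.seq (.assign 13 (.mem (.reg 10))) fmSet)))
      (.assign 9 (.reg 9 + 1)))))

/-- The registers hold a description of a transfer between slot `σ` and line `l` of file `f`. -/
structure Transfer (m : Params) (P : VParams) (H : ℕ) (s : State) (σ f l : ℕ) : Prop where
  r1 : s.reg 1 = m.B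
  r3 : s.reg 3 = 3 * P.b
  r5 : s.reg 5 = H
  r7 : s.reg 7 = f
  r8 : s.reg 8 = l
  r11 : s.reg 11 = σ

section Transfer

variable {m : Params} {P : VParams} {H : ℕ} {s t : State} {σ f l : ℕ}

theorem Transfer.congr (h : Transfer m P H s σ f l) (hr : ∀ r < 9, t.reg r = s.reg r)
    (h11 : t.reg 11 = s.reg 11) : Transfer m P H t σ f l :=
  ⟨by rw [hr _ (by omega), h.r1], by rw [hr _ (by omega), h.r3], by rw [hr _ (by omega), h.r5],
    by rw [hr _ (by omega), h.r7], by rw [hr _ (by omega), h.r8], by rw [h11, h.r11]⟩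

theorem Transfer.lineStart (h : Transfer m P H s σ f l) :
    lineStart.eval s = f * H * m.B + l * (3 * P.b) := by
  simp [ExtMem.lineStart, h.r1, h.r3, h.r5, h.r7, h.r8]

theorem Transfer.curCell (h : Transfer m P H s σ f l) :
    curCell.eval s = s.reg 9 * m.B + s.reg 10 := by
  simp [ExtMem.curCell, h.r1]

theorem Transfer.inLine (h : Transfer m P H s σ f l) : inLine.eval s ≠ 0 ↔
    f * H * m.B + l * (3 * P.b) ≤ s.reg 9 * m.B + s.reg 10 ∧
    s.reg 9 * m.B + s.reg 10 < f * H * m.B + l * (3 * P.b) + 3 * P.b := by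
  simp only [ExtMem.inLine, Expr.eval_mul, Expr.eval_sub, Expr.eval_ofNat, Expr.eval_lt,
    Expr.eval_add, h.curCell, h.lineStart, Expr.eval_reg, h.r3]
  split_ifs <;> simp <;> omega

theorem Transfer.curAddr (h : Transfer m P H s σ f l) : curAddr.eval s =
    σ * (3 * P.b + 3) + 3 + (s.reg 9 * m.B + s.reg 10 - (f * H * m.B + l * (3 * P.b))) := by
  simp [ExtMem.curAddr, h.r3, h.r11, h.curCell, h.lineStart]

theorem slot_lt {S D σ k : ℕ} (hσ : σ < S) (hk : k < D) : σ * D + k < S * D := by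
  calc σ * D + k < σ * D + D := by omega
    _ = (σ + 1) * D := by ring
    _ ≤ S * D := Nat.mul_le_mul_right _ hσ

theorem slot_inj {D σ τ j k : ℕ} (hj : j < D) (hk : k < D) (h : σ * D + j = τ * D + k) :
    σ = τ ∧ j = k := by
  have h1 : σ = τ := by
    have := congrArg (· / D) h
    rwa [mul_comm σ, mul_comm τ, Nat.mul_add_div (by omega), Nat.mul_add_div (by omega),
      Nat.div_eq_of_lt hj, Nat.div_eq_of_lt hk, add_zero, add_zero] at this
  subst h1
  exact ⟨rfl, by omega⟩

/-- The loop over the cells of a block. -/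
theorem reach_forCells {body : Prog} {Q : State → ℕ → Prop} (hB : m.B < m.W)
    (I : ℕ → State → Prop) (h1 : s.reg 1 = m.B) (h0 : I 0 (s.setReg 10 0))
    (hI : ∀ o t, I o t → t.reg 1 = m.B)
    (hbody : ∀ o t, o < m.B → t.reg 10 = o → I o t → inLine.eval t ≠ 0 →
      Reach m body (fun u i => i = 0 ∧ u.reg 10 = o ∧ I (o + 1) (u.setReg 10 (o + 1))) t)
    (hskip : ∀ o t, o < m.B → t.reg 10 = o → I o t → inLine.eval t = 0 →
      I (o + 1) (t.setReg 10 (o + 1)))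
    (hQ : ∀ t, I m.B t → Q t 0) : Reach m (forCells body) Q s := by
  refine reach_seq (reach_assign (by simp; omega) ?_)
  refine reach_while (fun n t i => ∃ o ≤ m.B, n = m.B - o ∧ i = 0 ∧ t.reg 10 = o ∧ I o t)
    ?_ ?_ m.B ⟨0, by omega, rfl, rfl, by simp, h0⟩
  · rintro n t i ⟨o, ho, rfl, rfl, h10, hIo⟩ hc
    simp only [Expr.eval_lt, Expr.eval_reg, h10, hI o t hIo, ne_eq, ite_eq_right_iff, one_ne_zero,
      imp_false, not_not] at hc
    refine reach_seq (reach_ite (fun hin => ?_) (fun hin => reach_skip ?_))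
    · refine (hbody o t hc h10 hIo hin).mono ?_
      rintro u i ⟨rfl, hu, hI'⟩
      refine reach_assign (by simp [hu]; omega) ⟨_, ?_, o + 1, hc, rfl, rfl, by simp [hu], ?_⟩
      · omega
      · simpa [hu] using hI'
    · refine reach_assign (by simp [h10]; omega) ⟨_, ?_, o + 1, hc, rfl, rfl, by simp [h10], ?_⟩
      · omega
      · simpa [h10] using hskip o t hc h10 hIo hin
  · rintro n t i ⟨o, ho, rfl, rfl, h10, hIo⟩ hc
    simp only [Expr.eval_lt, Expr.eval_reg, h10, hI o t hIo, ite_eq_right_iff, one_ne_zero,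
      imp_false, not_lt] at hc
    obtain rfl : o = m.B := by omega
    exact hQ t hIo

end Transfer

end ExtMem

namespace ExtMem

section Transfer

variable {m : Params} {P : VParams} {H : ℕ} {s t : State} {σ f l : ℕ}

theorem fm_congr {m : Params} {s t : State} (hr : ∀ r, 20 ≤ r → r < 116 → t.reg r = s.reg r)
    (hm : ∀ a, m.B ≤ a → t.mem a = s.mem a) (a : ℕ) : fm m t a = fm m s a := by
  unfold fm
  split_ifs with h
  · exact hr _ (by omega) (by omega)
  · exact hm _ (by omega)

theorem fm_setReg {r v : ℕ} (hr : r < 20 ∨ 116 ≤ r) (a : ℕ) :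
    fm m (s.setReg r v) a = fm m s a := by
  refine fm_congr (t := s.setReg r v) (s := s) (fun r' h h' => ?_) (fun _ _ => rfl) a
  rw [State.setReg_reg, Function.update_of_ne]
  omega

theorem fm_load {q : ℕ} (a : ℕ) : fm m (s.load m q 0) a = fm m s a := by
  refine fm_congr (t := s.load m q 0) (s := s) (fun _ _ _ => rfl) (fun a ha => ?_) a
  rw [State.load_mem, if_neg]
  omega

theorem fm_save {q a' : ℕ} (a : ℕ) : fm m (s.save m q a') a = fm m s a :=
  fm_congr (fun _ _ _ => rfl) (fun _ _ => rfl) a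

theorem fm_setMem {o v : ℕ} (ho : o < m.B) (a : ℕ) : fm m (s.setMem m o v) a = fm m s a := by
  refine fm_congr (t := s.setMem m o v) (s := s) (fun _ _ _ => rfl) (fun a ha => ?_) a
  rw [State.setMem_mem, if_neg]
  omega

/-- Lines of file `f` lie within the part of external memory that belongs to the eight files. -/
theorem line_bound (hf : f < 8)
    (hl : (l + 1) * (3 * P.b) ≤ H * m.B) :
    f * H * m.B + l * (3 * P.b) + 3 * P.b ≤ 8 * H * m.B := by
  have h1 : f * H * m.B + H * m.B ≤ 8 * H * m.B := by
    calc f * H * m.B + H * m.B = (f + 1) * (H * m.B) := by ring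
      _ ≤ 8 * (H * m.B) := Nat.mul_le_mul_right _ hf
      _ = 8 * H * m.B := by ring
  have h2 : (l + 1) * (3 * P.b) = l * (3 * P.b) + 3 * P.b := by ring
  omega

/-- A line has at most `3 * B` words and thus meets at most four blocks, each of which is read and
written back, so that saving a line takes at most eight IOs. -/
theorem reach_saveLine {Q : State → ℕ → Prop} (lay : Layout m P H) (ht : Transfer m P H s σ f l)
    (hf : f < 8) (hl : (l + 1) * (3 * P.b) ≤ H * m.B) (hfm : ∀ a, fm m s a < m.W)
    (hQ : ∀ t i, i ≤ 8 → (∀ r, r ≠ 9 → r ≠ 10 → t.reg r = s.reg r) →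
      (∀ a, fm m t a = fm m s a) →
      (∀ c, t.ext c = if f * H * m.B + l * (3 * P.b) ≤ c ∧
        c < f * H * m.B + l * (3 * P.b) + 3 * P.b then
        fm m s (σ * (3 * P.b + 3) + 3 + (c - (f * H * m.B + l * (3 * P.b)))) else s.ext c) →
      Q t i) :
    Reach m saveLine Q s := by
  have hbnd := line_bound hf hl
  have hB := lay.b_pos
  have hbB := lay.b_le
  have hBM := lay.B_le
  have hMW := lay.M_lt
  have hHW := lay.H_lt
  set a0 := f * H * m.B + l * (3 * P.b) with ha0
  set q0 := a0 / m.B with hq0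
  have hq0le : q0 * m.B ≤ a0 := Nat.div_mul_le_self _ _
  have hq0lt : a0 < q0 * m.B + m.B := Nat.lt_div_mul_add (by omega)
  have hqlt : ∀ q, q * m.B < a0 + 3 * P.b → q < 8 * H := fun q hq =>
    lt_of_mul_lt_mul_right (lt_of_lt_of_le hq hbnd) (Nat.zero_le m.B)
  have hqlt' : ∀ q, q * m.B < a0 + 3 * P.b → q < q0 + 4 := fun q hq => by
    refine lt_of_mul_lt_mul_right (a := m.B) ?_ (Nat.zero_le _)
    calc q * m.B < a0 + 3 * P.b := hq
      _ ≤ (q0 + 4) * m.B := by rw [add_mul]; omega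
  refine reach_seq (reach_assign ?_ ?_)
  · simp only [Expr.eval_div, ht.lineStart, Expr.eval_reg, ht.r1, ← ha0, ← hq0]
    have := hqlt q0 (by omega)
    omega
  simp only [Expr.eval_div, ht.lineStart, Expr.eval_reg, ht.r1, ← ha0, ← hq0]
  refine (reach_while (fun n t i => ∃ q, n = a0 + 3 * P.b - q * m.B ∧ q0 ≤ q ∧ q ≤ q0 + 4 ∧
    i = 2 * (q - q0) ∧ t.reg 9 = q ∧ (∀ r, r ≠ 9 → r ≠ 10 → t.reg r = s.reg r) ∧
    (∀ a, fm m t a = fm m s a) ∧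
    ∀ c, t.ext c = if (a0 ≤ c ∧ c < a0 + 3 * P.b) ∧ c < q * m.B then
      fm m s (σ * (3 * P.b + 3) + 3 + (c - a0)) else s.ext c) ?_ ?_ _
      ⟨q0, rfl, le_rfl, by omega, by simp, by simp, ?_, ?_, ?_⟩)
  rotate_left 2
  · intro r hr _; simp [hr]
  · exact fm_setReg (by omega)
  · intro c; rw [if_neg (by omega)]; rfl
  · rintro n t i ⟨q, rfl, hq, hq', rfl, h9, hr, hfmt, hext⟩ hc
    have htt : Transfer m P H t σ f l := ht.congr (fun r h => hr r (by omega) (by omega))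
      (hr 11 (by omega) (by omega))
    have hcq : q * m.B < a0 + 3 * P.b := by
      by_contra hcon
      apply hc
      simp only [Expr.eval_lt, Expr.eval_mul, Expr.eval_reg, Expr.eval_add, htt.lineStart,
        htt.r1, htt.r3, h9]
      rw [if_neg hcon]
    have hqW := hqlt q hcq
    have hq4 := hqlt' q hcq
    refine reach_seq (reach_readBlock (by simp only [Expr.eval_reg, h9]; omega)
      (reach_seq ?_))
    simp only [Expr.eval_reg, h9, Expr.eval_ofNat]
    refine reach_forCells (by omega) (fun o u => (∀ r, r ≠ 10 → u.reg r = t.reg r) ∧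
      (∀ a, fm m u a = fm m s a) ∧ u.ext = t.ext ∧
      ∀ j < m.B, u.mem j = if (a0 ≤ q * m.B + j ∧ q * m.B + j < a0 + 3 * P.b) ∧ j < o then
        fm m s (σ * (3 * P.b + 3) + 3 + (q * m.B + j - a0)) else t.ext (q * m.B + j))
      (by simp [htt.r1]) ⟨?_, ?_, rfl, ?_⟩ ?_ ?_ ?_ ?_
    · intro r h; simp [h]
    · intro a; rw [fm_setReg (by omega), fm_load, hfmt]
    · intro j hj
      rw [if_neg (by omega)]
      simp only [State.setReg_mem, State.load_mem]
      rw [if_pos (by omega)]; rfl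
    · intro o u hu
      rw [hu.1 1 (by omega), htt.r1]
    · rintro o u ho h10 ⟨hur, huf, hue, hum⟩ hin
      have hut : Transfer m P H u σ f l := htt.congr (fun r h => hur r (by omega))
        (hur 11 (by omega))
      have hu9 : u.reg 9 = q := by rw [hur 9 (by omega), h9]
      rw [hut.inLine, hu9, h10, ← ha0] at hin
      refine reach_store ?_ ?_
      · rw [eval_fmGet hut.r1, huf]; exact hfm _
      rw [eval_fmGet hut.r1, huf, hut.curAddr, hu9, h10, ← ha0]
      simp only [Expr.eval_reg, h10]
      refine ⟨trivial, h10, ?_, ?_, hue, ?_⟩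
      · intro r h; simp [h, hur r h]
      · intro a; rw [fm_setReg (by omega), fm_setMem ho, huf]
      · intro j hj
        simp only [State.setReg_mem, State.setMem_mem]
        by_cases hjo : j = o
        · subst hjo; rw [if_pos (by omega), if_pos (by omega)]
        · rw [if_neg (by omega), hum j hj]
          congr 1
          exact propext ⟨fun h => ⟨h.1, by omega⟩, fun h => ⟨h.1, by omega⟩⟩
    · rintro o u ho h10 ⟨hur, huf, hue, hum⟩ hin
      have hut : Transfer m P H u σ f l := htt.congr (fun r h => hur r (by omega))
        (hur 11 (by omega))
      have hu9 : u.reg 9 = q := by rw [hur 9 (by omega), h9]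
      have hin' := hut.inLine.not
      rw [hu9, h10, ← ha0] at hin'
      have hin'' := hin'.mp (by simpa using hin)
      refine ⟨?_, ?_, hue, ?_⟩
      · intro r h; simp [h, hur r h]
      · intro a; rw [fm_setReg (by omega), huf]
      · intro j hj
        simp only [State.setReg_mem]
        rw [hum j hj]
        congr 1
        refine propext ⟨fun h => ⟨h.1, by omega⟩, fun h => ⟨h.1, ?_⟩⟩
        by_contra hcon
        obtain rfl : j = o := by omega
        exact hin'' h.1
    · rintro u ⟨hur, huf, hue, hum⟩
      have hu9 : u.reg 9 = q := by rw [hur 9 (by omega), h9]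
      refine reach_seq (reach_writeBlock (by simp only [Expr.eval_reg, hu9]; omega)
        (reach_assign (by simp [hu9]; omega) ?_))
      simp only [Expr.eval_add, Expr.eval_reg, hu9, Expr.eval_ofNat, State.save_reg]
      refine ⟨a0 + 3 * P.b - (q + 1) * m.B, by rw [add_mul]; omega, q + 1, rfl, by omega, by omega,
        by omega, by simp, ?_, ?_, ?_⟩
      · intro r h h'; simp [h, hur r h', hr r h h']
      · intro a; rw [fm_setReg (by omega), fm_save, huf]
      · intro c
        simp only [State.setReg_ext, State.save_ext, add_mul, one_mul]
        by_cases hcq : q * m.B ≤ c ∧ c < q * m.B + m.B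
        · rw [if_pos hcq, zero_add, hum _ (by omega)]
          have : q * m.B + (c - q * m.B) = c := by omega
          rw [this, hext c]
          by_cases hcin : a0 ≤ c ∧ c < a0 + 3 * P.b
          · rw [if_pos (by omega), if_pos (by omega)]
          · rw [if_neg (by omega), if_neg (by omega), if_neg (by omega)]
        · rw [if_neg hcq, hue, hext c]
          congr 1
          exact propext ⟨fun h => ⟨h.1, by omega⟩, fun h => ⟨h.1, by omega⟩⟩
  · rintro n t i ⟨q, rfl, hq, hq', rfl, h9, hr, hfmt, hext⟩ hc
    have htt : Transfer m P H t σ f l := ht.congr (fun r h => hr r (by omega) (by omega))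
      (hr 11 (by omega) (by omega))
    have hcq : ¬ q * m.B < a0 + 3 * P.b := by
      intro hcon
      simp only [Expr.eval_lt, Expr.eval_mul, Expr.eval_reg, Expr.eval_add, htt.lineStart,
        htt.r1, htt.r3, h9] at hc
      rw [if_pos hcon] at hc
      exact one_ne_zero hc
    refine hQ t _ (by omega) hr hfmt fun c => ?_
    rw [hext c]
    congr 1
    exact propext ⟨fun h => h.1, fun h => ⟨h, by omega⟩⟩

/-- Loading a line takes at most four IOs, one for each of the blocks that it meets. -/
theorem reach_loadLine {Q : State → ℕ → Prop} (lay : Layout m P H) (ht : Transfer m P H s σ f l)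
    (hf : f < 8) (hl : (l + 1) * (3 * P.b) ≤ H * m.B) (hσ : σ < P.S) (hext : ∀ c, s.ext c < m.W)
    (hQ : ∀ t i, i ≤ 4 → (∀ r, r < 9 ∨ r = 11 ∨ 14 ≤ r ∧ r < 20 ∨ 116 ≤ r → t.reg r = s.reg r) →
      (∀ a, fm m t a = if σ * (3 * P.b + 3) + 3 ≤ a ∧ a < σ * (3 * P.b + 3) + 3 + 3 * P.b then
        s.ext (f * H * m.B + l * (3 * P.b) + (a - (σ * (3 * P.b + 3) + 3))) else fm m s a) →
      t.ext = s.ext → Q t i) :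
    Reach m loadLine Q s := by
  have hbnd := line_bound hf hl
  have hB := lay.b_pos
  have hbB := lay.b_le
  have hBM := lay.B_le
  have hMW := lay.M_lt
  have hHW := lay.H_lt
  have hslot : σ * (3 * P.b + 3) + (3 * P.b + 2) < 96 + (m.M - m.B) :=
    lt_of_lt_of_le (slot_lt hσ (by omega)) lay.slots
  set a0 := f * H * m.B + l * (3 * P.b) with ha0
  set d0 := σ * (3 * P.b + 3) + 3 with hd0
  set q0 := a0 / m.B with hq0
  have hq0le : q0 * m.B ≤ a0 := Nat.div_mul_le_self _ _
  have hq0lt : a0 < q0 * m.B + m.B := Nat.lt_div_mul_add (by omega)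
  have hqlt : ∀ q, q * m.B < a0 + 3 * P.b → q < 8 * H := fun q hq =>
    lt_of_mul_lt_mul_right (lt_of_lt_of_le hq hbnd) (Nat.zero_le m.B)
  have hqlt' : ∀ q, q * m.B < a0 + 3 * P.b → q < q0 + 4 := fun q hq => by
    refine lt_of_mul_lt_mul_right (a := m.B) ?_ (Nat.zero_le _)
    calc q * m.B < a0 + 3 * P.b := hq
      _ ≤ (q0 + 4) * m.B := by rw [add_mul]; omega
  refine reach_seq (reach_assign ?_ ?_)
  · simp only [Expr.eval_div, ht.lineStart, Expr.eval_reg, ht.r1, ← ha0, ← hq0]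
    have := hqlt q0 (by omega)
    omega
  simp only [Expr.eval_div, ht.lineStart, Expr.eval_reg, ht.r1, ← ha0, ← hq0]
  refine (reach_while (fun n t i => ∃ q, n = a0 + 3 * P.b - q * m.B ∧ q0 ≤ q ∧ q ≤ q0 + 4 ∧
    i = q - q0 ∧ t.reg 9 = q ∧
    (∀ r, r < 9 ∨ r = 11 ∨ 14 ≤ r ∧ r < 20 ∨ 116 ≤ r → t.reg r = s.reg r) ∧
    (∀ a, fm m t a = if (d0 ≤ a ∧ a < d0 + 3 * P.b) ∧ a0 + (a - d0) < q * m.B then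
      s.ext (a0 + (a - d0)) else fm m s a) ∧ t.ext = s.ext) ?_ ?_ _
      ⟨q0, rfl, le_rfl, by omega, by simp, by simp, ?_, ?_, rfl⟩)
  rotate_left 2
  · intro r hr; simp only [State.setReg_reg]; rw [Function.update_of_ne (by omega)]
  · intro a; rw [if_neg (by omega), fm_setReg (by omega)]
  · rintro n t i ⟨q, rfl, hq, hq', rfl, h9, hr, hfmt, hextt⟩ hc
    have htt : Transfer m P H t σ f l := ht.congr (fun r h => hr r (by omega))
      (hr 11 (by omega))
    have hcq : q * m.B < a0 + 3 * P.b := by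
      by_contra hcon
      apply hc
      simp only [Expr.eval_lt, Expr.eval_mul, Expr.eval_reg, Expr.eval_add, htt.lineStart,
        htt.r1, htt.r3, h9]
      rw [if_neg hcon]
    have hqW := hqlt q hcq
    have hq4 := hqlt' q hcq
    refine reach_seq (reach_readBlock (by simp only [Expr.eval_reg, h9]; omega)
      (reach_seq ?_))
    simp only [Expr.eval_reg, h9, Expr.eval_ofNat]
    refine reach_forCells (by omega) (fun o u =>
      (∀ r, r ≤ 9 ∨ r = 11 ∨ 14 ≤ r ∧ r < 20 ∨ 116 ≤ r → u.reg r = t.reg r) ∧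
      (∀ a, fm m u a = if (d0 ≤ a ∧ a < d0 + 3 * P.b) ∧ a0 + (a - d0) < q * m.B + o then
        s.ext (a0 + (a - d0)) else fm m s a) ∧ u.ext = t.ext ∧
      ∀ j < m.B, u.mem j = s.ext (q * m.B + j))
      (by simp [htt.r1]) ⟨?_, ?_, rfl, ?_⟩ ?_ ?_ ?_ ?_
    · intro r h; simp only [State.setReg_reg]; rw [Function.update_of_ne (by omega)]; rfl
    · intro a; rw [fm_setReg (by omega), fm_load, hfmt, add_zero]
    · intro j hj
      simp only [State.setReg_mem, State.load_mem]
      rw [if_pos (by omega), hextt]; rfl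
    · intro o u hu
      rw [hu.1 1 (by omega), htt.r1]
    · rintro o u ho h10 ⟨hur, huf, hue, hum⟩ hin
      have hut : Transfer m P H u σ f l := htt.congr (fun r h => hur r (by omega))
        (hur 11 (by omega))
      have hu9 : u.reg 9 = q := by rw [hur 9 (by omega), h9]
      rw [hut.inLine, hu9, h10, ← ha0] at hin
      refine reach_seq (reach_assign ?_ (reach_seq (reach_assign ?_ (reach_fmSet
        (a := d0 + (q * m.B + o - a0)) (v := s.ext (q * m.B + o)) ?_ ?_ ?_ (hext _) ?_ ?_))))
      · rw [hut.curAddr, hu9, h10, ← ha0, ← hd0]; omega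
      · simp only [Expr.eval_mem, Expr.eval_reg, State.setReg_mem, State.setReg_reg]
        rw [Function.update_of_ne (by omega), h10, hum o ho]; exact hext _
      · simp [hut.r1]
      · simp only [hut.curAddr, hu9, h10, ← ha0, ← hd0]; simp
      · simp [h10, hum o ho]
      · omega
      · intro v hvr hvf hvm hve
        have hv : ∀ r, r ≤ 11 ∨ 14 ≤ r ∧ r < 20 ∨ 116 ≤ r → v.reg r = u.reg r := by
          intro r h
          rw [hvr r (by omega)]
          simp only [State.setReg_reg]
          rw [Function.update_of_ne (by omega), Function.update_of_ne (by omega)]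
        refine ⟨rfl, by rw [hv 10 (by omega), h10], ?_, ?_, ?_, ?_⟩
        · intro r h
          simp only [State.setReg_reg]
          rw [Function.update_of_ne (by omega), hv r (by omega), hur r h]
        · intro a
          rw [fm_setReg (by omega), hvf, fm_setReg (by omega), fm_setReg (by omega), huf]
          by_cases ha : a = d0 + (q * m.B + o - a0)
          · rw [if_pos ha, if_pos (by omega)]
            congr 1; omega
          · rw [if_neg ha]
            congr 1
            exact propext ⟨fun h => ⟨h.1, by omega⟩, fun h => ⟨h.1, by omega⟩⟩
        · simp [hve, hue]
        · intro j hj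
          simp only [State.setReg_mem]
          rw [hvm j hj]
          exact hum j hj
    · rintro o u ho h10 ⟨hur, huf, hue, hum⟩ hin
      have hut : Transfer m P H u σ f l := htt.congr (fun r h => hur r (by omega))
        (hur 11 (by omega))
      have hu9 : u.reg 9 = q := by rw [hur 9 (by omega), h9]
      have hin' := hut.inLine.not
      rw [hu9, h10, ← ha0] at hin'
      have hin'' := hin'.mp (by simpa using hin)
      refine ⟨?_, ?_, hue, hum⟩
      · intro r h
        simp only [State.setReg_reg]
        rw [Function.update_of_ne (by omega), hur r h]
      · intro a
        rw [fm_setReg (by omega), huf]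
        congr 1
        exact propext ⟨fun h => ⟨h.1, by omega⟩, fun h => ⟨h.1, by omega⟩⟩
    · rintro u ⟨hur, huf, hue, hum⟩
      have hu9 : u.reg 9 = q := by rw [hur 9 (by omega), h9]
      refine reach_assign (by simp [hu9]; omega) ?_
      simp only [Expr.eval_add, Expr.eval_reg, hu9, Expr.eval_ofNat]
      refine ⟨a0 + 3 * P.b - (q + 1) * m.B, by rw [add_mul]; omega, q + 1, rfl, by omega, by omega,
        by omega, by simp, ?_, ?_, ?_⟩
      · intro r h
        simp only [State.setReg_reg]
        rw [Function.update_of_ne (by omega), hur r (by omega), hr r h]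
      · intro a; rw [fm_setReg (by omega), huf, add_mul, one_mul]
      · rw [State.setReg_ext, hue, hextt]
  · rintro n t i ⟨q, rfl, hq, hq', rfl, h9, hr, hfmt, hextt⟩ hc
    have htt : Transfer m P H t σ f l := ht.congr (fun r h => hr r (by omega))
      (hr 11 (by omega))
    have hcq : ¬ q * m.B < a0 + 3 * P.b := by
      intro hcon
      simp only [Expr.eval_lt, Expr.eval_mul, Expr.eval_reg, Expr.eval_add, htt.lineStart,
        htt.r1, htt.r3, h9] at hc
      rw [if_pos hcon] at hc
      exact one_ne_zero hc
    refine hQ t _ (by omega) hr (fun a => ?_) hextt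
    rw [hfmt a]
    congr 1
    exact propext ⟨fun h => h.1, fun h => ⟨h, by omega⟩⟩

end Transfer

end ExtMem

namespace ExtMem

/-! ### The virtual machine runs on the machine -/

/-- Configuration `st` of the machine represents configuration `s` of the virtual machine. Slot `σ`
occupies the words of `fm` from `σ * (3 * b + 3)` on: the file that its line belongs to, plus one
(`0` if the slot is empty), the number of the line, a word of local memory, and the line itself.
Variable `x` is kept in register `120 + x`. -/
structure Represents (m : Params) (P : VParams) (H : ℕ) (st : State) (s : VState) : Prop where
  r1 : st.reg 1 = m.B
  r3 : st.reg 3 = 3 * P.b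
  r4 : st.reg 4 = P.S
  r5 : st.reg 5 = H
  var : ∀ x, st.reg (120 + x) = s.reg x
  var_lt : ∀ x, s.reg x < m.W
  fm_lt : ∀ a, fm m st a < m.W
  ext_lt : ∀ c, st.ext c < m.W
  tag_none : ∀ σ < P.S, s.tag σ = none → fm m st (σ * (3 * P.b + 3)) = 0
  tag_some : ∀ σ < P.S, ∀ f l, s.tag σ = some (f, l) → fm m st (σ * (3 * P.b + 3)) = f + 1 ∧
    fm m st (σ * (3 * P.b + 3) + 1) = l ∧ f < 8 ∧ (l + 1) * (3 * P.b) ≤ H * m.B ∧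
    ∀ k < 3 * P.b, fm m st (σ * (3 * P.b + 3) + 3 + k) = s.file f (l * (3 * P.b) + k)
  tag_out : ∀ σ, P.S ≤ σ → s.tag σ = none
  distinct : s.TagsDistinct
  aux : ∀ σ < P.S, fm m st (σ * (3 * P.b + 3) + 2) = s.aux σ
  ext : ∀ f < 8, ∀ l, (l + 1) * (3 * P.b) ≤ H * m.B → (∀ σ, s.tag σ ≠ some (f, l)) →
    ∀ k < 3 * P.b, st.ext (f * H * m.B + (l * (3 * P.b) + k)) = s.file f (l * (3 * P.b) + k)

/-- The number of slots that hold a line. -/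
def VState.used (P : VParams) (s : VState) : ℕ :=
  ((Finset.range P.S).filter fun σ => s.tag σ ≠ none).card

/-- Word `k` of slot `reg 11`. -/
def slotWord (k : ℕ) : Expr := .reg 11 * (.reg 3 + 3) + .const k

/-- Write the line in slot `reg 11`, if any, to external memory, and empty the slot. -/
def evict : Prog := .ite (fmGet (slotWord 0))
  (.seq (.assign 7 (fmGet (slotWord 0) - 1)) (.seq (.assign 8 (fmGet (slotWord 1)))
    (.seq saveLine (.seq (.assign 12 (slotWord 0)) (.seq (.assign 13 0) fmSet)))))
  .skip

/-- Empty slot `reg 6` and the slots that hold the line of word `reg 14` of file `reg 15`, so that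
this line in external memory is up to date and can be loaded into slot `reg 6`. -/
def evictAll : Prog := .seq (.assign 11 0) (.while (.lt (.reg 11) (.reg 4))
  (.seq (.ite (.eq (.reg 11) (.reg 6) + .eq (fmGet (slotWord 0)) (.reg 15 + 1) *
      .eq (fmGet (slotWord 1)) (.reg 14 / .reg 3)) evict .skip)
    (.assign 11 (.reg 11 + 1))))

/-- Bring the line of word `reg 14` of file `reg 15` into slot `reg 6`. -/
def access : Prog :=
  .seq (.assign 11 (.reg 6)) (.ite
    (.eq (fmGet (slotWord 0)) (.reg 15 + 1) * .eq (fmGet (slotWord 1)) (.reg 14 / .reg 3)) .skip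
    (.seq evictAll (.seq (.assign 11 (.reg 6)) (.seq (.assign 7 (.reg 15))
      (.seq (.assign 8 (.reg 14 / .reg 3))
        (.seq (.assign 12 (slotWord 0)) (.seq (.assign 13 (.reg 15 + 1)) (.seq fmSet
          (.seq (.assign 12 (slotWord 1)) (.seq (.assign 13 (.reg 8)) (.seq fmSet
            loadLine)))))))))))

section Represents

variable {m : Params} {P : VParams} {H : ℕ} {st : State} {s : VState} {σ f l : ℕ}

theorem Represents.slotWord (h : Represents m P H st s) (h11 : st.reg 11 = σ) (k : ℕ) :
    (slotWord k).eval st = σ * (3 * P.b + 3) + k := by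
  simp [ExtMem.slotWord, h.r3, h11]

theorem Represents.fmGet (h : Represents m P H st s) (a : Expr) :
    (fmGet a).eval st = fm m st (a.eval st) := eval_fmGet h.r1 a

/-- Registers that are not part of the representation can be changed. -/
theorem Represents.congr {st' : State} (h : Represents m P H st s)
    (hr : ∀ r, r = 1 ∨ r = 3 ∨ r = 4 ∨ r = 5 ∨ 120 ≤ r → st'.reg r = st.reg r)
    (hf : ∀ a, fm m st' a = fm m st a) (he : st'.ext = st.ext) : Represents m P H st' s where
  r1 := by rw [hr _ (by omega), h.r1]
  r3 := by rw [hr _ (by omega), h.r3]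
  r4 := by rw [hr _ (by omega), h.r4]
  r5 := by rw [hr _ (by omega), h.r5]
  var x := by rw [hr _ (by omega), h.var]
  var_lt := h.var_lt
  fm_lt a := by rw [hf]; exact h.fm_lt a
  ext_lt c := by rw [he]; exact h.ext_lt c
  tag_none := by simpa only [hf] using h.tag_none
  tag_some := by simpa only [hf] using h.tag_some
  tag_out := h.tag_out
  distinct := h.distinct
  aux := by simpa only [hf] using h.aux
  ext := by simpa only [he] using h.ext

theorem Represents.setReg (h : Represents m P H st s) {r v : ℕ} (hr : 6 ≤ r ∧ r < 20) :
    Represents m P H (st.setReg r v) s := by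
  refine h.congr (fun r' hr' => ?_) (fm_setReg (by omega)) rfl
  rw [State.setReg_reg, Function.update_of_ne]
  omega

theorem used_update_none (hσ : σ < P.S) (h : s.tag σ ≠ none) :
    ({ s with tag := Function.update s.tag σ none } : VState).used P + 1 = s.used P := by
  unfold VState.used
  have : (Finset.range P.S).filter (fun τ => s.tag τ ≠ none) =
      insert σ ((Finset.range P.S).filter fun τ => Function.update s.tag σ none τ ≠ none) := by
    ext τ
    by_cases hτ : τ = σ
    · subst hτ; simp [hσ, h]
    · simp [hτ]
  rw [this, Finset.card_insert_of_notMem (by simp)]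

/-- Evicting takes up to eight IOs, which are paid for by the potential: eight for each slot in use.
-/
theorem reach_evict {Q : State → ℕ → Prop} (lay : Layout m P H) (h : Represents m P H st s)
    (h11 : st.reg 11 = σ) (hσ : σ < P.S)
    (hQ : ∀ st' i, Represents m P H st' { s with tag := Function.update s.tag σ none } →
      (∀ r, r = 6 ∨ r = 11 ∨ 14 ≤ r ∧ r < 20 → st'.reg r = st.reg r) →
      i + 8 * ({ s with tag := Function.update s.tag σ none } : VState).used P ≤ 8 * s.used P →
      Q st' i) : Reach m evict Q st := by
  have hslots := lay.slots
  have hb := lay.b_pos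
  have hM := lay.M_lt
  have hHW := lay.H_lt
  refine reach_ite (fun hc => ?_) (fun hc => ?_)
  · rw [h.fmGet, h.slotWord h11, add_zero] at hc
    have hne : s.tag σ ≠ none := fun hn => hc (h.tag_none σ hσ hn)
    obtain ⟨⟨f, l⟩, hfl⟩ := Option.ne_none_iff_exists'.mp hne
    obtain ⟨hf0, hf1, hf, hl, hdata⟩ := h.tag_some σ hσ f l hfl
    have hlW : l < m.W := by rw [← hf1]; exact h.fm_lt _
    refine reach_seq (reach_assign ?_ (reach_seq (reach_assign ?_ (reach_seq ?_))))
    · simp only [Expr.eval_sub, h.fmGet, h.slotWord h11, add_zero, hf0, Expr.eval_ofNat]; omega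
    · rw [(h.setReg (by omega)).fmGet, (h.setReg (by omega)).slotWord (σ := σ) (by simp [h11]),
        fm_setReg (by omega), hf1]
      exact hlW
    simp only [Expr.eval_sub, h.fmGet, h.slotWord h11, add_zero, hf0, Expr.eval_ofNat,
      Nat.add_sub_cancel]
    rw [(h.setReg (by omega)).fmGet, (h.setReg (by omega)).slotWord (σ := σ) (by simp [h11]),
        fm_setReg (by omega), hf1]
    have h' : Represents m P H ((st.setReg 7 f).setReg 8 l) s :=
      (h.setReg (by omega)).setReg (by omega)
    refine reach_saveLine (σ := σ) lay ⟨h'.r1, h'.r3, h'.r5, by simp, by simp, by simp [h11]⟩ hf hl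
      h'.fm_lt ?_
    intro t i hi htr htf hte
    have ht1 : t.reg 1 = m.B := by rw [htr 1 (by omega) (by omega), h'.r1]
    have hword : (ExtMem.slotWord 0).eval t = σ * (3 * P.b + 3) := by
      simp [ExtMem.slotWord, htr, h.r3, h11]
    have hlt := slot_lt (k := 0) (D := 3 * P.b + 3) hσ (by omega)
    refine reach_seq (reach_assign (by rw [hword]; omega) (reach_seq (reach_assign (by simp; omega)
      (reach_fmSet (a := σ * (3 * P.b + 3)) (v := 0) (by simpa using ht1) (by simp [hword])
          (by simp)
        (by omega) (by omega) ?_))))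
    intro u hur huf _ hue
    have hur' : ∀ r, r < 7 ∨ r = 11 ∨ 14 ≤ r ∧ r < 20 ∨ 116 ≤ r → u.reg r = st.reg r := by
      intro r hr
      rw [hur r (by omega)]
      simp only [State.setReg_reg]
      rw [Function.update_of_ne (by omega), Function.update_of_ne (by omega),
        htr r (by omega) (by omega)]
      simp only [State.setReg_reg]
      rw [Function.update_of_ne (by omega), Function.update_of_ne (by omega)]
    have huf' : ∀ a, fm m u a = if a = σ * (3 * P.b + 3) then 0 else fm m st a := by
      intro a
      rw [huf, fm_setReg (by omega), fm_setReg (by omega), htf, fm_setReg (by omega),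
        fm_setReg (by omega)]
    have hue' : ∀ c, u.ext c = if f * H * m.B + l * (3 * P.b) ≤ c ∧
        c < f * H * m.B + l * (3 * P.b) + 3 * P.b then
        fm m st (σ * (3 * P.b + 3) + 3 + (c - (f * H * m.B + l * (3 * P.b)))) else st.ext c := by
      intro c
      rw [hue, State.setReg_ext, State.setReg_ext, hte]
      simp only [fm_setReg (m := m) (s := st.setReg 7 f) (r := 8) (v := l) (by omega),
        fm_setReg (m := m) (s := st) (r := 7) (v := f) (by omega), State.setReg_ext]
    refine hQ u _ ?_ (fun r hr => hur' r (by omega)) ?_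
    · refine ⟨by rw [hur' _ (by omega), h.r1], by rw [hur' _ (by omega), h.r3],
        by rw [hur' _ (by omega), h.r4], by rw [hur' _ (by omega), h.r5],
        fun x => by rw [hur' _ (by omega), h.var], h.var_lt, ?_, ?_, ?_, ?_, ?_, ?_, ?_, ?_⟩
      · intro a; rw [huf']; split_ifs
        · omega
        · exact h.fm_lt a
      · intro c; rw [hue']; split_ifs
        · exact h.fm_lt _
        · exact h.ext_lt c
      · intro τ hτ htag
        rw [huf']
        split_ifs with h1
        · rfl
        · refine h.tag_none τ hτ ?_
          have htag' : Function.update s.tag σ none τ = none := htag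
          rwa [Function.update_of_ne] at htag'
          rintro rfl; exact h1 rfl
      · intro τ hτ f' l' htag
        have hne : τ ≠ σ := by rintro rfl; simp at htag
        simp only [Function.update_of_ne hne] at htag
        have hadd : ∀ k < 3 * P.b + 3, τ * (3 * P.b + 3) + k ≠ σ * (3 * P.b + 3) := by
          intro k hk heq
          exact hne (slot_inj (k := 0) hk (by omega) heq).1
        obtain ⟨h0, h1, h2, h3, h4⟩ := h.tag_some τ hτ f' l' htag
        refine ⟨?_, ?_, h2, h3, fun k hk => ?_⟩
        · have := hadd 0 (by omega)
          rw [add_zero] at this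
          rw [huf', if_neg this, h0]
        · rw [huf', if_neg (hadd 1 (by omega)), h1]
        · rw [huf', add_assoc, if_neg (hadd _ (by omega)), ← add_assoc, h4 k hk]
      · intro τ hτ
        by_cases hne : τ = σ
        · simp [hne]
        · simpa [Function.update_of_ne hne] using h.tag_out τ hτ
      · intro τ ρ p h1 h2
        by_cases hne : τ = σ
        · subst hne; simp at h1
        by_cases hne' : ρ = σ
        · subst hne'; simp at h2
        simp only [Function.update_of_ne hne] at h1
        simp only [Function.update_of_ne hne'] at h2
        exact h.distinct _ _ _ h1 h2
      · intro τ hτ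
        rw [huf', if_neg, h.aux τ hτ]
        intro heq
        have := (slot_inj (k := 0) (by omega) (by omega) heq).2
        omega
      · intro f' hf' l' hl' htag k hk
        rw [hue']
        have hoff : ∀ l' k, (l' + 1) * (3 * P.b) ≤ H * m.B → k < 3 * P.b →
            l' * (3 * P.b) + k < H * m.B := by
          intro l' k h1 h2
          rw [add_mul] at h1
          omega
        split_ifs with hc
        · have e1 : f' * (H * m.B) + (l' * (3 * P.b) + k) = f * (H * m.B) + (l * (3 * P.b) +
              (f' * H * m.B + (l' * (3 * P.b) + k) - (f * H * m.B + l * (3 * P.b)))) := by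
            rw [← mul_assoc f', ← mul_assoc f]; omega
          obtain ⟨rfl, e2⟩ := slot_inj (hoff _ _ hl' hk) (hoff _ _ hl (by omega)) e1
          obtain ⟨rfl, e3⟩ := slot_inj hk (by omega) e2
          rw [← e3, hdata k hk]
        · refine h.ext f' hf' l' hl' (fun τ hτ => ?_) k hk
          by_cases hne : τ = σ
          · subst hne
            rw [hfl] at hτ
            obtain ⟨rfl, rfl⟩ : f = f' ∧ l = l' := by simpa using hτ
            apply hc; omega
          · exact htag τ (by simpa [Function.update_of_ne hne] using hτ)
    · have := used_update_none hσ hne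
      omega
  · rw [h.fmGet, h.slotWord h11, add_zero] at hc
    have hn : s.tag σ = none := by
      by_contra hne
      obtain ⟨⟨f, l⟩, hfl⟩ := Option.ne_none_iff_exists'.mp hne
      have := (h.tag_some σ hσ f l hfl).1
      omega
    have hs : ({ s with tag := Function.update s.tag σ none } : VState) = s := by
      rw [← hn, Function.update_eq_self]
    refine reach_skip (hQ _ _ (by rwa [hs]) (fun _ _ => rfl) ?_)
    rw [hs, zero_add]

/-- The test whether slot `σ` holds the line of word `i` of file `f`. -/
theorem Represents.test (h : Represents m P H st s) (h11 : st.reg 11 = σ) (hσ : σ < P.S)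
    {i : ℕ} (h14 : st.reg 14 = i) (h15 : st.reg 15 = f) :
    ((Expr.eq (ExtMem.fmGet (ExtMem.slotWord 0)) (.reg 15 + 1) *
      .eq (ExtMem.fmGet (ExtMem.slotWord 1)) (.reg 14 / .reg 3)).eval st ≠ 0 ↔
      s.tag σ = some (f, i / (3 * P.b))) := by
  simp only [Expr.eval_mul, Expr.eval_eq, h.fmGet, h.slotWord h11, add_zero, Expr.eval_add,
    Expr.eval_reg, Expr.eval_ofNat, Expr.eval_div, h14, h15, h.r3]
  cases htag : s.tag σ with
  | none => simp [h.tag_none σ hσ htag]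
  | some p =>
    obtain ⟨f', l'⟩ := p
    obtain ⟨h0, h1, -⟩ := h.tag_some σ hσ f' l' htag
    rw [h0, h1]
    simp [and_comm]

theorem reach_evictAll {Q : State → ℕ → Prop} {i : ℕ} (lay : Layout m P H)
    (h : Represents m P H st s) (h6 : st.reg 6 = σ) (h14 : st.reg 14 = i) (h15 : st.reg 15 = f)
    (hQ : ∀ st' j (s' : VState), s' = { s with
        tag := fun τ => if τ = σ ∨ s.tag τ = some (f, i / (3 * P.b)) then none else s.tag τ } →
      Represents m P H st' s' →
      (∀ r, r = 6 ∨ 14 ≤ r ∧ r < 20 → st'.reg r = st.reg r) →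
      j + 8 * s'.used P ≤ 8 * s.used P → Q st' j) : Reach m evictAll Q st := by
  have hM := lay.M_lt
  have hS : P.S < m.W := by
    have h1 := lay.slots
    have h2 : P.S * 1 ≤ P.S * (3 * P.b + 3) := Nat.mul_le_mul_left _ (by omega)
    omega
  refine reach_seq (reach_assign (by simp; omega) ?_)
  refine reach_while (fun n st' j => ∃ τ ≤ P.S, n = P.S - τ ∧ st'.reg 11 = τ ∧
    (∀ r, r = 6 ∨ 14 ≤ r ∧ r < 20 → st'.reg r = st.reg r) ∧
    ∃ s' : VState, s' = { s with
        tag := fun ρ => if ρ < τ ∧ (ρ = σ ∨ s.tag ρ = some (f, i / (3 * P.b))) then none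
          else s.tag ρ } ∧
      Represents m P H st' s' ∧ j + 8 * s'.used P ≤ 8 * s.used P) ?_ ?_ P.S
    ⟨0, by omega, rfl, by simp, ?_, s, by simp, h.setReg (by omega), by omega⟩
  · rintro n st' j ⟨τ, hτ, rfl, h11, hr, s', hs', hrep, hj⟩ hc
    simp only [Expr.eval_lt, Expr.eval_reg, h11, hrep.r4, ne_eq, ite_eq_right_iff, one_ne_zero,
      imp_false, not_not] at hc
    have htag : s'.tag τ = s.tag τ := by simp [hs']
    have htest := hrep.test h11 hc ((hr 14 (by omega)).trans h14) ((hr 15 (by omega)).trans h15)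
    have hiff : (Expr.eq (.reg 11) (.reg 6) + .eq (fmGet (slotWord 0)) (.reg 15 + 1) *
      .eq (fmGet (slotWord 1)) (.reg 14 / .reg 3)).eval st' ≠ 0 ↔
        (τ = σ ∨ s.tag τ = some (f, i / (3 * P.b))) := by
      rw [← htag, ← htest, Expr.eval_add]
      simp only [Expr.eval_eq, Expr.eval_reg, h11, hr 6 (by omega), h6]
      by_cases hτσ : τ = σ <;> simp [hτσ]
    refine reach_seq (reach_ite (fun hif => ?_) (fun hif => reach_skip ?_))
    · refine reach_evict lay hrep h11 hc fun st'' j' hrep' hr' hj' => ?_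
      refine reach_assign (by simp [hr', h11]; omega) ⟨P.S - (τ + 1), by omega, τ + 1, hc, rfl,
        by simp [hr', h11], ?_, _, ?_, hrep'.setReg (by omega), by omega⟩
      · intro r h'
        rw [State.setReg_reg, Function.update_of_ne (by omega), hr' r (by omega), hr r h']
      · rw [hs']
        congr 1
        funext ρ
        rw [hiff] at hif
        by_cases hρ : ρ = τ
        · subst hρ; simp [hif]
        · rw [Function.update_of_ne hρ]
          dsimp only
          congr 1
          exact propext ⟨fun h => ⟨by omega, h.2⟩, fun h => ⟨by omega, h.2⟩⟩
    · refine reach_assign (by simp [h11]; omega) ⟨P.S - (τ + 1), by omega, τ + 1, hc, rfl,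
        by simp [h11], ?_, s', ?_, hrep.setReg (by omega), by omega⟩
      · intro r h'
        rw [State.setReg_reg, Function.update_of_ne (by omega), hr r h']
      · rw [hs']
        congr 1
        funext ρ
        have hif' := hiff.not.mp (by simpa using hif)
        congr 1
        refine propext ⟨fun h => ⟨by omega, h.2⟩, fun h => ⟨?_, h.2⟩⟩
        by_contra hcon
        obtain rfl : ρ = τ := by omega
        exact hif' h.2
  · rintro n st' j ⟨τ, hτ, rfl, h11, hr, s', hs', hrep, hj⟩ hc
    simp only [Expr.eval_lt, Expr.eval_reg, h11, hrep.r4, ite_eq_right_iff, one_ne_zero,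
      imp_false] at hc
    obtain rfl : τ = P.S := by omega
    rw [zero_add]
    refine hQ st' j s' ?_ hrep hr hj
    rw [hs']
    congr 1
    funext ρ
    by_cases hρ : ρ < P.S
    · simp [hρ]
    · simp [hρ, h.tag_out ρ (by omega)]
  · intro r hr
    rw [State.setReg_reg, Function.update_of_ne (by omega)]

/-- An access to a line that is in its slot is free. Otherwise the line is loaded with four IOs, and
one more slot may be in use, which raises the potential by eight: this is why a line transfer counts
for twelve IOs. Evictions are paid for by the potential. -/
theorem reach_access {Q : State → ℕ → Prop} {i : ℕ} (lay : Layout m P H)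
    (h : Represents m P H st s) (h6 : st.reg 6 = σ) (hσ : σ < P.S) (h14 : st.reg 14 = i)
    (hi : i < P.cap) (h15 : st.reg 15 = f) (hf : f < 8)
    (hQ : ∀ st' j, Represents m P H st' (s.touch σ f (i / (3 * P.b))) →
      (∀ r, r = 6 ∨ 14 ≤ r ∧ r < 20 → st'.reg r = st.reg r) →
      j + 8 * (s.touch σ f (i / (3 * P.b))).used P + 12 * s.cost ≤
        8 * s.used P + 12 * (s.touch σ f (i / (3 * P.b))).cost → Q st' j) :
    Reach m access Q st := by
  have hM := lay.M_lt
  have hb := lay.b_pos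
  have hbB := lay.b_le
  have hHW := lay.H_lt
  have hcap := lay.cap_le
  have hslots := lay.slots
  have hslot : ∀ k < 3 * P.b + 3, σ * (3 * P.b + 3) + k < 96 + (m.M - m.B) := fun k hk =>
    lt_of_lt_of_le (slot_lt hσ hk) lay.slots
  have hσW : σ < m.W := by
    have h1 := hslot 0 (by omega)
    have h2 : σ * 1 ≤ σ * (3 * P.b + 3) := Nat.mul_le_mul_left _ (by omega)
    omega
  have hl : (i / (3 * P.b) + 1) * (3 * P.b) ≤ H * m.B := by
    have h1 := Nat.div_mul_le_self i (3 * P.b)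
    have h2 : H * 1 ≤ H * m.B := Nat.mul_le_mul_left _ (by omega)
    rw [add_mul]
    omega
  have hli : i / (3 * P.b) ≤ i := Nat.div_le_self _ _
  set l := i / (3 * P.b) with hldef
  refine reach_seq (reach_assign (by simp [h6]; omega) ?_)
  simp only [Expr.eval_reg, h6]
  have h' : Represents m P H (st.setReg 11 σ) s := h.setReg (by omega)
  have htest := h'.test (σ := σ) (f := f) (i := i) (by simp) hσ (by simp [h14]) (by simp [h15])
  refine reach_ite (fun hc => reach_skip ?_) (fun hc => ?_)
  · rw [htest] at hc
    have hs := VState.touch_of_tag s f σ l h.distinct hc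
    refine hQ _ _ (by rwa [hs]) (fun r hr => ?_) (by rw [hs]; omega)
    rw [State.setReg_reg, Function.update_of_ne (by omega)]
  · have hc' : s.tag σ ≠ some (f, l) := fun h => htest.mpr h hc
    refine reach_seq (reach_evictAll lay h' (by simpa using h6) (by simpa using h14)
      (by simpa using h15) ?_)
    intro t j s' hs' hrep hr hj
    rw [← hldef] at hs'
    have htr : ∀ r, r = 6 ∨ 14 ≤ r ∧ r < 20 → t.reg r = st.reg r := fun r h => by
      rw [hr r h, State.setReg_reg, Function.update_of_ne (by omega)]
    have ht6 : t.reg 6 = σ := by rw [htr 6 (by omega), h6]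
    have ht14 : t.reg 14 = i := by rw [htr 14 (by omega), h14]
    have ht15 : t.reg 15 = f := by rw [htr 15 (by omega), h15]
    have ht3 := hrep.r3
    have ht1 := hrep.r1
    refine reach_seq (reach_assign (by simp [ht6]; omega) (reach_seq (reach_assign
      (by simp [ht15]; omega) (reach_seq (reach_assign (by simp [ht14, ht3, ← hldef]; omega) ?_)))))
    rw [show Expr.eval t (.reg 6) = σ from ht6,
      show Expr.eval (t.setReg 11 σ) (.reg 15) = f by simp [ht15],
      show Expr.eval ((t.setReg 11 σ).setReg 7 f) (.reg 14 / .reg 3) = l by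
        simp [ht14, ht3, ← hldef]]
    set t1 := ((t.setReg 11 σ).setReg 7 f).setReg 8 l with ht1def
    have h1rep : Represents m P H t1 s' :=
      ((hrep.setReg (by omega)).setReg (by omega)).setReg (by omega)
    have h111 : t1.reg 11 = σ := by simp [ht1def]
    have h115 : t1.reg 15 = f := by simp [ht1def, ht15]
    have h18 : t1.reg 8 = l := by simp [ht1def]
    have h17 : t1.reg 7 = f := by simp [ht1def]
    have h1r : ∀ r, r = 6 ∨ 14 ≤ r ∧ r < 20 → t1.reg r = st.reg r := fun r h => by
      rw [← htr r h]
      simp only [ht1def, State.setReg_reg]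
      rw [Function.update_of_ne (by omega), Function.update_of_ne (by omega),
        Function.update_of_ne (by omega)]
    clear_value t1
    have ha0 := hslot 0 (by omega)
    have ha1 := hslot 1 (by omega)
    refine reach_seq (reach_assign (by rw [h1rep.slotWord h111]; omega) (reach_seq (reach_assign
      (by simp [h115]; omega) (reach_seq (reach_fmSet (a := σ * (3 * P.b + 3)) (v := f + 1)
      (by simp [h1rep.r1]) (by simp [h1rep.slotWord h111]) (by simp [h115]) (by omega) (by omega)
      ?_)))))
    intro t2 h2r h2f _ h2e
    have h2r' : ∀ r, r < 12 ∨ 14 ≤ r ∧ r < 20 ∨ 116 ≤ r → t2.reg r = t1.reg r := fun r h => by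
      rw [h2r r (by omega)]
      simp only [State.setReg_reg]
      rw [Function.update_of_ne (by omega), Function.update_of_ne (by omega)]
    have h2w : (slotWord 1).eval t2 = σ * (3 * P.b + 3) + 1 := by
      simp [slotWord, h2r', h111, h1rep.r3]
    refine reach_seq (reach_assign (by rw [h2w]; omega) (reach_seq (reach_assign
      (by simp [h2r', h18]; omega) (reach_seq (reach_fmSet (a := σ * (3 * P.b + 3) + 1) (v := l)
      (by simp [h2r', h1rep.r1]) (by simp [h2w]) (by simp [h2r', h18]) (by omega) (by omega)
      ?_)))))
    intro t3 h3r h3f _ h3e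
    have h3r' : ∀ r, r < 12 ∨ 14 ≤ r ∧ r < 20 ∨ 116 ≤ r → t3.reg r = t1.reg r := fun r h => by
      rw [h3r r (by omega), ← h2r' r h]
      simp only [State.setReg_reg]
      rw [Function.update_of_ne (by omega), Function.update_of_ne (by omega)]
    have h3e' : t3.ext = t1.ext := by rw [h3e, State.setReg_ext, State.setReg_ext, h2e,
      State.setReg_ext, State.setReg_ext]
    have h3f' : ∀ a, fm m t3 a = if a = σ * (3 * P.b + 3) + 1 then l else
        if a = σ * (3 * P.b + 3) then f + 1 else fm m t1 a := by
      intro a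
      rw [h3f, fm_setReg (by omega), fm_setReg (by omega), h2f, fm_setReg (by omega),
        fm_setReg (by omega)]
    refine reach_loadLine (σ := σ) (f := f) (l := l) lay ⟨?_, ?_, ?_, ?_, ?_, ?_⟩ hf hl hσ ?_ ?_
    · rw [h3r' _ (by omega), h1rep.r1]
    · rw [h3r' _ (by omega), h1rep.r3]
    · rw [h3r' _ (by omega), h1rep.r5]
    · rw [h3r' _ (by omega), h17]
    · rw [h3r' _ (by omega), h18]
    · rw [h3r' _ (by omega), h111]
    · rw [h3e']; exact h1rep.ext_lt
    intro t4 j4 hj4 h4r h4f h4e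
    have h4r' : ∀ r, r < 7 ∨ r = 11 ∨ 14 ≤ r ∧ r < 20 ∨ 116 ≤ r → t4.reg r = t1.reg r :=
      fun r h => by rw [h4r r (by omega), h3r' r (by omega)]
    -- the words of slot `σ` and of the other slots
    have hoth : ∀ τ k, k < 3 * P.b + 3 → τ ≠ σ →
        fm m t4 (τ * (3 * P.b + 3) + k) = fm m t1 (τ * (3 * P.b + 3) + k) := by
      intro τ k hk hne
      have hn : ∀ k' < 3 * P.b + 3, τ * (3 * P.b + 3) + k ≠ σ * (3 * P.b + 3) + k' :=
        fun k' hk' heq => hne (slot_inj hk hk' heq).1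
      rw [h4f, if_neg, h3f', if_neg (hn 1 (by omega)),
        if_neg (by simpa using hn 0 (by omega))]
      rintro ⟨h1, h2⟩
      exact hn (τ * (3 * P.b + 3) + k - σ * (3 * P.b + 3)) (by omega) (by omega)
    have htouch : s.touch σ f l = { s with
        tag := Function.update s'.tag σ (some (f, l)), cost := s.cost + 1 } := by
      simp only [VState.touch, hc', if_false, hs']
      congr 1
      funext τ
      by_cases hτ : τ = σ
      · simp [hτ]
      · simp [hτ]
    have hfile : s'.file = s.file := by rw [hs']
    have hreg : s'.reg = s.reg := by rw [hs']
    have haux : s'.aux = s.aux := by rw [hs']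
    have hused : (s.touch σ f l).used P ≤ s'.used P + 1 := by
      unfold VState.used
      refine (Finset.card_le_card (t := insert σ _) ?_).trans (Finset.card_insert_le σ _)
      intro τ
      simp only [htouch, Finset.mem_filter, Finset.mem_insert]
      by_cases hτ : τ = σ
      · simp [hτ]
      · simp [hτ]
    have hs'none : ∀ τ, s'.tag τ ≠ some (f, l) := by
      intro τ
      simp only [hs']
      split_ifs with hh
      · simp
      · exact fun h2 => hh (Or.inr h2)
    have hs'σ : s'.tag σ = none := by simp [hs']
    refine hQ t4 _ ?_ (fun r hr => by rw [h4r' r (by omega), h1r r hr]) ?_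
    · refine ⟨by rw [h4r' _ (by omega), h1rep.r1], by rw [h4r' _ (by omega), h1rep.r3],
        by rw [h4r' _ (by omega), h1rep.r4], by rw [h4r' _ (by omega), h1rep.r5],
        fun x => by rw [h4r' _ (by omega), h1rep.var, hreg]; rfl, h.var_lt, ?_, ?_, ?_, ?_, ?_,
        h.distinct.touch _ _ _, ?_, ?_⟩
      · intro a; rw [h4f]; split_ifs
        · rw [h3e']; exact h1rep.ext_lt _
        · rw [h3f']; split_ifs
          · omega
          · omega
          · exact h1rep.fm_lt a
      · rw [h4e, h3e']; exact h1rep.ext_lt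
      · intro τ hτ htag
        have hne : τ ≠ σ := by rintro rfl; simp at htag
        rw [htouch] at htag
        simp only [Function.update_of_ne hne] at htag
        have := hoth τ 0 (by omega) hne
        rw [add_zero] at this
        rw [this, h1rep.tag_none τ hτ htag]
      · intro τ hτ f' l' htag
        by_cases hne : τ = σ
        · subst hne
          obtain ⟨rfl, rfl⟩ : f = f' ∧ l = l' := by simpa using htag
          refine ⟨?_, ?_, hf, hl, fun k hk => ?_⟩
          · rw [h4f, if_neg (by omega), h3f', if_neg (by omega), if_pos rfl]
          · rw [h4f, if_neg (by omega), h3f', if_pos rfl]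
          · rw [h4f, if_pos (by omega), h3e', VState.touch_file, ← hfile,
              ← h1rep.ext f hf l hl hs'none k hk]
            congr 1; omega
        · rw [htouch] at htag
          simp only [Function.update_of_ne hne] at htag
          obtain ⟨h0, h1, h2, h3, h4⟩ := h1rep.tag_some τ hτ f' l' htag
          refine ⟨?_, ?_, h2, h3, fun k hk => ?_⟩
          · have := hoth τ 0 (by omega) hne
            rw [add_zero] at this
            rw [this, h0]
          · rw [hoth τ 1 (by omega) hne, h1]
          · rw [add_assoc, hoth τ _ (by omega) hne, ← add_assoc, h4 k hk, hfile]
            rfl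
      · intro τ hτ
        have hne : τ ≠ σ := by omega
        rw [htouch]
        simp only [Function.update_of_ne hne]
        exact h1rep.tag_out τ hτ
      · intro τ hτ
        by_cases hne : τ = σ
        · subst hne
          rw [h4f, if_neg (by omega), h3f', if_neg (by omega), if_neg (by omega), h1rep.aux τ hτ,
            haux]; rfl
        · rw [hoth τ 2 (by omega) hne, h1rep.aux τ hτ, haux]; rfl
      · intro f' hf' l' hl' htag k hk
        rw [h4e, h3e', VState.touch_file, ← hfile]
        refine h1rep.ext f' hf' l' hl' (fun τ hτ => ?_) k hk
        by_cases hne : τ = σ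
        · subst hne; rw [hs'σ] at hτ; cases hτ
        · apply htag τ
          rw [htouch]
          simpa [Function.update_of_ne hne] using hτ
    · have hcost : (s.touch σ f l).cost = s.cost + 1 := by simp [VState.touch_cost, hc']
      rw [hcost]
      omega

end Represents

end ExtMem

namespace ExtMem

/-- Translation of expressions. -/
def VExpr.compile : VExpr → Expr
  | const n => .const n
  | var x => .reg (120 + x)
  | add a b => .add a.compile b.compile
  | sub a b => .sub a.compile b.compile
  | mul a b => .mul a.compile b.compile
  | div a b => .div a.compile b.compile
  | mod a b => .mod a.compile b.compile
  | lt a b => .lt a.compile b.compile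
  | eq a b => .eq a.compile b.compile

/-- The expression for the slot of an access to file `f`. -/
def compileSlot (f : ℕ) : Option VExpr → Expr
  | none => .const f
  | some e => 8 + e.compile

/-- Bring the line of word `i` of file `f` into slot `σ`. -/
def compileAccess (f : ℕ) (σ : Option VExpr) (i : VExpr) : Prog :=
  .seq (.assign 6 (compileSlot f σ)) (.seq (.assign 15 (.const f))
    (.seq (.assign 14 i.compile) access))

/-- The place in `fm` of word `reg 14` of a file whose line is in slot `reg 6`. -/
def wordAddr : Expr := .reg 6 * (.reg 3 + 3) + 3 + .reg 14 % .reg 3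

/-- Translation of programs. -/
def VProg.compile : VProg → Prog
  | skip => .skip
  | assign x e => .assign (120 + x) e.compile
  | auxGet x e => .assign (120 + x) (fmGet (e.compile * (.reg 3 + 3) + 2))
  | auxSet e x => .seq (.assign 12 (e.compile * (.reg 3 + 3) + 2))
      (.seq (.assign 13 (.reg (120 + x))) fmSet)
  | get x f σ i => .seq (compileAccess f σ i) (.assign (120 + x) (fmGet wordAddr))
  | put f σ i x => .seq (compileAccess f σ i) (.seq (.assign 12 wordAddr)
      (.seq (.assign 13 (.reg (120 + x))) fmSet))
  | seq p q => .seq p.compile q.compile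
  | ite c p q => .ite c.compile p.compile q.compile
  | .while c p => .while c.compile p.compile

/-- Empty all slots. -/
def flushAll : Prog := .seq (.assign 11 0) (.while (.lt (.reg 11) (.reg 4))
  (.seq evict (.assign 11 (.reg 11 + 1))))

@[simp] theorem VState.used_setReg (P : VParams) (s : VState) (x v : ℕ) :
    (s.setReg x v).used P = s.used P := (rfl)
@[simp] theorem VState.used_setAux (P : VParams) (s : VState) (x v : ℕ) :
    (s.setAux x v).used P = s.used P := (rfl)
@[simp] theorem VState.used_setFile (P : VParams) (s : VState) (f i v : ℕ) :
    (s.setFile f i v).used P = s.used P := (rfl)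

section Represents

variable {m : Params} {P : VParams} {H : ℕ} {st : State} {s : VState} {σ f l : ℕ}

theorem Represents.eval_compile (h : Represents m P H st s) (e : VExpr) :
    e.compile.eval st = e.eval s.reg := by
  induction e <;> simp_all [VExpr.compile, VExpr.eval, Expr.eval, h.var]

theorem Represents.setVar (h : Represents m P H st s) {x v : ℕ} (hv : v < m.W) :
    Represents m P H (st.setReg (120 + x) v) (s.setReg x v) := by
  have hr : ∀ r, r < 120 → (st.setReg (120 + x) v).reg r = st.reg r := fun r h => by
    rw [State.setReg_reg, Function.update_of_ne (by omega)]
  have hf : ∀ a, fm m (st.setReg (120 + x) v) a = fm m st a := fm_setReg (by omega)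
  exact {
    r1 := by rw [hr _ (by omega), h.r1]
    r3 := by rw [hr _ (by omega), h.r3]
    r4 := by rw [hr _ (by omega), h.r4]
    r5 := by rw [hr _ (by omega), h.r5]
    var := fun y => by
      by_cases hy : y = x
      · subst hy; simp
      · simp [hy, h.var]
    var_lt := fun y => by
      by_cases hy : y = x
      · subst hy; simpa using hv
      · simpa [hy] using h.var_lt y
    fm_lt := by simpa only [hf] using h.fm_lt
    ext_lt := h.ext_lt
    tag_none := fun σ hσ ht => by rw [hf]; exact h.tag_none σ hσ ht
    tag_some := by simp only [hf]; exact h.tag_some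
    tag_out := h.tag_out
    distinct := h.distinct
    aux := by simp only [hf]; exact h.aux
    ext := h.ext }

theorem reach_compileAccess {Q : State → ℕ → Prop} (lay : Layout m P H)
    (h : Represents m P H st s) {o : Option VExpr} {i : VExpr} (hf : f < 8)
    (hσ : slotOf s.reg f o < P.S) (hi : i.eval s.reg < P.cap)
    (hQ : ∀ st' j, Represents m P H st' (s.touch (slotOf s.reg f o) f
        (i.eval s.reg / (3 * P.b))) →
      wordAddr.eval st' = slotOf s.reg f o * (3 * P.b + 3) + 3 + i.eval s.reg % (3 * P.b) →
      j + 8 * (s.touch (slotOf s.reg f o) f (i.eval s.reg / (3 * P.b))).used P + 12 * s.cost ≤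
        8 * s.used P + 12 * (s.touch (slotOf s.reg f o) f (i.eval s.reg / (3 * P.b))).cost →
      Q st' j) :
    Reach m (compileAccess f o i) Q st := by
  have hb := lay.b_pos
  have hcap := lay.cap_le
  have hHW := lay.H_lt
  have hslot : (compileSlot f o).eval st = slotOf s.reg f o := by
    cases o <;> simp [compileSlot, h.eval_compile]
  have hSW : P.S < m.W := by
    have h0 := lay.M_lt
    have h1 := lay.slots
    have h2 : P.S * 1 ≤ P.S * (3 * P.b + 3) := Nat.mul_le_mul_left _ (by omega)
    omega
  have h1 : Represents m P H (st.setReg 6 (slotOf s.reg f o)) s := h.setReg (by omega)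
  have h2 : Represents m P H ((st.setReg 6 (slotOf s.reg f o)).setReg 15 f) s :=
    h1.setReg (by omega)
  refine reach_seq (reach_assign (by rw [hslot]; omega) (reach_seq (reach_assign
    (by simp; omega) (reach_seq (reach_assign ?_ ?_)))))
  · rw [hslot, Expr.eval_const, h2.eval_compile]; omega
  rw [hslot, Expr.eval_const, h2.eval_compile]
  refine reach_access (σ := slotOf s.reg f o) (i := i.eval s.reg) (f := f) lay
    (h2.setReg (by omega)) (by simp) hσ (by simp) hi (by simp) hf ?_
  intro st' j hrep hr hj
  refine hQ st' _ hrep ?_ (by omega)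
  simp [wordAddr, hr, hrep.r3]

/-- The translation of a program is correct. A line transfer of the virtual machine accounts for at
most twelve IOs, amortised with the potential of eight per slot in use. -/
theorem reach_compile (lay : Layout m P H) {p : VProg} {Q : VState → Prop} (hwp : wp P p Q s)
    (h : Represents m P H st s) :
    Reach m p.compile (fun st' i => ∃ t, Q t ∧ Represents m P H st' t ∧
      i + 8 * t.used P + 12 * s.cost ≤ 8 * s.used P + 12 * t.cost) st := by
  have hWW := lay.hW
  have hSM : ∀ σ < P.S, ∀ k < 3 * P.b + 3, σ * (3 * P.b + 3) + k < 96 + (m.M - m.B) :=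
    fun σ hσ k hk => lt_of_lt_of_le (slot_lt hσ hk) lay.slots
  have hM := lay.M_lt
  induction p generalizing Q s st with
  | skip => exact reach_skip ⟨s, hwp, h, by omega⟩
  | assign x e =>
    have he := h.eval_compile e
    have hlt : e.eval s.reg < m.W := by
      rcases hwp.1 with h1 | h1
      · omega
      · cases e <;> simp [VExpr.IsVar] at h1
        exact h.var_lt _
    refine reach_assign (by rw [he]; exact hlt) ⟨_, hwp.2, ?_, ?_⟩
    · rw [he]; exact h.setVar hlt
    · simp
  | auxGet x e =>
    have he := h.eval_compile e
    have hv : (fmGet (e.compile * (.reg 3 + 3) + 2)).eval st = s.aux (e.eval s.reg) := by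
      rw [h.fmGet, ← h.aux _ hwp.1]; simp [h.r3, he]
    have hlt : s.aux (e.eval s.reg) < m.W := by
      rw [← h.aux _ hwp.1]; exact h.fm_lt _
    refine reach_assign (by rw [hv]; exact hlt) ⟨_, hwp.2, ?_, ?_⟩
    · rw [hv]; exact h.setVar hlt
    · simp
  | auxSet e x =>
    have he := h.eval_compile e
    have ha : (e.compile * (.reg 3 + 3) + 2).eval st = e.eval s.reg * (3 * P.b + 3) + 2 := by
      simp [h.r3, he]
    have hs := hSM _ hwp.1 2 (by omega)
    have h12 : Represents m P H (st.setReg 12 (e.eval s.reg * (3 * P.b + 3) + 2)) s :=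
      h.setReg (by omega)
    have h13 := h12.setReg (r := 13) (v := s.reg x) (by omega)
    refine reach_seq (reach_assign (by rw [ha]; omega) (reach_seq (reach_assign ?_
      (reach_fmSet (a := e.eval s.reg * (3 * P.b + 3) + 2) (v := s.reg x) ?_ ?_ ?_ (h.var_lt x) hs
        ?_))))
    · rw [ha, Expr.eval_reg, h12.var]; exact h.var_lt x
    · rw [ha, Expr.eval_reg, h12.var, h13.r1]
    · rw [ha, Expr.eval_reg, h12.var]; simp
    · rw [ha, Expr.eval_reg, h12.var]; simp
    · rw [ha, Expr.eval_reg, h12.var]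
      intro t htr htf _ hte
      refine ⟨_, hwp.2, ?_, by simp⟩
      have hne : ∀ σ k, k < 3 * P.b + 3 → k ≠ 2 →
          σ * (3 * P.b + 3) + k ≠ e.eval s.reg * (3 * P.b + 3) + 2 := fun σ k hk h2 heq =>
        h2 (slot_inj hk (by omega) heq).2
      exact {
        r1 := by rw [htr _ (by omega), h13.r1]
        r3 := by rw [htr _ (by omega), h13.r3]
        r4 := by rw [htr _ (by omega), h13.r4]
        r5 := by rw [htr _ (by omega), h13.r5]
        var := fun y => by rw [htr _ (by omega), h13.var]; rfl
        var_lt := h.var_lt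
        fm_lt := fun a => by
          rw [htf]; split_ifs
          · exact h.var_lt x
          · exact h13.fm_lt a
        ext_lt := by rw [hte]; exact h13.ext_lt
        tag_none := fun σ hσ ht => by
          have := hne σ 0 (by omega) (by omega)
          rw [add_zero] at this
          rw [htf, if_neg this]
          exact h13.tag_none σ hσ ht
        tag_some := fun σ hσ f l ht => by
          obtain ⟨h0, h1, h2, h3, h4⟩ := h13.tag_some σ hσ f l ht
          have := hne σ 0 (by omega) (by omega)
          rw [add_zero] at this
          refine ⟨by rw [htf, if_neg this, h0], by rw [htf, if_neg (hne _ _ (by omega) (by omega)),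
            h1], h2, h3, fun k hk => ?_⟩
          rw [add_assoc, htf, if_neg (hne _ _ (by omega) (by omega)), ← add_assoc]
          exact h4 k hk
        tag_out := h.tag_out
        distinct := h.distinct
        aux := fun σ hσ => by
          rw [htf]
          by_cases hσe : σ = e.eval s.reg
          · subst hσe; simp
          · rw [if_neg (fun heq => hσe (slot_inj (by omega) (by omega) heq).1), h13.aux σ hσ]
            simp [hσe]
        ext := by rw [hte]; exact h13.ext }
  | get x f o i =>
    obtain ⟨hf, hσ, hi, hQ⟩ := hwp
    refine reach_seq (reach_compileAccess lay h hf hσ hi ?_)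
    intro st' j hrep hw hj
    have hmod : i.eval s.reg % (3 * P.b) < 3 * P.b := Nat.mod_lt _ (by have := lay.b_pos; omega)
    have hv : (fmGet wordAddr).eval st' = s.file f (i.eval s.reg) := by
      obtain ⟨-, -, -, -, h4⟩ := hrep.tag_some _ hσ _ _ (VState.touch_tag_self _ _ _ _)
      rw [hrep.fmGet, hw, h4 _ hmod, VState.touch_file, Nat.div_add_mod']
    have hlt : s.file f (i.eval s.reg) < m.W := by
      rw [← hv, hrep.fmGet]; exact hrep.fm_lt _
    refine reach_assign (by rw [hv]; exact hlt) ⟨_, hQ, ?_, ?_⟩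
    · rw [hv]; exact hrep.setVar hlt
    · simpa using hj
  | put f o i x =>
    obtain ⟨hf, hσ, hi, hQ⟩ := hwp
    refine reach_seq (reach_compileAccess lay h hf hσ hi ?_)
    intro st' j hrep hw hj
    have hmod : i.eval s.reg % (3 * P.b) < 3 * P.b := Nat.mod_lt _ (by have := lay.b_pos; omega)
    set σ := slotOf s.reg f o with hσdef
    set l := i.eval s.reg / (3 * P.b) with hldef
    set k0 := i.eval s.reg % (3 * P.b) with hk0
    have hi' : i.eval s.reg = l * (3 * P.b) + k0 := (Nat.div_add_mod' _ _).symm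
    have hs := hSM σ hσ (3 + k0) (by omega)
    have h12 : Represents m P H (st'.setReg 12 (σ * (3 * P.b + 3) + 3 + k0))
      (s.touch σ f l) := hrep.setReg (by omega)
    have h13 := h12.setReg (r := 13) (v := s.reg x) (by omega)
    refine reach_seq (reach_assign (by rw [hw]; omega) (reach_seq (reach_assign ?_
      (reach_fmSet (a := σ * (3 * P.b + 3) + 3 + k0) (v := s.reg x) ?_ ?_ ?_ (h.var_lt x)
        (by omega) ?_))))
    · rw [hw, Expr.eval_reg, h12.var, VState.touch_reg]; exact h.var_lt x
    · rw [hw, Expr.eval_reg, h12.var, VState.touch_reg]; exact h13.r1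
    · rw [hw, Expr.eval_reg, h12.var, VState.touch_reg]; simp
    · rw [hw, Expr.eval_reg, h12.var, VState.touch_reg]; simp
    · rw [hw, Expr.eval_reg, h12.var, VState.touch_reg]
      intro t htr htf _ hte
      refine ⟨_, hQ, ?_, by simpa using hj⟩
      have hne : ∀ τ k, k < 3 * P.b + 3 → (τ ≠ σ ∨ k ≠ 3 + k0) →
          τ * (3 * P.b + 3) + k ≠ σ * (3 * P.b + 3) + 3 + k0 := fun τ k hk h2 heq => by
        have := slot_inj hk (by omega : 3 + k0 < 3 * P.b + 3) (heq.trans (add_assoc _ _ _))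
        omega
      exact {
        r1 := by rw [htr _ (by omega)]; exact h13.r1
        r3 := by rw [htr _ (by omega)]; exact h13.r3
        r4 := by rw [htr _ (by omega)]; exact h13.r4
        r5 := by rw [htr _ (by omega)]; exact h13.r5
        var := fun y => by rw [htr _ (by omega)]; exact h13.var y
        var_lt := h.var_lt
        fm_lt := fun a => by
          rw [htf]; split_ifs
          · exact h.var_lt x
          · exact h13.fm_lt a
        ext_lt := by rw [hte]; exact h13.ext_lt
        tag_none := fun τ hτ ht => by
          have := hne τ 0 (by omega) (by omega)
          rw [add_zero] at this
          rw [htf, if_neg this]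
          exact h13.tag_none τ hτ ht
        tag_some := fun τ hτ g l' ht => by
          obtain ⟨h0, h1, h2, h3, h4⟩ := h13.tag_some τ hτ g l' ht
          have := hne τ 0 (by omega) (by omega)
          rw [add_zero] at this
          refine ⟨by rw [htf, if_neg this, h0], by rw [htf, if_neg (hne _ _ (by omega) (by omega)),
            h1], h2, h3, fun k hk => ?_⟩
          rw [htf, hi']
          by_cases hτσ : τ = σ
          · subst hτσ
            obtain ⟨rfl, rfl⟩ : f = g ∧ l = l' := by simpa using ht
            by_cases hk' : k = k0
            · subst hk'; simp
            · rw [if_neg (by omega), h4 k hk]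
              simp [hk']
          · rw [add_assoc, if_neg (hne τ _ (by omega) (by omega)), ← add_assoc, h4 k hk]
            -- the line in slot `τ` is another one than that in slot `σ`
            have hother : ¬ (g = f ∧ l' * (3 * P.b) + k = l * (3 * P.b) + k0) := by
              rintro ⟨rfl, heq⟩
              obtain ⟨rfl, -⟩ := slot_inj hk hmod heq
              exact hτσ (h13.distinct _ _ _ ht (VState.touch_tag_self _ _ _ _))
            simp only [VState.setFile_file]
            by_cases hgf : g = f
            · subst hgf
              rw [Function.update_self, Function.update_of_ne fun heq => hother ⟨rfl, heq⟩]
            · rw [Function.update_of_ne hgf]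
        tag_out := h13.tag_out
        distinct := h13.distinct
        aux := fun τ hτ => by
          rw [htf, if_neg (hne _ _ (by omega) (by omega))]
          exact h13.aux τ hτ
        ext := fun g hg l' hl' ht k hk => by
          rw [hte, h13.ext g hg l' hl' ht k hk, hi']
          have hother : ¬ (g = f ∧ l' * (3 * P.b) + k = l * (3 * P.b) + k0) := by
            rintro ⟨rfl, heq⟩
            obtain ⟨rfl, -⟩ := slot_inj hk hmod heq
            exact ht _ (VState.touch_tag_self _ _ _ _)
          simp only [VState.setFile_file]
          by_cases hgf : g = f
          · subst hgf
            rw [Function.update_self, Function.update_of_ne fun heq => hother ⟨rfl, heq⟩]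
          · rw [Function.update_of_ne hgf] }
  | seq p q ihp ihq =>
    refine reach_seq ((ihp hwp h).mono ?_)
    rintro t i ⟨u, hu, hrep, hi⟩
    refine (ihq hu hrep).mono ?_
    rintro t' j ⟨v, hv, hrep', hj⟩
    exact ⟨v, hv, hrep', by omega⟩
  | ite c p q ihp ihq =>
    refine reach_ite (fun hc => ?_) (fun hc => ?_)
    · rw [h.eval_compile] at hc
      exact ihp (hwp.1 hc) h
    · rw [h.eval_compile] at hc
      exact ihq (hwp.2 hc) h
  | _ c p ih =>
    obtain ⟨n, hn⟩ := hwp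
    induction n generalizing s st with
    | zero =>
      exact ⟨st, 0, .while_false (by rw [h.eval_compile]; exact hn.1), s, hn.2, h, by omega⟩
    | succ n ihn =>
      rcases hn with hn | hn
      · exact ⟨st, 0, .while_false (by rw [h.eval_compile]; exact hn.1), s, hn.2, h, by omega⟩
      · obtain ⟨t, i, he, u, hu, hrep, hi⟩ := ih hn.2 h
        obtain ⟨t', j, he', v, hv, hrep', hj⟩ := ihn hrep hu
        exact ⟨t', i + j, .while_true (by rw [h.eval_compile]; exact hn.1) he he', v, hv, hrep',
          by omega⟩

theorem reach_flushAll {Q : State → ℕ → Prop} (lay : Layout m P H)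
    (h : Represents m P H st s)
    (hQ : ∀ st' j, Represents m P H st' { s with tag := fun _ => none } → j ≤ 8 * s.used P →
      Q st' j) : Reach m flushAll Q st := by
  have hS : P.S < m.W := by
    have h0 := lay.M_lt
    have h1 := lay.slots
    have h2 : P.S * 1 ≤ P.S * (3 * P.b + 3) := Nat.mul_le_mul_left _ (by omega)
    omega
  refine reach_seq (reach_assign (by simp; omega) ?_)
  refine reach_while (fun n st' j => ∃ τ ≤ P.S, n = P.S - τ ∧ st'.reg 11 = τ ∧
    ∃ s' : VState, s' = { s with
        tag := fun ρ => if ρ < τ then none else s.tag ρ } ∧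
      Represents m P H st' s' ∧ j + 8 * s'.used P ≤ 8 * s.used P) ?_ ?_ P.S
    ⟨0, by omega, rfl, by simp, s, by simp, h.setReg (by omega), by omega⟩
  · rintro n st' j ⟨τ, hτ, rfl, h11, s', hs', hrep, hj⟩ hc
    simp only [Expr.eval_lt, Expr.eval_reg, h11, hrep.r4, ne_eq, ite_eq_right_iff, one_ne_zero,
      imp_false, not_not] at hc
    refine reach_seq (reach_evict lay hrep h11 hc fun st'' j' hrep' hr' hj' => ?_)
    refine reach_assign (by simp [hr', h11]; omega) ⟨P.S - (τ + 1), by omega, τ + 1, hc, rfl,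
      by simp [hr', h11], _, ?_, hrep'.setReg (by omega), by omega⟩
    rw [hs']
    congr 1
    funext ρ
    by_cases hρ : ρ = τ
    · subst hρ; simp
    · rw [Function.update_of_ne hρ]
      dsimp only
      congr 1
      exact propext ⟨fun h => by omega, fun h => by omega⟩
  · rintro n st' j ⟨τ, hτ, rfl, h11, s', hs', hrep, hj⟩ hc
    simp only [Expr.eval_lt, Expr.eval_reg, h11, hrep.r4, ite_eq_right_iff, one_ne_zero,
      imp_false] at hc
    obtain rfl : τ = P.S := by omega
    have : s' = { s with tag := fun _ => none } := by
      rw [hs']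
      congr 1
      funext ρ
      by_cases hρ : ρ < P.S
      · simp [hρ]
      · simp [hρ, h.tag_out ρ (by omega)]
    rw [zero_add]
    exact hQ st' j (this ▸ hrep) (by omega)

end Represents

end ExtMem

namespace ExtMem

open VState

section Rules

variable {P : VParams} {p q : VProg} {Q Q' : VState → Prop} {s t : VState}

theorem wp_seq (h : wp P p (wp P q Q) s) : wp P (.seq p q) Q s := h

theorem wp_assign {x : ℕ} {e : VExpr} (v : ℕ) (hv : e.eval s.reg = v) (hW : v < P.W)
    (h : Q (s.setReg x v)) : wp P (.assign x e) Q s :=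
  ⟨Or.inl (hv ▸ hW), hv ▸ h⟩

theorem wp_assign_var {x y : ℕ} (h : Q (s.setReg x (s.reg y))) :
    wp P (.assign x (.var y)) Q s :=
  ⟨Or.inr trivial, h⟩

theorem wp_auxGet {x : ℕ} {e : VExpr} (j : ℕ) (hj : e.eval s.reg = j) (hS : j < P.S)
    (h : Q (s.setReg x (s.aux j))) : wp P (.auxGet x e) Q s :=
  ⟨hj ▸ hS, hj ▸ h⟩

theorem wp_auxSet {x : ℕ} {e : VExpr} (j : ℕ) (hj : e.eval s.reg = j) (hS : j < P.S)
    (h : Q (s.setAux j (s.reg x))) : wp P (.auxSet e x) Q s :=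
  ⟨hj ▸ hS, hj ▸ h⟩

theorem wp_get {x f : ℕ} {o : Option VExpr} {i : VExpr} (σ k : ℕ) (hσ : slotOf s.reg f o = σ)
    (hk : i.eval s.reg = k) (hf : f < 8) (hS : σ < P.S) (hc : k < P.cap)
    (h : Q ((s.touch σ f (k / (3 * P.b))).setReg x (s.file f k))) : wp P (.get x f o i) Q s :=
  ⟨hf, hσ ▸ hS, hk ▸ hc, hσ ▸ hk ▸ h⟩

theorem wp_put {x f : ℕ} {o : Option VExpr} {i : VExpr} (σ k : ℕ) (hσ : slotOf s.reg f o = σ)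
    (hk : i.eval s.reg = k) (hf : f < 8) (hS : σ < P.S) (hc : k < P.cap)
    (h : Q ((s.touch σ f (k / (3 * P.b))).setFile f k (s.reg x))) : wp P (.put f o i x) Q s :=
  ⟨hf, hσ ▸ hS, hk ▸ hc, hσ ▸ hk ▸ h⟩

theorem wp_ite {c : VExpr} (h1 : c.eval s.reg ≠ 0 → wp P p Q s)
    (h2 : c.eval s.reg = 0 → wp P q Q s) :
    wp P (.ite c p q) Q s := ⟨h1, h2⟩

theorem Frame.while_trans {c : VExpr} {u : VState} (h : Frame (.while c p) s t) (h' : Frame p t u) :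
    Frame (.while c p) s u :=
  h.trans h' (fun _ h => ⟨h, h⟩) (fun _ h => ⟨h, h⟩) (fun _ h => ⟨h, h⟩)

/-- The rule for loops, in which the frame of the loop is available throughout. -/
theorem wp_while_frame {c : VExpr} (I : ℕ → VState → Prop) (n : ℕ) (h : I n s)
    (hstep : ∀ n t, I n t → Frame (.while c p) s t → c.eval t.reg ≠ 0 →
      wp P p (fun t => ∃ k < n, I k t) t)
    (hexit : ∀ n t, I n t → Frame (.while c p) s t → c.eval t.reg = 0 → Q t) :
    wp P (.while c p) Q s := by
  refine wp_while (fun n t => I n t ∧ Frame (.while c p) s t) ?_ ?_ n ⟨h, Frame.refl _ _⟩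
  · rintro n t ⟨hI, hF⟩ hc
    exact wp_conseq (hstep n t hI hF hc) fun u ⟨k, hk, hu⟩ hF' => ⟨k, hk, hu, hF.while_trans hF'⟩
  · rintro n t ⟨hI, hF⟩ hc
    exact hexit n t hI hF hc

/-- The rule for counting loops, in which the frame of the loop is available throughout. -/
theorem wp_for_frame {x : ℕ} {e : VExpr} (N : ℕ) (I : ℕ → VState → Prop)
    (hN : N < P.W) (h0 : I 0 (s.setReg x 0))
    (hbound : ∀ k t, k ≤ N → t.reg x = k → I k t → Frame (VProg.forTo x e p) s t →
      e.eval t.reg = N)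
    (hstep : ∀ k t, k < N → t.reg x = k → I k t → Frame (VProg.forTo x e p) s t →
      wp P p (fun t => t.reg x = k ∧ I (k + 1) (t.setReg x (k + 1))) t)
    (hexit : ∀ t, t.reg x = N → I N t → Frame (VProg.forTo x e p) s t → Q t) :
    wp P (VProg.forTo x e p) Q s := by
  have hset : ∀ t v, Frame (VProg.forTo x e p) s t → Frame (VProg.forTo x e p) s (t.setReg x v) :=
      by
    intro t v hF
    refine ⟨fun y hy => ?_, hF.file, hF.tag, hF.distinct⟩
    rw [setReg_reg, Function.update_of_ne, hF.reg y hy]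
    rintro rfl
    simp [VProg.forTo, VProg.writes] at hy
  refine wp_for N (fun k t => I k t ∧ Frame (VProg.forTo x e p) s t) hN
    ⟨h0, hset _ _ (Frame.refl _ _)⟩ ?_ ?_ ?_
  · exact fun k t hk hx hI => hbound k t hk hx hI.1 hI.2
  · intro k t hk hx hI
    refine wp_conseq (hstep k t hk hx hI.1 hI.2) fun u hu hF => ⟨hu.1, hu.2, hset _ _ ?_⟩
    exact hI.2.trans hF (by simp +contextual [VProg.forTo, VProg.writes])
      (by simp [VProg.forTo, VProg.changes]) (by simp [VProg.forTo, VProg.uses])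
  · exact fun t hx hI => hexit t hx hI.1 hI.2

end Rules

/-! ### Files of records -/

/-- Records of three words, ordered lexicographically. -/
abbrev Rec : Type := ℕ ×ₗ ℕ ×ₗ ℕ

/-- The record with the given words. -/
def mkRec (a b c : ℕ) : Rec := toLex (a, toLex (b, c))

theorem mkRec_lt {a b c a' b' c' : ℕ} : mkRec a b c < mkRec a' b' c' ↔
    a < a' ∨ a = a' ∧ (b < b' ∨ b = b' ∧ c < c') := by
  simp [mkRec, Prod.Lex.toLex_lt_toLex]

theorem mkRec_le {a b c a' b' c' : ℕ} : mkRec a b c ≤ mkRec a' b' c' ↔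
    a < a' ∨ a = a' ∧ (b < b' ∨ b = b' ∧ c ≤ c') := by
  simp [mkRec, Prod.Lex.toLex_le_toLex]

theorem mkRec_inj {a b c a' b' c' : ℕ} :
    mkRec a b c = mkRec a' b' c' ↔ a = a' ∧ b = b' ∧ c = c' := by
  simp [mkRec]

/-- The file as an array of records: record `i` consists of the words `3 * i`, `3 * i + 1` and
`3 * i + 2`. -/
def recs (g : ℕ → ℕ) (i : ℕ) : Rec := mkRec (g (3 * i)) (g (3 * i + 1)) (g (3 * i + 2))

namespace VState

/-- Set the variables `x`, `x + 1`, `x + 2`. -/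
def setRegs (s : VState) (x a b c : ℕ) : VState :=
  ((s.setReg x a).setReg (x + 1) b).setReg (x + 2) c

/-- Set record `i` of file `f`. -/
def setRec (s : VState) (f i a b c : ℕ) : VState :=
  ((s.setFile f (3 * i) a).setFile f (3 * i + 1) b).setFile f (3 * i + 2) c

variable (s : VState) (x a b c f i : ℕ)

theorem setRegs_reg (y : ℕ) : (s.setRegs x a b c).reg y =
    if y = x + 2 then c else if y = x + 1 then b else if y = x then a else s.reg y := by
  simp [setRegs, Function.update_apply]
@[simp] theorem setRegs_aux : (s.setRegs x a b c).aux = s.aux := rfl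
@[simp] theorem setRegs_file : (s.setRegs x a b c).file = s.file := rfl
@[simp] theorem setRegs_tag : (s.setRegs x a b c).tag = s.tag := rfl
@[simp] theorem setRegs_cost : (s.setRegs x a b c).cost = s.cost := rfl
@[simp] theorem setRec_reg : (s.setRec f i a b c).reg = s.reg := rfl
@[simp] theorem setRec_aux : (s.setRec f i a b c).aux = s.aux := rfl
@[simp] theorem setRec_tag : (s.setRec f i a b c).tag = s.tag := rfl
@[simp] theorem setRec_cost : (s.setRec f i a b c).cost = s.cost := rfl

theorem setRec_file (g : ℕ) (hg : g ≠ f) : (s.setRec f i a b c).file g = s.file g := by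
  simp [setRec, hg]

theorem recs_setRec : recs ((s.setRec f i a b c).file f) =
    Function.update (recs (s.file f)) i (mkRec a b c) := by
  funext j
  by_cases hj : j = i
  · subst hj
    simp [recs, setRec]
  · rw [Function.update_of_ne hj]
    simp only [recs, setRec, setFile_file, Function.update_self]
    repeat rw [Function.update_of_ne (by omega)]

/-- An access that goes forward in a file, by the numbers of the lines passed. -/
theorem touch_cost_forward {s : VState} {σ f l l' : ℕ} (h : s.tag σ = some (f, l)) (hl : l ≤ l') :
    (s.touch σ f l').cost + l ≤ s.cost + l' := by
  rw [touch_cost, h]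
  split_ifs with heq
  · omega
  · have : l ≠ l' := by rintro rfl; exact heq rfl
    omega

theorem touch_tag_of_ne {s : VState} {σ f l τ g k : ℕ} (h : s.tag τ = some (g, k)) (hτ : τ ≠ σ)
    (hne : g ≠ f ∨ k ≠ l) : (s.touch σ f l).tag τ = some (g, k) := by
  rw [touch_tag, if_neg hτ, h, if_neg]
  simp only [Option.some.injEq, Prod.mk.injEq, not_and_or]
  exact hne

end VState

namespace VProg

/-- Read record `i` of file `f` into the variables `x`, `x + 1`, `x + 2`. -/
def getRec (x f : ℕ) (σ : Option VExpr) (i : VExpr) : VProg :=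
  .seq (.get x f σ (3 * i)) (.seq (.get (x + 1) f σ (3 * i + 1)) (.get (x + 2) f σ (3 * i + 2)))

/-- Write the variables `x`, `x + 1`, `x + 2` to record `i` of file `f`. -/
def putRec (f : ℕ) (σ : Option VExpr) (i : VExpr) (x : ℕ) : VProg :=
  .seq (.put f σ (3 * i) x) (.seq (.put f σ (3 * i + 1) (x + 1)) (.put f σ (3 * i + 2) (x + 2)))

/-- Whether the record in the variables from `x` on is less than that from `y` on. -/
def ltRec (x y : ℕ) : VExpr :=
  .lt (.var x) (.var y) + .eq (.var x) (.var y) * (.lt (.var (x + 1)) (.var (y + 1)) +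
    .eq (.var (x + 1)) (.var (y + 1)) * .lt (.var (x + 2)) (.var (y + 2)))

end VProg

open VProg

theorem eval_ltRec (r : ℕ → ℕ) (x y : ℕ) : (ltRec x y).eval r ≠ 0 ↔
    mkRec (r x) (r (x + 1)) (r (x + 2)) < mkRec (r y) (r (y + 1)) (r (y + 2)) := by
  rw [mkRec_lt]
  simp only [ltRec, VExpr.eval_add, VExpr.eval_lt, VExpr.eval_eq, VExpr.eval_mul, VExpr.eval_var]
  split_ifs <;> simp <;> omega

section Rules

variable {P : VParams} {Q : VState → Prop} {s : VState}

/-- The three words of a record are in the same line, because lines consist of `b` records. -/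
theorem line_div {b k j : ℕ} (hj : j < 3) : (3 * k + j) / (3 * b) = k / b := by
  rw [← Nat.div_div_eq_div_mul]
  congr 1
  omega

theorem line_div_zero {b k : ℕ} : 3 * k / (3 * b) = k / b := Nat.mul_div_mul_left _ _ (by omega)

/-- The index `k` and the slot `σ` must not depend on the variables that are read. -/
theorem wp_getRec {x f : ℕ} {o : Option VExpr} {i : VExpr} (σ k : ℕ) (hd : s.TagsDistinct)
    (hσ : ∀ r : ℕ → ℕ, (∀ y, y ≠ x → y ≠ x + 1 → r y = s.reg y) → slotOf r f o = σ)
    (hk : ∀ r : ℕ → ℕ, (∀ y, y ≠ x → y ≠ x + 1 → r y = s.reg y) → i.eval r = k)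
    (hf : f < 8) (hS : σ < P.S) (hc : 3 * k + 2 < P.cap)
    (h : Q ((s.touch σ f (k / P.b)).setRegs x (s.file f (3 * k)) (s.file f (3 * k + 1))
      (s.file f (3 * k + 2)))) :
    wp P (getRec x f o i) Q s := by
  refine wp_seq (wp_get σ (3 * k) (hσ _ fun _ _ _ => rfl) ?_ hf hS (by omega) ?_)
  · simp [hk _ fun _ _ _ => rfl]
  rw [line_div_zero]
  have hd1 := hd.touch σ f (k / P.b)
  refine wp_seq (wp_get σ (3 * k + 1) (hσ _ fun y h1 _ => ?_) ?_ hf hS (by omega) ?_)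
  · simp [h1]
  · simp only [VExpr.eval_add, VExpr.eval_mul, VExpr.eval_ofNat]
    rw [hk _ fun y h1 _ => ?_]
    simp [h1]
  rw [line_div (by omega), touch_of_tag ((s.touch σ f (k / P.b)).setReg x (s.file f (3 * k)))
      _ _ _ hd1
      (by simp)]
  simp only [setReg_file, touch_file]
  refine wp_get σ (3 * k + 2) (hσ _ fun y h1 h2 => ?_) ?_ hf hS hc ?_
  · simp [h1, h2]
  · simp only [VExpr.eval_add, VExpr.eval_mul, VExpr.eval_ofNat]
    rw [hk _ fun y h1 h2 => ?_]
    simp [h1, h2]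
  rw [line_div (by omega), touch_of_tag (((s.touch σ f (k / P.b)).setReg x
      (s.file f (3 * k))).setReg (x + 1)
      (s.file f (3 * k + 1))) _ _ _ hd1 (by simp)]
  exact h

theorem wp_putRec {x f : ℕ} {o : Option VExpr} {i : VExpr} (σ k : ℕ) (hd : s.TagsDistinct)
    (hσ : slotOf s.reg f o = σ) (hk : i.eval s.reg = k)
    (hf : f < 8) (hS : σ < P.S) (hc : 3 * k + 2 < P.cap)
    (h : Q ((s.touch σ f (k / P.b)).setRec f k (s.reg x) (s.reg (x + 1)) (s.reg (x + 2)))) :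
    wp P (putRec f o i x) Q s := by
  refine wp_seq (wp_put σ (3 * k) hσ (by simp [hk]) hf hS (by omega) ?_)
  rw [line_div_zero]
  have hd1 := hd.touch σ f (k / P.b)
  refine wp_seq (wp_put σ (3 * k + 1) hσ (by simp [hk]) hf hS (by omega) ?_)
  rw [line_div (by omega), touch_of_tag ((s.touch σ f (k / P.b)).setFile f (3 * k) (s.reg x))
      _ _ _ hd1
      (by simp)]
  simp only [setFile_reg, touch_reg]
  refine wp_put σ (3 * k + 2) hσ (by simp [hk]) hf hS hc ?_
  rw [line_div (by omega), touch_of_tag (((s.touch σ f (k / P.b)).setFile f (3 * k)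
      (s.reg x)).setFile f (3 * k + 1)
      (s.reg (x + 1))) _ _ _ hd1 (by simp)]
  exact h

end Rules

end ExtMem

namespace ExtMem

open VState VProg

/-- The limits that the programs rely on. -/
structure Fits (P : VParams) : Prop where
  b_pos : 1 ≤ P.b
  S_ge : 16 ≤ P.S
  S_lt : P.S < P.W
  b_lt : P.b < P.W
  cap_lt : P.cap < P.W

/-! ### Sorting within lines -/

/-- The first `n` records of a file. -/
def seg (g : ℕ → Rec) (n : ℕ) : Multiset Rec := (Multiset.range n).map g

theorem seg_succ (g : ℕ → Rec) (n : ℕ) : seg g (n + 1) = g n ::ₘ seg g n := by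
  simp [seg, Multiset.range_succ]

theorem seg_congr {g g' : ℕ → Rec} {n : ℕ} (h : ∀ i < n, g i = g' i) : seg g n = seg g' n :=
  Multiset.map_congr rfl fun i hi => h i (by simpa using hi)

theorem mem_seg {g : ℕ → Rec} {n : ℕ} {r : Rec} : r ∈ seg g n ↔ ∃ i < n, g i = r := by
  simp [seg]

theorem seg_swap (g : ℕ → Rec) {n i j : ℕ} (hi : i < n) (hj : j < n) :
    seg (Function.update (Function.update g i (g j)) j (g i)) n = seg g n := by
  have h1 : Function.update (Function.update g i (g j)) j (g i) = g ∘ Equiv.swap i j := by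
    funext k
    simp only [Function.update_apply, Function.comp, Equiv.swap_apply_def]
    split_ifs <;> simp_all
  have h2 : (Multiset.range n).map (Equiv.swap i j) = Multiset.range n := by
    have := Finset.map_perm (s := Finset.range n) (σ := Equiv.swap i j) ?_
    · simpa using congrArg Finset.val this
    · intro k hk
      by_contra hkn
      simp only [Finset.coe_range, Set.mem_Iio, not_lt] at hkn
      exact hk (Equiv.swap_apply_of_ne_of_ne (by omega) (by omega))
  rw [h1, seg, ← Multiset.map_map, h2, seg]

namespace VProg

/-- Exchange the records in the variables from `44` and `47` on, which are records `var 41` and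
`var 42` of file `a`, if they are in the wrong order. -/
def exchange (a : ℕ) : VProg :=
  .seq (getRec 44 a none (.var 41)) (.seq (getRec 47 a none (.var 42))
    (.ite (ltRec 47 44) (.seq (putRec a none (.var 41) 47) (putRec a none (.var 42) 44)) .skip))

/-- Sort the first `var 40` records of file `a` within lines of `var 0` records, by exchange sort:
computation within a line is free. -/
def sortLines (a : ℕ) : VProg :=
  forTo 41 (.var 40) (.seq (.assign 43 (.min ((.var 41 / .var 0 + 1) * .var 0) (.var 40)))
    (.seq (.assign 42 (.var 41 + 1)) (.while (.lt (.var 42) (.var 43))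
      (.seq (exchange a) (.assign 42 (.var 42 + 1))))))

end VProg

/-- The two records are in the same line, so that the only transfer is that from line `l` to line
`l'`, if these differ. -/
theorem wp_exchange {P : VParams} {a : ℕ} {Q : VState → Prop} {s : VState} {i j l l' : ℕ}
    (hP : Fits P) (ha : a < 8) (hd : s.TagsDistinct) (hi : s.reg 41 = i) (hj : s.reg 42 = j)
    (hic : 3 * i + 2 < P.cap) (hjc : 3 * j + 2 < P.cap) (hil : i / P.b = l') (hjl : j / P.b = l')
    (htag : s.tag a = some (a, l)) (hl : l ≤ l')
    (hQ : ∀ t, Frame (exchange a) s t → t.tag a = some (a, l') → t.cost + l ≤ s.cost + l' →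
      (recs (s.file a) i ≤ recs (s.file a) j → recs (t.file a) = recs (s.file a)) →
      (¬ recs (s.file a) i ≤ recs (s.file a) j → recs (t.file a) = Function.update
        (Function.update (recs (s.file a)) i (recs (s.file a) j)) j (recs (s.file a) i)) → Q t) :
    wp P (exchange a) Q s := by
  have haS : a < P.S := by have := hP.S_ge; omega
  suffices h : wp P (exchange a) (fun t => t.tag a = some (a, l') ∧ t.cost + l ≤ s.cost + l' ∧
      (recs (s.file a) i ≤ recs (s.file a) j → recs (t.file a) = recs (s.file a)) ∧
      (¬ recs (s.file a) i ≤ recs (s.file a) j → recs (t.file a) = Function.update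
        (Function.update (recs (s.file a)) i (recs (s.file a) j)) j (recs (s.file a) i))) s from
    wp_conseq h fun t ht hF => hQ t hF ht.1 ht.2.1 ht.2.2.1 ht.2.2.2
  refine wp_seq (wp_getRec a i hd (fun _ _ => rfl) (fun r hr => by simp [hr, hi]) ha haS hic ?_)
  rw [hil]
  set s1 := s.touch a a l' with hs1
  have hd1 : s1.TagsDistinct := hd.touch _ _ _
  have ht1 : s1.tag a = some (a, l') := touch_tag_self _ _ _ _
  have hc1 : s1.cost + l ≤ s.cost + l' := touch_cost_forward htag hl
  have hf1 : s1.file = s.file := rfl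
  have hr1 : s1.reg = s.reg := rfl
  clear_value s1
  refine wp_seq (wp_getRec a j hd1 (fun _ _ => rfl)
    (fun r hr => by simp [hr, setRegs_reg, hr1, hj]) ha haS hjc ?_)
  rw [hjl, touch_of_tag (s1.setRegs _ _ _ _) _ _ _ hd1 (by simpa using ht1)]
  refine wp_ite (fun hc => ?_) (fun hc => ?_)
  · rw [eval_ltRec] at hc
    simp only [setRegs_reg, setRegs_file, hf1] at hc
    refine wp_seq (wp_putRec a i hd1 rfl (by simp [setRegs_reg, hr1, hi]) ha haS hic ?_)
    rw [hil, touch_of_tag ((s1.setRegs _ _ _ _).setRegs _ _ _ _) _ _ _ hd1 (by simpa using ht1)]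
    refine wp_putRec a j hd1 rfl (by simp [setRegs_reg, hr1, hj]) ha haS hjc ?_
    rw [hjl, touch_of_tag (((s1.setRegs _ _ _ _).setRegs _ _ _ _).setRec _ _ _ _ _) _ _ _ hd1
      (by simpa using ht1)]
    refine ⟨by simpa using ht1, by simpa using hc1, fun h => absurd hc (not_lt.mpr h), fun _ => ?_⟩
    rw [recs_setRec, recs_setRec]
    simp [setRegs_reg, hf1, recs]
  · have hc' := (eval_ltRec _ _ _).not.mp (not_not.mpr hc)
    simp only [setRegs_reg, setRegs_file, hf1] at hc'
    exact ⟨by simpa using ht1, by simpa using hc1, fun _ => by simp [hf1],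
      fun h => absurd (not_lt.mp hc') h⟩

/-- Sorting within lines is a single pass through the file. -/
theorem wp_sortLines {P : VParams} {a n : ℕ} {Q : VState → Prop} {s : VState}
    (hP : Fits P) (ha : a < 8) (hd : s.TagsDistinct) (h0 : s.reg 0 = P.b) (h40 : s.reg 40 = n)
    (hn : 3 * n + 3 ≤ P.cap) (htag : s.tag a = some (a, 0))
    (hQ : ∀ t l, Frame (sortLines a) s t → l ≤ (n - 1) / P.b → t.tag a = some (a, l) →
      t.cost ≤ s.cost + l → seg (recs (t.file a)) n = seg (recs (s.file a)) n →
      (∀ i j, i < j → j < n → i / P.b = j / P.b → recs (t.file a) i ≤ recs (t.file a) j) → Q t) :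
    wp P (sortLines a) Q s := by
  have hb := hP.b_pos
  have hcap := hP.cap_lt
  refine wp_for_frame n (fun i t => (∃ l ≤ (i - 1) / P.b, t.tag a = some (a, l) ∧
    t.cost ≤ s.cost + l) ∧ seg (recs (t.file a)) n = seg (recs (s.file a)) n ∧
    ∀ i' j, i' < i → i' < j → j < n → i' / P.b = j / P.b →
      recs (t.file a) i' ≤ recs (t.file a) j) (by omega) ?_ ?_ ?_ ?_
  · exact ⟨⟨0, Nat.zero_le _, htag, le_rfl⟩, rfl, fun i' j h => absurd h (by omega)⟩
  · intro k t _ _ _ hF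
    simpa [hF.reg 40 rfl] using h40
  · rintro i t hi h41 ⟨⟨l, hl, htl, hcl⟩, hseg, hsort⟩ hF
    have h40t : t.reg 40 = n := by rw [hF.reg 40 rfl, h40]
    have h0t : t.reg 0 = P.b := by rw [hF.reg 0 rfl, h0]
    have hdt := hF.distinct hd
    have hle : l ≤ i / P.b := hl.trans (Nat.div_le_div_right (by omega))
    set e := min ((i / P.b + 1) * P.b) n with he
    refine wp_seq (wp_assign e (by simp [h41, h40t, h0t, he]) (by omega) ?_)
    refine wp_seq (wp_assign (i + 1) (by simp [h41]) (by omega) ?_)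
    refine wp_while_frame (fun k u => ∃ j l', k = n - j ∧ i < j ∧ u.reg 42 = j ∧ l' ≤ i / P.b ∧
      u.tag a = some (a, l') ∧ u.cost ≤ s.cost + l' ∧
      seg (recs (u.file a)) n = seg (recs (s.file a)) n ∧
      (∀ i' j, i' < i → i' < j → j < n → i' / P.b = j / P.b →
        recs (u.file a) i' ≤ recs (u.file a) j) ∧
      (∀ j', i < j' → j' < j → j' < e → recs (u.file a) i ≤ recs (u.file a) j')) _
      ⟨i + 1, l, rfl, by omega, by simp, hle, htl, hcl, hseg, hsort, fun j' h h' => by omega⟩ ?_ ?_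
    · rintro k u ⟨j, l', rfl, hij, h42, hl', htu, hcu, hsegu, hsortu, hminu⟩ hFu hc
      have h43u : u.reg 43 = e := by rw [hFu.reg 43 rfl]; simp
      have h41u : u.reg 41 = i := by rw [hFu.reg 41 rfl]; simp [h41]
      simp only [VExpr.eval_lt, VExpr.eval_var, h42, h43u, ne_eq, ite_eq_right_iff, one_ne_zero,
        imp_false, not_not] at hc
      have hje : j < (i / P.b + 1) * P.b := by omega
      have hjn : j < n := by omega
      have hjl : j / P.b = i / P.b := by
        apply le_antisymm
        · exact Nat.lt_succ_iff.mp (Nat.div_lt_of_lt_mul (by rwa [mul_comm] at hje))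
        · exact Nat.div_le_div_right (by omega)
      have hmem : ∀ j', j' < n → j' / P.b = i / P.b → j' < e := by
        intro j' hj' hjl'
        refine lt_min ?_ hj'
        rw [← hjl', add_mul, one_mul]
        exact Nat.lt_div_mul_add (by omega)
      refine wp_seq (wp_exchange (i := i) (j := j) hP ha (hFu.distinct (by exact hdt)) h41u h42
        (by omega) (by omega) rfl hjl htu hl' ?_)
      intro v hFv htv hcv hle hgt
      refine wp_assign (j + 1) (by simp [hFv.reg 42 rfl, h42]) (by omega) ?_
      refine ⟨n - (j + 1), by omega, j + 1, i / P.b, rfl, by omega, by simp, le_rfl, htv,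
        by simp; omega, ?_⟩
      simp only [setReg_file]
      by_cases hcmp : recs (u.file a) i ≤ recs (u.file a) j
      · rw [hle hcmp]
        refine ⟨hsegu, hsortu, fun j' h1 h2 h3 => ?_⟩
        rcases Nat.lt_succ_iff_lt_or_eq.mp h2 with h | rfl
        · exact hminu j' h1 h h3
        · exact hcmp
      · rw [hgt hcmp, seg_swap _ hi hjn]
        have hji : j ≠ i := by omega
        refine ⟨hsegu, fun i' j' h1 h2 h3 h4 => ?_, fun j' h1 h2 h3 => ?_⟩
        · have hi'j : i' ≠ j := by omega
          have hi'i : i' ≠ i := by omega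
          rw [Function.update_of_ne hi'j, Function.update_of_ne hi'i]
          by_cases hj' : j' = j
          · subst hj'
            rw [Function.update_self]
            exact hsortu i' i h1 h1 hi (by rw [h4, hjl])
          · rw [Function.update_of_ne hj']
            by_cases hj'' : j' = i
            · subst hj''
              rw [Function.update_self]
              exact hsortu i' j h1 (by omega) hjn (by rw [h4, hjl])
            · rw [Function.update_of_ne hj'']
              exact hsortu i' j' h1 h2 h3 h4
        · rw [Function.update_of_ne hji.symm, Function.update_self]
          by_cases hj' : j' = j
          · subst hj'
            rw [Function.update_self]
            exact (not_le.mp hcmp).le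
          · rw [Function.update_of_ne hj', Function.update_of_ne (by omega)]
            exact (not_le.mp hcmp).le.trans (hminu j' h1 (by omega) h3)
    · rintro k u ⟨j, l', rfl, hij, h42, hl', htu, hcu, hsegu, hsortu, hminu⟩ hFu hc
      have h43u : u.reg 43 = e := by rw [hFu.reg 43 rfl]; simp
      have h41u : u.reg 41 = i := by rw [hFu.reg 41 rfl]; simp [h41]
      simp only [VExpr.eval_lt, VExpr.eval_var, h42, h43u, ite_eq_right_iff, one_ne_zero,
        imp_false, not_lt] at hc
      refine ⟨h41u, ⟨l', by simpa using hl', htu, hcu⟩, hsegu, fun i' j' h1 h2 h3 h4 => ?_⟩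
      rcases Nat.lt_succ_iff_lt_or_eq.mp h1 with h | rfl
      · exact hsortu i' j' h h2 h3 h4
      · have hlt : j' < e := by
          refine lt_min ?_ h3
          rw [h4, add_mul, one_mul]
          exact Nat.lt_div_mul_add (by omega)
        exact hminu j' h2 (by omega) hlt
  · rintro t h41 ⟨⟨l, hl, htl, hcl⟩, hseg, hsort⟩ hF
    exact hQ t l hF hl htl hcl hseg fun i j hij hj hl => hsort i j (by omega) hij hj hl

end ExtMem

namespace ExtMem

open VState VProg

/-! ### Merging sorted runs -/

/-- The beginning of run `j` in a group of runs of length `R` that begins at `lo`, in a file of `n`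
records. Run `j` ends where run `j + 1` begins. -/
def runStart (n R lo j : ℕ) : ℕ := min (lo + j * R) n

theorem runStart_mono (n R lo : ℕ) {i j : ℕ} (h : i ≤ j) : runStart n R lo i ≤ runStart n R lo j :=
  min_le_min_right _ (by have := Nat.mul_le_mul_right R h; omega)

theorem runStart_le (n R lo j : ℕ) : runStart n R lo j ≤ n := min_le_right _ _

theorem runStart_le_of_index {n R lo i : ℕ} (hi : lo ≤ i) :
    runStart n R lo ((i - lo) / R) ≤ i :=
  (min_le_left _ _).trans (by have := Nat.div_mul_le_self (i - lo) R; omega)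

theorem lt_runStart_of_index {n R lo i : ℕ} (hR : 0 < R) (hi : i < n) :
    i < runStart n R lo ((i - lo) / R + 1) := by
  refine lt_min ?_ hi
  have := Nat.lt_div_mul_add (a := i - lo) hR
  rw [add_mul, one_mul]
  omega

theorem index_of_mem {n R lo i j : ℕ} (h1 : runStart n R lo j ≤ i)
    (h2 : i < runStart n R lo (j + 1)) :
    lo ≤ i ∧ (i - lo) / R = j := by
  have hn : i < n := lt_of_lt_of_le h2 (runStart_le _ _ _ _)
  have h3 : lo + j * R ≤ i := by
    rcases min_le_iff.mp h1 with h | h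
    · exact h
    · omega
  have h4 : i < lo + (j + 1) * R := lt_of_lt_of_le h2 (min_le_left _ _)
  refine ⟨by omega, ?_⟩
  apply Nat.div_eq_of_lt_le
  · omega
  · omega

/-- The records before position `p j` of run `j`, for all `j`, and those before the group. -/
def taken (n R lo K : ℕ) (p : ℕ → ℕ) : Finset ℕ :=
  (Finset.range (runStart n R lo K)).filter fun i => i < lo ∨ i < p ((i - lo) / R)

section taken

variable {n R lo K : ℕ} {p : ℕ → ℕ}

theorem taken_runStart (hlo : lo ≤ n) (hR : 0 < R) (hp : ∀ j < K, p j = runStart n R lo j) :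
    taken n R lo K p = Finset.range lo := by
  ext i
  simp only [taken, Finset.mem_filter, Finset.mem_range]
  constructor
  · rintro ⟨h1, h2 | h2⟩
    · exact h2
    · by_contra hcon
      have hK : (i - lo) / R < K := by
        have : i < lo + K * R := lt_of_lt_of_le h1 (min_le_left _ _)
        rw [Nat.div_lt_iff_lt_mul hR]; omega
      rw [hp _ hK] at h2
      exact absurd (runStart_le_of_index (n := n) (R := R) (not_lt.mp hcon)) (by omega)
  · exact fun h => ⟨lt_min (by omega) (by omega), Or.inl h⟩

theorem taken_update {j : ℕ} (hj : j < K) (h1 : runStart n R lo j ≤ p j)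
    (h2 : p j < runStart n R lo (j + 1)) :
    p j ∉ taken n R lo K p ∧
      taken n R lo K (Function.update p j (p j + 1)) = insert (p j) (taken n R lo K p) := by
  obtain ⟨hlo, hidx⟩ := index_of_mem h1 h2
  have hK : p j < runStart n R lo K := lt_of_lt_of_le h2 (runStart_mono _ _ _ hj)
  constructor
  · simp only [taken, Finset.mem_filter, Finset.mem_range, hidx]
    omega
  · ext i
    simp only [taken, Finset.mem_filter, Finset.mem_range, Finset.mem_insert]
    by_cases hij : i = p j
    · subst hij
      simp [hK, hidx]
    · by_cases hidx' : (i - lo) / R = j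
      · rw [hidx', Function.update_self]; omega
      · rw [Function.update_of_ne hidx']; omega

theorem exists_not_taken (hR : 0 < R) (h : (taken n R lo K p).card < runStart n R lo K) :
    ∃ j < K, p j < runStart n R lo (j + 1) := by
  by_contra! hcon
  have : taken n R lo K p = Finset.range (runStart n R lo K) := by
    refine Finset.filter_true_of_mem fun i hi => ?_
    rw [Finset.mem_range] at hi
    by_contra! hi'
    have hK : (i - lo) / R < K := by
      have : i < lo + K * R := lt_of_lt_of_le hi (min_le_left _ _)
      rw [Nat.div_lt_iff_lt_mul hR]; omega
    have h1 := hcon _ hK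
    have h2 := lt_runStart_of_index (lo := lo) hR (lt_of_lt_of_le hi (runStart_le _ _ _ _))
    omega
  rw [this, Finset.card_range] at h
  exact lt_irrefl _ h

theorem taken_eq_range (h : runStart n R lo K ≤ (taken n R lo K p).card) :
    taken n R lo K p = Finset.range (runStart n R lo K) :=
  Finset.eq_of_subset_of_card_le (Finset.filter_subset _ _) (by simpa using h)

end taken

namespace VProg

/-- The end of run `var 53` in the group that begins at `var 51`. -/
def runEnd : VExpr := .min (.var 51 + (.var 53 + 1) * .var 50) (.var 40)

/-- Set up the positions in the runs of a group, and fetch the first records of the runs. -/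
def initGroup (a : ℕ) : VProg :=
  forTo 53 (.var 1) (.seq (.assign 55 (.min (.var 51 + .var 53 * .var 50) (.var 40)))
    (.seq (.auxSet (.var 53) 55)
      (.ite (.lt (.var 55) (.var 40)) (.get 60 a (some (.var 53)) (3 * .var 55)) .skip)))

/-- Find the least among the current records of the runs. Variable `56` becomes the number of its
run plus one, and the record is copied to the variables from `57` on. -/
def findMin (a : ℕ) : VProg :=
  .seq (.assign 56 0) (forTo 53 (.var 1) (.seq (.auxGet 55 (.var 53)) (.seq (.assign 63 runEnd)
    (.ite (.lt (.var 55) (.var 63))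
      (.seq (getRec 60 a (some (.var 53)) (.var 55))
        (.ite (.eq (.var 56) 0 + ltRec 60 57)
          (.seq (.assign 57 (.var 60)) (.seq (.assign 58 (.var 61)) (.seq (.assign 59 (.var 62))
            (.assign 56 (.var 53 + 1))))) .skip)) .skip))))

/-- Append the record in the variables from `57` on to file `4`, and advance in its run. -/
def emit (a : ℕ) : VProg :=
  .seq (putRec 4 none (.var 54) 57) (.seq (.assign 53 (.var 56 - 1)) (.seq (.auxGet 55 (.var 53))
    (.seq (.assign 55 (.var 55 + 1)) (.seq (.auxSet (.var 53) 55) (.seq (.assign 63 runEnd)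
      (.ite (.lt (.var 55) (.var 63)) (.get 60 a (some (.var 53)) (3 * .var 55)) .skip))))))

/-- Merge the runs of a group, which extends from `var 51` to `var 52`, into file `4`. -/
def mergeGroup (a : ℕ) : VProg :=
  .seq (initGroup a) (.seq (.assign 54 (.var 51)) (.while (.lt (.var 54) (.var 52))
    (.seq (findMin a) (.seq (emit a) (.assign 54 (.var 54 + 1))))))

end VProg

/-- The variables that describe a merge: there are `n` records in runs of length `R`, and groups
consist of `K` runs. -/
structure MergeVars (P : VParams) (n R K : ℕ) (s : VState) : Prop where
  r1 : s.reg 1 = K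
  r40 : s.reg 40 = n
  r50 : s.reg 50 = R
  K_le : 8 + K ≤ P.S
  n_le : 3 * n + 3 ≤ P.cap
  R_pos : 0 < R
  dvd : P.b ∣ R
  distinct : s.TagsDistinct

theorem MergeVars.congr {P : VParams} {n R K : ℕ} {s t : VState} (h : MergeVars P n R K s)
    {p : VProg} (hF : Frame p s t) (h1 : p.writes 1 = false) (h40 : p.writes 40 = false)
    (h50 : p.writes 50 = false) : MergeVars P n R K t :=
  ⟨by rw [hF.reg _ h1, h.r1], by rw [hF.reg _ h40, h.r40], by rw [hF.reg _ h50, h.r50], h.K_le,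
    h.n_le, h.R_pos, h.dvd, hF.distinct h.distinct⟩

/-- The number of lines that meet the first `x` records. -/
def lines (b x : ℕ) : ℕ := (x + b - 1) / b

theorem lines_mono (b : ℕ) {x y : ℕ} (h : x ≤ y) : lines b x ≤ lines b y :=
  Nat.div_le_div_right (by omega)

theorem lines_le {b x : ℕ} (hb : 0 < b) : lines b x ≤ x / b + 1 := by
  calc lines b x ≤ (x + b) / b := Nat.div_le_div_right (by omega)
    _ = x / b + 1 := Nat.add_div_right _ hb

theorem lines_lt {b x y : ℕ} (hb : 0 < b) (hx : b ∣ x) (h : x < y) : lines b x + 1 ≤ lines b y := by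
  obtain ⟨c, rfl⟩ := hx
  have h1 : lines b (b * c) = c := by
    rw [lines, Nat.add_sub_assoc (by omega), Nat.mul_add_div hb, Nat.div_eq_of_lt (by omega),
      add_zero]
  rw [h1, lines, Nat.le_div_iff_mul_le hb]
  rw [add_mul, one_mul, mul_comm]
  omega

section merge

variable {P : VParams} {n R K a lo : ℕ} {Q : VState → Prop} {s : VState}

/-- The cost is stated with `lines`, so that the costs for consecutive groups add up to `lines b n`.
-/
theorem wp_initGroup (hP : Fits P) (hm : MergeVars P n R K s) (ha : a < 8) (h51 : s.reg 51 = lo)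
    (hlo : P.b ∣ lo) (hlon : lo ≤ n)
    (hQ : ∀ t, Frame (initGroup a) s t → (∀ j < K, t.aux j = runStart n R lo j) →
      (∀ j < K, runStart n R lo j < n → t.tag (8 + j) = some (a, runStart n R lo j / P.b)) →
      t.cost + lines P.b lo ≤ s.cost + lines P.b (runStart n R lo K) → Q t) :
    wp P (initGroup a) Q s := by
  have hcap := hP.cap_lt
  have hSW := hP.S_lt
  have hKS := hm.K_le
  have hnc := hm.n_le
  have hmul : ∀ {j}, runStart n R lo j < n → runStart n R lo j = lo + j * R := by
    intro j hj
    rcases min_choice (lo + j * R) n with h | h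
    · exact h
    · have : runStart n R lo j = n := h
      omega
  have hdvd : ∀ {j}, runStart n R lo j < n → P.b ∣ runStart n R lo j := by
    intro j hj
    rw [hmul hj]
    exact dvd_add hlo (Dvd.dvd.mul_left hm.dvd _)
  have hlt : ∀ {i j}, i < j → runStart n R lo i < n → runStart n R lo i < runStart n R lo j := by
    intro i j hij hi
    refine lt_min ?_ hi
    rw [hmul hi]
    have := Nat.mul_lt_mul_of_pos_right hij hm.R_pos
    omega
  refine wp_for_frame K (fun k t => (∀ j < k, t.aux j = runStart n R lo j) ∧
      (∀ j < k, runStart n R lo j < n → t.tag (8 + j) = some (a, runStart n R lo j / P.b)) ∧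
      t.cost + lines P.b lo ≤ s.cost + lines P.b (runStart n R lo k)) (by omega) ?_ ?_ ?_ ?_
  · refine ⟨fun j h => absurd h (by omega), fun j h => absurd h (by omega), ?_⟩
    have : runStart n R lo 0 = lo := by simpa [runStart] using hlon
    rw [this]; rfl
  · intro k t _ _ _ hF
    simpa [hF.reg 1 rfl] using hm.r1
  · rintro k t hk h53 ⟨haux, htag, hcost⟩ hF
    have h51t : t.reg 51 = lo := by rw [hF.reg 51 rfl, h51]
    have h50t : t.reg 50 = R := by rw [hF.reg 50 rfl, hm.r50]
    have h40t : t.reg 40 = n := by rw [hF.reg 40 rfl, hm.r40]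
    have hle := runStart_le n R lo k
    refine wp_seq (wp_assign (runStart n R lo k) (by simp [h51t, h53, h50t, h40t, runStart])
      (by omega) ?_)
    refine wp_seq (wp_auxSet k (by simp [h53]) (by omega) ?_)
    refine wp_ite (fun hc => ?_) (fun hc => ?_)
    · have hc' : runStart n R lo k < n := by simpa [h40t] using hc
      refine wp_get (8 + k) (3 * runStart n R lo k) (by simp [h53]) (by simp) ha (by omega)
        (by omega) ⟨by simp [h53], ?_⟩
      rw [line_div_zero]
      refine ⟨fun j hj => ?_, fun j hj hjn => ?_, ?_⟩
      · by_cases hjk : j = k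
        · subst hjk; simp
        · simp [hjk, haux j (by omega)]
      · by_cases hjk : j = k
        · subst hjk; simp
        · simp only [setReg_tag]
          refine touch_tag_of_ne ?_ (by omega) (Or.inr ?_)
          · exact htag j (by omega) hjn
          · have h1 := hlt (show j < k by omega) hjn
            obtain ⟨c, hc⟩ := hdvd hjn
            obtain ⟨d, hd⟩ := hdvd hc'
            rw [hc, hd, Nat.mul_div_cancel_left _ hP.b_pos, Nat.mul_div_cancel_left _ hP.b_pos]
            rw [hc, hd] at h1
            exact (lt_of_mul_lt_mul_left h1 (Nat.zero_le _)).ne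
      · have h1 := lines_lt hP.b_pos (hdvd hc') (hlt (Nat.lt_succ_self k) hc')
        have h2 := touch_cost_le ((t.setReg 55 (runStart n R lo k)).setAux k (runStart n R lo k))
          a (8 + k) (runStart n R lo k / P.b)
        simp only [setAux_cost, setReg_cost] at h2
        simp only [setReg_cost, setReg_reg, Function.update_self]
        rw [Nat.succ_eq_add_one] at h1
        omega
    · have hc' : ¬ runStart n R lo k < n := by simpa [h40t] using hc
      have h1 := lines_mono P.b (runStart_mono n R lo (Nat.le_succ k))
      refine ⟨by simp [h53], fun j hj => ?_, fun j hj hjn => ?_, ?_⟩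
      · by_cases hjk : j = k
        · subst hjk; simp
        · simp [hjk, haux j (by omega)]
      · have hjk : j ≠ k := by rintro rfl; exact hc' hjn
        exact htag j (by omega) hjn
      · exact hcost.trans (by simpa using h1)
  · rintro t h53 ⟨haux, htag, hcost⟩ hF
    exact hQ t hF haux htag hcost

/-- No line is transferred, since all current records are in the slots of their runs. -/
theorem wp_findMin {g : ℕ → Rec} (hP : Fits P) (hm : MergeVars P n R K s) (ha : a < 8)
    (h51 : s.reg 51 = lo) (hg : recs (s.file a) = g)
    (htag : ∀ j < K, s.aux j < runStart n R lo (j + 1) → s.tag (8 + j) = some (a, s.aux j / P.b))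
    (hex : ∃ j < K, s.aux j < runStart n R lo (j + 1))
    (hQ : ∀ t j, Frame (findMin a) s t → t.aux = s.aux → t.file = s.file → t.tag = s.tag →
      t.cost = s.cost → j < K → s.aux j < runStart n R lo (j + 1) → t.reg 56 = j + 1 →
      mkRec (t.reg 57) (t.reg 58) (t.reg 59) = g (s.aux j) →
      (∀ i < K, s.aux i < runStart n R lo (i + 1) → g (s.aux j) ≤ g (s.aux i)) → Q t) :
    wp P (findMin a) Q s := by
  have hcap := hP.cap_lt
  have hSW := hP.S_lt
  have hKS := hm.K_le
  have hnc := hm.n_le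
  suffices h : wp P (findMin a) (fun t => t.aux = s.aux ∧ t.file = s.file ∧ t.tag = s.tag ∧
      t.cost = s.cost ∧ ∃ j < K, s.aux j < runStart n R lo (j + 1) ∧ t.reg 56 = j + 1 ∧
      mkRec (t.reg 57) (t.reg 58) (t.reg 59) = g (s.aux j) ∧
      (∀ i < K, s.aux i < runStart n R lo (i + 1) → g (s.aux j) ≤ g (s.aux i))) s from
    wp_conseq h fun t ⟨h1, h2, h3, h4, j, h5, h6, h7, h8, h9⟩ hF =>
      hQ t j hF h1 h2 h3 h4 h5 h6 h7 h8 h9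
  refine wp_seq (wp_assign 0 rfl (by omega) ?_)
  refine wp_for_frame K (fun k t => t.aux = s.aux ∧ t.file = s.file ∧ t.tag = s.tag ∧
      t.cost = s.cost ∧ ((t.reg 56 = 0 ∧ ∀ i < k, ¬ s.aux i < runStart n R lo (i + 1)) ∨
        ∃ j < k, s.aux j < runStart n R lo (j + 1) ∧ t.reg 56 = j + 1 ∧
        mkRec (t.reg 57) (t.reg 58) (t.reg 59) = g (s.aux j) ∧
        (∀ i < k, s.aux i < runStart n R lo (i + 1) → g (s.aux j) ≤ g (s.aux i))))
      (by omega) ?_ ?_ ?_ ?_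
  · exact ⟨rfl, rfl, rfl, rfl, Or.inl ⟨by simp, fun i h => absurd h (by omega)⟩⟩
  · intro k t _ _ _ hF
    simpa [hF.reg 1 rfl] using hm.r1
  · rintro k t hk h53 ⟨haux, hfile, htags, hcost, hbest⟩ hF
    have h51t : t.reg 51 = lo := by rw [hF.reg 51 rfl]; simp [h51]
    have h50t : t.reg 50 = R := by rw [hF.reg 50 rfl]; simp [hm.r50]
    have h40t : t.reg 40 = n := by rw [hF.reg 40 rfl]; simp [hm.r40]
    have hdt : t.TagsDistinct := hF.distinct (by exact hm.distinct)
    have hle := runStart_le n R lo (k + 1)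
    refine wp_seq (wp_auxGet k (by simp [h53]) (by omega) ?_)
    refine wp_seq (wp_assign (runStart n R lo (k + 1))
      (by simp [runEnd, h51t, h53, h50t, h40t, runStart]) (by omega) ?_)
    rw [haux]
    refine wp_ite (fun hc => ?_) (fun hc => ?_)
    · have hc' : s.aux k < runStart n R lo (k + 1) := by simpa using hc
      refine wp_seq (wp_getRec (8 + k) (s.aux k) (by exact hdt)
        (fun r hr => by simp [hr, h53]) (fun r hr => by simp [hr])
        ha (by omega) (by omega) ?_)
      rw [touch_of_tag ((t.setReg 55 (s.aux k)).setReg 63 _) _ _ _ hdt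
        (by simpa [htags] using htag k hk hc')]
      have hcur : mkRec (t.file a (3 * s.aux k)) (t.file a (3 * s.aux k + 1))
          (t.file a (3 * s.aux k + 2)) = g (s.aux k) := by rw [← hg, hfile]; rfl
      refine wp_ite (fun hc2 => ?_) (fun hc2 => ?_)
      · refine wp_seq (wp_assign_var (wp_seq (wp_assign_var (wp_seq (wp_assign_var
          (wp_assign (k + 1) (by simp [setRegs_reg, h53]) (by omega) ?_))))))
        refine ⟨by simp [setRegs_reg, h53], haux, hfile, htags, hcost, Or.inr ⟨k, by omega, hc',
          by simp, ?_, fun i hi hi' => ?_⟩⟩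
        · simpa [setRegs_reg] using hcur
        · rcases Nat.lt_succ_iff_lt_or_eq.mp hi with h | rfl
          · rcases hbest with ⟨h56, hnone⟩ | ⟨j, hj, hjlt, h56, hrec, hmin⟩
            · exact absurd hi' (hnone i h)
            · have hlt : (ltRec 60 57).eval (((t.setReg 55 (s.aux k)).setReg 63
                (runStart n R lo (k + 1))).setRegs 60 (t.file a (3 * s.aux k))
                (t.file a (3 * s.aux k + 1)) (t.file a (3 * s.aux k + 2))).reg ≠ 0 := by
                simpa [setRegs_reg, h56] using hc2
              rw [eval_ltRec] at hlt
              simp only [setRegs_reg, setReg_reg] at hlt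
              simp at hlt
              rw [hcur, hrec] at hlt
              exact hlt.le.trans (hmin i h hi')
          · exact le_rfl
      · refine ⟨by simp [setRegs_reg, h53], haux, hfile, htags, hcost, Or.inr ?_⟩
        simp only [VExpr.eval_add, Nat.add_eq_zero_iff] at hc2
        rcases hbest with ⟨h56, hnone⟩ | ⟨j, hj, hjlt, h56, hrec, hmin⟩
        · exfalso
          have := hc2.1
          simp [setRegs_reg, h56] at this
        · refine ⟨j, by omega, hjlt, by simp [setRegs_reg, h56],
            by simpa [setRegs_reg] using hrec, fun i hi hi' => ?_⟩
          rcases Nat.lt_succ_iff_lt_or_eq.mp hi with h | rfl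
          · exact hmin i h hi'
          · have hnlt := (eval_ltRec _ _ _).not.mp (not_not.mpr hc2.2)
            simp only [setRegs_reg, setReg_reg] at hnlt
            simp at hnlt
            rwa [hcur, hrec] at hnlt
    · have hc' : ¬ s.aux k < runStart n R lo (k + 1) := by simpa using hc
      refine ⟨by simp [h53], haux, hfile, htags, hcost, ?_⟩
      rcases hbest with ⟨h56, hnone⟩ | ⟨j, hj, hjlt, h56, hrec, hmin⟩
      · refine Or.inl ⟨by simp [h56], fun i hi => ?_⟩
        rcases Nat.lt_succ_iff_lt_or_eq.mp hi with h | rfl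
        · exact hnone i h
        · exact hc'
      · refine Or.inr ⟨j, by omega, hjlt, by simp [h56], by simpa using hrec, fun i hi hi' => ?_⟩
        rcases Nat.lt_succ_iff_lt_or_eq.mp hi with h | rfl
        · exact hmin i h hi'
        · exact absurd hi' hc'
  · rintro t h53 ⟨haux, hfile, htags, hcost, hbest⟩ hF
    rcases hbest with ⟨h56, hnone⟩ | ⟨j, hj, hjlt, h56, hrec, hmin⟩
    · obtain ⟨j, hj, hjlt⟩ := hex
      exact absurd hjlt (hnone j hj)
    · exact ⟨haux, hfile, htags, hcost, j, hj, hjlt, h56, hrec, hmin⟩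

/-- Besides the transfers for file `4`, a line is fetched only when the run passes from one line to
the next, that is, when the length of lines divides the new position. -/
theorem wp_emit {j o lT : ℕ} (hP : Fits P) (hm : MergeVars P n R K s) (ha : a < 8) (ha4 : a ≠ 4)
    (h51 : s.reg 51 = lo) (h54 : s.reg 54 = o) (ho : o < n) (hj : j < K)
    (h56 : s.reg 56 = j + 1) (hlt : s.aux j < runStart n R lo (j + 1))
    (htag : s.tag (8 + j) = some (a, s.aux j / P.b)) (h4 : s.tag 4 = some (4, lT))
    (hlT : lT ≤ o / P.b)
    (hQ : ∀ t, Frame (emit a) s t → t.aux = Function.update s.aux j (s.aux j + 1) →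
      recs (t.file 4) = Function.update (recs (s.file 4)) o
        (mkRec (s.reg 57) (s.reg 58) (s.reg 59)) →
      t.tag 4 = some (4, o / P.b) →
      (s.aux j + 1 < runStart n R lo (j + 1) →
        t.tag (8 + j) = some (a, (s.aux j + 1) / P.b)) →
      (∀ i l, i ≠ j → s.tag (8 + i) = some (a, l) →
        (s.aux j + 1 < runStart n R lo (j + 1) → l ≠ (s.aux j + 1) / P.b) →
        t.tag (8 + i) = some (a, l)) →
      t.cost + lT ≤ s.cost + o / P.b + (if P.b ∣ s.aux j + 1 then 1 else 0) → Q t) :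
    wp P (emit a) Q s := by
  have hcap := hP.cap_lt
  have hSW := hP.S_lt
  have hKS := hm.K_le
  have hnc := hm.n_le
  have hle := runStart_le n R lo (j + 1)
  suffices h : wp P (emit a) (fun t => t.aux = Function.update s.aux j (s.aux j + 1) ∧
      recs (t.file 4) = Function.update (recs (s.file 4)) o
        (mkRec (s.reg 57) (s.reg 58) (s.reg 59)) ∧
      t.tag 4 = some (4, o / P.b) ∧
      (s.aux j + 1 < runStart n R lo (j + 1) →
        t.tag (8 + j) = some (a, (s.aux j + 1) / P.b)) ∧
      (∀ i l, i ≠ j → s.tag (8 + i) = some (a, l) →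
        (s.aux j + 1 < runStart n R lo (j + 1) → l ≠ (s.aux j + 1) / P.b) →
        t.tag (8 + i) = some (a, l)) ∧
      t.cost + lT ≤ s.cost + o / P.b + (if P.b ∣ s.aux j + 1 then 1 else 0)) s from
    wp_conseq h fun t ⟨h1, h2, h3, h4, h5, h6⟩ hF => hQ t hF h1 h2 h3 h4 h5 h6
  refine wp_seq (wp_putRec 4 o hm.distinct rfl (by simp [h54]) (by omega) (by omega) (by omega) ?_)
  have hct := touch_cost_forward h4 hlT
  have hd1 : (s.touch 4 4 (o / P.b)).TagsDistinct := hm.distinct.touch _ _ _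
  have ht4 : (s.touch 4 4 (o / P.b)).tag 4 = some (4, o / P.b) := touch_tag_self _ _ _ _
  have ht8 : ∀ i l, s.tag (8 + i) = some (a, l) →
      (s.touch 4 4 (o / P.b)).tag (8 + i) = some (a, l) := fun i l h =>
    touch_tag_of_ne h (by omega) (Or.inl ha4)
  have hs1r : (s.touch 4 4 (o / P.b)).reg = s.reg := rfl
  have hs1a : (s.touch 4 4 (o / P.b)).aux = s.aux := rfl
  have hs1f : (s.touch 4 4 (o / P.b)).file = s.file := rfl
  generalize s.touch 4 4 (o / P.b) = s1 at *
  refine wp_seq (wp_assign j (by simp [hs1r, h56]) (by omega) ?_)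
  refine wp_seq (wp_auxGet j (by simp) (by omega) ?_)
  refine wp_seq (wp_assign (s.aux j + 1) (by simp [hs1a]) (by omega) ?_)
  refine wp_seq (wp_auxSet j (by simp) (by omega) ?_)
  refine wp_seq (wp_assign (runStart n R lo (j + 1))
      (by simp [runEnd, hs1r, h51, hm.r50, hm.r40, runStart]) (by omega) ?_)
  have hrec : recs ((s1.setRec 4 o (s.reg 57) (s.reg 58) (s.reg 59)).file 4) =
      Function.update (recs (s.file 4)) o (mkRec (s.reg 57) (s.reg 58) (s.reg 59)) := by
    rw [recs_setRec, hs1f]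
  refine wp_ite (fun hc => ?_) (fun hc => ?_)
  · have hc' : s.aux j + 1 < runStart n R lo (j + 1) := by simpa using hc
    refine wp_get (8 + j) (3 * (s.aux j + 1)) (by simp) (by simp) ha (by omega) (by omega) ?_
    rw [line_div_zero]
    refine ⟨by simp [hs1a], by simpa using hrec, ?_, fun _ => by simp, fun i l hi hil hl => ?_, ?_⟩
    · simp only [setReg_tag]
      exact touch_tag_of_ne (by simpa using ht4) (by omega) (Or.inl (Ne.symm ha4))
    · simp only [setReg_tag]
      exact touch_tag_of_ne (by simpa using ht8 i l hil) (by omega) (Or.inr (hl hc'))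
    · rw [setReg_cost, touch_cost]
      simp only [setReg_tag, setAux_tag, setRec_tag, ht8 j _ htag, setReg_cost, setAux_cost,
        setRec_cost, Option.some.injEq, Prod.mk.injEq, true_and]
      rw [Nat.succ_div]
      split_ifs <;> omega
  · have hc' : ¬ s.aux j + 1 < runStart n R lo (j + 1) := by simpa using hc
    refine ⟨by simp [hs1a], by simpa using hrec, by simpa using ht4, fun h => absurd h hc',
      fun i l hi hil hl => by simpa using ht8 i l hil, ?_⟩
    simp only [setReg_cost, setAux_cost, setRec_cost]
    omega

end merge

end ExtMem

namespace ExtMem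

open VState VProg

/-! ### Merging a group of runs -/

section merge

variable {P : VParams} {n R K a lo : ℕ} {Q : VState → Prop} {s : VState}

theorem div_of_mem_run {i x : ℕ} (hlo : R ∣ lo) (h1 : runStart n R lo i ≤ x)
    (h2 : x < runStart n R lo (i + 1)) : x / R = lo / R + i := by
  obtain ⟨h3, h4⟩ := index_of_mem h1 h2
  obtain ⟨c, rfl⟩ := hlo
  have hR : 0 < R := by
    rcases Nat.eq_zero_or_pos R with rfl | h
    · simp [runStart] at h1 h2
    · exact h
  obtain ⟨y, rfl⟩ := Nat.exists_eq_add_of_le h3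
  rw [Nat.add_sub_cancel_left] at h4
  rw [Nat.mul_add_div hR, Nat.mul_div_cancel_left _ hR, h4]

/-- Runs begin at line boundaries, so different runs never compete for the same line. -/
theorem line_ne_of_mem_run {b i j x y : ℕ} (hlo : R ∣ lo) (hb : b ∣ R) (hij : i ≠ j)
    (h1 : runStart n R lo i ≤ x) (h2 : x < runStart n R lo (i + 1))
    (h3 : runStart n R lo j ≤ y) (h4 : y < runStart n R lo (j + 1)) : x / b ≠ y / b := by
  intro h
  have hx := div_of_mem_run hlo h1 h2
  have hy := div_of_mem_run hlo h3 h4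
  obtain ⟨c, rfl⟩ := hb
  rw [← Nat.div_div_eq_div_mul] at hx hy
  rw [h] at hx
  omega

/-- Within a run, the lines after the first are fetched at the positions divisible by `b`, of which
`range x` holds `x / b`; the costs for consecutive groups therefore telescope. -/
theorem wp_mergeGroup {g : ℕ → Rec} {hi l0 : ℕ} (hP : Fits P) (hm : MergeVars P n R K s)
    (ha : a < 8) (ha4 : a ≠ 4)
    (h51 : s.reg 51 = lo) (h52 : s.reg 52 = hi) (hhi : runStart n R lo K = hi) (hlohi : lo ≤ hi)
    (hlo : R ∣ lo) (hg : recs (s.file a) = g)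
    (hsorted : ∀ i j, i < j → j < n → i / R = j / R → g i ≤ g j)
    (hseg : seg (recs (s.file 4)) lo = seg g lo)
    (h4 : s.tag 4 = some (4, l0)) (hl0 : l0 ≤ (lo - 1) / P.b)
    (hQ : ∀ t l, Frame (mergeGroup a) s t →
      (∀ i < lo, recs (t.file 4) i = recs (s.file 4) i) →
      (∀ i j, lo ≤ i → i < j → j < hi → recs (t.file 4) i ≤ recs (t.file 4) j) →
      seg (recs (t.file 4)) hi = seg g hi → t.tag 4 = some (4, l) → l ≤ (hi - 1) / P.b →
      t.cost + l0 + lines P.b lo + lo / P.b ≤ s.cost + lines P.b hi + l + hi / P.b → Q t) :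
    wp P (mergeGroup a) Q s := by
  have hb := hP.b_pos
  have hcap := hP.cap_lt
  have hnc := hm.n_le
  have hR := hm.R_pos
  have hin : hi ≤ n := hhi ▸ runStart_le _ _ _ _
  have hblo : P.b ∣ lo := hm.dvd.trans hlo
  suffices h : wp P (mergeGroup a) (fun t => (∀ i < lo, recs (t.file 4) i = recs (s.file 4) i) ∧
      (∀ i j, lo ≤ i → i < j → j < hi → recs (t.file 4) i ≤ recs (t.file 4) j) ∧
      seg (recs (t.file 4)) hi = seg g hi ∧ ∃ l, t.tag 4 = some (4, l) ∧ l ≤ (hi - 1) / P.b ∧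
      t.cost + l0 + lines P.b lo + lo / P.b ≤ s.cost + lines P.b hi + l + hi / P.b) s from
    wp_conseq h fun t ⟨h1, h2, h3, l, h4, h5, h6⟩ hF => hQ t l hF h1 h2 h3 h4 h5 h6
  refine wp_seq (wp_initGroup hP hm ha h51 hblo (hlohi.trans hin) ?_)
  intro s1 hF1 haux1 htag1 hcost1
  have hm1 := hm.congr hF1 rfl rfl rfl
  have hfile1 : s1.file = s.file := funext fun f => hF1.file f rfl
  have h41 : s1.tag 4 = some (4, l0) := hF1.tag 4 (by omega)
      (by simpa [initGroup, forTo, VProg.uses] using ha4) _ h4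
  refine wp_seq (wp_assign lo (by simp [hF1.reg 51 rfl, h51]) (by omega) ?_)
  -- the records taken so far have been written to file `4`, in order, and are not greater than
  -- any record that has not been taken
  refine wp_while_frame (fun k t => ∃ o l, k = hi - o ∧ lo ≤ o ∧ o ≤ hi ∧ t.reg 54 = o ∧
    (taken n R lo K t.aux).card = o ∧
    (taken n R lo K t.aux).val.map g = seg (recs (t.file 4)) o ∧
    (∀ j < K, runStart n R lo j ≤ t.aux j) ∧
    (∀ i < lo, recs (t.file 4) i = recs (s.file 4) i) ∧
    (∀ i j, lo ≤ i → i < j → j < o → recs (t.file 4) i ≤ recs (t.file 4) j) ∧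
    (∀ i j, lo ≤ i → i < o → j < K → t.aux j < runStart n R lo (j + 1) →
      recs (t.file 4) i ≤ g (t.aux j)) ∧
    (∀ j < K, t.aux j < runStart n R lo (j + 1) → t.tag (8 + j) = some (a, t.aux j / P.b)) ∧
    t.tag 4 = some (4, l) ∧ l ≤ (o - 1) / P.b ∧
    t.cost + l0 + lines P.b lo + lo / P.b ≤ s.cost + lines P.b hi + l +
      ((taken n R lo K t.aux).filter fun i => P.b ∣ i + 1).card) _
    ⟨lo, l0, rfl, le_rfl, hlohi, by simp, ?_⟩ ?_ ?_
  · simp only [setReg_aux, setReg_file, setReg_tag, setReg_cost]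
    rw [taken_runStart (hlohi.trans hin) hR haux1, hfile1, Finset.card_range]
    refine ⟨rfl, hseg.symm, fun j hj => (haux1 j hj).ge, fun _ _ => rfl,
      fun i j h1 h2 h3 => absurd h3 (by omega), fun i j h1 h2 h3 => absurd h2 (by omega), ?_,
      h41, hl0, ?_⟩
    · intro j hj hlt
      rw [haux1 j hj] at hlt ⊢
      exact htag1 j hj (hlt.trans_le (runStart_le _ _ _ _))
    · rw [Nat.card_multiples, ← hhi]
      omega
  · rintro _ t ⟨o, l, rfl, hloo, hohi, h54, hcard, hmap, hge, hpre, hso, hbd, htag, ht4, hl, hcost⟩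
      hF hc
    have hmt : MergeVars P n R K t :=
      (⟨hm1.r1, hm1.r40, hm1.r50, hm1.K_le, hm1.n_le, hm1.R_pos, hm1.dvd, hm1.distinct⟩ :
        MergeVars P n R K (s1.setReg 54 lo)).congr hF rfl rfl rfl
    have h51t : t.reg 51 = lo := by rw [hF.reg 51 rfl]; simp [hF1.reg 51 rfl, h51]
    have h52t : t.reg 52 = hi := by rw [hF.reg 52 rfl]; simp [hF1.reg 52 rfl, h52]
    have hchange : ∀ {p}, p = mergeGroup a → p.changes a = false := by
      rintro p rfl; simpa [mergeGroup, initGroup, findMin, emit, forTo, getRec, putRec,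
          VProg.changes] using ha4.symm
    have hgt : recs (t.file a) = g := by
      rw [hF.file a (by have := hchange rfl; simp only
          [mergeGroup, VProg.changes, Bool.or_eq_false_iff] at this ⊢; tauto)]
      simpa [hfile1] using hg
    have ho : o < hi := by simpa [h54, h52t] using hc
    refine wp_seq (wp_findMin hP hmt ha h51t hgt htag (exists_not_taken hR (by omega)) ?_)
    intro u j hFu hauxu hfileu htagu hcostu hj hjlt h56 hbest hmin
    have hmu := hmt.congr hFu rfl rfl rfl
    obtain ⟨hnt, htk⟩ := taken_update hj (hge j hj) hjlt
    refine wp_seq (wp_emit (lT := l) (j := j) (o := o) hP hmu ha ha4 (by rw [hFu.reg 51 rfl, h51t])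
      (by rw [hFu.reg 54 rfl, h54]) (by omega) hj h56 (by rwa [hauxu])
      (by rw [hauxu, htagu]; exact htag j hj hjlt)
      (by rwa [htagu]) (hl.trans (Nat.div_le_div_right (by omega))) ?_)
    rw [hauxu, hfileu, htagu, hcostu, hbest]
    intro v hFv hauxv hrecv h4v htagv htagv' hcostv
    refine wp_assign (o + 1) (by simp [hFv.reg 54 rfl, hFu.reg 54 rfl, h54]) (by omega) ?_
    refine ⟨hi - (o + 1), by omega, o + 1, o / P.b, rfl, by omega, ho, by simp, ?_⟩
    simp only [setReg_aux, setReg_file, setReg_tag, setReg_cost, hauxv, htk, hrecv]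
    have hmono : ∀ k < K, ¬ k = j → ∀ {x y}, Function.update t.aux j x k < y → t.aux k < y := by
      intro k _ hkj x y h; rwa [Function.update_of_ne hkj] at h
    refine ⟨?_, ?_, ?_, ?_, ?_, ?_, ?_, h4v, by simp, ?_⟩
    · rw [Finset.card_insert_of_notMem hnt, hcard]
    · rw [Finset.insert_val_of_notMem hnt, Multiset.map_cons, hmap, seg_succ, Function.update_self]
      congr 1
      exact seg_congr fun i hi => by rw [Function.update_of_ne (by omega)]
    · intro k hk
      by_cases hkj : k = j
      · subst hkj; rw [Function.update_self]; exact (hge k hk).trans (Nat.le_succ _)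
      · rw [Function.update_of_ne hkj]; exact hge k hk
    · intro i hi
      rw [Function.update_of_ne (by omega)]; exact hpre i hi
    · intro i i' h1 h2 h3
      rw [Function.update_of_ne (show i ≠ o by omega)]
      by_cases hio : i' = o
      · subst hio; rw [Function.update_self]; exact hbd i j h1 h2 hj hjlt
      · rw [Function.update_of_ne hio]; exact hso i i' h1 h2 (by omega)
    · intro i k h1 h2 hk hklt
      have hle : g (t.aux j) ≤ g (Function.update t.aux j (t.aux j + 1) k) := by
        by_cases hkj : k = j
        · subst hkj
          rw [Function.update_self] at hklt ⊢
          refine hsorted _ _ (Nat.lt_succ_self _) (hklt.trans_le (runStart_le _ _ _ _)) ?_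
          rw [div_of_mem_run hlo (hge k hk) hjlt,
            div_of_mem_run hlo ((hge k hk).trans (Nat.le_succ _)) hklt]
        · rw [Function.update_of_ne hkj] at hklt ⊢
          exact hmin k hk hklt
      by_cases hio : i = o
      · subst hio; rwa [Function.update_self]
      · rw [Function.update_of_ne hio]
        exact (hbd i j h1 (by omega) hj hjlt).trans hle
    · intro k hk hklt
      by_cases hkj : k = j
      · subst hkj
        rw [Function.update_self] at hklt ⊢
        exact htagv hklt
      · rw [Function.update_of_ne hkj] at hklt ⊢
        refine htagv' k _ hkj (htag k hk hklt) fun hjlt' => ?_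
        exact line_ne_of_mem_run hlo hm.dvd hkj (hge k hk) hklt
          ((hge j hj).trans (Nat.le_succ _)) hjlt'
    · rw [Finset.filter_insert]
      have hnt' : t.aux j ∉ (taken n R lo K t.aux).filter fun i => P.b ∣ i + 1 := fun h =>
        hnt (Finset.mem_filter.mp h).1
      split_ifs at hcostv ⊢
      · rw [Finset.card_insert_of_notMem hnt']; omega
      · omega
  · rintro _ t ⟨o, l, rfl, hloo, hohi, h54, hcard, hmap, hge, hpre, hso, hbd, htag, ht4, hl, hcost⟩
      hF hc
    have h52t : t.reg 52 = hi := by rw [hF.reg 52 rfl]; simp [hF1.reg 52 rfl, h52]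
    have ho : ¬ o < hi := by simpa [h54, h52t] using hc
    obtain rfl : o = hi := by omega
    have htk : taken n R lo K t.aux = Finset.range o := by
      rw [taken_eq_range (by omega), hhi]
    rw [htk] at hmap hcost
    rw [Nat.card_multiples] at hcost
    exact ⟨hpre, hso, hmap.symm, l, ht4, hl, hcost⟩

end merge

end ExtMem

namespace ExtMem

open VState VProg

/-! ### Merge sort -/

namespace VProg

/-- Merge all groups of runs of file `a` into file `4`. -/
def mergePass (a : ℕ) : VProg :=
  .seq (.get 60 4 none 0) (.seq (.assign 51 0) (.while (.lt (.var 51) (.var 40))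
    (.seq (.assign 52 (.min (.var 51 + .var 1 * .var 50) (.var 40)))
      (.seq (mergeGroup a) (.assign 51 (.var 52))))))

/-- Copy the first `var 40` records of file `4` to file `a`. -/
def copyBack (a : ℕ) : VProg :=
  .seq (.get 60 4 none 0) (.seq (.get 60 a none 0)
    (.seq (forTo 41 (.var 40) (.seq (getRec 57 4 none (.var 41)) (putRec a none (.var 41) 57)))
      (.get 60 a none 0)))

/-- Sort the first `var 40` records of file `a`. The length of the runs, `var 50`, is not allowed to
grow beyond the number of records, so that it remains a word. -/
def sort (a : ℕ) : VProg :=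
  .seq (sortLines a) (.seq (.get 60 a none 0) (.seq (.assign 50 (.var 0))
    (.while (.lt (.var 50) (.var 40)) (.seq (mergePass a) (.seq (copyBack a)
      (.assign 50 (.min (.var 50 * .var 1) (.var 40))))))))

end VProg

section sort

variable {P : VParams} {n R K a : ℕ} {Q : VState → Prop} {s : VState}

theorem wp_mergePass {g : ℕ → Rec} (hP : Fits P) (hm : MergeVars P n R K s) (hK : 0 < K)
    (ha : a < 8) (ha4 : a ≠ 4) (hg : recs (s.file a) = g)
    (hsorted : ∀ i j, i < j → j < n → i / R = j / R → g i ≤ g j)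
    (hQ : ∀ t l, Frame (mergePass a) s t →
      (∀ i j, i < j → j < n → i / (R * K) = j / (R * K) → recs (t.file 4) i ≤ recs (t.file 4) j) →
      seg (recs (t.file 4)) n = seg g n → t.tag 4 = some (4, l) → l ≤ (n - 1) / P.b →
      t.cost ≤ s.cost + 1 + lines P.b n + l + n / P.b → Q t) :
    wp P (mergePass a) Q s := by
  have hb := hP.b_pos
  have hcap := hP.cap_lt
  have hS := hP.S_ge
  have hnc := hm.n_le
  have hR := hm.R_pos
  have hRK : 0 < R * K := Nat.mul_pos hR hK
  suffices h : wp P (mergePass a) (fun t =>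
      (∀ i j, i < j → j < n → i / (R * K) = j / (R * K) → recs (t.file 4) i ≤ recs (t.file 4) j) ∧
      seg (recs (t.file 4)) n = seg g n ∧ ∃ l, t.tag 4 = some (4, l) ∧ l ≤ (n - 1) / P.b ∧
      t.cost ≤ s.cost + 1 + lines P.b n + l + n / P.b) s from
    wp_conseq h fun t ⟨h1, h2, l, h3, h4, h5⟩ hF => hQ t l hF h1 h2 h3 h4 h5
  refine wp_seq (wp_get 4 0 rfl rfl (by omega) (by omega) (by omega) ?_)
  rw [Nat.zero_div]
  have hc1 := touch_cost_le s 4 4 0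
  have ht1 := touch_tag_self s 4 4 0
  have hm1 : MergeVars P n R K ((s.touch 4 4 0).setReg 60 (s.file 4 0)) :=
    ⟨by simp [hm.r1], by simp [hm.r40], by simp [hm.r50], hm.K_le, hm.n_le, hm.R_pos, hm.dvd,
      hm.distinct.touch _ _ _⟩
  have hf1 : ((s.touch 4 4 0).setReg 60 (s.file 4 0)).file = s.file := rfl
  replace hc1 : ((s.touch 4 4 0).setReg 60 (s.file 4 0)).cost ≤ s.cost + 1 := hc1
  replace ht1 : ((s.touch 4 4 0).setReg 60 (s.file 4 0)).tag 4 = some (4, 0) := ht1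
  generalize (s.touch 4 4 0).setReg 60 (s.file 4 0) = s1 at *
  refine wp_seq (wp_assign 0 rfl (by omega) ?_)
  refine wp_while_frame (fun k t => ∃ lo l, k = n - lo ∧ lo ≤ n ∧ (R * K ∣ lo ∨ lo = n) ∧
    t.reg 51 = lo ∧ MergeVars P n R K t ∧ recs (t.file a) = g ∧
    (∀ i j, i < j → j < lo → i / (R * K) = j / (R * K) →
      recs (t.file 4) i ≤ recs (t.file 4) j) ∧
    seg (recs (t.file 4)) lo = seg g lo ∧ t.tag 4 = some (4, l) ∧ l ≤ (lo - 1) / P.b ∧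
    t.cost ≤ s.cost + 1 + lines P.b lo + l + lo / P.b) _
    ⟨0, 0, rfl, Nat.zero_le _, Or.inl (dvd_zero _), by simp, ?_, by simp [hf1, hg],
      fun i j h h' => absurd h' (by omega), by simp [seg], ht1, Nat.zero_le _, ?_⟩ ?_ ?_
  · exact ⟨by simp [hm1.r1], by simp [hm1.r40], by simp [hm1.r50], hm.K_le, hm.n_le, hm.R_pos,
      hm.dvd, hm1.distinct⟩
  · simp only [setReg_cost, Nat.zero_div]; omega
  · rintro _ t ⟨lo, l, rfl, hlo, hdvd, h51, hmt, hgt, hso, hseg, h4, hl, hcost⟩ hF hc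
    have hlon : lo < n := by simpa [h51, hmt.r40] using hc
    replace hdvd : R * K ∣ lo := by
      rcases hdvd with h | h
      · exact h
      · omega
    have hhi : lo < runStart n R lo K := lt_min (by rw [mul_comm K]; omega) hlon
    have hhn := runStart_le n R lo K
    refine wp_seq (wp_assign (runStart n R lo K)
      (by simp [h51, hmt.r1, hmt.r50, hmt.r40, runStart]) (by omega) ?_)
    have hmt' : MergeVars P n R K (t.setReg 52 (runStart n R lo K)) :=
      ⟨by simp [hmt.r1], by simp [hmt.r40], by simp [hmt.r50], hm.K_le, hm.n_le, hm.R_pos,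
        hm.dvd, hmt.distinct⟩
    refine wp_seq (wp_mergeGroup (hi := runStart n R lo K) hP hmt' ha ha4 (by simp [h51]) (by simp)
      rfl hhi.le (Dvd.dvd.trans (Dvd.intro _ rfl) hdvd) hgt hsorted hseg h4 hl ?_)
    intro u l' hFu hpre hso' hseg' h4' hl' hcost'
    refine wp_assign_var ?_
    have h52 : u.reg 52 = runStart n R lo K := by rw [hFu.reg 52 rfl]; simp
    rw [h52]
    refine ⟨n - runStart n R lo K, by omega, runStart n R lo K, l', rfl, hhn, ?_, by simp, ?_, ?_,
        ?_, hseg', h4', hl', ?_⟩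
    · exact (min_choice (lo + K * R) n).imp
        (fun h => by rw [runStart, h]; exact dvd_add hdvd (by rw [mul_comm])) id
    · have := hmt'.congr hFu rfl rfl rfl
      exact ⟨by simp [this.r1], by simp [this.r40], by simp [this.r50], hm.K_le, hm.n_le, hm.R_pos,
        hm.dvd, this.distinct⟩
    · rw [setReg_file, hFu.file a (by simpa [mergeGroup, initGroup, findMin, emit, forTo, getRec,
        putRec, VProg.changes] using ha4.symm)]
      exact hgt
    · intro i j hij hj hdiv
      simp only [setReg_file]
      by_cases hjlo : j < lo
      · rw [hpre i (by omega), hpre j hjlo]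
        exact hso i j hij hjlo hdiv
      · refine hso' i j ?_ hij hj
        have := Nat.div_le_div_right (c := R * K) (not_lt.mp hjlo)
        rw [← hdiv, Nat.le_div_iff_mul_le hRK, Nat.div_mul_cancel hdvd] at this
        exact this
    · simp only [setReg_cost] at hcost' ⊢
      omega
  · rintro _ t ⟨lo, l, rfl, hlo, hdvd, h51, hmt, hgt, hso, hseg, h4, hl, hcost⟩ hF hc
    have hlon : ¬ lo < n := by simpa [h51, hmt.r40] using hc
    obtain rfl : lo = n := by omega
    exact ⟨hso, hseg, l, h4, hl, hcost⟩

theorem wp_copyBack (hP : Fits P) (h40 : s.reg 40 = n) (hn : 3 * n + 3 ≤ P.cap) (ha : a < 8)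
    (ha4 : a ≠ 4) (hd : s.TagsDistinct)
    (hQ : ∀ t, Frame (copyBack a) s t → (∀ i < n, recs (t.file a) i = recs (s.file 4) i) →
      t.tag a = some (a, 0) → t.cost ≤ s.cost + 3 + 2 * ((n - 1) / P.b) → Q t) :
    wp P (copyBack a) Q s := by
  have hb := hP.b_pos
  have hcap := hP.cap_lt
  have hS := hP.S_ge
  suffices h : wp P (copyBack a) (fun t => (∀ i < n, recs (t.file a) i = recs (s.file 4) i) ∧
      t.tag a = some (a, 0) ∧ t.cost ≤ s.cost + 3 + 2 * ((n - 1) / P.b)) s from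
    wp_conseq h fun t ⟨h1, h2, h3⟩ hF => hQ t hF h1 h2 h3
  refine wp_seq (wp_get 4 0 rfl rfl (by omega) (by omega) (by omega) ?_)
  refine wp_seq (wp_get a 0 rfl rfl ha (by omega) (by omega) ?_)
  rw [Nat.zero_div]
  set s1 := s.touch 4 4 0 with hs1
  have hc1 : s1.cost ≤ s.cost + 1 := touch_cost_le s 4 4 0
  have ht1 : s1.tag 4 = some (4, 0) := touch_tag_self s 4 4 0
  have hd1 : s1.TagsDistinct := hd.touch _ _ _
  have hf1 : s1.file = s.file := rfl
  have hr1 : s1.reg = s.reg := rfl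
  clear_value s1
  set s2 := (s1.setReg 60 (s.file 4 0)).touch a a 0 with hs2
  have hc2 : s2.cost ≤ s1.cost + 1 := touch_cost_le _ a a 0
  have ht2 : s2.tag 4 = some (4, 0) := touch_tag_of_ne (by exact ht1) (by omega) (Or.inl (by omega))
  have ht2a : s2.tag a = some (a, 0) := touch_tag_self _ _ _ _
  have hd2 : s2.TagsDistinct := TagsDistinct.touch (by exact hd1) _ _ _
  have hf2 : s2.file = s.file := by rw [hs2]; exact hf1
  have hr2 : s2.reg 40 = n := by rw [hs2]; simp [hr1, h40]
  clear_value s2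
  refine wp_seq (wp_for_frame n (fun k t => (∀ i < k, recs (t.file a) i = recs (s.file 4) i) ∧
    ∃ l ≤ (k - 1) / P.b, t.tag 4 = some (4, l) ∧ t.tag a = some (a, l) ∧
      t.cost ≤ s.cost + 2 + 2 * l) (by omega) ?_ ?_ ?_ ?_)
  · exact ⟨fun i h => absurd h (by omega), 0, Nat.zero_le _, ht2, ht2a, by simp; omega⟩
  · intro k t _ _ _ hF
    simp [hF.reg 40 rfl, hr2]
  · rintro k t hk h41 ⟨hcopy, l, hl, ht4, hta, hcost⟩ hF
    have hdt : t.TagsDistinct := hF.distinct (by exact hd2)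
    have hlk : l ≤ k / P.b := hl.trans (Nat.div_le_div_right (by omega))
    have hf4 : t.file 4 = s.file 4 := by
      rw [hF.file 4 (by simpa [forTo, getRec, putRec, VProg.changes] using ha4)]
      simp [hf2]
    refine wp_seq (wp_getRec 4 k hdt (fun _ _ => rfl) (fun r hr => by simp [hr, h41]) (by omega)
      (by omega) (by omega) ?_)
    refine wp_putRec a k (by exact hdt.touch _ _ _) rfl (by simp [setRegs_reg, h41]) ha (by omega)
      (by omega) ?_
    refine ⟨by simp [setRegs_reg, h41], ?_, k / P.b, by simp, ?_, by simp, ?_⟩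
    · intro i hi
      simp only [setReg_file]
      rw [recs_setRec]
      by_cases hik : i = k
      · subst hik
        rw [Function.update_self]
        simp [setRegs_reg, recs, hf4]
      · rw [Function.update_of_ne hik]
        exact hcopy i (by omega)
    · simp only [setReg_tag, setRec_tag]
      exact touch_tag_of_ne (by simp) (by omega) (Or.inl (by omega))
    · simp only [setReg_cost, setRec_cost]
      have h1 := touch_cost_forward ht4 hlk
      have h2 := touch_cost_forward (s := (t.touch 4 4 (k / P.b)).setRegs 57 (t.file 4 (3 * k))
        (t.file 4 (3 * k + 1)) (t.file 4 (3 * k + 2))) (σ := a) (f := a) (l := l) (l' := k / P.b)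
        (by simpa using touch_tag_of_ne hta ha4 (Or.inl ha4)) hlk
      simp only [setRegs_cost] at h2
      omega
  · rintro t h41 ⟨hcopy, l, hl, ht4, hta, hcost⟩ hF
    refine wp_get a 0 rfl rfl ha (by omega) (by omega) ?_
    rw [Nat.zero_div]
    refine ⟨hcopy, by simp, ?_⟩
    have := touch_cost_le t a a 0
    simp only [setReg_cost]
    omega

/-- Sorting `n` records takes `O(n / b)` transfers for each of the `e + 1` passes. As the number of
lines is rounded down, a file that fits into the line in its slot is sorted without any transfer. -/
theorem wp_sort {e : ℕ} (hP : Fits P) (ha : a < 8) (ha4 : a ≠ 4) (hd : s.TagsDistinct)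
    (h0 : s.reg 0 = P.b) (h1 : s.reg 1 = K) (hK : 2 ≤ K) (hKS : 8 + K ≤ P.S)
    (h40 : s.reg 40 = n) (hn : 3 * n + 3 ≤ P.cap) (he : n ≤ P.b * K ^ e)
    (htag : s.tag a = some (a, 0))
    (hQ : ∀ t, Frame (sort a) s t → t.tag a = some (a, 0) →
      t.cost ≤ s.cost + n / P.b * (10 * e + 2) → seg (recs (t.file a)) n = seg (recs (s.file a)) n →
      (∀ i j, i < j → j < n → recs (t.file a) i ≤ recs (t.file a) j) → Q t) :
    wp P (sort a) Q s := by
  have hb := hP.b_pos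
  have hblt := hP.b_lt
  have hcap := hP.cap_lt
  have hS := hP.S_ge
  have hnb : (n - 1) / P.b ≤ n / P.b := Nat.div_le_div_right (by omega)
  suffices h : wp P (sort a) (fun t => t.tag a = some (a, 0) ∧
      t.cost ≤ s.cost + n / P.b * (10 * e + 2) ∧
      seg (recs (t.file a)) n = seg (recs (s.file a)) n ∧
      (∀ i j, i < j → j < n → recs (t.file a) i ≤ recs (t.file a) j)) s from
    wp_conseq h fun t ⟨h1, h2, h3, h4⟩ hF => hQ t hF h1 h2 h3 h4
  refine wp_seq (wp_sortLines hP ha hd h0 h40 hn htag ?_)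
  intro s1 l hF1 hl ht1 hc1 hseg1 hsort1
  refine wp_seq (wp_get a 0 rfl rfl ha (by omega) (by omega) ?_)
  rw [Nat.zero_div]
  set s2 := (s1.touch a a 0).setReg 60 (s1.file a 0) with hs2
  have hc2 : s2.cost ≤ s.cost + 2 * (n / P.b) := by
    have h := touch_cost_forward ht1 le_rfl
    rw [hs2, setReg_cost, touch_cost, ht1]
    split_ifs with h'
    · simp only [Option.some.injEq, Prod.mk.injEq, true_and] at h'
      omega
    · have : l ≠ 0 := by rintro rfl; exact h' rfl
      omega
  have ht2 : s2.tag a = some (a, 0) := touch_tag_self _ _ _ _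
  have hd2 : s2.TagsDistinct := TagsDistinct.touch (hF1.distinct hd) _ _ _
  have hf2 : s2.file = s1.file := rfl
  have h02 : s2.reg 0 = P.b := by simp [hs2, hF1.reg 0 rfl, h0]
  have h12 : s2.reg 1 = K := by simp [hs2, hF1.reg 1 rfl, h1]
  have h402 : s2.reg 40 = n := by simp [hs2, hF1.reg 40 rfl, h40]
  clear_value s2
  refine wp_seq (wp_assign_var ?_)
  rw [h02]
  -- after `k` passes there are sorted runs of length `b * K ^ k`
  refine wp_while_frame (fun r t => ∃ k, r = e - k ∧ k ≤ e ∧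
    (t.reg 50 = P.b * K ^ k ∨ n ≤ t.reg 50 ∧ n ≤ P.b * K ^ k) ∧ t.tag a = some (a, 0) ∧
    t.cost ≤ s.cost + n / P.b * (10 * k + 2) ∧
    seg (recs (t.file a)) n = seg (recs (s.file a)) n ∧
    (∀ i j, i < j → j < n → i / (P.b * K ^ k) = j / (P.b * K ^ k) →
      recs (t.file a) i ≤ recs (t.file a) j)) _ ⟨0, rfl, Nat.zero_le _, Or.inl (by simp), ht2,
      by simp; omega, by simpa [hf2] using hseg1, by simpa [hf2] using hsort1⟩ ?_ ?_
  · rintro _ t ⟨k, rfl, hk, h50, hta, hcost, hseg, hsort⟩ hF hc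
    have h40t : t.reg 40 = n := by rw [hF.reg 40 rfl]; simp [h402]
    have h1t : t.reg 1 = K := by rw [hF.reg 1 rfl]; simp [h12]
    have hlt : t.reg 50 < n := by simpa [h40t] using hc
    replace h50 : t.reg 50 = P.b * K ^ k := by
      rcases h50 with h | h
      · exact h
      · omega
    rw [h50] at hlt
    have hke : k < e := by
      by_contra hcon
      obtain rfl : k = e := by omega
      omega
    have hbn : P.b ≤ n := (Nat.le_mul_of_pos_right P.b (Nat.pow_pos (by omega : 0 < K))).trans
        hlt.le
    have hnb1 : 1 ≤ n / P.b := Nat.div_pos hbn hb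
    have hmt : MergeVars P n (P.b * K ^ k) K t :=
      ⟨h1t, h40t, h50, hKS, hn, Nat.mul_pos hb (Nat.pow_pos (by omega)), Dvd.intro _ rfl,
        hF.distinct (by exact hd2)⟩
    refine wp_seq (wp_mergePass hP hmt (by omega) ha ha4 rfl hsort ?_)
    intro u l' hFu hsortu hsegu htu hlu hcu
    have hmu := hmt.congr hFu rfl rfl rfl
    refine wp_seq (wp_copyBack hP hmu.r40 hn ha ha4 hmu.distinct ?_)
    intro v hFv hcopy htv hcv
    have hmv := hmu.congr hFv rfl rfl rfl
    have hcapn : min (P.b * K ^ k * K) n ≤ n := min_le_right _ _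
    refine wp_assign (min (P.b * K ^ k * K) n) (by simp [hmv.r50, hmv.r1, hmv.r40]) (by omega) ?_
    refine ⟨_, Nat.sub_lt_sub_left hke (Nat.lt_succ_self k), k + 1, rfl, hke, ?_, htv, ?_, ?_, ?_⟩
    · simp only [setReg_reg, Function.update_self, pow_succ, ← mul_assoc]
      rcases le_total (P.b * K ^ k * K) n with h | h
      · left; exact min_eq_left h
      · right; rw [min_eq_right h]; exact ⟨le_rfl, h⟩
    · have hl := lines_le (x := n) hb
      simp only [setReg_cost]
      have : n / P.b * (10 * (k + 1) + 2) = n / P.b * (10 * k + 2) + 10 * (n / P.b) := by ring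
      omega
    · rw [← hseg, ← hsegu]
      exact seg_congr hcopy
    · intro i j hij hj hdiv
      simp only [setReg_file]
      rw [hcopy i (by omega), hcopy j hj]
      exact hsortu i j hij hj (by rwa [pow_succ, ← mul_assoc] at hdiv)
  · rintro _ t ⟨k, rfl, hk, h50, hta, hcost, hseg, hsort⟩ hF hc
    have h40t : t.reg 40 = n := by rw [hF.reg 40 rfl]; simp [h402]
    have hge : n ≤ t.reg 50 := by simpa [h40t] using hc
    have hle : n ≤ P.b * K ^ k := by rcases h50 with h | h <;> omega
    refine ⟨hta, hcost.trans (Nat.add_le_add_left (Nat.mul_le_mul_left _ (by omega)) _), hseg,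
      fun i j hij hj => hsort i j hij hj ?_⟩
    rw [Nat.div_eq_of_lt (by omega), Nat.div_eq_of_lt (by omega)]

end sort

end ExtMem

/-! ### Documents as sequences of depths and labels -/

namespace XMLForest

/-- The depths and labels of the elements in document order, where the top-level elements have
depth `d`. -/
def nodes (d : ℕ) : XMLForest → List (ℕ × ℕ)
  | nil => []
  | elem l c r => (d, l) :: (c.nodes (d + 1) ++ r.nodes d)

theorem length_nodes (F : XMLForest) (d : ℕ) : (F.nodes d).length = F.size := by
  induction F generalizing d with
  | nil => rfl
  | elem l c r ihc ihr => simp [nodes, size, ihc, ihr]; omega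

theorem map_snd_nodes (F : XMLForest) (d : ℕ) : (F.nodes d).map Prod.snd = F.labels := by
  induction F generalizing d with
  | nil => rfl
  | elem l c r ihc ihr => simp [nodes, labels, ihc, ihr]

theorem length_tags (F : XMLForest) : F.tags.length = 2 * F.size := by
  induction F with
  | nil => rfl
  | elem l c r ihc ihr => simp [tags, size, ihc, ihr]; omega

theorem length_parents (F : XMLForest) (p : Option ℕ) (i : ℕ) :
    (F.parents p i).length = F.size := by
  induction F generalizing p i with
  | nil => rfl
  | elem l c r ihc ihr => simp [parents, size, ihc, ihr]; omega

/-- All tags are words if the start tags are. -/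
theorem lt_of_mem_tags (F : XMLForest) {W t : ℕ} (h0 : 0 < W) (h : ∀ l ∈ F.labels, l + 1 < W)
    (ht : t ∈ F.tags) : t < W := by
  induction F with
  | nil => simp [tags] at ht
  | elem l c r ihc ihr =>
    simp only [labels, List.mem_cons, List.mem_append] at h
    simp only [tags, List.mem_cons, List.mem_append] at ht
    rcases ht with rfl | ht | rfl | ht
    · exact h l (Or.inl rfl)
    · exact ihc (fun x hx => h x (Or.inr (Or.inl hx))) ht
    · exact h0
    · exact ihr (fun x hx => h x (Or.inr (Or.inr hx))) ht

/-- One step of the scan through the tags: the current depth and the elements seen so far. -/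
def scanTag (a : ℕ × List (ℕ × ℕ)) (t : ℕ) : ℕ × List (ℕ × ℕ) :=
  if t = 0 then (a.1 - 1, a.2) else (a.1 + 1, a.2 ++ [(a.1, t - 1)])

theorem foldl_scanTag (F : XMLForest) (d : ℕ) (L : List (ℕ × ℕ)) :
    F.tags.foldl scanTag (d, L) = (d, L ++ F.nodes d) := by
  induction F generalizing d L with
  | nil => simp [tags, nodes]
  | elem l c r ihc ihr => simp [tags, nodes, scanTag, ihc, ihr]

theorem le_depth (F : XMLForest) (d : ℕ) {j : ℕ} {x : ℕ × ℕ} (h : (F.nodes d)[j]? = some x) :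
    d ≤ x.1 := by
  induction F generalizing d j with
  | nil => simp [nodes] at h
  | elem l c r ihc ihr =>
    have hx : x ∈ (elem l c r).nodes d := List.mem_of_getElem? h
    simp only [nodes, List.mem_cons, List.mem_append] at hx
    rcases hx with rfl | hx | hx
    · exact le_rfl
    · obtain ⟨k, hk⟩ := List.mem_iff_getElem?.mp hx
      exact (Nat.le_succ d).trans (ihc _ hk)
    · obtain ⟨k, hk⟩ := List.mem_iff_getElem?.mp hx
      exact ihr _ hk

end XMLForest

/-- `q` is the last position before `j` whose depth is one less than that of `j`. -/
def IsParent (dep : ℕ → ℕ) (q j : ℕ) : Prop :=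
  q < j ∧ dep q + 1 = dep j ∧ ∀ k, q < k → k < j → dep k ≠ dep q

theorem IsParent.unique {dep : ℕ → ℕ} {q q' j : ℕ} (h : IsParent dep q j) (h' : IsParent dep q' j) :
    q = q' := by
  obtain ⟨h1, h2, h3⟩ := h
  obtain ⟨h1', h2', h3'⟩ := h'
  rcases lt_trichotomy q q' with hq | hq | hq
  · exact absurd (by omega) (h3 q' hq h1')
  · exact hq
  · exact absurd (by omega) (h3' q hq h1)

namespace XMLForest

/-- The depth of element `j`. -/
def depth (F : XMLForest) (d j : ℕ) : ℕ := ((F.nodes d).getD j (0, 0)).1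

theorem depth_zero (l : ℕ) (c r : XMLForest) (d : ℕ) : (elem l c r).depth d 0 = d := rfl

theorem depth_content {l : ℕ} {c r : XMLForest} {d j : ℕ} (h : j < c.size) :
    (elem l c r).depth d (1 + j) = c.depth (d + 1) j := by
  simp only [depth, nodes, Nat.add_comm 1, List.getD_cons_succ]
  rw [List.getD_append _ _ _ _ (by rwa [length_nodes])]

theorem depth_rest (l : ℕ) (c r : XMLForest) (d j : ℕ) :
    (elem l c r).depth d (1 + c.size + j) = r.depth d j := by
  have : 1 + c.size + j = (c.size + j) + 1 := by omega
  simp only [depth, nodes, this, List.getD_cons_succ]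
  rw [List.getD_append_right _ _ _ _ (by rw [length_nodes]; omega), length_nodes,
    Nat.add_sub_cancel_left]

theorem le_depth' (F : XMLForest) (d : ℕ) {j : ℕ} (h : j < F.size) : d ≤ F.depth d j := by
  rw [← length_nodes F d] at h
  refine F.le_depth d (j := j) ?_
  rw [List.getElem?_eq_getElem h, List.getD_eq_getElem _ _ h]

/-- The parents are determined by the depths. -/
theorem parents_spec (F : XMLForest) (d i : ℕ) (p : Option ℕ) {j : ℕ} (h : j < F.size) :
    (F.depth d j = d ∧ (F.parents p i)[j]? = some p) ∨
      ∃ q, IsParent (F.depth d) q j ∧ (F.parents p i)[j]? = some (some (i + q)) := by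
  induction F generalizing d i p j with
  | nil => simp [size] at h
  | elem l c r ihc ihr =>
    rcases Nat.eq_zero_or_pos j with rfl | hj
    · exact Or.inl ⟨rfl, rfl⟩
    · obtain ⟨j, rfl⟩ := Nat.exists_eq_add_of_le (Nat.succ_le_of_lt hj)
      rw [Nat.succ_eq_add_one, zero_add] at *
      by_cases hc : j < c.size
      · have hget : ((elem l c r).parents p i)[1 + j]? = (c.parents (some i) (i + 1))[j]? := by
          simp only [parents, Nat.add_comm 1 j, List.getElem?_cons_succ]
          rw [List.getElem?_append_left (by rwa [length_parents])]
        right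
        rw [hget]
        rcases ihc (d + 1) (i + 1) (some i) hc with ⟨h1, h2⟩ | ⟨q, ⟨h1, h2, h3⟩, h4⟩
        · refine ⟨0, ⟨by omega, by rw [depth_content hc, h1, depth_zero], fun k hk hk' => ?_⟩, h2⟩
          obtain ⟨k, rfl⟩ := Nat.exists_eq_add_of_le (Nat.succ_le_of_lt hk)
          rw [Nat.succ_eq_add_one, zero_add] at *
          have := c.le_depth' (d + 1) (j := k) (by omega)
          rw [depth_content (by omega), depth_zero]
          omega
        · refine ⟨1 + q, ⟨by omega, ?_, fun k hk hk' => ?_⟩, by rw [h4]; congr 2; omega⟩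
          · rw [depth_content hc, depth_content (by omega), h2]
          · obtain ⟨k, rfl⟩ := Nat.exists_eq_add_of_le (show 1 ≤ k by omega)
            rw [depth_content (by omega), depth_content (by omega)]
            exact h3 k (by omega) (by omega)
      · obtain ⟨j, rfl⟩ := Nat.exists_eq_add_of_le (not_lt.mp hc)
        have hr : j < r.size := by simp only [size] at h; omega
        have hget : ((elem l c r).parents p i)[1 + (c.size + j)]? =
            (r.parents p (i + 1 + c.size))[j]? := by
          simp only [parents, Nat.add_comm 1 (c.size + j), List.getElem?_cons_succ]
          rw [List.getElem?_append_right (by rw [length_parents]; omega), length_parents,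
            Nat.add_sub_cancel_left]
        rw [hget, ← add_assoc]
        rcases ihr d (i + 1 + c.size) p hr with ⟨h1, h2⟩ | ⟨q, ⟨h1, h2, h3⟩, h4⟩
        · exact Or.inl ⟨by rw [depth_rest, h1], h2⟩
        · refine Or.inr ⟨1 + c.size + q, ⟨by omega, ?_, fun k hk hk' => ?_⟩,
            by rw [h4]; congr 2; omega⟩
          · rw [depth_rest, depth_rest, h2]
          · obtain ⟨k, rfl⟩ := Nat.exists_eq_add_of_le (show 1 + c.size ≤ k by omega)
            rw [depth_rest, depth_rest]
            exact h3 k (by omega) (by omega)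

end XMLForest

namespace XMLDocument

/-- The depth of node `v`. -/
def depth (D : XMLDocument) (v : ℕ) : ℕ := D.toForest.depth 0 v

/-- The label of node `v`. -/
def labelAt (D : XMLDocument) (v : ℕ) : ℕ := D.labels.getD v 0

/-- The parent of a node is the last node before it whose depth is one less, so the tree can be
recovered from the depths. -/
theorem adj_iff (D : XMLDocument) (u v : Fin D.size) :
    D.graph.Adj u v ↔ IsParent D.depth u v := by
  change (D.toForest.parents none 0)[(v : ℕ)]? = some (some (u : ℕ)) ↔ _
  rcases D.toForest.parents_spec 0 0 none v.2 with ⟨h1, h2⟩ | ⟨q, h1, h2⟩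
  · rw [h2]
    refine ⟨fun h => by simp at h, fun h => ?_⟩
    have := h.2.1
    change _ = D.toForest.depth 0 v at this
    omega
  · rw [h2, zero_add]
    refine ⟨fun h => ?_, fun h => ?_⟩
    · obtain rfl : q = u := by simpa using h
      exact h1
    · rw [h1.unique h]

theorem exists_parent (D : XMLDocument) {v : ℕ} (hv : v < D.size) (hd : D.depth v ≠ 0) :
    ∃ u, IsParent D.depth u v := by
  rcases D.toForest.parents_spec 0 0 none hv with ⟨h1, h2⟩ | ⟨q, h1, h2⟩
  · exact absurd h1 hd
  · exact ⟨q, h1⟩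

end XMLDocument

/-! ### Classes of nodes from the keys of nodes -/

/-- Nodes `u` and `v` have equal labels and depths, and their parents are in the same class. -/
def SameKey (dep lab cl : ℕ → ℕ) (u v : ℕ) : Prop :=
  lab u = lab v ∧ dep u = dep v ∧ ∀ p q, IsParent dep p u → IsParent dep q v → cl p = cl q

section PartialIndex

variable {N : ℕ} {dep lab cl : ℕ → ℕ} {E L G : ℕ → ℕ} {q c ne : ℕ}

theorem SameKey.refl (u : ℕ) : SameKey dep lab cl u u :=
  ⟨rfl, rfl, fun _ _ h h' => by rw [h.unique h']⟩

theorem SameKey.symm {u v : ℕ} (h : SameKey dep lab cl u v) : SameKey dep lab cl v u :=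
  ⟨h.1.symm, h.2.1.symm, fun _ _ hp hq => (h.2.2 _ _ hq hp).symm⟩

theorem SameKey.trans (hpar : ∀ v < N, dep v ≠ 0 → ∃ u, IsParent dep u v) {u v w : ℕ} (hv : v < N)
    (h : SameKey dep lab cl u v) (h' : SameKey dep lab cl v w) : SameKey dep lab cl u w := by
  refine ⟨h.1.trans h'.1, h.2.1.trans h'.2.1, fun p q hp hq => ?_⟩
  obtain ⟨r, hr⟩ := hpar v hv (by have := hp.2.1; have := h.2.1; omega)
  exact (h.2.2 p r hp hr).trans (h'.2.2 r q hr hq)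

theorem sameKey_congr {cl' : ℕ → ℕ} {u v : ℕ} (hu : ∀ p, IsParent dep p u → cl' p = cl p)
    (hv : ∀ p, IsParent dep p v → cl' p = cl p) :
    SameKey dep lab cl' u v ↔ SameKey dep lab cl u v := by
  refine and_congr Iff.rfl (and_congr Iff.rfl (forall₂_congr fun p q => forall₂_congr fun hp hq =>
      ?_))
  rw [hu p hp, hv q hq]

/-- Node `v` occurs in the list of `q` pairs in `E`. -/
def Listed (E : ℕ → ℕ) (q v : ℕ) : Prop := ∃ j < q, E (2 * j) = v

/-- The 1-index, with classes given by `cl`, of the part of a tree that consists of the nodes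
in the list: `E` holds the `q` pairs (node, class), `L` the labels of the `c` classes, and `G` the
`ne` edges between the classes. -/
structure PartialIndex (N : ℕ) (dep lab cl : ℕ → ℕ) (E L G : ℕ → ℕ) (q c ne : ℕ) : Prop where
  node_lt : ∀ j < q, E (2 * j) < N
  cls : ∀ j < q, E (2 * j + 1) = cl (E (2 * j))
  mono : ∀ i j, i < j → j < q → E (2 * i + 1) ≤ E (2 * j + 1)
  cls_lt : ∀ j < q, E (2 * j + 1) < c
  surj : ∀ e < c, ∃ v, Listed E q v ∧ cl v = e
  key : ∀ u v, Listed E q u → Listed E q v → (cl u = cl v ↔ SameKey dep lab cl u v)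
  label : ∀ v, Listed E q v → L (cl v) = lab v
  closed : ∀ u v, Listed E q v → IsParent dep u v → Listed E q u
  edge : ∀ e < ne, ∃ u v, Listed E q v ∧ IsParent dep u v ∧ G (2 * e) = cl u ∧
    G (2 * e + 1) = cl v
  exists_edge : ∀ u v, Listed E q v → IsParent dep u v →
    ∃ e < ne, G (2 * e) = cl u ∧ G (2 * e + 1) = cl v
  edge_lt : ∀ i j, i < j → j < ne → G (2 * i + 1) < G (2 * j + 1)
  c_le : c ≤ q
  ne_le : ne ≤ c

theorem PartialIndex.empty : PartialIndex N dep lab cl E L G 0 0 0 where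
  node_lt j h := absurd h (by omega)
  cls j h := absurd h (by omega)
  mono i j _ h := absurd h (by omega)
  cls_lt j h := absurd h (by omega)
  surj j h := absurd h (by omega)
  key u v h := by obtain ⟨j, h, _⟩ := h; omega
  label v h := by obtain ⟨j, h, _⟩ := h; omega
  closed u v h := by obtain ⟨j, h, _⟩ := h; omega
  edge e h := absurd h (by omega)
  exists_edge u v h := by obtain ⟨j, h, _⟩ := h; omega
  edge_lt i j _ h := absurd h (by omega)
  c_le := le_rfl
  ne_le := le_rfl

theorem PartialIndex.cl_lt (h : PartialIndex N dep lab cl E L G q c ne) {v : ℕ}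
    (hv : Listed E q v) : cl v < c := by
  obtain ⟨j, hj, rfl⟩ := hv
  rw [← h.cls j hj]
  exact h.cls_lt j hj

theorem listed_succ {E' : ℕ → ℕ} {v : ℕ} (hE : ∀ i < 2 * q, E' i = E i) (hv : E' (2 * q) = v)
    (w : ℕ) : Listed E' (q + 1) w ↔ Listed E q w ∨ w = v := by
  constructor
  · rintro ⟨j, hj, hw⟩
    rcases Nat.lt_succ_iff_lt_or_eq.mp hj with h | rfl
    · exact Or.inl ⟨j, h, by rw [← hw, hE _ (by omega)]⟩
    · exact Or.inr (by rw [← hw, hv])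
  · rintro (⟨j, hj, hw⟩ | rfl)
    · exact ⟨j, by omega, by rw [hE _ (by omega), hw]⟩
    · exact ⟨q, by omega, hv⟩

/-- Listing one more node, which forms a class of its own or is put into the last class. -/
theorem PartialIndex.add (h : PartialIndex N dep lab cl E L G q c ne)
    (hpar : ∀ v < N, dep v ≠ 0 → ∃ u, IsParent dep u v) {E' L' G' : ℕ → ℕ} {v e c' ne' : ℕ}
    (hv : v < N) (hnew : ¬ Listed E q v) (hclosed : ∀ u, IsParent dep u v → Listed E q u)
    (hE : ∀ i < 2 * q, E' i = E i) (hE0 : E' (2 * q) = v) (hE1 : E' (2 * q + 1) = e)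
    (hL : ∀ i < c, L' i = L i) (hG : ∀ i < 2 * ne, G' i = G i)
    (hcase : (∃ u, Listed E q u ∧ SameKey dep lab cl u v ∧ cl u = e ∧ e + 1 = c ∧ c' = c ∧
        ne' = ne) ∨
      ((∀ u, Listed E q u → ¬ SameKey dep lab cl u v) ∧ e = c ∧ c' = c + 1 ∧ L' c = lab v ∧
        (dep v = 0 ∧ ne' = ne ∨ dep v ≠ 0 ∧ ne' = ne + 1 ∧
          (∀ u, IsParent dep u v → G' (2 * ne) = cl u) ∧ G' (2 * ne + 1) = c))) :
    PartialIndex N dep lab (Function.update cl v e) E' L' G' (q + 1) c' ne' := by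
  have hlist := listed_succ (q := q) hE hE0
  have hne : ∀ u, Listed E q u → u ≠ v := by rintro u hu rfl; exact hnew hu
  have hcl : ∀ u, Listed E q u → Function.update cl v e u = cl u := fun u hu =>
    Function.update_of_ne (hne u hu) _ _
  have hpl : ∀ w, (Listed E q w ∨ w = v) → ∀ p, IsParent dep p w → Listed E q p := by
    rintro w (hw | rfl) p hp
    · exact h.closed p w hw hp
    · exact hclosed p hp
  have hN : ∀ w, Listed E q w → w < N := by rintro _ ⟨j, hj, rfl⟩; exact h.node_lt j hj
  have hcc : c ≤ c' := by
    rcases hcase with ⟨u, -, -, -, -, rfl, -⟩ | ⟨-, rfl, rfl, -⟩ <;> omega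
  have hec : e < c' := by
    rcases hcase with ⟨u, -, -, -, h, rfl, -⟩ | ⟨-, rfl, rfl, -⟩ <;> omega
  have hce : c ≤ e + 1 := by
    rcases hcase with ⟨u, -, -, -, h, rfl, -⟩ | ⟨-, rfl, rfl, -⟩ <;> omega
  have hnn : ne ≤ ne' := by
    rcases hcase with ⟨u, -, -, -, -, -, rfl⟩ | ⟨-, -, -, -, ⟨-, rfl⟩ | ⟨-, rfl, -⟩⟩ <;> omega
  have hkeyv : ∀ u, Listed E q u → (cl u = e ↔ SameKey dep lab cl u v) := by
    intro u hu
    rcases hcase with ⟨w, hw, hwv, rfl, -⟩ | ⟨hno, rfl, -⟩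
    · rw [h.key u w hu hw]
      exact ⟨fun huw => huw.trans hpar (hN w hw) hwv, fun huv => huv.trans hpar hv hwv.symm⟩
    · exact ⟨fun hue => absurd (h.cl_lt hu) (by omega), fun hk => absurd hk (hno u hu)⟩
  -- an edge for the new node
  have hedge : ∀ u, IsParent dep u v → ∃ i < ne', G' (2 * i) = cl u ∧ G' (2 * i + 1) = e := by
    intro u hu
    rcases hcase with ⟨w, hw, hwv, rfl, -, -, rfl⟩ | ⟨-, rfl, -, -, ⟨h0, -⟩ | ⟨-, rfl, h1, h2⟩⟩
    · obtain ⟨p, hp⟩ := hpar w (hN w hw) (by have := hu.2.1; have := hwv.2.1; omega)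
      obtain ⟨i, hi, h1, h2⟩ := h.exists_edge p w hw hp
      exact ⟨i, hi, by rw [hG _ (by omega), h1, hwv.2.2 p u hp hu], by rw [hG _ (by omega), h2]⟩
    · exact absurd hu.2.1 (by omega)
    · exact ⟨ne, by omega, h1 u hu, h2⟩
  have hGlt : ∀ i < ne, G (2 * i + 1) < c := by
    intro i hi
    obtain ⟨u, w, hw, -, -, h2⟩ := h.edge i hi
    rw [h2]; exact h.cl_lt hw
  constructor
  case node_lt =>
    intro j hj
    rcases Nat.lt_succ_iff_lt_or_eq.mp hj with hj | rfl
    · rw [hE _ (by omega)]; exact h.node_lt j hj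
    · rwa [hE0]
  case cls =>
    intro j hj
    rcases Nat.lt_succ_iff_lt_or_eq.mp hj with hj | rfl
    · rw [hE _ (by omega), hE _ (by omega), hcl _ ⟨j, hj, rfl⟩]; exact h.cls j hj
    · rw [hE0, hE1, Function.update_self]
  case mono =>
    intro i j hij hj
    rcases Nat.lt_succ_iff_lt_or_eq.mp hj with hj | rfl
    · rw [hE _ (by omega), hE _ (by omega)]; exact h.mono i j hij hj
    · rw [hE1, hE _ (by omega)]
      have := h.cls_lt i hij
      omega
  case cls_lt =>
    intro j hj
    rcases Nat.lt_succ_iff_lt_or_eq.mp hj with hj | rfl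
    · rw [hE _ (by omega)]; exact (h.cls_lt j hj).trans_le hcc
    · rwa [hE1]
  case surj =>
    intro i hi
    by_cases hic : i < c
    · obtain ⟨w, hw, rfl⟩ := h.surj i hic
      exact ⟨w, (hlist w).mpr (Or.inl hw), hcl w hw⟩
    · refine ⟨v, (hlist v).mpr (Or.inr rfl), ?_⟩
      rw [Function.update_self]
      rcases hcase with ⟨u, -, -, -, h, rfl, -⟩ | ⟨-, rfl, rfl, -⟩ <;> omega
  case key =>
    intro u w hu hw
    rw [hlist] at hu hw
    rw [sameKey_congr (cl := cl) (fun p hp => hcl p (hpl u hu p hp))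
      (fun p hp => hcl p (hpl w hw p hp))]
    rcases hu with hu | rfl <;> rcases hw with hw | rfl
    · rw [hcl u hu, hcl w hw]; exact h.key u w hu hw
    · rw [hcl u hu, Function.update_self]; exact hkeyv u hu
    · rw [hcl w hw, Function.update_self, eq_comm, hkeyv w hw]
      exact ⟨SameKey.symm, SameKey.symm⟩
    · exact ⟨fun _ => SameKey.refl _, fun _ => rfl⟩
  case label =>
    intro u hu
    rcases (hlist u).mp hu with hu | rfl
    · rw [hcl u hu, hL _ (h.cl_lt hu)]; exact h.label u hu
    · rw [Function.update_self]
      rcases hcase with ⟨w, hw, hwv, rfl, hec, -⟩ | ⟨-, rfl, -, h1, -⟩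
      · rw [hL _ (by omega), h.label w hw, hwv.1]
      · exact h1
  case closed =>
    intro u w hw hu
    exact (hlist u).mpr (Or.inl (hpl w ((hlist w).mp hw) u hu))
  case edge =>
    intro i hi
    by_cases hi' : i < ne
    · obtain ⟨u, w, hw, hu, h1, h2⟩ := h.edge i hi'
      exact ⟨u, w, (hlist w).mpr (Or.inl hw), hu,
        by rw [hG _ (by omega), h1, hcl u (h.closed u w hw hu)],
            by rw [hG _ (by omega), h2, hcl w hw]⟩
    · rcases hcase with ⟨w, hw, hwv, -, -, -, rfl⟩ | ⟨-, rfl, -, -, ⟨h0, rfl⟩ | ⟨h0, rfl, h1, h2⟩⟩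
      · exact absurd hi hi'
      · exact absurd hi hi'
      · obtain rfl : i = ne := by omega
        obtain ⟨u, hu⟩ := hpar v hv h0
        refine ⟨u, v, (hlist v).mpr (Or.inr rfl), hu, ?_, ?_⟩
        · rw [h1 u hu, hcl u (hclosed u hu)]
        · rw [h2, Function.update_self]
  case exists_edge =>
    intro u w hw hu
    rw [hcl u (hpl w ((hlist w).mp hw) u hu)]
    rcases (hlist w).mp hw with hw | rfl
    · obtain ⟨i, hi, h1, h2⟩ := h.exists_edge u w hw hu
      exact ⟨i, by omega, by rw [hG _ (by omega), h1], by rw [hG _ (by omega), h2, hcl w hw]⟩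
    · rw [Function.update_self]
      exact hedge u hu
  case edge_lt =>
    intro i j hij hj
    by_cases hj' : j < ne
    · rw [hG _ (by omega), hG _ (by omega)]; exact h.edge_lt i j hij hj'
    · rcases hcase with ⟨w, hw, hwv, -, -, -, rfl⟩ | ⟨-, rfl, -, -, ⟨h0, rfl⟩ | ⟨h0, rfl, h1, h2⟩⟩
      · exact absurd hj hj'
      · exact absurd hj hj'
      · obtain rfl : j = ne := by omega
        rw [h2, hG _ (by omega)]
        exact hGlt i (by omega)
  case c_le =>
    have := h.c_le
    rcases hcase with ⟨u, -, -, -, -, rfl, -⟩ | ⟨-, -, rfl, -⟩ <;> omega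
  case ne_le =>
    have := h.ne_le
    rcases hcase with ⟨u, -, -, -, -, rfl, rfl⟩ | ⟨-, -, rfl, -, ⟨-, rfl⟩ | ⟨-, rfl, -⟩⟩ <;> omega

end PartialIndex

namespace XMLDocument

variable (D : XMLDocument) {cl : ℕ → ℕ}

/-- Numbers that are equal for nodes with the same label, the same depth and parents with equal
numbers, and only for those, describe the backward bisimilarity classes. -/
theorem cl_eq_iff_backwardBisimilar (h : ∀ u v, u < D.size → v < D.size →
      (cl u = cl v ↔ SameKey D.depth D.labelAt cl u v)) (u v : Fin D.size) :
    cl u = cl v ↔ D.graph.BackwardBisimilar u v := by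
  constructor
  · intro huv
    refine ⟨fun u v : Fin D.size => cl u = cl v, fun u v huv => ?_, huv⟩
    obtain ⟨h1, h2, h3⟩ := (h u v u.2 v.2).mp huv
    refine ⟨h1, fun p hp => ?_, fun p hp => ?_⟩
    · have hp : IsParent D.depth p u := (D.adj_iff p u).mp hp
      obtain ⟨q, hq⟩ := D.exists_parent v.2 (by have := hp.2.1; omega)
      exact ⟨⟨q, hq.1.trans v.2⟩, (D.adj_iff _ v).mpr hq, h3 _ _ hp hq⟩
    · have hp : IsParent D.depth p v := (D.adj_iff p v).mp hp
      obtain ⟨q, hq⟩ := D.exists_parent u.2 (by have := hp.2.1; omega)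
      exact ⟨⟨q, hq.1.trans u.2⟩, (D.adj_iff _ u).mpr hq, h3 _ _ hq hp⟩
  · rintro ⟨R, hR, huv⟩
    suffices H : ∀ n, ∀ u v : Fin D.size, (u : ℕ) = n → R u v → cl u = cl v from H u u v rfl huv
    intro n
    induction n using Nat.strong_induction_on with
    | _ n ih =>
      rintro u v rfl huv
      obtain ⟨h1, h2, h3⟩ := hR u v huv
      refine (h u v u.2 v.2).mpr ⟨h1, ?_, fun p q hp hq => ?_⟩
      · by_cases hu : D.depth u = 0
        · by_contra hne
          obtain ⟨q, hq⟩ := D.exists_parent v.2 (by omega)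
          obtain ⟨p, hp, -⟩ := h3 ⟨q, hq.1.trans v.2⟩ ((D.adj_iff _ v).mpr hq)
          have := ((D.adj_iff p u).mp hp).2.1
          omega
        · obtain ⟨p, hp⟩ := D.exists_parent u.2 hu
          obtain ⟨q, hq, hpq⟩ := h2 ⟨p, hp.1.trans u.2⟩ ((D.adj_iff _ u).mpr hp)
          have hq' := (D.adj_iff q v).mp hq
          have := ih p hp.1 ⟨p, hp.1.trans u.2⟩ q rfl hpq
          rw [h p q (hp.1.trans u.2) q.2] at this
          rw [← hp.2.1, ← hq'.2.1, this.2.1]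
      · obtain ⟨q', hq', hpq⟩ := h2 ⟨p, hp.1.trans u.2⟩ ((D.adj_iff _ u).mpr hp)
        obtain rfl := hq.unique ((D.adj_iff q' v).mp hq')
        exact ih p hp.1 ⟨p, hp.1.trans u.2⟩ q' rfl hpq

end XMLDocument

/-! ### From the files to the 1-index -/

/-- A file that holds pairs in its words `2 * j` and `2 * j + 1` holds the flattened list of the
pairs. -/
theorem getElem_flatMap_pair {α : Type} (f g : α → ℕ) (l : List α) (E : ℕ → ℕ)
    (h : ∀ (j : ℕ) (hj : j < l.length), E (2 * j) = f l[j] ∧ E (2 * j + 1) = g l[j]) (i : ℕ)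
    (hi : i < (l.flatMap fun a => [f a, g a]).length) :
    E i = (l.flatMap fun a => [f a, g a])[i] := by
  induction l generalizing E i with
  | nil => simp at hi
  | cons a l ih =>
    match i with
    | 0 => exact (h 0 (by simp)).1
    | 1 => exact (h 0 (by simp)).2
    | i + 2 =>
      have := ih (fun i => E (i + 2)) (fun j hj => h (j + 1) (by simpa using hj)) i
        (by simpa using hi)
      simpa using this

namespace XMLDocument

variable (D : XMLDocument) {cl E L G : ℕ → ℕ} {c ne : ℕ}

/-- When all nodes are listed, the three files hold the 1-index. -/
theorem exists_oneIndex (h : PartialIndex D.size D.depth D.labelAt cl E L G D.size c ne)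
    (hall : ∀ v < D.size, Listed E D.size v) :
    ∃ I : OneIndex D.graph, I.extents.length = D.size ∧ I.k = c ∧ I.edges.length = ne ∧
      (∀ i (hi : i < (I.extents.flatMap fun p => [(p.1 : ℕ), (p.2 : ℕ)]).length),
        E i = (I.extents.flatMap fun p => [(p.1 : ℕ), (p.2 : ℕ)])[i]) ∧
      (∀ i (hi : i < (List.ofFn I.label).length), L i = (List.ofFn I.label)[i]) ∧
      ∀ i (hi : i < (I.edges.flatMap fun p => [(p.1 : ℕ), (p.2 : ℕ)]).length),
        G i = (I.edges.flatMap fun p => [(p.1 : ℕ), (p.2 : ℕ)])[i] := by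
  have hcl : ∀ v : Fin D.size, cl v < c := fun v => h.cl_lt (hall v v.2)
  have hG : ∀ e < ne, G (2 * e) < c ∧ G (2 * e + 1) < c := by
    intro e he
    obtain ⟨u, v, hv, hu, h1, h2⟩ := h.edge e he
    rw [h1, h2]
    exact ⟨h.cl_lt (h.closed u v hv hu), h.cl_lt hv⟩
  let node : Fin D.size → Fin D.size := fun j => ⟨E (2 * j), h.node_lt j j.2⟩
  let cls : Fin D.size → Fin c := fun v => ⟨cl v, hcl v⟩
  let ext : Fin D.size → Fin D.size × Fin c := fun j => (node j, cls (node j))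
  let edge : Fin ne → Fin c × Fin c := fun e =>
    (⟨G (2 * e), (hG e e.2).1⟩, ⟨G (2 * e + 1), (hG e e.2).2⟩)
  have hsurj : Function.Surjective node := by
    intro v
    obtain ⟨j, hj, hv⟩ := hall v v.2
    exact ⟨⟨j, hj⟩, Fin.ext hv⟩
  have hinj : Function.Injective ext := fun i j hij =>
    Finite.injective_iff_surjective.mpr hsurj (congrArg Prod.fst hij)
  have hinj' : Function.Injective edge := by
    intro i j hij
    have h2 : G (2 * i + 1) = G (2 * j + 1) := congrArg Fin.val (congrArg Prod.snd hij)
    rcases lt_trichotomy (i : ℕ) j with hlt | heq | hlt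
    · exact absurd h2 (h.edge_lt i j hlt j.2).ne
    · exact Fin.ext heq
    · exact absurd h2 (h.edge_lt j i hlt i.2).ne'
  refine ⟨{ k := c, cls := cls, cls_surjective := ?_, cls_eq_iff := fun u v => ?_,
            extents := (List.finRange D.size).map ext,
            extents_nodup := (List.nodup_finRange _).map hinj,
            mem_extents := fun v e => ?_, extents_sorted := ?_,
            label := fun e => L e, label_cls := fun v => h.label v (hall v v.2),
            edges := (List.finRange ne).map edge,
            edges_nodup := (List.nodup_finRange _).map hinj',
            mem_edges := fun a b => ?_ }, by simp, rfl, by simp, ?_, ?_, ?_⟩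
  · rintro ⟨e, he⟩
    obtain ⟨v, ⟨j, hj, rfl⟩, hv⟩ := h.surj e he
    exact ⟨⟨_, h.node_lt j hj⟩, Fin.ext hv⟩
  · rw [← D.cl_eq_iff_backwardBisimilar fun u v hu hv => h.key u v (hall u hu) (hall v hv)]
    simp [cls]
  · simp only [List.mem_map, List.mem_finRange, true_and, ext, Prod.mk.injEq]
    constructor
    · rintro ⟨j, rfl, rfl⟩; rfl
    · rintro rfl
      obtain ⟨j, rfl⟩ := hsurj v
      exact ⟨j, rfl, rfl⟩
  · rw [List.pairwise_map]
    refine (List.pairwise_lt_finRange _).imp fun {i j} hij => ?_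
    change cl (E (2 * i)) ≤ cl (E (2 * j))
    rw [← h.cls i i.2, ← h.cls j j.2]
    exact h.mono i j hij j.2
  · simp only [List.mem_map, List.mem_finRange, true_and, edge, Prod.mk.injEq]
    constructor
    · rintro ⟨e, rfl, rfl⟩
      obtain ⟨u, v, ⟨j, hj, hv⟩, hu, h1, h2⟩ := h.edge e e.2
      have hvN : v < D.size := hv ▸ h.node_lt j hj
      refine ⟨⟨u, hu.1.trans hvN⟩, ⟨v, hvN⟩, (D.adj_iff _ _).mpr hu, Fin.ext h1.symm,
          Fin.ext h2.symm⟩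
    · rintro ⟨u, v, huv, rfl, rfl⟩
      obtain ⟨e, he, h1, h2⟩ := h.exists_edge u v (hall v v.2) ((D.adj_iff u v).mp huv)
      exact ⟨⟨e, he⟩, Fin.ext h1, Fin.ext h2⟩
  · refine getElem_flatMap_pair (fun p : Fin D.size × Fin c => (p.1 : ℕ)) (fun p => (p.2 : ℕ))
        _ E ?_
    intro j hj
    simp only [List.getElem_map, List.getElem_finRange, ext, node, cls]
    refine ⟨rfl, ?_⟩
    simp only [List.length_map, List.length_finRange] at hj
    exact h.cls j hj
  · intro i hi
    simp
  · refine getElem_flatMap_pair (fun p : Fin c × Fin c => (p.1 : ℕ)) (fun p => (p.2 : ℕ)) _ G ?_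
    intro j hj
    simp [edge]

end XMLDocument

/-! ### Parsing -/

namespace XMLForest

theorem length_foldl_scanTag (ts : List ℕ) (a : ℕ × List (ℕ × ℕ)) :
    a.2.length ≤ (ts.foldl scanTag a).2.length := by
  induction ts generalizing a with
  | nil => exact le_rfl
  | cons t ts ih =>
    refine le_trans ?_ (ih _)
    simp only [scanTag]
    split_ifs <;> simp

theorem foldl_scanTag_le (ts : List ℕ) (a : ℕ × List (ℕ × ℕ)) :
    (ts.foldl scanTag a).1 ≤ a.1 + ts.length := by
  induction ts generalizing a with
  | nil => exact le_rfl
  | cons t ts ih =>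
    refine (ih _).trans ?_
    simp only [scanTag, List.length_cons]
    split_ifs <;> simp <;> omega

end XMLForest

namespace ExtMem

open VState VProg

namespace VProg

/-- Process tag `var 11`, at depth `var 12`, after `var 10` start tags. -/
def parseStep : VProg :=
  .seq (.get 20 0 none (.var 11)) (.ite (.var 20)
    (.seq (.assign 24 (.var 12)) (.seq (.assign 25 (.var 10)) (.seq (.assign 26 (.var 20 - 1))
      (.seq (putRec 1 none (.var 10) 24) (.seq (.assign 10 (.var 10 + 1))
        (.assign 12 (.var 12 + 1)))))))
    (.assign 12 (.var 12 - 1)))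

/-- Convert the `var 2` tags in file `0` into the records (depth, node, label) in file `1`. -/
def parse : VProg :=
  .seq (.get 20 0 none 0) (.seq (.get 24 1 none 0) (.seq (.assign 10 0) (.seq (.assign 12 0)
    (.seq (forTo 11 (.var 2) parseStep) (.get 24 1 none 0)))))

end VProg

open XMLForest

/-- Parsing is a single pass through the tags and through the records. -/
theorem wp_parse {P : VParams} {Q : VState → Prop} {s : VState} (hP : Fits P) (F : XMLForest)
    (h2 : s.reg 2 = F.tags.length)
    (hF : ∀ (i : ℕ) (hi : i < F.tags.length), s.file 0 i = F.tags[i])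
    (hW : ∀ t ∈ F.tags, t < P.W) (hn : 3 * F.size + 3 ≤ P.cap) (hd : s.TagsDistinct)
    (hQ : ∀ t, Frame parse s t → t.reg 10 = F.size →
      (∀ i (hi : i < (F.nodes 0).length), recs (t.file 1) i =
        mkRec (F.nodes 0)[i].1 i (F.nodes 0)[i].2) → t.tag 1 = some (1, 0) →
      t.cost ≤ s.cost + 3 + 2 * (F.size / P.b) → Q t) :
    wp P parse Q s := by
  have hb := hP.b_pos
  have hcap := hP.cap_lt
  have hS := hP.S_ge
  have hlen := F.length_tags
  suffices h : wp P parse (fun t => t.reg 10 = F.size ∧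
      (∀ i (hi : i < (F.nodes 0).length), recs (t.file 1) i =
        mkRec (F.nodes 0)[i].1 i (F.nodes 0)[i].2) ∧ t.tag 1 = some (1, 0) ∧
      t.cost ≤ s.cost + 3 + 2 * (F.size / P.b)) s from
    wp_conseq h fun t ⟨h1, h2, h3, h4⟩ hF => hQ t hF h1 h2 h3 h4
  refine wp_seq (wp_get 0 0 rfl rfl (by omega) (by omega) (by omega) ?_)
  refine wp_seq (wp_get 1 0 rfl rfl (by omega) (by omega) (by omega) ?_)
  rw [Nat.zero_div]
  set s1 := s.touch 0 0 0 with hs1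
  have hc1 : s1.cost ≤ s.cost + 1 := touch_cost_le s 0 0 0
  have ht1 : s1.tag 0 = some (0, 0) := touch_tag_self s 0 0 0
  have hd1 : s1.TagsDistinct := hd.touch _ _ _
  have hf1 : s1.file = s.file := rfl
  have hr1 : s1.reg = s.reg := rfl
  clear_value s1
  set s2 := (s1.setReg 20 (s.file 0 0)).touch 1 1 0 with hs2
  have hc2 : s2.cost ≤ s1.cost + 1 := touch_cost_le _ 1 1 0
  have ht2 : s2.tag 0 = some (0, 0) := touch_tag_of_ne (by exact ht1) (by omega) (Or.inl (by omega))
  have ht2a : s2.tag 1 = some (1, 0) := touch_tag_self _ _ _ _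
  have hd2 : s2.TagsDistinct := TagsDistinct.touch (by exact hd1) _ _ _
  have hf2 : s2.file = s.file := by rw [hs2]; exact hf1
  have hr2 : s2.reg 2 = F.tags.length := by rw [hs2]; simp [hr1, h2]
  clear_value s2
  refine wp_seq (wp_assign 0 rfl (by omega) ?_)
  refine wp_seq (wp_assign 0 rfl (by omega) ?_)
  have hall := F.foldl_scanTag 0 []
  have hcount : ∀ k, ((F.tags.take k).foldl scanTag (0, [])).2.length ≤ F.size := by
    intro k
    have h := length_foldl_scanTag (F.tags.drop k) ((F.tags.take k).foldl scanTag (0, []))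
    rw [← List.foldl_append, List.take_append_drop, hall] at h
    simpa [length_nodes] using h
  refine wp_seq (wp_for_frame F.tags.length (fun k t =>
    t.reg 12 = ((F.tags.take k).foldl scanTag (0, [])).1 ∧
    t.reg 10 = ((F.tags.take k).foldl scanTag (0, [])).2.length ∧
    (∀ i (hi : i < ((F.tags.take k).foldl scanTag (0, [])).2.length), recs (t.file 1) i =
      mkRec ((F.tags.take k).foldl scanTag (0, [])).2[i].1 i
        ((F.tags.take k).foldl scanTag (0, [])).2[i].2) ∧
    ∃ l0 l1, t.tag 0 = some (0, l0) ∧ t.tag 1 = some (1, l1) ∧ l0 ≤ (k - 1) / (3 * P.b) ∧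
      l1 ≤ (t.reg 10 - 1) / P.b ∧ t.cost ≤ s.cost + 2 + l0 + l1) (by omega) ?_ ?_ ?_ ?_)
  · refine ⟨by simp, by simp, fun i hi => absurd hi (by simp), 0, 0, ht2, ht2a, Nat.zero_le _,
      Nat.zero_le _, ?_⟩
    simp only [setReg_cost]
    omega
  · intro k t _ _ _ hF
    simp [hF.reg 2 rfl, hr2]
  · rintro k t hk h11 ⟨h12, h10, hrec, l0, l1, ht0, ht1', hl0, hl1, hcost⟩ hFr
    have hstep : (F.tags.take (k + 1)).foldl scanTag (0, []) =
        scanTag ((F.tags.take k).foldl scanTag (0, [])) F.tags[k] := by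
      rw [← List.take_append_getElem hk, List.foldl_append]; rfl
    have hk1 := hcount (k + 1)
    have hk0 := hcount k
    have hdep := foldl_scanTag_le (F.tags.take k) (0, [])
    rw [List.length_take] at hdep
    have hdt : t.TagsDistinct := hFr.distinct (by exact hd2)
    rw [hstep] at hk1 ⊢
    generalize (F.tags.take k).foldl scanTag (0, []) = acc at *
    have hf0 : t.file 0 k = F.tags[k] := by
      rw [hFr.file 0 rfl]; simp [hf2, hF k hk]
    have hle0 : l0 ≤ k / (3 * P.b) := hl0.trans (Nat.div_le_div_right (by omega))
    refine wp_seq (wp_get 0 k rfl (by simp [h11]) (by omega) (by omega) (by omega) ?_)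
    have hct := touch_cost_forward ht0 hle0
    have ht0' := touch_tag_self t 0 0 (k / (3 * P.b))
    have ht1'' : (t.touch 0 0 (k / (3 * P.b))).tag 1 = some (1, l1) :=
      touch_tag_of_ne ht1' (by omega) (Or.inl (by omega))
    have hd' : (t.touch 0 0 (k / (3 * P.b))).TagsDistinct := hdt.touch _ _ _
    have hfile' : (t.touch 0 0 (k / (3 * P.b))).file = t.file := rfl
    have hreg' : (t.touch 0 0 (k / (3 * P.b))).reg = t.reg := rfl
    generalize t.touch 0 0 (k / (3 * P.b)) = t' at *
    rw [hf0]
    refine wp_ite (fun hc => ?_) (fun hc => ?_)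
    · have hc' : F.tags[k] ≠ 0 := by simpa using hc
      have hlt := hW _ (List.getElem_mem hk)
      simp only [scanTag, hc', if_false, List.length_append, List.length_cons,
        List.length_nil] at hk1 ⊢
      have hle1 : l1 ≤ acc.2.length / P.b :=
        hl1.trans (Nat.div_le_div_right (by rw [h10]; omega))
      refine wp_seq (wp_assign acc.1 (by simp [hreg', h12]) (by simp at hdep; omega) ?_)
      refine wp_seq (wp_assign acc.2.length (by simp [hreg', h10]) (by omega) ?_)
      refine wp_seq (wp_assign (F.tags[k] - 1) (by simp) (by omega) ?_)
      refine wp_seq (wp_putRec 1 acc.2.length (by exact hd') rfl (by simp [hreg', h10]) (by omega)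
        (by omega) (by omega) ?_)
      have hcy := touch_cost_forward (s := (((t'.setReg 20 F.tags[k]).setReg 24 acc.1).setReg 25
        acc.2.length).setReg 26 (F.tags[k] - 1)) (σ := 1) (f := 1) ht1'' hle1
      simp only [setReg_cost] at hcy
      refine wp_seq (wp_assign (acc.2.length + 1) (by simp [hreg', h10]) (by omega) ?_)
      refine wp_assign (acc.1 + 1) (by simp [hreg', h12]) (by simp at hdep; omega) ?_
      refine ⟨by simp [hreg', h11], by simp, by simp, ?_, k / (3 * P.b), acc.2.length / P.b, ?_, ?_,
        by simp, by simp, ?_⟩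
      · intro i hi
        simp only [setReg_file]
        rw [recs_setRec]
        by_cases hia : i = acc.2.length
        · subst hia
          simp
        · rw [Function.update_of_ne hia]
          have hi' : i < acc.2.length := by omega
          simp only [touch_file, setReg_file, hfile', hrec i hi', List.getElem_append_left hi']
      · simp only [setReg_tag, setRec_tag]
        exact touch_tag_of_ne (by simpa using ht0') (by omega) (Or.inl (by omega))
      · simp
      · simp only [setReg_cost, setRec_cost]
        omega
    · have hc' : F.tags[k] = 0 := by simpa using hc
      simp only [scanTag, hc', if_true]
      refine wp_assign (acc.1 - 1) (by simp [hreg', h12]) (by simp at hdep; omega) ?_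
      refine ⟨by simp [hreg', h11], by simp, by simp [hreg', h10], ?_, k / (3 * P.b), l1, ht0',
          ht1'',
        by simp, by simpa [hreg'] using hl1, ?_⟩
      · intro i hi
        simp only [setReg_file, hfile', hrec i hi]
      · simp only [setReg_cost]
        omega
  · rintro t h11 ⟨h12, h10, hrec, l0, l1, ht0, ht1', hl0, hl1, hcost⟩ hFr
    rw [List.take_length, hall] at h10 hrec
    simp only [List.nil_append] at h10 hrec
    rw [length_nodes] at h10
    refine wp_get 1 0 rfl rfl (by omega) (by omega) (by omega) ?_
    rw [Nat.zero_div]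
    refine ⟨by simp [h10], hrec, by simp, ?_⟩
    have hct := touch_cost_le t 1 1 0
    have h1 : l0 ≤ F.size / P.b := by
      refine hl0.trans ?_
      rw [← Nat.div_div_eq_div_mul]
      exact Nat.div_le_div_right (by omega)
    have h2 : l1 ≤ F.size / P.b := hl1.trans (Nat.div_le_div_right (by omega))
    simp only [setReg_cost]
    omega

end ExtMem

namespace ExtMem

open VState VProg

/-! ### Finding the parents of a level -/

namespace VProg

/-- Move forward to the last record of file `2` whose first word is less than `var 21`, starting at
record `var 16`. Variable `27` is the second word of the current record. -/
def advance : VProg :=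
  .seq (.assign 18 1) (.while (.var 18) (.ite (.lt (.var 16 + 1) (.var 11))
    (.seq (getRec 28 2 none (.var 16 + 1)) (.ite (.lt (.var 28) (.var 21))
      (.seq (.assign 16 (.var 16 + 1)) (.assign 27 (.var 29))) (.assign 18 0)))
    (.assign 18 0)))

/-- Append the record (class of the parent, label, node) of the node in `var 21` to file `3`. -/
def buildRec : VProg :=
  .seq advance (.seq (.assign 31 (.var 27)) (.seq (.assign 32 (.var 22))
      (.seq (.assign 33 (.var 21))
    (.seq (putRec 3 none (.var 13) 31) (.assign 13 (.var 13 + 1))))))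

/-- Write the records (class of the parent, label, node) of the nodes of depth `var 12` to file `3`.
Their records in file `1` begin at index `var 10`; file `2` contains the `var 11` nodes of the level
above with their classes. -/
def buildLevel : VProg :=
  .seq (.assign 13 0) (.seq (.assign 16 0) (.seq (.get 27 2 none 1) (.seq (.assign 17 1)
    (.while (.var 17) (.ite (.lt (.var 10 + .var 13) (.var 3))
      (.seq (getRec 20 1 none (.var 10 + .var 13)) (.ite (.eq (.var 20) (.var 12)) buildRec
        (.assign 17 0)))
      (.assign 17 0))))))

end VProg

section

variable {P : VParams} {Q : VState → Prop} {s : VState}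

/-- The scan of file `2` only moves forward, so that its cost is the number of lines passed. -/
theorem wp_advance {m x v l : ℕ} (hP : Fits P) (hd : s.TagsDistinct) (h11 : s.reg 11 = m)
    (h16 : s.reg 16 = x) (h21 : s.reg 21 = v) (h27 : s.reg 27 = s.file 2 (3 * x + 1))
    (hxm : x = 0 ∨ x < m) (hxv : x = 0 ∨ s.file 2 (3 * x) < v) (hm : 3 * m + 3 ≤ P.cap)
    (htag : s.tag 2 = some (2, l)) (hl : l ≤ (x + 1) / P.b) (hlm : l ≤ (m - 1) / P.b)
    (hQ : ∀ t x' l', Frame advance s t → t.reg 16 = x' → t.reg 27 = s.file 2 (3 * x' + 1) →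
      (x' = 0 ∨ x' < m) → (x' = 0 ∨ s.file 2 (3 * x') < v) →
      (x' + 1 < m → v ≤ s.file 2 (3 * (x' + 1))) → t.tag 2 = some (2, l') →
      l' ≤ (x' + 1) / P.b → l' ≤ (m - 1) / P.b → t.cost + l ≤ s.cost + l' → Q t) :
    wp P advance Q s := by
  have hcap := hP.cap_lt
  have hS := hP.S_ge
  suffices h : wp P advance (fun t => ∃ x' l', t.reg 16 = x' ∧ t.reg 27 = s.file 2 (3 * x' + 1) ∧
      (x' = 0 ∨ x' < m) ∧ (x' = 0 ∨ s.file 2 (3 * x') < v) ∧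
      (x' + 1 < m → v ≤ s.file 2 (3 * (x' + 1))) ∧ t.tag 2 = some (2, l') ∧
      l' ≤ (x' + 1) / P.b ∧ l' ≤ (m - 1) / P.b ∧ t.cost + l ≤ s.cost + l') s from
    wp_conseq h fun t ⟨x', l', h1, h2, h3, h4, h5, h6, h7, h8, h9⟩ hF =>
      hQ t x' l' hF h1 h2 h3 h4 h5 h6 h7 h8 h9
  refine wp_seq (wp_assign 1 rfl (by omega) ?_)
  refine wp_while_frame (fun k t => ∃ x' l', k = 2 * (m - x') + t.reg 18 ∧ t.reg 18 ≤ 1 ∧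
      t.reg 16 = x' ∧ t.reg 27 = s.file 2 (3 * x' + 1) ∧
      (x' = 0 ∨ x' < m) ∧ (x' = 0 ∨ s.file 2 (3 * x') < v) ∧
      (t.reg 18 = 0 → x' + 1 < m → v ≤ s.file 2 (3 * (x' + 1))) ∧ t.tag 2 = some (2, l') ∧
      l' ≤ (x' + 1) / P.b ∧ l' ≤ (m - 1) / P.b ∧ t.cost + l ≤ s.cost + l') _
    ⟨x, l, rfl, by simp, by simp [h16], by simp [h27], hxm, hxv, by simp, htag, hl, hlm, le_rfl⟩
    ?_ ?_
  · rintro _ t ⟨x', l', rfl, h18, h16, h27, hxm, hxv, -, htag, hl', hlm', hcost⟩ hF hc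
    have h18' : t.reg 18 = 1 := by simp at hc; omega
    have h11t : t.reg 11 = m := by rw [hF.reg 11 rfl]; simp [h11]
    have h21t : t.reg 21 = v := by rw [hF.reg 21 rfl]; simp [h21]
    have hf : t.file 2 = s.file 2 := by rw [hF.file 2 rfl]; rfl
    refine wp_ite (fun hc1 => ?_) (fun hc1 => ?_)
    · have hlt : x' + 1 < m := by simpa [h16, h11t] using hc1
      refine wp_seq (wp_getRec 2 (x' + 1) (hF.distinct (by exact hd)) (fun _ _ => rfl)
        (fun r hr => by simp [hr, h16]) (by omega) (by omega) (by omega) ?_)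
      have hct := touch_cost_forward htag hl'
      have hlast : (x' + 1) / P.b ≤ (m - 1) / P.b := Nat.div_le_div_right (by omega)
      refine wp_ite (fun hc2 => ?_) (fun hc2 => ?_)
      · have hlt2 : s.file 2 (3 * (x' + 1)) < v := by
          simpa [setRegs_reg, h21t, hf] using hc2
        refine wp_seq (wp_assign (x' + 1) (by simp [setRegs_reg, h16]) (by omega) ?_)
        refine wp_assign_var ⟨_, ?_, x' + 1, (x' + 1) / P.b, rfl, ?_, ?_, ?_, Or.inr hlt,
          Or.inr hlt2, ?_, ?_, Nat.div_le_div_right (by omega), hlast, ?_⟩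
        · simp [setRegs_reg, h18']; omega
        · simp [setRegs_reg, h18']
        · simp
        · simp [setRegs_reg, hf]
        · simp [setRegs_reg, h18']
        · simp
        · simp only [setReg_cost, setRegs_cost]; omega
      · have hlt2 : v ≤ s.file 2 (3 * (x' + 1)) := by
          simpa [setRegs_reg, h21t, hf] using hc2
        refine wp_assign 0 rfl (by omega) ⟨_, ?_, x', (x' + 1) / P.b, rfl, ?_, ?_, ?_, hxm, hxv,
          fun _ _ => hlt2, ?_, le_rfl, hlast, ?_⟩
        · simp [h18']
        · simp
        · simp [setRegs_reg, h16]
        · simp [setRegs_reg, h27]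
        · simp
        · simp only [setReg_cost, setRegs_cost]; omega
    · have hlt : ¬ x' + 1 < m := by simpa [h16, h11t] using hc1
      refine wp_assign 0 rfl (by omega) ⟨_, ?_, x', l', rfl, ?_, ?_, ?_, hxm, hxv,
          fun _ h => absurd h hlt, htag, hl', hlm', hcost⟩
      · simp [h18']
      · simp
      · simp [h16]
      · simp [h27]
  · rintro _ t ⟨x', l', rfl, h18, h16, h27, hxm, hxv, hex, htag, hl', hlm', hcost⟩ hF hc
    exact ⟨x', l', h16, h27, hxm, hxv, hex (by simpa using hc), htag, hl', hlm', hcost⟩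

/-- The records (depth, node, label) of the nodes, in the order of their depths; `ord i` is the
node in place `i`. -/
structure Ordered (N : ℕ) (dep lab ord : ℕ → ℕ) (g : ℕ → Rec) : Prop where
  rec_eq : ∀ i < N, g i = mkRec (dep (ord i)) (ord i) (lab (ord i))
  lt : ∀ i < N, ord i < N
  surj : ∀ v < N, ∃ i < N, ord i = v
  mono : ∀ i j, i < j → j < N → g i < g j

/-- The nodes of depth less than `d` are those in the first `y` places. -/
def LevelStart (N : ℕ) (dep ord : ℕ → ℕ) (d y : ℕ) : Prop :=
  y ≤ N ∧ ∀ i < N, dep (ord i) < d ↔ i < y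

/-- The file contains the `m` nodes of depth `d - 1` with their classes, in the order of the
nodes. -/
structure LevelFile (N : ℕ) (dep cl : ℕ → ℕ) (d m : ℕ) (g : ℕ → Rec) : Prop where
  node : ∀ i < m, ∃ v < N, dep v + 1 = d ∧ g i = mkRec v (cl v) 0
  exists_index : ∀ v < N, dep v + 1 = d → ∃ i < m, g i = mkRec v (cl v) 0
  mono : ∀ i j, i < j → j < m → g i ≤ g j

variable {N : ℕ} {dep lab ord cl : ℕ → ℕ} {d m y : ℕ}

/-- The last record before `v` in the level above is the parent of `v`. -/
theorem LevelFile.parent {h : ℕ → ℕ} (hX : LevelFile N dep cl d m (recs h)) {v u x : ℕ}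
    (hv : v < N) (hdv : dep v = d) (hu : IsParent dep u v) (hxm : x = 0 ∨ x < m)
    (hxv : x = 0 ∨ h (3 * x) < v) (hx : x + 1 < m → v ≤ h (3 * (x + 1))) :
    h (3 * x + 1) = cl u := by
  obtain ⟨huv, hdu, hlast⟩ := hu
  obtain ⟨i, hi, hgi⟩ := hX.exists_index u (huv.trans hv) (by omega)
  have hmono : ∀ {i j}, i ≤ j → j < m → h (3 * i) ≤ h (3 * j) := by
    intro i j hij hj
    rcases hij.lt_or_eq with hij | rfl
    · have := hX.mono i j hij hj
      rw [recs, recs, mkRec_le] at this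
      omega
    · exact le_rfl
  have hgi' := hgi
  rw [recs, mkRec_inj] at hgi'
  have hix : i ≤ x := by
    by_contra hcon
    have h1 := hx (by omega)
    have h2 := hmono (show x + 1 ≤ i by omega) hi
    omega
  rcases hix.lt_or_eq with hlt | rfl
  · have hxm' : x < m := by omega
    obtain ⟨w, hw, hdw, hgw⟩ := hX.node x hxm'
    rw [recs, mkRec_inj] at hgw
    have h1 := hmono hix hxm'
    have : ¬ u < w := fun huw => hlast w huw (by omega) (by omega)
    obtain rfl : w = u := by omega
    exact hgw.2.1
  · exact hgi'.2.1

/-- The nodes of depth `d` are consecutive in file `1`, and they appear there in the order of the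
nodes, as the nodes of the level above do in file `2`. Hence the parents are found in a single
simultaneous scan of the two files. -/
theorem wp_buildLevel {lY : ℕ} (hP : Fits P) (hd : s.TagsDistinct) (h3 : s.reg 3 = N)
    (h10 : s.reg 10 = y) (h11 : s.reg 11 = m) (h12 : s.reg 12 = d) (hN : 3 * N + 3 ≤ P.cap)
    (hmN : m ≤ N) (hY : Ordered N dep lab ord (recs (s.file 1))) (hy : y ≤ N)
    (hX : LevelFile N dep cl d m (recs (s.file 2)))
    (h1 : s.tag 1 = some (1, lY)) (hlY : lY ≤ y / P.b)
    (h2 : s.tag 2 = some (2, 0)) (h3' : s.tag 3 = some (3, 0))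
    (hQ : ∀ t n c0 lY' lX lZ, Frame buildLevel s t → t.reg 13 = n → y + n ≤ N →
      (∀ i, y ≤ i → i < y + n → dep (ord i) = d) → (y + n < N → dep (ord (y + n)) ≠ d) →
      (∀ k < n, ∃ p, recs (t.file 3) k = mkRec p (lab (ord (y + k))) (ord (y + k)) ∧
        (∀ u, IsParent dep u (ord (y + k)) → p = cl u) ∧ (d = 0 → p = c0)) →
      t.tag 1 = some (1, lY') → lY' ≤ (y + n) / P.b → t.tag 2 = some (2, lX) →
      lX ≤ (m - 1) / P.b → t.tag 3 = some (3, lZ) → lZ ≤ (n - 1) / P.b →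
      t.cost + lY ≤ s.cost + lY' + lX + lZ → Q t) :
    wp P buildLevel Q s := by
  have hb := hP.b_pos
  have hcap := hP.cap_lt
  have hS := hP.S_ge
  have hd3 : 1 / (3 * P.b) = 0 := Nat.div_eq_of_lt (by omega)
  suffices h : wp P buildLevel (fun t => ∃ n c0 lY' lX lZ, t.reg 13 = n ∧ y + n ≤ N ∧
      (∀ i, y ≤ i → i < y + n → dep (ord i) = d) ∧ (y + n < N → dep (ord (y + n)) ≠ d) ∧
      (∀ k < n, ∃ p, recs (t.file 3) k = mkRec p (lab (ord (y + k))) (ord (y + k)) ∧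
        (∀ u, IsParent dep u (ord (y + k)) → p = cl u) ∧ (d = 0 → p = c0)) ∧
      t.tag 1 = some (1, lY') ∧ lY' ≤ (y + n) / P.b ∧ t.tag 2 = some (2, lX) ∧
      lX ≤ (m - 1) / P.b ∧ t.tag 3 = some (3, lZ) ∧ lZ ≤ (n - 1) / P.b ∧
      t.cost + lY ≤ s.cost + lY' + lX + lZ) s from
    wp_conseq h fun t ⟨n, c0, lY', lX, lZ, g1, g2, g3, g4, g5, g6, g7, g8, g9, g10, g11, g12⟩ hF =>
      hQ t n c0 lY' lX lZ hF g1 g2 g3 g4 g5 g6 g7 g8 g9 g10 g11 g12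
  refine wp_seq (wp_assign 0 rfl (by omega) ?_)
  refine wp_seq (wp_assign 0 rfl (by omega) ?_)
  refine wp_seq (wp_get 2 1 rfl rfl (by omega) (by omega) (by omega) ?_)
  rw [hd3, touch_of_tag _ _ _ _ (by exact hd) (by exact h2)]
  refine wp_seq (wp_assign 1 rfl (by omega) ?_)
  -- at depth `0` the file of the level above is empty, and its first record is used throughout
  refine wp_while_frame (fun r t => ∃ n x lY' lX lZ, r = (N - n) + t.reg 17 ∧ t.reg 17 ≤ 1 ∧
      t.reg 13 = n ∧ y + n ≤ N ∧
      (∀ i, y ≤ i → i < y + n → dep (ord i) = d) ∧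
      (t.reg 17 = 0 → y + n < N → dep (ord (y + n)) ≠ d) ∧
      (∀ k < n, ∃ p, recs (t.file 3) k = mkRec p (lab (ord (y + k))) (ord (y + k)) ∧
        (∀ u, IsParent dep u (ord (y + k)) → p = cl u) ∧ (d = 0 → p = s.file 2 1)) ∧
      t.reg 16 = x ∧ t.reg 27 = s.file 2 (3 * x + 1) ∧ (x = 0 ∨ x < m) ∧
      (x = 0 ∨ ∀ i, y + n ≤ i → i < N → dep (ord i) = d → s.file 2 (3 * x) < ord i) ∧
      t.tag 1 = some (1, lY') ∧ lY' ≤ (y + n) / P.b ∧ t.tag 2 = some (2, lX) ∧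
      lX ≤ (x + 1) / P.b ∧ lX ≤ (m - 1) / P.b ∧ t.tag 3 = some (3, lZ) ∧ lZ ≤ (n - 1) / P.b ∧
      t.cost + lY ≤ s.cost + lY' + lX + lZ) _
    ⟨0, 0, lY, 0, 0, rfl, by simp, by simp, hy, fun i h1 h2 => absurd h2 (by omega), by simp,
      fun k hk => absurd hk (by omega), by simp, by simp, Or.inl rfl, Or.inl rfl, h1, hlY, h2,
      Nat.zero_le _, Nat.zero_le _, h3', Nat.zero_le _, by simp [add_comm]⟩ ?_ ?_
  · rintro _ t ⟨n, x, lY', lX, lZ, rfl, h17, h13, hyn, hlev, -, hZ, h16, h27, hxm, hxv, ht1, hlY',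
        ht2,
      hlX, hlX', ht3, hlZ, hcost⟩ hF hc
    have h17' : t.reg 17 = 1 := by simp at hc; omega
    have hdt : t.TagsDistinct := hF.distinct (by exact hd)
    have h3t : t.reg 3 = N := by rw [hF.reg 3 rfl]; simp [h3]
    have h10t : t.reg 10 = y := by rw [hF.reg 10 rfl]; simp [h10]
    have h11t : t.reg 11 = m := by rw [hF.reg 11 rfl]; simp [h11]
    have h12t : t.reg 12 = d := by rw [hF.reg 12 rfl]; simp [h12]
    have hf1 : t.file 1 = s.file 1 := by rw [hF.file 1 rfl]; rfl
    have hf2 : t.file 2 = s.file 2 := by rw [hF.file 2 rfl]; rfl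
    refine wp_ite (fun hc1 => ?_) (fun hc1 => ?_)
    · have hlt : y + n < N := by simpa [h10t, h13, h3t] using hc1
      refine wp_seq (wp_getRec 1 (y + n) hdt (fun _ _ => rfl)
        (fun r hr => by simp [hr, h10t, h13]) (by omega) (by omega) (by omega) ?_)
      have hrec := hY.rec_eq (y + n) hlt
      rw [recs, mkRec_inj] at hrec
      rw [hf1, hrec.1, hrec.2.1, hrec.2.2]
      have hct := touch_cost_forward ht1 hlY'
      have ht1' := touch_tag_self t 1 1 ((y + n) / P.b)
      have ht2' : (t.touch 1 1 ((y + n) / P.b)).tag 2 = some (2, lX) :=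
        touch_tag_of_ne ht2 (by omega) (Or.inl (by omega))
      have ht3' : (t.touch 1 1 ((y + n) / P.b)).tag 3 = some (3, lZ) :=
        touch_tag_of_ne ht3 (by omega) (Or.inl (by omega))
      have hd' : (t.touch 1 1 ((y + n) / P.b)).TagsDistinct := hdt.touch _ _ _
      have hfile' : (t.touch 1 1 ((y + n) / P.b)).file = t.file := rfl
      have hreg' : (t.touch 1 1 ((y + n) / P.b)).reg = t.reg := rfl
      generalize t.touch 1 1 ((y + n) / P.b) = t' at *
      refine wp_ite (fun hc2 => ?_) (fun hc2 => ?_)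
      · have hdep : dep (ord (y + n)) = d := by
          simpa [setRegs_reg, hreg', h12t] using hc2
        refine wp_seq (wp_advance (m := m) (x := x) (v := ord (y + n)) (l := lX) hP (by exact hd')
          (by simp [setRegs_reg, hreg', h11t]) (by simp [setRegs_reg, hreg', h16])
          (by simp [setRegs_reg]) (by simp [setRegs_reg, hreg', h27, hfile', hf2]) hxm
          (hxv.imp_right fun h => by simpa [hfile', hf2] using h _ le_rfl hlt hdep) (by omega)
              ht2' hlX hlX' ?_)
        intro u x' lX1 hFu h16u h27u hxm' hxv' hxn htu hlu hlu' hcu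
        simp only [setRegs_file, hfile', hf2, setRegs_cost] at h27u hxv' hxn hcu
        refine wp_seq (wp_assign_var (wp_seq (wp_assign_var (wp_seq (wp_assign_var ?_)))))
        change wp P _ _ (((u.setReg 31 (u.reg 27)).setReg 32 (u.reg 22)).setReg 33 (u.reg 21))
        have h13u : u.reg 13 = n := by rw [hFu.reg 13 rfl]; simp [setRegs_reg, hreg', h13]
        have h21u : u.reg 21 = ord (y + n) := by rw [hFu.reg 21 rfl]; simp [setRegs_reg]
        have h22u : u.reg 22 = lab (ord (y + n)) := by rw [hFu.reg 22 rfl]; simp [setRegs_reg]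
        have h17u : u.reg 17 = 1 := by rw [hFu.reg 17 rfl]; simp [setRegs_reg, hreg', h17']
        have hf3u : u.file 3 = t.file 3 := by rw [hFu.file 3 rfl]; simp [hfile']
        have hlZ' : lZ ≤ n / P.b := hlZ.trans (Nat.div_le_div_right (by omega))
        have ht3u : u.tag 3 = some (3, lZ) := hFu.tag 3 (by omega) rfl _ ht3'
        have ht1u : u.tag 1 = some (1, (y + n) / P.b) := hFu.tag 1 (by omega) rfl _ ht1'
        refine wp_seq (wp_putRec 3 n (by exact hFu.distinct (by exact hd')) rfl (by simp [h13u])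
          (by omega) (by omega) (by omega) ?_)
        have hcz := touch_cost_forward (s := ((u.setReg 31 (u.reg 27)).setReg 32 (u.reg 22)).setReg
            33
          (u.reg 21)) (σ := 3) (f := 3) ht3u hlZ'
        simp only [setReg_cost] at hcz
        refine wp_assign (n + 1) (by simp [h13u]) (by omega) ?_
        refine ⟨(N - (n + 1)) + 1, by omega, n + 1, x', (y + n) / P.b, lX1, n / P.b, ?_, ?_, ?_, ?_,
          ?_, ?_, ?_, ?_, ?_, hxm', ?_, ?_, ?_, ?_, hlu, hlu', ?_, by simp, ?_⟩
        · simp [h17u]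
        · simp [h17u]
        · simp
        · omega
        · intro i h1 h2
          by_cases hi : i = y + n
          · rw [hi, hdep]
          · exact hlev i h1 (by omega)
        · simp [h17u]
        · intro k hk
          simp only [setReg_file]
          rw [recs_setRec]
          by_cases hkn : k = n
          · subst hkn
            refine ⟨u.reg 27, by simp [h21u, h22u], fun w hw => ?_, fun hd0 => ?_⟩
            · rw [h27u]
              exact hX.parent (hY.lt _ hlt) hdep hw hxm' hxv' hxn
            · have hx0 : x' = 0 := by
                rcases hxm' with h | h
                · exact h
                · obtain ⟨w, -, hw, -⟩ := hX.node x' h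
                  omega
              rw [h27u, hx0]
          · rw [Function.update_of_ne hkn]
            simp only [touch_file, setReg_file, hf3u]
            exact hZ k (by omega)
        · simp [h16u]
        · simp [h27u]
        · refine hxv'.imp_right fun h i h1 h2 h3 => h.trans ?_
          have hm := hY.mono (y + n) i (by omega) h2
          rw [hY.rec_eq _ hlt, hY.rec_eq _ h2, mkRec_lt, h3, hdep] at hm
          rcases hm with hm | ⟨-, hm | ⟨heq, hm⟩⟩
          · exact absurd hm (lt_irrefl _)
          · exact hm
          · rw [heq] at hm; exact absurd hm (lt_irrefl _)
        · simp only [setReg_tag, setRec_tag]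
          exact touch_tag_of_ne (by exact ht1u) (by omega) (Or.inl (by omega))
        · exact Nat.div_le_div_right (by omega)
        · simp only [setReg_tag, setRec_tag]
          exact touch_tag_of_ne (by exact htu) (by omega) (Or.inl (by omega))
        · simp
        · simp only [setReg_cost, setRec_cost]
          omega
      · have hdep : dep (ord (y + n)) ≠ d := by
          simpa [setRegs_reg, hreg', h12t] using hc2
        refine wp_assign 0 rfl (by omega) ⟨_, ?_, n, x, (y + n) / P.b, lX, lZ, rfl, by simp, ?_,
            hyn,
          hlev, fun _ _ => hdep, ?_, ?_, ?_, hxm, hxv, ht1', le_rfl, ht2', hlX, hlX', ht3', hlZ, ?_⟩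
        · simp [h17']
        · simp [setRegs_reg, hreg', h13]
        · simpa [hfile'] using hZ
        · simp [setRegs_reg, hreg', h16]
        · simp [setRegs_reg, hreg', h27]
        · simp only [setReg_cost, setRegs_cost]
          omega
    · have hlt : ¬ y + n < N := by simpa [h10t, h13, h3t] using hc1
      refine wp_assign 0 rfl (by omega) ⟨_, ?_, n, x, lY', lX, lZ, rfl, by simp, ?_, hyn,
          hlev, fun _ h => absurd h hlt, ?_, ?_, ?_, hxm, hxv, ht1, hlY', ht2, hlX, hlX', ht3, hlZ,
          hcost⟩
      · simp [h17']
      · simp [h13]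
      · simpa using hZ
      · simp [h16]
      · simp [h27]
  · rintro _ t ⟨n, x, lY', lX, lZ, rfl, h17, h13, hyn, hlev, hupto, hZ, h16, h27, hxm, hxv, ht1,
        hlY',
      ht2, hlX, hlX', ht3, hlZ, hcost⟩ hF hc
    exact ⟨n, s.file 2 1, lY', lX, lZ, h13, hyn, hlev, hupto (by simpa using hc), hZ, ht1, hlY',
        ht2, hlX', ht3,
      hlZ, hcost⟩

end

end ExtMem

namespace ExtMem

open VState VProg

/-! ### Assigning classes to a level -/

namespace VProg

/-- Open a class with label `var 21`, below class `var 20` unless `var 12` is zero. -/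
def newClass : VProg :=
  .seq (.put 6 none (.var 14) 21) (.seq (.ite (.var 12) (.seq (.put 7 none (2 * .var 15) 20)
      (.seq (.put 7 none (2 * .var 15 + 1) 14) (.assign 15 (.var 15 + 1)))) .skip)
    (.seq (.assign 35 (.var 20)) (.seq (.assign 36 (.var 21)) (.assign 14 (.var 14 + 1)))))

/-- Put node `var 22` into the last class. -/
def listNode : VProg :=
  .seq (.assign 23 (.var 14 - 1)) (.seq (.assign 24 0)
      (.seq (.put 5 none (2 * (.var 10 + .var 34)) 22)
    (.seq (.put 5 none (2 * (.var 10 + .var 34) + 1) 23) (putRec 2 none (.var 34) 22))))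

/-- Assign classes to the `var 13` nodes in file `3`, which is sorted. The variables `35` and `36`
hold the key of the last class. -/
def scanLevel : VProg :=
  forTo 34 (.var 13) (.seq (getRec 20 3 none (.var 34))
    (.seq (.ite (.eq (.var 34) 0 + (1 - .eq (.var 20) (.var 35) * .eq (.var 21) (.var 36)))
      newClass .skip) listNode))

end VProg

section

variable {P : VParams} {Q : VState → Prop} {s : VState}

theorem wp_newClass {c ne d lL lG : ℕ} (hP : Fits P) (hd : s.TagsDistinct) (h14 : s.reg 14 = c)
    (h15 : s.reg 15 = ne) (h12 : s.reg 12 = d) (hc : c + 1 < P.cap) (hne : 2 * ne + 1 < P.cap)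
    (h6 : s.tag 6 = some (6, lL)) (hlL : lL ≤ c / (3 * P.b)) (h7 : s.tag 7 = some (7, lG))
    (hlG : lG ≤ 2 * ne / (3 * P.b))
    (hQ : ∀ t ne' lL' lG', Frame newClass s t → t.reg 14 = c + 1 → t.reg 15 = ne' →
      t.reg 35 = s.reg 20 → t.reg 36 = s.reg 21 → t.file 6 = Function.update (s.file 6)
          c (s.reg 21) →
      (∀ i < 2 * ne, t.file 7 i = s.file 7 i) →
      (d = 0 ∧ ne' = ne ∨ d ≠ 0 ∧ ne' = ne + 1 ∧ t.file 7 (2 * ne) = s.reg 20 ∧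
        t.file 7 (2 * ne + 1) = c) →
      t.tag 6 = some (6, lL') → lL' ≤ (c + 1) / (3 * P.b) → t.tag 7 = some (7, lG') →
      lG' ≤ 2 * ne' / (3 * P.b) → t.cost + lL + lG ≤ s.cost + lL' + lG' → Q t) :
    wp P newClass Q s := by
  have hcap := hP.cap_lt
  have hS := hP.S_ge
  suffices h : wp P newClass (fun t => ∃ ne' lL' lG', t.reg 14 = c + 1 ∧ t.reg 15 = ne' ∧
      t.reg 35 = s.reg 20 ∧ t.reg 36 = s.reg 21 ∧ t.file 6 = Function.update (s.file 6)
          c (s.reg 21) ∧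
      (∀ i < 2 * ne, t.file 7 i = s.file 7 i) ∧
      (d = 0 ∧ ne' = ne ∨ d ≠ 0 ∧ ne' = ne + 1 ∧ t.file 7 (2 * ne) = s.reg 20 ∧
        t.file 7 (2 * ne + 1) = c) ∧
      t.tag 6 = some (6, lL') ∧ lL' ≤ (c + 1) / (3 * P.b) ∧ t.tag 7 = some (7, lG') ∧
      lG' ≤ 2 * ne' / (3 * P.b) ∧ t.cost + lL + lG ≤ s.cost + lL' + lG') s from
    wp_conseq h fun t ⟨ne', lL', lG', g1, g2, g3, g4, g5, g6, g7, g8, g9, g10, g11, g12⟩ hF =>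
      hQ t ne' lL' lG' hF g1 g2 g3 g4 g5 g6 g7 g8 g9 g10 g11 g12
  refine wp_seq (wp_put 6 c rfl (by simp [h14]) (by omega) (by omega) (by omega) ?_)
  have hc1 := touch_cost_forward h6 hlL
  have h61 := touch_tag_self s 6 6 (c / (3 * P.b))
  have h71 : (s.touch 6 6 (c / (3 * P.b))).tag 7 = some (7, lG) :=
    touch_tag_of_ne h7 (by omega) (Or.inl (by omega))
  have hd1 : (s.touch 6 6 (c / (3 * P.b))).TagsDistinct := hd.touch _ _ _
  have hf1 : (s.touch 6 6 (c / (3 * P.b))).file = s.file := rfl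
  have hr1 : (s.touch 6 6 (c / (3 * P.b))).reg = s.reg := rfl
  generalize s.touch 6 6 (c / (3 * P.b)) = s1 at *
  have hline : c / (3 * P.b) ≤ (c + 1) / (3 * P.b) := Nat.div_le_div_right (by omega)
  refine wp_seq (wp_ite (fun hcd => ?_) (fun hcd => ?_))
  · have hd0 : d ≠ 0 := by simpa [hr1, h12] using hcd
    refine wp_seq (wp_put 7 (2 * ne) rfl (by simp [hr1, h15]) (by omega) (by omega) (by omega) ?_)
    refine wp_seq (wp_put 7 (2 * ne + 1) rfl (by simp [hr1, h15]) (by omega) (by omega) (by omega)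
        ?_)
    have hc2 := touch_cost_forward (s := s1.setFile 6 c (s.reg 21)) (σ := 7) (f := 7) h71 hlG
    have h72 := touch_tag_self (s1.setFile 6 c (s.reg 21)) 7 7 (2 * ne / (3 * P.b))
    have h62 := touch_tag_of_ne (s := s1.setFile 6 c (s.reg 21)) (σ := 7) (f := 7)
      (l := 2 * ne / (3 * P.b)) h61 (by omega) (Or.inl (by omega))
    have hf2 : ((s1.setFile 6 c (s.reg 21)).touch 7 7 (2 * ne / (3 * P.b))).file =
      Function.update s.file 6 (Function.update (s.file 6) c (s.reg 21)) := by simp [hf1]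
    have hr2 : ((s1.setFile 6 c (s.reg 21)).touch 7 7 (2 * ne / (3 * P.b))).reg = s.reg := hr1
    generalize (s1.setFile 6 c (s.reg 21)).touch 7 7 (2 * ne / (3 * P.b)) = s2 at *
    have hc3 := touch_cost_forward (s := s2.setFile 7 (2 * ne) (s.reg 20)) (σ := 7) (f := 7)
      (l' := (2 * ne + 1) / (3 * P.b)) h72 (Nat.div_le_div_right (by omega))
    have h73 := touch_tag_self (s2.setFile 7 (2 * ne) (s.reg 20)) 7 7 ((2 * ne + 1) / (3 * P.b))
    have h63 := touch_tag_of_ne (s := s2.setFile 7 (2 * ne) (s.reg 20)) (σ := 7) (f := 7)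
      (l := (2 * ne + 1) / (3 * P.b)) h62 (by omega) (Or.inl (by omega))
    have hr1' : ((s1.setFile 6 c (s.reg 21)).reg 20) = s.reg 20 := by simp [hr1]
    simp only [setFile_reg, hr1, hr2]
    have hf3 : ((s2.setFile 7 (2 * ne) (s.reg 20)).touch 7 7 ((2 * ne + 1) / (3 * P.b))).file =
        Function.update (Function.update s.file 6 (Function.update (s.file 6) c (s.reg 21))) 7
          (Function.update (s.file 7) (2 * ne) (s.reg 20)) := by simp [hf2]
    have hr3 : ((s2.setFile 7 (2 * ne) (s.reg 20)).touch 7 7 ((2 * ne + 1) / (3 * P.b))).reg =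
      s.reg := hr2
    generalize (s2.setFile 7 (2 * ne) (s.reg 20)).touch 7 7 ((2 * ne + 1) / (3 * P.b)) = s3 at *
    have hr14 : ((s2.setFile 7 (2 * ne) (s.reg 20)).reg 14) = c := by simp [hr2, h14]
    simp only [setFile_cost] at hc2 hc3
    refine wp_assign (ne + 1) (by simp [hr3, h15]) (by omega) ?_
    refine wp_seq (wp_assign_var (wp_seq (wp_assign_var
      (wp_assign (c + 1) (by simp [hr3, h14]) (by omega) ?_))))
    refine ⟨ne + 1, c / (3 * P.b), (2 * ne + 1) / (3 * P.b), by simp, by simp, by simp [hr3],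
      by simp [hr3], by simp [hf3], fun i hi => ?_, Or.inr ⟨hd0, rfl, ?_, ?_⟩, h63, hline, h73,
      Nat.div_le_div_right (by omega), ?_⟩
    · simp only [setReg_file, setFile_file, hf3, Function.update_self]
      rw [Function.update_of_ne (by omega), Function.update_of_ne (by omega)]
    · simp [hf3]
    · simp [hf3, h14]
    · simp only [setReg_cost, setFile_cost]
      omega
  · have hd0 : d = 0 := by simpa [hr1, h12] using hcd
    refine wp_seq (wp_assign_var (wp_seq (wp_assign_var
      (wp_assign (c + 1) (by simp [hr1, h14]) (by omega) ?_))))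
    refine ⟨ne, c / (3 * P.b), lG, by simp, by simp [hr1, h15], by simp [hr1],
      by simp [hr1], by simp [hf1], fun i hi => by simp [hf1], Or.inl ⟨hd0, rfl⟩, h61, hline, h71,
      hlG, ?_⟩
    simp only [setReg_cost, setFile_cost]
    omega

theorem wp_listNode {c y k lE lX : ℕ} (hP : Fits P) (hd : s.TagsDistinct) (h14 : s.reg 14 = c)
    (h10 : s.reg 10 = y) (h34 : s.reg 34 = k) (hyk : 3 * (y + k) + 3 ≤ P.cap) (hcc : c ≤ P.cap)
    (h5 : s.tag 5 = some (5, lE)) (hlE : lE ≤ 2 * (y + k) / (3 * P.b)) (h2 : s.tag 2 = some (2, lX))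
    (hlX : lX ≤ k / P.b)
    (hQ : ∀ t lE', Frame listNode s t → t.file 5 = Function.update (Function.update (s.file 5)
        (2 * (y + k)) (s.reg 22)) (2 * (y + k) + 1) (c - 1) →
      recs (t.file 2) = Function.update (recs (s.file 2)) k (mkRec (s.reg 22) (c - 1) 0) →
      t.tag 5 = some (5, lE') → lE' ≤ 2 * (y + k + 1) / (3 * P.b) → t.tag 2 = some (2, k / P.b) →
      t.cost + lE + lX ≤ s.cost + lE' + k / P.b → Q t) :
    wp P listNode Q s := by
  have hcap := hP.cap_lt
  have hS := hP.S_ge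
  suffices h : wp P listNode (fun t => ∃ lE', t.file 5 = Function.update (Function.update (s.file 5)
        (2 * (y + k)) (s.reg 22)) (2 * (y + k) + 1) (c - 1) ∧
      recs (t.file 2) = Function.update (recs (s.file 2)) k (mkRec (s.reg 22) (c - 1) 0) ∧
      t.tag 5 = some (5, lE') ∧ lE' ≤ 2 * (y + k + 1) / (3 * P.b) ∧ t.tag 2 = some (2, k / P.b) ∧
      t.cost + lE + lX ≤ s.cost + lE' + k / P.b) s from
    wp_conseq h fun t ⟨lE', g1, g2, g3, g4, g5, g6⟩ hF => hQ t lE' hF g1 g2 g3 g4 g5 g6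
  refine wp_seq (wp_assign (c - 1) (by simp [h14]) (by omega) ?_)
  refine wp_seq (wp_assign 0 rfl (by omega) ?_)
  set s1 := (s.setReg 23 (c - 1)).setReg 24 0 with hs1
  have h51 : s1.tag 5 = some (5, lE) := h5
  have h21 : s1.tag 2 = some (2, lX) := h2
  have hf1 : s1.file = s.file := rfl
  have hc1 : s1.cost = s.cost := rfl
  have hd1 : s1.TagsDistinct := hd
  have h101 : s1.reg 10 = y := by simp [hs1, h10]
  have h341 : s1.reg 34 = k := by simp [hs1, h34]
  have h221 : s1.reg 22 = s.reg 22 := by simp [hs1]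
  have h231 : s1.reg 23 = c - 1 := by simp [hs1]
  have h241 : s1.reg 24 = 0 := by simp [hs1]
  clear_value s1
  refine wp_seq (wp_put 5 (2 * (y + k)) rfl (by simp [h101, h341]) (by omega) (by omega) (by omega)
      ?_)
  have hct := touch_cost_forward h51 hlE
  have h52 := touch_tag_self s1 5 5 (2 * (y + k) / (3 * P.b))
  have h22 : (s1.touch 5 5 (2 * (y + k) / (3 * P.b))).tag 2 = some (2, lX) :=
    touch_tag_of_ne h21 (by omega) (Or.inl (by omega))
  have hd2 : (s1.touch 5 5 (2 * (y + k) / (3 * P.b))).TagsDistinct := hd1.touch _ _ _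
  have hf2 : (s1.touch 5 5 (2 * (y + k) / (3 * P.b))).file = s.file := hf1
  have hr2 : (s1.touch 5 5 (2 * (y + k) / (3 * P.b))).reg = s1.reg := rfl
  generalize s1.touch 5 5 (2 * (y + k) / (3 * P.b)) = s2 at *
  refine wp_seq (wp_put 5 (2 * (y + k) + 1) rfl (by simp [hr2, h101, h341]) (by omega) (by omega)
    (by omega) ?_)
  have hct3 := touch_cost_forward (s := s2.setFile 5 (2 * (y + k)) (s1.reg 22)) (σ := 5) (f := 5)
    (l' := (2 * (y + k) + 1) / (3 * P.b)) h52 (Nat.div_le_div_right (by omega))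
  have h53 := touch_tag_self (s2.setFile 5 (2 * (y + k)) (s1.reg 22)) 5 5
    ((2 * (y + k) + 1) / (3 * P.b))
  have h23 := touch_tag_of_ne (s := s2.setFile 5 (2 * (y + k)) (s1.reg 22)) (σ := 5) (f := 5)
    (l := (2 * (y + k) + 1) / (3 * P.b)) h22 (by omega) (Or.inl (by omega))
  have hd3 := TagsDistinct.touch (s := s2.setFile 5 (2 * (y + k)) (s1.reg 22)) hd2 5 5
    ((2 * (y + k) + 1) / (3 * P.b))
  have hf3 : ((s2.setFile 5 (2 * (y + k)) (s1.reg 22)).touch 5 5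
      ((2 * (y + k) + 1) / (3 * P.b))).file = Function.update s.file 5
        (Function.update (s.file 5) (2 * (y + k)) (s.reg 22)) := by simp [hf2, h221]
  have hr3 : ((s2.setFile 5 (2 * (y + k)) (s1.reg 22)).touch 5 5
      ((2 * (y + k) + 1) / (3 * P.b))).reg = s1.reg := hr2
  simp only [setFile_reg, setFile_cost, hr2, h231] at hct3 ⊢
  generalize (s2.setFile 5 (2 * (y + k)) (s1.reg 22)).touch 5 5
      ((2 * (y + k) + 1) / (3 * P.b)) = s3 at *
  refine wp_putRec 2 k (by exact hd3) rfl (by simp [hr3, h341]) (by omega) (by omega) (by omega) ?_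
  have hct4 := touch_cost_forward (s := s3.setFile 5 (2 * (y + k) + 1) (c - 1)) (σ := 2) (f := 2)
    h23 hlX
  refine ⟨(2 * (y + k) + 1) / (3 * P.b), ?_, ?_, ?_, Nat.div_le_div_right (by omega), by simp, ?_⟩
  · rw [setRec_file _ _ _ _ _ _ _ (by omega)]
    simp [hf3]
  · rw [recs_setRec]
    simp [hf3, hr3, h221, h231, h241]
  · simp only [setRec_tag]
    exact touch_tag_of_ne (by exact h53) (by omega) (Or.inl (by omega))
  · simp only [setRec_cost, setFile_cost] at hct4 ⊢
    omega

end

end ExtMem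

namespace ExtMem

open VState VProg

section

variable {P : VParams} {Q : VState → Prop} {s : VState}
variable {N : ℕ} {dep lab cl : ℕ → ℕ} {d n c0 : ℕ}

/-- The words `z` of a file are the sorted records (class of the parent, label, node) of the `n`
nodes of depth `d`; at depth `0` a constant takes the place of the class of the parent. -/
structure KeyFile (N : ℕ) (dep lab cl : ℕ → ℕ) (d n c0 : ℕ) (z : ℕ → ℕ) : Prop where
  lt : ∀ k < n, z (3 * k + 2) < N
  dep_eq : ∀ k < n, dep (z (3 * k + 2)) = d
  lab_eq : ∀ k < n, z (3 * k + 1) = lab (z (3 * k + 2))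
  parent : ∀ k < n, ∀ u, IsParent dep u (z (3 * k + 2)) → z (3 * k) = cl u
  const : ∀ k < n, d = 0 → z (3 * k) = c0
  exists_index : ∀ v < N, dep v = d → ∃ k < n, z (3 * k + 2) = v
  mono : ∀ i j, i < j → j < n → recs z i < recs z j

variable {z : ℕ → ℕ}

/-- Nodes of the same depth have the same key if and only if the first two words of their records
agree. -/
theorem KeyFile.sameKey_iff (h : KeyFile N dep lab cl d n c0 z)
    (hpar : ∀ v < N, dep v ≠ 0 → ∃ u, IsParent dep u v) {cl' : ℕ → ℕ}
    (hcl : ∀ u, dep u < d → cl' u = cl u) {i j : ℕ} (hi : i < n) (hj : j < n) :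
    SameKey dep lab cl' (z (3 * i + 2)) (z (3 * j + 2)) ↔
      z (3 * i) = z (3 * j) ∧ z (3 * i + 1) = z (3 * j + 1) := by
  have hup : ∀ {k}, k < n → ∀ u, IsParent dep u (z (3 * k + 2)) → cl' u = z (3 * k) := by
    intro k hk u hu
    have h1 := hu.2.1
    have h2 := h.dep_eq k hk
    rw [hcl u (by omega), h.parent k hk u hu]
  rw [h.lab_eq i hi, h.lab_eq j hj]
  constructor
  · rintro ⟨h1, h2, h3⟩
    refine ⟨?_, h1⟩
    by_cases hd : d = 0
    · rw [h.const i hi hd, h.const j hj hd]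
    · obtain ⟨u, hu⟩ := hpar _ (h.lt i hi) (by rw [h.dep_eq i hi]; exact hd)
      obtain ⟨w, hw⟩ := hpar _ (h.lt j hj) (by rw [h.dep_eq j hj]; exact hd)
      rw [← hup hi u hu, ← hup hj w hw]
      exact h3 u w hu hw
  · rintro ⟨h1, h2⟩
    refine ⟨h2, by rw [h.dep_eq i hi, h.dep_eq j hj], fun u w hu hw => ?_⟩
    rw [hup hi u hu, hup hj w hw, h1]

theorem KeyFile.injective (h : KeyFile N dep lab cl d n c0 z)
    (hpar : ∀ v < N, dep v ≠ 0 → ∃ u, IsParent dep u v) {i j : ℕ} (hij : i < j) (hj : j < n) :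
    z (3 * i + 2) ≠ z (3 * j + 2) := by
  intro heq
  have h1 : SameKey dep lab cl (z (3 * i + 2)) (z (3 * j + 2)) := by rw [heq]; exact SameKey.refl _
  rw [h.sameKey_iff hpar (fun _ _ => rfl) (by omega) hj] at h1
  have h2 := h.mono i j hij hj
  rw [recs, recs, heq, h1.1, h1.2] at h2
  exact lt_irrefl _ h2

/-- Two records with the same key have only records with that key between them. -/
theorem KeyFile.between (h : KeyFile N dep lab cl d n c0 z) {i k : ℕ} (hik : i < k) (hk : k < n)
    (h1 : z (3 * i) = z (3 * k)) (h2 : z (3 * i + 1) = z (3 * k + 1)) :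
    z (3 * (k - 1)) = z (3 * k) ∧ z (3 * (k - 1) + 1) = z (3 * k + 1) := by
  have ha := h.mono (k - 1) k (by omega) hk
  rcases (show i ≤ k - 1 by omega).lt_or_eq with hlt | rfl
  · have hb := h.mono i (k - 1) hlt (by omega)
    rw [recs, recs, mkRec_lt] at ha hb
    omega
  · exact ⟨h1, h2⟩

/-- The state of `scanLevel` after `k` records. -/
def ScanInv (P : VParams) (N : ℕ) (dep lab cl : ℕ → ℕ) (d : ℕ) (z : ℕ → ℕ) (y w w0 k : ℕ)
    (t : VState) : Prop :=
  ∃ cl' c' ne' lX lZ lE' lL' lG', t.reg 14 = c' ∧ t.reg 15 = ne' ∧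
      PartialIndex N dep lab cl' (t.file 5) (t.file 6) (t.file 7) (y + k) c' ne' ∧
      (∀ v, Listed (t.file 5) (y + k) v ↔ (v < N ∧ dep v < d) ∨ ∃ j < k, z (3 * j + 2) = v) ∧
      (∀ u, dep u < d → cl' u = cl u) ∧
      (∀ j < k, recs (t.file 2) j = mkRec (z (3 * j + 2)) (cl' (z (3 * j + 2))) 0) ∧
      (k ≠ 0 → t.reg 35 = z (3 * (k - 1)) ∧ t.reg 36 = z (3 * (k - 1) + 1) ∧
        cl' (z (3 * (k - 1) + 2)) + 1 = c') ∧
      t.tag 2 = some (2, lX) ∧ lX ≤ (k - 1) / P.b ∧ t.tag 3 = some (3, lZ) ∧ lZ ≤ (k - 1) / P.b ∧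
      t.tag 5 = some (5, lE') ∧ lE' ≤ 2 * (y + k) / (3 * P.b) ∧
      t.tag 6 = some (6, lL') ∧ lL' ≤ c' / (3 * P.b) ∧
      t.tag 7 = some (7, lG') ∧ lG' ≤ 2 * ne' / (3 * P.b) ∧
      t.cost + w ≤ w0 + lX + lZ + lE' + lL' + lG'

/-- The invariant of `scanLevel` is restored when the node of record `k` is put into the last class
`c1 - 1`, whether or not that class has just been opened. -/
theorem wp_listNode_scan {f5 f2 cl' : ℕ → ℕ} {c1 ne1 y k lX lE' lL1 lG1 w w0 : ℕ} (hP : Fits P)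
    (hpar : ∀ v < N, dep v ≠ 0 → ∃ u, IsParent dep u v) (hN : 3 * N + 3 ≤ P.cap) (hyn : y + n ≤ N)
    (hk : k < n) (hZ : KeyFile N dep lab cl d n c0 z)
    (hLt : ∀ v, Listed f5 (y + k) v ↔ (v < N ∧ dep v < d) ∨ ∃ j < k, z (3 * j + 2) = v)
    (hclt : ∀ u, dep u < d → cl' u = cl u)
    (hXt : ∀ j < k, recs f2 j = mkRec (z (3 * j + 2)) (cl' (z (3 * j + 2))) 0)
    (hlX' : lX ≤ k / P.b) (hlE' : lE' ≤ 2 * (y + k) / (3 * P.b))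
    (hdu : s.TagsDistinct) (h14u : s.reg 14 = c1) (h15u : s.reg 15 = ne1) (h10u : s.reg 10 = y)
    (h34u : s.reg 34 = k) (h22u : s.reg 22 = z (3 * k + 2)) (h35u : s.reg 35 = z (3 * k))
    (h36u : s.reg 36 = z (3 * k + 1)) (hc1 : 1 ≤ c1) (hc1' : c1 ≤ y + k + 1) (hf5u : s.file 5 = f5)
    (hf2u : s.file 2 = f2)
    (hadd : ∀ E', (∀ i < 2 * (y + k), E' i = f5 i) → E' (2 * (y + k)) = z (3 * k + 2) →
      E' (2 * (y + k) + 1) = c1 - 1 → PartialIndex N dep lab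
        (Function.update cl' (z (3 * k + 2)) (c1 - 1)) E' (s.file 6) (s.file 7) (y + k + 1) c1 ne1)
    (hu2 : s.tag 2 = some (2, lX)) (hu3 : s.tag 3 = some (3, k / P.b))
        (hu5 : s.tag 5 = some (5, lE'))
    (hu6 : s.tag 6 = some (6, lL1)) (hlL1 : lL1 ≤ c1 / (3 * P.b)) (hu7 : s.tag 7 = some (7, lG1))
    (hlG1 : lG1 ≤ 2 * ne1 / (3 * P.b))
    (hcu : s.cost + w ≤ w0 + lX + k / P.b + lE' + lL1 + lG1) :
    wp P listNode (fun t => t.reg 34 = k ∧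
      ScanInv P N dep lab cl d z y w w0 (k + 1) (t.setReg 34 (k + 1))) s := by
  have hcap := hP.cap_lt
  have hvN := hZ.lt k hk
  have hvd := hZ.dep_eq k hk
  refine wp_listNode (c := c1) (y := y) (k := k) (lE := lE') (lX := lX) hP hdu h14u h10u h34u
    (by omega) (by omega) hu5 hlE' hu2 hlX' ?_
  intro t lE1 hFw hf5w hf2w hw5 hlE1 hw2 hcw
  rw [h22u] at hf5w hf2w
  rw [hf5u] at hf5w
  rw [hf2u] at hf2w
  have hE0 : t.file 5 (2 * (y + k)) = z (3 * k + 2) := by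
    rw [hf5w, Function.update_of_ne (by omega), Function.update_self]
  have hE1 : t.file 5 (2 * (y + k) + 1) = c1 - 1 := by rw [hf5w, Function.update_self]
  have hE : ∀ i < 2 * (y + k), t.file 5 i = f5 i := fun i hi => by
    rw [hf5w, Function.update_of_ne (by omega), Function.update_of_ne (by omega)]
  have hPI := hadd (t.file 5) hE hE0 hE1
  refine ⟨by rw [hFw.reg 34 rfl, h34u], Function.update cl' (z (3 * k + 2)) (c1 - 1), c1, ne1,
      k / P.b,
    k / P.b, lE1, lL1, lG1, by simp [hFw.reg 14 rfl, h14u], by simp [hFw.reg 15 rfl, h15u], ?_, ?_,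
    ?_, ?_, ?_, hw2, le_rfl, hFw.tag 3 (by omega) rfl _ hu3, le_rfl, hw5, hlE1,
    hFw.tag 6 (by omega) rfl _ hu6, hlL1, hFw.tag 7 (by omega) rfl _ hu7, hlG1, ?_⟩
  · rw [setReg_file, hFw.file 6 rfl, hFw.file 7 rfl]
    exact hPI
  · intro v
    rw [setReg_file, ← add_assoc, listed_succ hE hE0, hLt]
    constructor
    · rintro ((h | ⟨j, hj, h⟩) | rfl)
      · exact Or.inl h
      · exact Or.inr ⟨j, by omega, h⟩
      · exact Or.inr ⟨k, by omega, rfl⟩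
    · rintro (h | ⟨j, hj, h⟩)
      · exact Or.inl (Or.inl h)
      · rcases Nat.lt_succ_iff_lt_or_eq.mp hj with hj | rfl
        · exact Or.inl (Or.inr ⟨j, hj, h⟩)
        · exact Or.inr h.symm
  · intro v hv
    rw [Function.update_of_ne (by rintro rfl; omega)]
    exact hclt v hv
  · intro j hj
    rw [setReg_file, hf2w]
    rcases Nat.lt_succ_iff_lt_or_eq.mp hj with hj | rfl
    · rw [Function.update_of_ne (by omega), Function.update_of_ne (hZ.injective hpar hj hk)]
      exact hXt j hj
    · rw [Function.update_self, Function.update_self]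
  · intro _
    rw [Nat.add_sub_cancel, Function.update_self]
    exact ⟨by simp [hFw.reg 35 rfl, h35u], by simp [hFw.reg 36 rfl, h36u], by omega⟩
  · rw [setReg_cost]; omega

/-- Nodes of the same class are adjacent in the sorted file, so a new class is opened exactly where
the key changes. All files are scanned forward only. -/
theorem wp_scanLevel {y c ne lE lL lG : ℕ} (hP : Fits P) (hd : s.TagsDistinct)
    (hpar : ∀ v < N, dep v ≠ 0 → ∃ u, IsParent dep u v)
    (h10 : s.reg 10 = y) (h12 : s.reg 12 = d) (h13 : s.reg 13 = n) (h14 : s.reg 14 = c)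
    (h15 : s.reg 15 = ne) (hN : 3 * N + 3 ≤ P.cap) (hyn : y + n ≤ N)
    (hZ : KeyFile N dep lab cl d n c0 (s.file 3))
    (hI : PartialIndex N dep lab cl (s.file 5) (s.file 6) (s.file 7) y c ne)
    (hL : ∀ v, Listed (s.file 5) y v ↔ v < N ∧ dep v < d)
    (h2 : s.tag 2 = some (2, 0)) (h3 : s.tag 3 = some (3, 0))
    (h5 : s.tag 5 = some (5, lE)) (hlE : lE ≤ 2 * y / (3 * P.b))
    (h6 : s.tag 6 = some (6, lL)) (hlL : lL ≤ c / (3 * P.b))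
    (h7 : s.tag 7 = some (7, lG)) (hlG : lG ≤ 2 * ne / (3 * P.b))
    (hQ : ∀ t cl' c' ne' lX lZ lE' lL' lG', Frame scanLevel s t → t.reg 14 = c' → t.reg 15 = ne' →
      PartialIndex N dep lab cl' (t.file 5) (t.file 6) (t.file 7) (y + n) c' ne' →
      (∀ v, Listed (t.file 5) (y + n) v ↔ v < N ∧ dep v < d + 1) →
      (∀ k < n, recs (t.file 2) k = mkRec (s.file 3 (3 * k + 2)) (cl' (s.file 3 (3 * k + 2))) 0) →
      t.tag 2 = some (2, lX) → lX ≤ (n - 1) / P.b → t.tag 3 = some (3, lZ) → lZ ≤ (n - 1) / P.b →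
      t.tag 5 = some (5, lE') → lE' ≤ 2 * (y + n) / (3 * P.b) →
      t.tag 6 = some (6, lL') → lL' ≤ c' / (3 * P.b) →
      t.tag 7 = some (7, lG') → lG' ≤ 2 * ne' / (3 * P.b) →
      t.cost + lE + lL + lG ≤ s.cost + lX + lZ + lE' + lL' + lG' → Q t) :
    wp P scanLevel Q s := by
  have hcap := hP.cap_lt
  have hS := hP.S_ge
  set z := s.file 3 with hz
  refine wp_for_frame n (fun k t => ScanInv P N dep lab cl d z y (lE + lL + lG) s.cost k t)
      (by omega) ?_ ?_ ?_ ?_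
  · refine ⟨cl, c, ne, 0, 0, lE, lL, lG, by simp [h14], by simp [h15], hI, ?_, fun _ _ => rfl,
      fun j hj => absurd hj (by omega), fun h => absurd rfl h, h2, Nat.zero_le _, h3, Nat.zero_le _,
      h5, hlE, h6, hlL, h7, hlG, by simp; omega⟩
    intro v
    rw [add_zero, setReg_file, hL]
    exact ⟨Or.inl, fun h => h.resolve_right fun ⟨j, hj, _⟩ => absurd hj (by omega)⟩
  · intro k t _ _ _ hF
    simp [hF.reg 13 rfl, h13]
  · rintro k t hk h34 ⟨cl', c', ne', lX, lZ, lE', lL', lG', h14t, h15t, hIt, hLt, hclt, hXt, hprev,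
        ht2, hlX,
      ht3, hlZ, ht5, hlE', ht6, hlL', ht7, hlG', hcost⟩ hF
    have hdt := hF.distinct hd
    have h10t : t.reg 10 = y := by rw [hF.reg 10 rfl, h10]
    have h12t : t.reg 12 = d := by rw [hF.reg 12 rfl, h12]
    have hf3 : t.file 3 = z := hF.file 3 rfl
    have hcle := hIt.c_le
    have hnle := hIt.ne_le
    have hlZ' : lZ ≤ k / P.b := hlZ.trans (Nat.div_le_div_right (by omega))
    have hlX' : lX ≤ k / P.b := hlX.trans (Nat.div_le_div_right (by omega))
    have hvN := hZ.lt k hk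
    have hvd := hZ.dep_eq k hk
    have hnew : ¬ Listed (t.file 5) (y + k) (z (3 * k + 2)) := by
      rw [hLt]
      rintro (⟨-, h⟩ | ⟨j, hj, h⟩)
      · omega
      · exact hZ.injective hpar hj hk h
    have hclosed : ∀ u, IsParent dep u (z (3 * k + 2)) → Listed (t.file 5) (y + k) u := by
      intro u hu
      have h1 := hu.1
      have h2 := hu.2.1
      exact (hLt u).mpr (Or.inl ⟨by omega, by omega⟩)
    refine wp_seq (wp_getRec 3 k hdt (fun _ _ => rfl) (fun r hr => by simp [hr, h34]) (by omega)
      (by omega) (by omega) ?_)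
    rw [hf3]
    have hct := touch_cost_forward ht3 hlZ'
    have ht3' := touch_tag_self t 3 3 (k / P.b)
    have ht2' : (t.touch 3 3 (k / P.b)).tag 2 = some (2, lX) :=
      touch_tag_of_ne ht2 (by omega) (Or.inl (by omega))
    have ht5' : (t.touch 3 3 (k / P.b)).tag 5 = some (5, lE') :=
      touch_tag_of_ne ht5 (by omega) (Or.inl (by omega))
    have ht6' : (t.touch 3 3 (k / P.b)).tag 6 = some (6, lL') :=
      touch_tag_of_ne ht6 (by omega) (Or.inl (by omega))
    have ht7' : (t.touch 3 3 (k / P.b)).tag 7 = some (7, lG') :=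
      touch_tag_of_ne ht7 (by omega) (Or.inl (by omega))
    have hd' : (t.touch 3 3 (k / P.b)).TagsDistinct := hdt.touch _ _ _
    have hfile' : (t.touch 3 3 (k / P.b)).file = t.file := rfl
    have hreg' : (t.touch 3 3 (k / P.b)).reg = t.reg := rfl
    generalize t.touch 3 3 (k / P.b) = t1 at *
    have finish := fun u c1 ne1 lL1 lG1 => wp_listNode_scan (s := u) (c1 := c1) (ne1 := ne1)
        (lL1 := lL1)
      (lG1 := lG1) (w := lE + lL + lG) (w0 := s.cost) hP hpar hN hyn hk hZ hLt hclt hXt hlX' hlE'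
    refine wp_seq (wp_ite (fun hc => ?_) (fun hc => ?_))
    · -- the key differs from all those before it
      have hne : k = 0 ∨ ¬ (z (3 * (k - 1)) = z (3 * k) ∧ z (3 * (k - 1) + 1) = z (3 * k + 1)) := by
        by_cases hk0 : k = 0
        · exact Or.inl hk0
        · right
          rintro ⟨e1, e2⟩
          obtain ⟨r1, r2, -⟩ := hprev hk0
          apply hc
          simp [setRegs_reg, hreg', h34, r1, r2, e1, e2, hk0]
      refine wp_newClass (c := c') (ne := ne') (d := d) (lL := lL') (lG := lG') hP (by exact hd')
        (by simp [setRegs_reg, hreg', h14t]) (by simp [setRegs_reg, hreg', h15t])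
        (by simp [setRegs_reg, hreg', h12t]) (by omega) (by omega) ht6' hlL' ht7' hlG' ?_
      intro u ne1 lL1 lG1 hFu h14u h15u h35u h36u hf6u hf7u hcaseu hu6 hlL1 hu7 hlG1 hcu
      refine finish u (c' + 1) ne1 lL1 lG1 (hFu.distinct (by exact hd')) h14u h15u ?_ ?_ ?_ ?_ ?_
        (by omega) (by omega) ?_ ?_ ?_ (hFu.tag 2 (by omega) rfl _ ht2')
        (hFu.tag 3 (by omega) rfl _ ht3') (hFu.tag 5 (by omega) rfl _ ht5') hu6 hlL1 hu7 hlG1 ?_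
      · rw [hFu.reg 10 rfl]; simp [setRegs_reg, hreg', h10t]
      · rw [hFu.reg 34 rfl]; simp [setRegs_reg, hreg', h34]
      · rw [hFu.reg 22 rfl]; simp [setRegs_reg]
      · rw [h35u]; simp [setRegs_reg]
      · rw [h36u]; simp [setRegs_reg]
      · rw [hFu.file 5 rfl]; simp [hfile']
      · rw [hFu.file 2 rfl]; simp [hfile']
      · intro E' hE hE0 hE1
        refine hIt.add hpar hvN hnew hclosed hE hE0 hE1 (fun i hi => ?_) (fun i hi => ?_)
          (Or.inr ⟨fun w hw => ?_, by omega, rfl, ?_, ?_⟩)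
        · rw [hf6u, Function.update_of_ne (by omega)]; simp [hfile']
        · rw [hf7u i hi]; simp [hfile']
        · rcases (hLt w).mp hw with ⟨-, h⟩ | ⟨j, hj, rfl⟩
          · intro hs
            have := hs.2.1
            omega
          · rw [hZ.sameKey_iff hpar hclt (by omega) hk]
            rintro ⟨e1, e2⟩
            rcases hne with h | h
            · omega
            · exact h (hZ.between hj hk e1 e2)
        · rw [hf6u, Function.update_self, ← hZ.lab_eq k hk]
          simp [setRegs_reg]
        · rw [hvd]
          refine hcaseu.imp id fun ⟨g1, g2, g3, g4⟩ => ⟨g1, g2, fun w hw => ?_, g4⟩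
          rw [g3, hclt w (by have := hw.2.1; omega), ← hZ.parent k hk w hw]
          simp [setRegs_reg]
      · simp only [setRegs_cost] at hcu
        omega
    · -- the key is the same as that of the preceding record
      simp only [VExpr.eval_add, Nat.add_eq_zero_iff, VExpr.eval_eq, VExpr.eval_var,
        VExpr.eval_ofNat, VExpr.eval_sub, VExpr.eval_mul, setRegs_reg, hreg', h34] at hc
      have hk0 : k ≠ 0 := by
        rintro rfl
        simp at hc
      obtain ⟨r1, r2, r3⟩ := hprev hk0
      have heq : z (3 * (k - 1)) = z (3 * k) ∧ z (3 * (k - 1) + 1) = z (3 * k + 1) := by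
        have := hc.2
        simp [r1, r2] at this
        split_ifs at this <;> simp_all
      refine finish (t1.setRegs 20 (z (3 * k)) (z (3 * k + 1)) (z (3 * k + 2))) c' ne' lL' lG' hd'
        (by simp [setRegs_reg, hreg', h14t]) (by simp [setRegs_reg, hreg', h15t])
        (by simp [setRegs_reg, hreg', h10t]) (by simp [setRegs_reg, hreg', h34])
        (by simp [setRegs_reg]) (by simp [setRegs_reg, hreg', r1, heq.1])
        (by simp [setRegs_reg, hreg', r2, heq.2]) (by omega) (by omega) (by simp [hfile'])
        (by simp [hfile']) ?_ ht2' ht3' ht5' ht6' hlL' ht7' hlG' ?_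
      · intro E' hE hE0 hE1
        refine hIt.add hpar hvN hnew hclosed hE hE0 hE1 (fun i hi => by simp [hfile'])
          (fun i hi => by simp [hfile']) (Or.inl ⟨z (3 * (k - 1) + 2), (hLt _).mpr
            (Or.inr ⟨k - 1, by omega, rfl⟩), ?_, by omega, by omega, rfl, rfl⟩)
        exact (hZ.sameKey_iff hpar hclt (by omega) hk).mpr heq
      · simp only [setRegs_cost]
        omega
  · rintro t h34 ⟨cl', c', ne', lX, lZ, lE', lL', lG', h14t, h15t, hIt, hLt, hclt, hXt, hprev, ht2,
        hlX,
      ht3, hlZ, ht5, hlE', ht6, hlL', ht7, hlG', hcost⟩ hF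
    refine hQ t cl' c' ne' lX lZ lE' lL' lG' hF h14t h15t hIt (fun v => ?_)
        hXt ht2 hlX ht3 hlZ ht5 hlE'
      ht6 hlL' ht7 hlG' (by omega)
    rw [hLt]
    constructor
    · rintro (⟨h1, h2⟩ | ⟨j, hj, rfl⟩)
      · exact ⟨h1, by omega⟩
      · exact ⟨hZ.lt j hj, by rw [hZ.dep_eq j hj]; omega⟩
    · rintro ⟨h1, h2⟩
      rcases Nat.lt_succ_iff_lt_or_eq.mp h2 with h | h
      · exact Or.inl ⟨h1, h⟩
      · exact Or.inr (hZ.exists_index v h1 h)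

end

end ExtMem

namespace ExtMem

open VState VProg

/-! ### Processing a level -/

namespace VProg

/-- Fetch the first line of file `f`. -/
def rewind (f : ℕ) : VProg := .get 30 f none 0

/-- Process the nodes of depth `var 12`. -/
def level : VProg :=
  .seq buildLevel (.seq (rewind 3) (.seq (rewind 2) (.seq (.assign 40 (.var 13)) (.seq (sort 3)
    (.seq scanLevel (.seq (rewind 3) (.seq (rewind 2) (.seq (sort 2)
      (.seq (.assign 10 (.var 10 + .var 13)) (.seq (.assign 11 (.var 13))
        (.assign 12 (.var 12 + 1))))))))))))

end VProg

theorem seg_ne_of_ne {g g' : ℕ → Rec} {n : ℕ} (h : seg g n = seg g' n)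
    (hne : ∀ i j, i < j → j < n → g' i ≠ g' j) : ∀ i j, i < j → j < n → g i ≠ g j := by
  have hnd : (seg g' n).Nodup := by
    refine (Multiset.nodup_range n).map_on fun i hi j hj hij => ?_
    rw [Multiset.mem_range] at hi hj
    rcases lt_trichotomy i j with hlt | heq | hlt
    · exact absurd hij (hne i j hlt hj)
    · exact heq
    · exact absurd hij.symm (hne j i hlt hi)
  rw [← h] at hnd
  intro i j hij hj heq
  have := Multiset.inj_on_of_nodup_map hnd i (by simp; omega) j (by simpa using hj) heq
  omega

section

variable {P : VParams} {Q : VState → Prop} {s : VState}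
variable {N : ℕ} {dep lab ord : ℕ → ℕ} {K e : ℕ}

/-- The number of the current line pays for going back to the first line: there is nothing to pay if
this is line `0`. -/
theorem wp_rewind {f l : ℕ} (hP : Fits P) (hf : f < 8) (hcap : 0 < P.cap)
    (h : s.tag f = some (f, l))
    (hQ : ∀ t, Frame (rewind f) s t → t.file = s.file → t.tag f = some (f, 0) →
      t.cost ≤ s.cost + l → Q t) : wp P (rewind f) Q s := by
  have hS := hP.S_ge
  suffices h : wp P (rewind f) (fun t => t.file = s.file ∧ t.tag f = some (f, 0) ∧
      t.cost ≤ s.cost + l) s from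
    wp_conseq h fun t ⟨h1, h2, h3⟩ hF => hQ t hF h1 h2 h3
  refine wp_get f 0 rfl rfl hf (by omega) hcap ?_
  rw [Nat.zero_div]
  refine ⟨rfl, by simp, ?_⟩
  rw [setReg_cost, touch_cost, h]
  split_ifs with h'
  · omega
  · have : l ≠ 0 := by rintro rfl; exact h' rfl
    omega

/-- The configuration before the nodes of depth `d` are processed: the first `y` nodes, in the order
of their depths, have got their classes, and `m` of them have depth `d - 1`. The last condition
bounds the cost since the cost was `w`; the term `2 * (m / P.b)` is set aside for the scan of the
`m` nodes in file `2` that is still to come, and for the way back. -/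
def LevelInv (P : VParams) (N : ℕ) (dep lab ord : ℕ → ℕ) (K e w d m y : ℕ) (t : VState) : Prop :=
  ∃ cl c ne lY lE lL lG, t.reg 0 = P.b ∧ t.reg 1 = K ∧ t.reg 3 = N ∧ t.TagsDistinct ∧
    Ordered N dep lab ord (recs (t.file 1)) ∧
    t.reg 10 = y ∧ t.reg 11 = m ∧ t.reg 12 = d ∧ t.reg 14 = c ∧ t.reg 15 = ne ∧
    LevelStart N dep ord d y ∧ m ≤ y ∧ d ≤ y ∧
    PartialIndex N dep lab cl (t.file 5) (t.file 6) (t.file 7) y c ne ∧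
    (∀ v, Listed (t.file 5) y v ↔ v < N ∧ dep v < d) ∧
    LevelFile N dep cl d m (recs (t.file 2)) ∧
    t.tag 1 = some (1, lY) ∧ lY ≤ y / P.b ∧ t.tag 2 = some (2, 0) ∧ t.tag 3 = some (3, 0) ∧
    t.tag 5 = some (5, lE) ∧ lE ≤ 2 * y / (3 * P.b) ∧
    t.tag 6 = some (6, lL) ∧ lL ≤ c / (3 * P.b) ∧
    t.tag 7 = some (7, lG) ∧ lG ≤ 2 * ne / (3 * P.b) ∧
    t.cost + 2 * (m / P.b) ≤ w + lY + lE + lL + lG + y / P.b * (20 * e + 12)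

variable {w d m y : ℕ}

/-- All depths below that of a node occur. -/
theorem exists_depth_eq (hpar : ∀ v < N, dep v ≠ 0 → ∃ u, IsParent dep u v) {v : ℕ} (hv : v < N)
    (hd : d ≤ dep v) : ∃ u < N, dep u = d := by
  induction v using Nat.strong_induction_on with
  | _ v ih =>
    rcases hd.lt_or_eq with hlt | heq
    · obtain ⟨u, hu⟩ := hpar v hv (by omega)
      have h1 := hu.1
      have h2 := hu.2.1
      exact ih u h1 (by omega) (by omega)
    · exact ⟨v, hv, heq.symm⟩

section ordered

variable {g : ℕ → Rec}

theorem Ordered.dep_mono (hY : Ordered N dep lab ord g) {i j : ℕ} (hij : i ≤ j) (hj : j < N) :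
    dep (ord i) ≤ dep (ord j) := by
  rcases hij.lt_or_eq with hij | rfl
  · have := hY.mono i j hij hj
    rw [hY.rec_eq i (by omega), hY.rec_eq j hj, mkRec_lt] at this
    omega
  · exact le_rfl

theorem Ordered.ord_ne (hY : Ordered N dep lab ord g) {i j : ℕ} (hij : i < j) (hj : j < N) :
    ord i ≠ ord j := by
  intro h
  have := hY.mono i j hij hj
  rw [hY.rec_eq i (by omega), hY.rec_eq j hj, h] at this
  exact lt_irrefl _ this

theorem LevelStart.next {n : ℕ} (hY : Ordered N dep lab ord g)
    (h : LevelStart N dep ord d y) (hyn : y + n ≤ N)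
    (hlev : ∀ i, y ≤ i → i < y + n → dep (ord i) = d) (hupto : y + n < N → dep (ord (y + n)) ≠ d) :
    LevelStart N dep ord (d + 1) (y + n) := by
  refine ⟨hyn, fun i hi => ?_⟩
  constructor
  · intro hd
    by_contra hcon
    have h1 := hY.dep_mono (not_lt.mp hcon) hi
    have h2 := (h.2 (y + n) (by omega)).not.mpr (by omega)
    exact hupto (by omega) (by omega)
  · intro hin
    by_cases hiy : i < y
    · have := (h.2 i hi).mpr hiy
      omega
    · rw [hlev i (not_lt.mp hiy) hin]
      omega

theorem LevelStart.pos {n : ℕ} (hY : Ordered N dep lab ord g)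
    (h : LevelStart N dep ord d y)
    (hpar : ∀ v < N, dep v ≠ 0 → ∃ u, IsParent dep u v) (hy : y < N)
    (hupto : y + n < N → dep (ord (y + n)) ≠ d) : 0 < n := by
  by_contra hcon
  obtain rfl : n = 0 := by omega
  have h1 := (h.2 y hy).not.mpr (lt_irrefl _)
  obtain ⟨u, hu, hdu⟩ := exists_depth_eq (d := d) hpar (hY.lt y hy) (by omega)
  obtain ⟨i, hi, rfl⟩ := hY.surj u hu
  have h2 := (h.2 i hi).not.mp (by omega)
  have h3 := hY.dep_mono (show y ≤ i by omega) hi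
  exact hupto hy (by rw [add_zero]; omega)

/-- Sorting preserves the set of the records, so that the sorted file contains the keys of exactly
the nodes of the level. -/
theorem KeyFile.of_sorted {cl : ℕ → ℕ} {n c0 : ℕ} {f z : ℕ → ℕ} (hY : Ordered N dep lab ord g)
    (h : LevelStart N dep ord d y) (hyn : y + n ≤ N)
    (hlev : ∀ i, y ≤ i → i < y + n → dep (ord i) = d) (hupto : y + n < N → dep (ord (y + n)) ≠ d)
    (hZ : ∀ k < n, ∃ p, recs f k = mkRec p (lab (ord (y + k))) (ord (y + k)) ∧
        (∀ u, IsParent dep u (ord (y + k)) → p = cl u) ∧ (d = 0 → p = c0))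
    (hseg : seg (recs z) n = seg (recs f) n)
    (hsorted : ∀ i j, i < j → j < n → recs z i ≤ recs z j) :
    KeyFile N dep lab cl d n c0 z := by
  have hz : ∀ k < n, ∃ i < n, z (3 * k + 2) = ord (y + i) ∧ z (3 * k + 1) = lab (ord (y + i)) ∧
      (∀ u, IsParent dep u (ord (y + i)) → z (3 * k) = cl u) ∧ (d = 0 → z (3 * k) = c0) := by
    intro k hk
    have : recs z k ∈ seg (recs f) n := hseg ▸ mem_seg.mpr ⟨k, hk, rfl⟩
    obtain ⟨i, hi, hik⟩ := mem_seg.mp this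
    obtain ⟨p, hp, hpu, hp0⟩ := hZ i hi
    rw [hp, recs, mkRec_inj] at hik
    exact ⟨i, hi, hik.2.2.symm, hik.2.1.symm, fun u hu => hik.1 ▸ hpu u hu, fun h => hik.1 ▸ hp0 h⟩
  constructor
  · intro k hk
    obtain ⟨i, hi, h1, -⟩ := hz k hk
    rw [h1]; exact hY.lt _ (by omega)
  · intro k hk
    obtain ⟨i, hi, h1, -⟩ := hz k hk
    rw [h1]; exact hlev _ (by omega) (by omega)
  · intro k hk
    obtain ⟨i, hi, h1, h2, -⟩ := hz k hk
    rw [h1, h2]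
  · intro k hk u hu
    obtain ⟨i, hi, h1, h2, h3, -⟩ := hz k hk
    rw [h1] at hu
    exact h3 u hu
  · intro k hk h0
    obtain ⟨i, hi, h1, h2, h3, h4⟩ := hz k hk
    exact h4 h0
  · intro v hv hdv
    obtain ⟨i, hi, rfl⟩ := hY.surj v hv
    have hi1 : y ≤ i := by
      have := (h.2 i hi).not.mp (by omega)
      omega
    have hi2 : i < y + n := ((h.next hY hyn hlev hupto).2 i hi).mp (by omega)
    have hmem : recs f (i - y) ∈ seg (recs z) n := hseg ▸ mem_seg.mpr ⟨i - y, by omega, rfl⟩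
    obtain ⟨k, hk, hki⟩ := mem_seg.mp hmem
    obtain ⟨p, hp, -⟩ := hZ (i - y) (by omega)
    rw [hp, recs, mkRec_inj, Nat.add_sub_cancel' hi1] at hki
    exact ⟨k, hk, hki.2.2⟩
  · intro i j hij hj
    refine lt_of_le_of_ne (hsorted i j hij hj)
        (seg_ne_of_ne hseg (fun i j hij hj heq => ?_) i j hij hj)
    obtain ⟨p, hp, -⟩ := hZ i (by omega)
    obtain ⟨q, hq, -⟩ := hZ j hj
    rw [hp, hq, mkRec_inj] at heq
    exact hY.ord_ne (show y + i < y + j by omega) (by omega) heq.2.2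

end ordered

/-- Sorted by its first component, the list of the nodes of a level serves as the level above in the
next round. -/
theorem LevelFile.of_sorted {cl : ℕ → ℕ} {n c0 : ℕ} {g z : ℕ → ℕ} {h : ℕ → Rec}
    (hZ : KeyFile N dep lab cl d n c0 z) {cl' : ℕ → ℕ}
    (hX : ∀ k < n, h k = mkRec (z (3 * k + 2)) (cl' (z (3 * k + 2))) 0)
    (hseg : seg (recs g) n = seg h n)
    (hsorted : ∀ i j, i < j → j < n → recs g i ≤ recs g j) :
    LevelFile N dep cl' (d + 1) n (recs g) := by
  refine ⟨fun k hk => ?_, fun v hv hdv => ?_, hsorted⟩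
  · have : recs g k ∈ seg h n := hseg ▸ mem_seg.mpr ⟨k, hk, rfl⟩
    obtain ⟨i, hi, hik⟩ := mem_seg.mp this
    exact ⟨_, hZ.lt i hi, by rw [hZ.dep_eq i hi], by rw [← hik, hX i hi]⟩
  · obtain ⟨i, hi, rfl⟩ := hZ.exists_index v hv (by omega)
    have : h i ∈ seg (recs g) n := hseg ▸ mem_seg.mpr ⟨i, hi, rfl⟩
    obtain ⟨k, hk, hki⟩ := mem_seg.mp this
    exact ⟨k, hk, by rw [hki, hX i hi]⟩

/-- Processing a level of `n` nodes costs a multiple of `n / b`, rounded down, apart from the lines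
passed in the files that are scanned once in the whole computation. Rounding down matters, since the
number of levels may be as large as the number of nodes. -/
theorem wp_level (hP : Fits P) (hK : 2 ≤ K) (hKS : 8 + K ≤ P.S)
    (hpar : ∀ v < N, dep v ≠ 0 → ∃ u, IsParent dep u v) (hN : 3 * N + 3 ≤ P.cap)
    (he : N ≤ P.b * K ^ e) (hy : y < N) (hI : LevelInv P N dep lab ord K e w d m y s) :
    wp P level (fun t => ∃ n, 0 < n ∧ LevelInv P N dep lab ord K e w (d + 1) n (y + n) t) s := by
  obtain ⟨cl, c, ne, lY, lE, lL, lG, h0, h1, h3, hd, hY, h10, h11, h12, h14, h15, hst, hmy, hdy,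
      hPI, hli,
    hX, ht1, hlY, ht2, ht3, ht5, hlE, ht6, hlL, ht7, hlG, hcost⟩ := hI
  have hcap := hP.cap_lt
  have hc0 : 0 < P.cap := by omega
  refine wp_seq (wp_buildLevel hP hd h3 h10 h11 h12 hN (by omega) hY hy.le hX ht1 hlY ht2 ht3 ?_)
  intro s1 n c0 lY' lX lZ hF1 h13 hyn hlev hupto hZ1 ht11 hlY' ht12 hlX ht13 hlZ hcost1
  have hn := hst.pos hY hpar hy hupto
  refine wp_seq (wp_rewind hP (by omega) hc0 ht13 ?_)
  intro s2 hF2 hf2 ht23 hcost2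
  have ht22 := hF2.tag 2 (by omega) rfl _ ht12
  refine wp_seq (wp_rewind hP (by omega) hc0 ht22 ?_)
  intro s3 hF3 hf3 ht32 hcost3
  have ht33 := hF3.tag 3 (by omega) rfl _ ht23
  refine wp_seq (wp_assign_var ?_)
  -- the frame of the steps so far
  have hr3 : ∀ x, buildLevel.writes x = false → x ≠ 30 → s3.reg x = s.reg x := by
    intro x hx hx'
    rw [hF3.reg x (by simpa [rewind, VProg.writes] using hx'.symm),
      hF2.reg x (by simpa [rewind, VProg.writes] using hx'.symm), hF1.reg x hx]
  have h133 : s3.reg 13 = n := by rw [hF3.reg 13 rfl, hF2.reg 13 rfl, h13]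
  have hd3 : s3.TagsDistinct := hF3.distinct (hF2.distinct (hF1.distinct hd))
  rw [h133]
  refine wp_seq (wp_sort (n := n) (K := K) (e := e) hP (by omega) (by omega) (by exact hd3)
      (by simp [hr3 0 rfl, h0])
    (by simp [hr3 1 rfl, h1]) hK hKS (by simp) (by omega) (by omega) ht33 ?_)
  intro s4 hF4 ht43 hcost4 hseg4 hsort4
  have hr4 : ∀ x, (sort 3).writes x = false → x ≠ 40 → s4.reg x = s3.reg x := by
    intro x hx hx'
    rw [hF4.reg x hx, setReg_reg, Function.update_of_ne hx']
  have hKF : KeyFile N dep lab cl d n c0 (s4.file 3) := by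
    refine KeyFile.of_sorted hY hst hyn hlev hupto hZ1 ?_ hsort4
    rw [hseg4, setReg_file, hf3, hf2]
  have hf4 : ∀ f, f ≠ 3 → f ≠ 4 → s4.file f = s.file f := by
    intro f h3f h4f
    have h5 : (sort 3).changes f = false := by
      simp [sort, sortLines, exchange, mergePass, copyBack, mergeGroup, initGroup, findMin, emit,
          forTo,
        getRec, putRec, VProg.changes]
      omega
    have h6 : buildLevel.changes f = false := by
      simpa [buildLevel, buildRec, advance, getRec, putRec, VProg.changes] using Ne.symm h3f
    rw [hF4.file f h5, setReg_file, hf3, hf2, hF1.file f h6]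
  have htag4 : ∀ f l, f < 8 → 5 ≤ f → s.tag f = some (f, l) → s4.tag f = some (f, l) := by
    intro f l hf8 hf5 hl
    refine hF4.tag f hf8 ?_ l (hF3.tag f hf8 ?_ l (hF2.tag f hf8 ?_ l (hF1.tag f hf8 ?_ l hl))) <;>
    · simp [buildLevel, buildRec, advance, getRec, putRec, sort, sortLines, exchange, mergePass,
          copyBack,
        mergeGroup, initGroup, findMin, emit, forTo, rewind, VProg.uses]
      omega
  have ht42 : s4.tag 2 = some (2, 0) := hF4.tag 2 (by omega) rfl _ ht32
  have ht41 : s4.tag 1 = some (1, lY') := hF4.tag 1 (by omega) rfl _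
    (hF3.tag 1 (by omega) rfl _ (hF2.tag 1 (by omega) rfl _ ht11))
  refine wp_seq (wp_scanLevel (y := y) (c := c) (ne := ne) (lE := lE) (lL := lL) (lG := lG) hP
    (hF4.distinct (by exact hd3)) hpar ?_ ?_ ?_ ?_ ?_ hN hyn hKF ?_ ?_ ht42 ht43
    (htag4 5 _ (by omega) (by omega) ht5) hlE (htag4 6 _ (by omega) (by omega) ht6) hlL
    (htag4 7 _ (by omega) (by omega) ht7) hlG ?_)
  · rw [hr4 10 rfl (by omega), hr3 10 rfl (by omega), h10]
  · rw [hr4 12 rfl (by omega), hr3 12 rfl (by omega), h12]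
  · rw [hr4 13 rfl (by omega), h133]
  · rw [hr4 14 rfl (by omega), hr3 14 rfl (by omega), h14]
  · rw [hr4 15 rfl (by omega), hr3 15 rfl (by omega), h15]
  · rw [hf4 5 (by omega) (by omega), hf4 6 (by omega) (by omega), hf4 7 (by omega) (by omega)]
    exact hPI
  · rw [hf4 5 (by omega) (by omega)]
    exact hli
  intro s5 cl' c' ne' lX5 lZ5 lE' lL' lG' hF5 h145 h155 hPI5 hli5 hX5 ht52 hlX5 ht53 hlZ5 ht55 hlE'
      ht56
    hlL' ht57 hlG' hcost5
  refine wp_seq (wp_rewind hP (by omega) hc0 ht53 ?_)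
  intro s6 hF6 hf6 ht63 hcost6
  have ht62 := hF6.tag 2 (by omega) rfl _ ht52
  refine wp_seq (wp_rewind hP (by omega) hc0 ht62 ?_)
  intro s7 hF7 hf7 ht72 hcost7
  have hr7 : ∀ x, scanLevel.writes x = false → x ≠ 30 → s7.reg x = s4.reg x := by
    intro x hx hx'
    rw [hF7.reg x (by simpa [rewind, VProg.writes] using hx'.symm),
      hF6.reg x (by simpa [rewind, VProg.writes] using hx'.symm), hF5.reg x hx]
  have hd7 : s7.TagsDistinct :=
    hF7.distinct (hF6.distinct (hF5.distinct (hF4.distinct (by exact hd3))))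
  refine wp_seq (wp_sort (n := n) (K := K) (e := e) hP (by omega) (by omega)
      hd7 ?_ ?_ hK hKS ?_ (by omega) (by omega)
    ht72 ?_)
  · rw [hr7 0 rfl (by omega), hr4 0 rfl (by omega), hr3 0 rfl (by omega), h0]
  · rw [hr7 1 rfl (by omega), hr4 1 rfl (by omega), hr3 1 rfl (by omega), h1]
  · rw [hr7 40 rfl (by omega), hF4.reg 40 rfl]; simp
  intro s8 hF8 ht82 hcost8 hseg8 hsort8
  have hr8 : ∀ x, (sort 2).writes x = false → scanLevel.writes x = false → x ≠ 30 →
      s8.reg x = s4.reg x := fun x h1 h2 h3 => by rw [hF8.reg x h1, hr7 x h2 h3]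
  have hf8 : ∀ f, f ≠ 2 → f ≠ 4 → s8.file f = s5.file f := by
    intro f h3f h4f
    have h5 : (sort 2).changes f = false := by
      simp [sort, sortLines, exchange, mergePass, copyBack, mergeGroup, initGroup, findMin, emit,
          forTo,
        getRec, putRec, VProg.changes]
      omega
    rw [hF8.file f h5, hf7, hf6]
  have htag8 : ∀ f l, f < 8 → f ≠ 2 → f ≠ 3 → f ≠ 4 → s5.tag f = some (f, l) →
      s8.tag f = some (f, l) := by
    intro f l hf8 hf2 hf3 hf4 hl
    refine hF8.tag f hf8 ?_ l (hF7.tag f hf8 ?_ l (hF6.tag f hf8 ?_ l hl)) <;>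
    · simp [getRec, putRec, sort, sortLines, exchange, mergePass, copyBack,
        mergeGroup, initGroup, findMin, emit, forTo, rewind, VProg.uses]
      omega
  have h810 : s8.reg 10 = y := by
    rw [hr8 10 rfl rfl (by omega), hr4 10 rfl (by omega), hr3 10 rfl (by omega), h10]
  have h812 : s8.reg 12 = d := by
    rw [hr8 12 rfl rfl (by omega), hr4 12 rfl (by omega), hr3 12 rfl (by omega), h12]
  have h813 : s8.reg 13 = n := by
    rw [hr8 13 rfl rfl (by omega), hr4 13 rfl (by omega), h133]
  refine wp_seq (wp_assign (y + n) (by simp [h810, h813]) (by omega) ?_)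
  refine wp_seq (wp_assign_var (wp_assign (d + 1) (by simp [h812]) (by omega) ?_))
  have hst' := hst.next hY hyn hlev hupto
  refine ⟨n, hn, cl', c', ne', lY', lE', lL', lG', ?_, ?_, ?_, ?_, ?_, by simp, by simp [h813],
      by simp, ?_, ?_,
    hst', by omega, by omega, ?_, ?_, ?_, ?_, hlY', by simpa using ht82, ?_, ?_, hlE', ?_, hlL',
        ?_, hlG', ?_⟩
  · simp [hr8 0 rfl rfl (by omega), hr4 0 rfl (by omega), hr3 0 rfl (by omega), h0]
  · simp [hr8 1 rfl rfl (by omega), hr4 1 rfl (by omega), hr3 1 rfl (by omega), h1]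
  · simp [hr8 3 rfl rfl (by omega), hr4 3 rfl (by omega), hr3 3 rfl (by omega), h3]
  · exact hF8.distinct hd7
  · simp only [setReg_file]
    rw [hf8 1 (by omega) (by omega), hF5.file 1 rfl, hf4 1 (by omega) (by omega)]
    exact hY
  · simp [hF8.reg 14 rfl, hF7.reg 14 rfl, hF6.reg 14 rfl, h145]
  · simp [hF8.reg 15 rfl, hF7.reg 15 rfl, hF6.reg 15 rfl, h155]
  · simp only [setReg_file]
    rw [hf8 5 (by omega) (by omega), hf8 6 (by omega) (by omega), hf8 7 (by omega) (by omega)]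
    exact hPI5
  · simp only [setReg_file]
    rw [hf8 5 (by omega) (by omega)]
    exact hli5
  · simp only [setReg_file]
    refine LevelFile.of_sorted hKF hX5 ?_ hsort8
    rw [hseg8, hf7, hf6]
  · simp only [setReg_tag]
    exact htag8 1 _ (by omega) (by omega) (by omega) (by omega) (hF5.tag 1 (by omega) rfl _ ht41)
  · simp only [setReg_tag]
    exact hF8.tag 3 (by omega) rfl _ (hF7.tag 3 (by omega) rfl _ ht63)
  · simp only [setReg_tag]
    exact htag8 5 _ (by omega) (by omega) (by omega) (by omega) ht55
  · simp only [setReg_tag]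
    exact htag8 6 _ (by omega) (by omega) (by omega) (by omega) ht56
  · simp only [setReg_tag]
    exact htag8 7 _ (by omega) (by omega) (by omega) (by omega) ht57
  · simp only [setReg_cost] at hcost4 ⊢
    have hm1 : (m - 1) / P.b ≤ m / P.b := Nat.div_le_div_right (by omega)
    have hn1 : (n - 1) / P.b ≤ n / P.b := Nat.div_le_div_right (by omega)
    have hsum : y / P.b + n / P.b ≤ (y + n) / P.b := Nat.div_add_div_le_add_div
    have hmul := Nat.mul_le_mul_right (20 * e + 12) hsum
    have hexp : (y / P.b + n / P.b) * (20 * e + 12) =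
        y / P.b * (20 * e + 12) + (2 * (n / P.b * (10 * e + 2)) + 8 * (n / P.b)) := by ring
    omega

end

end ExtMem

namespace ExtMem

open VState VProg

/-! ### The computation of the 1-index -/

namespace VProg

/-- Compute the 1-index of the document of `var 3` nodes in file `0`: its three parts are written to
the files `5`, `6` and `7`; `var 14` and `var 15` become the numbers of classes and edges. -/
def index : VProg :=
  .seq parse (.seq (.assign 40 (.var 3)) (.seq (sort 1)
    (.seq (rewind 2) (.seq (rewind 3) (.seq (rewind 5) (.seq (rewind 6) (.seq (rewind 7)
      (.seq (.assign 10 0) (.seq (.assign 11 0) (.seq (.assign 12 0) (.seq (.assign 14 0)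
        (.seq (.assign 15 0) (.while (.lt (.var 10) (.var 3)) level)))))))))))))

end VProg

section

variable {P : VParams} {Q : VState → Prop} {s : VState}

theorem wp_fetch {f : ℕ} (hP : Fits P) (hf : f < 8) (hcap : 0 < P.cap)
    (hQ : ∀ t, Frame (rewind f) s t → t.tag f = some (f, 0) → t.cost ≤ s.cost + 1 → Q t) :
    wp P (rewind f) Q s := by
  have hS := hP.S_ge
  suffices h : wp P (rewind f) (fun t => t.tag f = some (f, 0) ∧ t.cost ≤ s.cost + 1) s from
    wp_conseq h fun t ⟨h1, h2⟩ hF => hQ t hF h1 h2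
  refine wp_get f 0 rfl rfl hf (by omega) hcap ?_
  rw [Nat.zero_div]
  exact ⟨by simp, touch_cost_le s f f 0⟩

theorem Ordered.of_sorted {N : ℕ} {dep lab : ℕ → ℕ} {g : ℕ → Rec} {h : ℕ → ℕ}
    (hg : ∀ i < N, g i = mkRec (dep i) i (lab i)) (hseg : seg (recs h) N = seg g N)
    (hsorted : ∀ i j, i < j → j < N → recs h i ≤ recs h j) :
    Ordered N dep lab (fun i => h (3 * i + 1)) (recs h) := by
  have key : ∀ i < N, ∃ v < N, recs h i = mkRec (dep v) v (lab v) := by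
    intro i hi
    have : recs h i ∈ seg g N := hseg ▸ mem_seg.mpr ⟨i, hi, rfl⟩
    obtain ⟨v, hv, hvi⟩ := mem_seg.mp this
    exact ⟨v, hv, by rw [← hvi, hg v hv]⟩
  refine ⟨fun i hi => ?_, fun i hi => ?_, fun v hv => ?_, fun i j hij hj => ?_⟩
  · obtain ⟨v, hv, hr⟩ := key i hi
    have hr' := hr
    rw [recs, mkRec_inj] at hr'
    rw [hr, hr'.2.1]
  · obtain ⟨v, hv, hr⟩ := key i hi
    rw [recs, mkRec_inj] at hr
    omega
  · have : g v ∈ seg (recs h) N := hseg ▸ mem_seg.mpr ⟨v, hv, rfl⟩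
    obtain ⟨i, hi, hr⟩ := mem_seg.mp this
    rw [hg v hv, recs, mkRec_inj] at hr
    exact ⟨i, hi, hr.2.1⟩
  · refine lt_of_le_of_ne (hsorted i j hij hj)
        (seg_ne_of_ne hseg (fun i j hij hj heq => ?_) i j hij hj)
    rw [hg i (by omega), hg j hj, mkRec_inj] at heq
    omega

theorem wp_levels {N : ℕ} {dep lab ord : ℕ → ℕ} {K e w : ℕ} (hP : Fits P) (hK : 2 ≤ K)
    (hKS : 8 + K ≤ P.S) (hpar : ∀ v < N, dep v ≠ 0 → ∃ u, IsParent dep u v)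
    (hN : 3 * N + 3 ≤ P.cap) (he : N ≤ P.b * K ^ e)
    (hI : LevelInv P N dep lab ord K e w 0 0 0 s)
    (hQ : ∀ t cl c ne, t.reg 14 = c → t.reg 15 = ne →
      PartialIndex N dep lab cl (t.file 5) (t.file 6) (t.file 7) N c ne →
      (∀ v < N, Listed (t.file 5) N v) → t.cost ≤ w + N / P.b * (20 * e + 16) → Q t) :
    wp P (.while (.lt (.var 10) (.var 3)) level) Q s := by
  have hb := hP.b_pos
  refine wp_while (fun k t => ∃ d m y, k = N - y ∧ LevelInv P N dep lab ord K e w d m y t) ?_ ?_ _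
    ⟨0, 0, 0, rfl, hI⟩
  · rintro _ t ⟨d, m, y, rfl, hIt⟩ hc
    have hy : y < N := by
      obtain ⟨cl, c, ne, lY, lE, lL, lG, -, -, h3, -, -, h10, -⟩ := hIt
      simpa [h3, h10] using hc
    refine wp_mono (p := level) (wp_level hP hK hKS hpar hN he hy hIt) ?_
    rintro u ⟨n, hn, hIu⟩
    exact ⟨N - (y + n), by omega, d + 1, n, y + n, rfl, hIu⟩
  · rintro _ t ⟨d, m, y, rfl, cl, c, ne, lY, lE, lL, lG, h0, h1, h3, hd, hY, h10, h11, h12, h14,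
        h15, hst, hmy,
      hdy, hPI, hli, hX, ht1, hlY, ht2, ht3, ht5, hlE, ht6, hlL, ht7, hlG, hcost⟩ hc
    have hy : ¬ y < N := by simpa [h3, h10] using hc
    obtain rfl : y = N := le_antisymm hst.1 (not_lt.mp hy)
    refine hQ t cl c ne h14 h15 hPI (fun v hv => ?_) ?_
    · obtain ⟨i, hi, rfl⟩ := hY.surj v hv
      exact (hli _).mpr ⟨hY.lt i hi, (hst.2 i hi).mpr hi⟩
    · have hle := hPI.c_le
      have hle' := hPI.ne_le
      have hthird : ∀ x, x ≤ 2 * y → x / (3 * P.b) ≤ y / P.b := by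
        intro x hx
        rw [← Nat.div_div_eq_div_mul]
        exact Nat.div_le_div_right (by omega)
      have h1 := hlE.trans (hthird _ (by omega))
      have h2 := hlL.trans (hthird _ (by omega))
      have h3 := hlG.trans (hthird _ (by omega))
      have : y / P.b * (20 * e + 16) = y / P.b * (20 * e + 12) + 4 * (y / P.b) := by ring
      omega

/-- The cost consists of a constant, a sorting of all nodes, and the sortings of the levels, which
together are not more expensive. -/
theorem wp_index (D : XMLDocument) {K e : ℕ} (hP : Fits P) (hK : 2 ≤ K) (hKS : 8 + K ≤ P.S)
    (hN : 3 * D.size + 3 ≤ P.cap) (he : D.size ≤ P.b * K ^ e) (hd : s.TagsDistinct)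
    (h0 : s.reg 0 = P.b) (h1 : s.reg 1 = K) (h2 : s.reg 2 = D.tags.length) (h3 : s.reg 3 = D.size)
    (hF : ∀ (i : ℕ) (hi : i < D.tags.length), s.file 0 i = D.tags[i])
    (hW : ∀ t ∈ D.tags, t < P.W)
    (hQ : ∀ t cl c ne, t.reg 14 = c → t.reg 15 = ne →
      PartialIndex D.size D.depth D.labelAt cl (t.file 5) (t.file 6) (t.file 7) D.size c ne →
      (∀ v < D.size, Listed (t.file 5) D.size v) →
      t.cost ≤ s.cost + 8 + D.size / P.b * (30 * e + 20) → Q t) :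
    wp P index Q s := by
  have hcap := hP.cap_lt
  have hc0 : 0 < P.cap := by omega
  refine wp_seq (wp_parse hP D.toForest h2 hF hW hN hd ?_)
  intro s1 hF1 h101 hrec1 ht11 hcost1
  refine wp_seq (wp_assign_var ?_)
  have hr1 : ∀ x, parse.writes x = false → s1.reg x = s.reg x := fun x hx => hF1.reg x hx
  refine wp_seq (wp_sort (n := D.size) (K := K) (e := e) hP (by omega) (by omega)
    (by exact hF1.distinct hd) (by simp [hr1 0 rfl, h0]) (by simp [hr1 1 rfl, h1]) hK hKS
    (by simp [hr1 3 rfl, h3]) hN he ht11 ?_)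
  intro s2 hF2 ht21 hcost2 hseg2 hsort2
  have hd2 : s2.TagsDistinct := hF2.distinct (hF1.distinct hd)
  have hr2 : ∀ x, (sort 1).writes x = false → x ≠ 40 → s2.reg x = s1.reg x := by
    intro x hx hx'
    rw [hF2.reg x hx, setReg_reg, Function.update_of_ne hx']
  have hY : Ordered D.size D.depth D.labelAt (fun i => s2.file 1 (3 * i + 1)) (recs (s2.file 1)) :=
      by
    refine Ordered.of_sorted (g := recs (s1.file 1)) (fun i hi => ?_) hseg2 hsort2
    have hlen : i < (D.toForest.nodes 0).length := by rw [XMLForest.length_nodes]; exact hi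
    have hlab : D.labelAt i = (D.toForest.nodes 0)[i].2 := by
      rw [XMLDocument.labelAt, XMLDocument.labels, ← XMLForest.map_snd_nodes D.toForest 0,
        List.getD_eq_getElem _ _ (by simpa using hlen), List.getElem_map]
    have hdep : D.depth i = (D.toForest.nodes 0)[i].1 := by
      rw [XMLDocument.depth, XMLForest.depth, List.getD_eq_getElem _ _ hlen]
    rw [hrec1 i hlen, hlab, hdep]
  refine wp_seq (wp_fetch hP (by omega) hc0 ?_)
  intro s3 hF3 ht3 hcost3
  refine wp_seq (wp_fetch hP (by omega) hc0 ?_)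
  intro s4 hF4 ht4 hcost4
  refine wp_seq (wp_fetch hP (by omega) hc0 ?_)
  intro s5 hF5 ht5 hcost5
  refine wp_seq (wp_fetch hP (by omega) hc0 ?_)
  intro s6 hF6 ht6 hcost6
  refine wp_seq (wp_fetch hP (by omega) hc0 ?_)
  intro s7 hF7 ht7 hcost7
  have hr7 : ∀ x, x ≠ 30 → s7.reg x = s2.reg x := by
    intro x hx
    have : ∀ f, (rewind f).writes x = false := fun f => by
      simpa [rewind, VProg.writes] using hx.symm
    rw [hF7.reg x (this _), hF6.reg x (this _), hF5.reg x (this _), hF4.reg x (this _),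
      hF3.reg x (this _)]
  have hf7 : s7.file = s2.file := funext fun f => by
    rw [hF7.file f rfl, hF6.file f rfl, hF5.file f rfl, hF4.file f rfl, hF3.file f rfl]
  have hd7 := hF7.distinct (hF6.distinct (hF5.distinct (hF4.distinct (hF3.distinct hd2))))
  have h37 : s7.reg 3 = D.size := by rw [hr7 3 (by omega), hr2 3 rfl (by omega), hr1 3 rfl, h3]
  have h07 : s7.reg 0 = P.b := by rw [hr7 0 (by omega), hr2 0 rfl (by omega), hr1 0 rfl, h0]
  have h17 : s7.reg 1 = K := by rw [hr7 1 (by omega), hr2 1 rfl (by omega), hr1 1 rfl, h1]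
  refine wp_seq (wp_assign 0 rfl (by omega) (wp_seq (wp_assign 0 rfl (by omega) (wp_seq
    (wp_assign 0 rfl (by omega) (wp_seq (wp_assign 0 rfl (by omega) (wp_seq
      (wp_assign 0 rfl (by omega) ?_)))))))))
  rw [← hf7] at hY
  have hI : LevelInv P D.size D.depth D.labelAt (fun i => s7.file 1 (3 * i + 1)) K e s7.cost 0 0 0
      (((((s7.setReg 10 0).setReg 11 0).setReg 12 0).setReg 14 0).setReg 15 0) :=
    ⟨id, 0, 0, 0, 0, 0, 0, by simp [h07], by simp [h17], by simp [h37], hd7, hY,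
      by simp, by simp, by simp, by simp, by simp, ⟨Nat.zero_le _, fun i hi => by simp⟩, le_rfl,
          le_rfl,
      PartialIndex.empty, fun v => ⟨fun ⟨j, hj, _⟩ => absurd hj (by omega),
          fun h => absurd h.2 (by omega)⟩,
      ⟨fun i hi => absurd hi (by omega), fun v hv h => absurd h (by omega),
        fun i j _ h => absurd h (by omega)⟩,
      hF7.tag 1 (by omega) rfl _ (hF6.tag 1 (by omega) rfl _ (hF5.tag 1 (by omega) rfl _
        (hF4.tag 1 (by omega) rfl _ (hF3.tag 1 (by omega) rfl _ ht21)))), Nat.zero_le _,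
      hF7.tag 2 (by omega) rfl _ (hF6.tag 2 (by omega) rfl _ (hF5.tag 2 (by omega) rfl _
        (hF4.tag 2 (by omega) rfl _ ht3))),
      hF7.tag 3 (by omega) rfl _ (hF6.tag 3 (by omega) rfl _ (hF5.tag 3 (by omega) rfl _ ht4)),
      hF7.tag 5 (by omega) rfl _ (hF6.tag 5 (by omega) rfl _ ht5), Nat.zero_le _,
      hF7.tag 6 (by omega) rfl _ ht6, Nat.zero_le _, ht7, Nat.zero_le _, by simp⟩
  refine wp_levels hP hK hKS (fun v hv => D.exists_parent hv) hN he hI ?_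
  intro t cl c ne h14 h15 hPI hli hcost
  refine hQ t cl c ne h14 h15 hPI hli ?_
  have hsize : D.toForest.size = D.size := rfl
  rw [hsize] at hcost1
  simp only [setReg_cost] at hcost2
  have : D.size / P.b * (30 * e + 20) = D.size / P.b * (20 * e + 16) +
    D.size / P.b * (10 * e + 2) + 2 * (D.size / P.b) := by ring
  omega

end

end ExtMem

namespace ExtMem

open VState VProg

/-! ### The number of IOs -/

/-- If a line is at least a constant fraction of a block, and the fan-in `k` of the merging at least
a root of `M / B`, then the number of line transfers is of the order of `sortIOs`. -/
theorem exists_rounds {m : Params} {N k b : ℕ} (hB : 1 ≤ m.B) (hM : 2 * m.B ≤ m.M) (hN : 1 ≤ N)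
    (hk : 2 ≤ k) (hb : 1 ≤ b) (hBb : m.B ≤ 192 * b) (hMk : m.M ≤ m.B * k ^ 8) :
    ∃ e, N ≤ b * k ^ e ∧
      ((12 * (8 + N / b * (30 * e + 20)) : ℕ) : ℝ) ≤ 1300000 * sortIOs m N := by
  have hB' : (1 : ℝ) ≤ m.B := by exact_mod_cast hB
  have hM' : (2 : ℝ) * m.B ≤ m.M := by exact_mod_cast hM
  have hN' : (1 : ℝ) ≤ N := by exact_mod_cast hN
  have hk' : (2 : ℝ) ≤ k := by exact_mod_cast hk
  have hb' : (1 : ℝ) ≤ b := by exact_mod_cast hb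
  have hBb' : (m.B : ℝ) ≤ 192 * b := by exact_mod_cast hBb
  have hMk' : (m.M : ℝ) ≤ m.B * (k : ℝ) ^ 8 := by exact_mod_cast hMk
  have hB0 : (0 : ℝ) < m.B := by linarith
  set q : ℝ := N / m.B with hq
  set r : ℝ := m.M / m.B with hr
  set x : ℝ := max 1 (Real.logb r q) with hx
  have hq0 : 0 < q := by positivity
  have hr1 : 1 < r := by rw [hr, lt_div_iff₀ hB0]; linarith
  have hx1 : 1 ≤ x := le_max_left _ _
  have hqx : q ≤ r ^ x := (Real.logb_le_iff_le_rpow hr1 hq0).mp (le_max_right _ _)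
  have hrk : r ≤ (k : ℝ) ^ (8 : ℝ) := by
    rw [hr, div_le_iff₀ hB0, mul_comm]; exact_mod_cast hMk
  have hqk : q ≤ (k : ℝ) ^ (8 * x) := by
    rw [Real.rpow_mul (by linarith)]
    exact hqx.trans (Real.rpow_le_rpow (by linarith) hrk (by linarith))
  have h192 : (192 : ℝ) ≤ (k : ℝ) ^ (8 : ℝ) := by
    calc (192 : ℝ) ≤ 2 ^ 8 := by norm_num
      _ ≤ (k : ℝ) ^ 8 := pow_le_pow_left₀ (by norm_num) hk' 8
      _ = (k : ℝ) ^ (8 : ℝ) := by norm_cast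
  have hNB : (N : ℝ) = m.B * q := by rw [hq]; field_simp
  -- `k ^ 8` bounds both the ratio of `B` to `b` and `M / B`
  refine ⟨⌈8 + 8 * x⌉₊, ?_, ?_⟩
  · have : (N : ℝ) ≤ b * (k : ℝ) ^ ⌈8 + 8 * x⌉₊ := by
      calc (N : ℝ) = m.B * q := hNB
        _ ≤ (192 * b) * q := by gcongr
        _ = b * (192 * q) := by ring
        _ ≤ b * ((k : ℝ) ^ (8 : ℝ) * (k : ℝ) ^ (8 * x)) := by gcongr
        _ = b * (k : ℝ) ^ (8 + 8 * x) := by rw [Real.rpow_add (by linarith)]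
        _ ≤ b * (k : ℝ) ^ ((⌈8 + 8 * x⌉₊ : ℕ) : ℝ) := by
          gcongr
          · linarith
          · exact Nat.le_ceil _
        _ = b * (k : ℝ) ^ ⌈8 + 8 * x⌉₊ := by rw [Real.rpow_natCast]
    exact_mod_cast this
  · have hc1 : (1 : ℝ) ≤ (⌈q⌉₊ : ℝ) := by
      exact_mod_cast Nat.one_le_iff_ne_zero.mpr (Nat.ceil_pos.mpr hq0).ne'
    have hqc : q ≤ (⌈q⌉₊ : ℝ) := Nat.le_ceil q
    have he : (⌈8 + 8 * x⌉₊ : ℝ) ≤ 17 * x := by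
      have := Nat.ceil_lt_add_one (a := 8 + 8 * x) (by linarith)
      linarith
    have hlines : ((N / b : ℕ) : ℝ) ≤ 192 * (⌈q⌉₊ : ℝ) := by
      refine Nat.cast_div_le.trans ?_
      rw [div_le_iff₀ (by linarith), hNB]
      nlinarith [mul_le_mul hBb' hqc hq0.le (by linarith)]
    have hs : sortIOs m N = (⌈q⌉₊ : ℝ) * x := rfl
    rw [hs]
    push_cast
    have h1 : (30 * (⌈8 + 8 * x⌉₊ : ℝ) + 20) ≤ 530 * x := by linarith
    have h2 : ((N / b : ℕ) : ℝ) * (30 * (⌈8 + 8 * x⌉₊ : ℝ) + 20) ≤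
        192 * (⌈q⌉₊ : ℝ) * (530 * x) :=
      mul_le_mul hlines h1 (by positivity) (by positivity)
    have h3 : 1 ≤ (⌈q⌉₊ : ℝ) * x := one_le_mul_of_one_le_of_one_le hc1 hx1
    nlinarith

/-! ### The layout of the fast memory -/

/-- The length `b` of lines and the number `S` of slots suit the machine. -/
structure GoodSize (m : Params) (b S : ℕ) : Prop where
  b_pos : 1 ≤ b
  b_le : b ≤ m.B
  S_ge : 16 ≤ S
  slots : S * (3 * b + 3) ≤ 96 + (m.M - m.B)
  B_le : m.B ≤ 192 * b
  M_le : m.M ≤ m.B * (S / 8) ^ 8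

/-- If the fast memory has less than 97 blocks, then sixteen slots for lines of length `B / 32` fit
into it or, if `B` is less than 96, sixteen slots for lines of three words fit into the 96
registers. -/
theorem goodSize_of_lt {m : Params} (hB : 1 ≤ m.B) (hM : 2 * m.B ≤ m.M) (h : m.M < 97 * m.B) :
    GoodSize m (m.B / 96 + if m.B / 96 = 0 then 1 else 0) 16 := by
  have := Nat.div_add_mod m.B 96
  have := Nat.mod_lt m.B (show 96 > 0 by omega)
  refine ⟨?_, ?_, le_rfl, ?_, ?_, by omega⟩ <;> split_ifs <;> omega

theorem goodSize_of_le {m : Params} (hB : 1 ≤ m.B) (h : 97 * m.B ≤ m.M) :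
    GoodSize m m.B ((m.M - m.B) / (6 * m.B)) := by
  have hpos : 0 < 6 * m.B := by omega
  have hS : 16 ≤ (m.M - m.B) / (6 * m.B) := by
    rw [Nat.le_div_iff_mul_le hpos]; omega
  refine ⟨hB, le_rfl, hS, ?_, by omega, ?_⟩
  · calc (m.M - m.B) / (6 * m.B) * (3 * m.B + 3) ≤ (m.M - m.B) / (6 * m.B) * (6 * m.B) :=
          Nat.mul_le_mul_left _ (by omega)
      _ ≤ m.M - m.B := Nat.div_mul_le_self _ _
      _ ≤ _ := by omega
  · set S := (m.M - m.B) / (6 * m.B) with hSdef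
    have h1 : m.M - m.B < 6 * m.B * (S + 1) := Nat.lt_mul_div_succ _ hpos
    have hk : 2 ≤ S / 8 := by omega
    set k := S / 8 with hkdef
    have h2 : S + 1 ≤ 8 * k + 8 := by omega
    have h3 : m.M ≤ m.B * (48 * k + 49) := by
      have := Nat.mul_le_mul_left (6 * m.B) h2
      have e : m.B * (48 * k + 49) = 6 * m.B * (8 * k + 8) + m.B := by ring
      omega
    refine h3.trans (Nat.mul_le_mul_left _ ?_)
    have h4 : 2 ^ 7 ≤ k ^ 7 := Nat.pow_le_pow_left hk 7
    calc 48 * k + 49 ≤ 2 ^ 7 * k := by omega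
      _ ≤ k ^ 7 * k := Nat.mul_le_mul_right _ h4
      _ = k ^ 8 := by ring

/-! ### The program -/

/-- Set the registers that describe the layout, and the variables on which `VProg.index` depends. If
`M / B` is small, then there are sixteen slots for lines that are short in comparison with blocks
(and that fit into the registers set aside if blocks are very small); otherwise lines have the
length of three blocks, and there are as many slots as fit. -/
def setup : Prog :=
  .seq (.ite (.lt (.reg 0) (97 * .reg 1))
    (.seq (.assign 120 (.reg 1 / 96 + .eq (.reg 1 / 96) 0)) (.assign 4 16))
    (.seq (.assign 120 (.reg 1)) (.assign 4 ((.reg 0 - .reg 1) / (6 * .reg 1)))))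
  (.seq (.assign 121 (.reg 4 / 8)) (.seq (.assign 122 (.reg 2)) (.seq (.assign 123 (.reg 2 / 2))
    (.seq (.assign 3 (3 * .reg 120)) (.assign 5 (3 * .reg 123 + 3 + .reg 3))))))

/-- Set the registers that describe the result. -/
def announce : Prog :=
  .seq (.assign 2 (7 * .reg 5)) (.seq (.assign 0 (5 * .reg 5)) (.seq (.assign 1 (6 * .reg 5))
    (.seq (.assign 3 (.reg 134)) (.assign 4 (.reg 135)))))

/-- The configuration of the virtual machine after `setup`. -/
def startState (input : List ℕ) (b S : ℕ) : VState where
  reg := fun x => if x = 0 then b else if x = 1 then S / 8 else if x = 2 then input.length else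
    if x = 3 then input.length / 2 else 0
  aux := fun _ => 0
  file := fun f i => if f = 0 then input.getD i 0 else 0
  tag := fun _ => none
  cost := 0

/-- The cells after the input are zero, so that the files `1` to `7`, which begin after the input,
are empty at first. -/
theorem reach_setup {m : Params} {input : List ℕ} {Q : State → ℕ → Prop} {N : ℕ} (hB : 1 ≤ m.B)
    (hM : 2 * m.B ≤ m.M) (hlen : input.length = 2 * N) (hW : 200 * (N + m.M) ≤ m.W)
    (hin : ∀ t ∈ input, t < m.W)
    (hQ : ∀ b S st, GoodSize m b S → Represents m ⟨m.W, S, b, 3 * N + 3⟩ (3 * N + 3 + 3 * b) st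
      (startState input b S) → Q st 0) :
    Reach m setup Q (initial m input) := by
  have hrep : ∀ b S st, GoodSize m b S → st.mem = (fun _ => 0) → st.ext =
      (fun i => input.getD i 0) →
      st.reg 1 = m.B → st.reg 3 = 3 * b → st.reg 4 = S → st.reg 5 = 3 * N + 3 + 3 * b →
      (∀ x, st.reg (120 + x) = (startState input b S).reg x) → (∀ a < 96, st.reg (20 + a) = 0) →
      Represents m ⟨m.W, S, b, 3 * N + 3⟩ (3 * N + 3 + 3 * b) st (startState input b S) := by
    intro b S st hg hmem hext h1 h3 h4 h5 hvar hreg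
    have hb_le := hg.b_le
    have hslots := hg.slots
    have hS : S * 1 ≤ S * (3 * b + 3) := Nat.mul_le_mul_left _ (by omega)
    have hfm : ∀ a, fm m st a = 0 := fun a => by
      unfold fm
      split_ifs with ha
      · exact hreg a ha
      · rw [hmem]
    refine ⟨h1, h3, h4, h5, hvar, ?_, fun a => by rw [hfm]; omega, fun c => ?_,
      fun σ _ _ => hfm _, fun σ _ f l h => by simp [startState] at h, fun σ _ => rfl,
      fun σ τ f l h => by simp [startState] at h, fun σ _ => hfm _, ?_⟩
    · intro x
      simp only [startState]
      split_ifs <;> omega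
    · rw [hext]
      dsimp only
      rcases lt_or_ge c input.length with hc | hc
      · rw [List.getD_eq_getElem _ _ hc]
        exact hin _ (List.getElem_mem hc)
      · rw [List.getD_eq_default _ _ hc]
        omega
    · intro f hf l hl _ k hk
      rw [hext]
      simp only [startState]
      split_ifs with hf0
      · simp [hf0]
      · refine List.getD_eq_default _ _ ?_
        have : 1 * (3 * N + 3 + 3 * b) * 1 ≤ f * (3 * N + 3 + 3 * b) * m.B :=
          Nat.mul_le_mul (Nat.mul_le_mul_right _ (by omega)) hB
        omega
  have hend : ∀ b S st, GoodSize m b S → st.mem = (fun _ => 0) →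
      st.ext = (fun i => input.getD i 0) → st.reg 1 = m.B → st.reg 2 = input.length →
      st.reg 4 = S → st.reg 120 = b → (∀ x, st.reg (121 + x) = 0) →
          (∀ a < 96, st.reg (20 + a) = 0) →
      Reach m (.seq (.assign 121 (.reg 4 / 8)) (.seq (.assign 122 (.reg 2))
        (.seq (.assign 123 (.reg 2 / 2)) (.seq (.assign 3 (3 * .reg 120))
          (.assign 5 (3 * .reg 123 + 3 + .reg 3)))))) Q st := by
    intro b S st hg hmem hext h1 h2 h4 h120 hvar hreg
    have hb_le := hg.b_le
    have hslots := hg.slots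
    have hS : S * 1 ≤ S * (3 * b + 3) := Nat.mul_le_mul_left _ (by omega)
    refine reach_seq (reach_assign (by simp [h4]; omega) (reach_seq (reach_assign
      (by simp [h2]; omega) (reach_seq (reach_assign (by simp [h2]; omega) (reach_seq (reach_assign
        (by simp [h120]; omega) (reach_assign (by simp [h120, h2]; omega) ?_))))))))
    refine hQ b S _ hg (hrep b S _ hg hmem hext ?_ ?_ ?_ ?_ ?_ ?_)
    · simpa using h1
    · simp [h120]
    · simpa using h4
    · simp [h120, h2]; omega
    · intro x
      match x with
      | 0 => simp [startState, h120]
      | 1 => simp [startState, h4]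
      | 2 => simp [startState, h2]
      | 3 => simp [startState, h2]
      | x + 4 =>
        have := hvar (x + 3)
        simp only [State.setReg_reg, Function.update_apply, startState]
        rw [show 120 + (x + 4) = 121 + (x + 3) by omega]
        repeat rw [if_neg (by omega)]
        exact this
    · intro a ha
      simp only [State.setReg_reg, Function.update_apply]
      repeat rw [if_neg (by omega)]
      exact hreg a ha
  have hzero : ∀ r, 3 ≤ r → (initial m input).reg r = 0 := fun r hr => by
    simp only [initial]
    repeat rw [if_neg (by omega)]
  have h0 : (initial m input).reg 0 = m.M := rfl
  have h1 : (initial m input).reg 1 = m.B := rfl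
  have h2 : (initial m input).reg 2 = input.length := rfl
  refine reach_seq (reach_ite (fun hc => ?_) (fun hc => ?_))
  · simp only [Expr.eval_lt, Expr.eval_mul, Expr.eval_ofNat, Expr.eval_reg, h0, h1, ne_eq,
      ite_eq_right_iff, one_ne_zero, imp_false, not_not] at hc
    have hg := goodSize_of_lt hB hM hc
    have := hg.b_le
    refine reach_seq (reach_assign (by simp only [Expr.eval_add, Expr.eval_div, Expr.eval_eq,
      Expr.eval_ofNat, Expr.eval_reg, h1]; omega) (reach_assign (by simp; omega) ?_))
    simp only [add_zero, zero_add]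
    refine hend _ _ _ hg ?_ ?_ ?_ ?_ ?_ ?_ ?_ ?_
    · rfl
    · rfl
    · simp [h1]
    · simp [h2]
    · simp
    · simp [h1]
    · intro x
      simp only [State.setReg_reg, Function.update_apply]
      rw [if_neg (by omega), if_neg (by omega), hzero _ (by omega)]
    · intro a ha
      simp only [State.setReg_reg, Function.update_apply]
      rw [if_neg (by omega), if_neg (by omega), hzero _ (by omega)]
  · simp only [Expr.eval_lt, Expr.eval_mul, Expr.eval_ofNat, Expr.eval_reg, h0, h1,
      ite_eq_right_iff, one_ne_zero, imp_false, not_lt] at hc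
    have hg := goodSize_of_le hB hc
    have : (m.M - m.B) / (6 * m.B) ≤ m.M - m.B := Nat.div_le_self _ _
    refine reach_seq (reach_assign (by simp [h1]; omega) (reach_assign (by
      simp [h0, h1]; omega) ?_))
    simp only [add_zero, zero_add]
    refine hend _ _ _ hg ?_ ?_ ?_ ?_ ?_ ?_ ?_ ?_
    · rfl
    · rfl
    · simp [h1]
    · simp [h2]
    · simp [h0, h1]
    · simp [h1]
    · intro x
      simp only [State.setReg_reg, Function.update_apply]
      rw [if_neg (by omega), if_neg (by omega), hzero _ (by omega)]
    · intro a ha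
      simp only [State.setReg_reg, Function.update_apply]
      rw [if_neg (by omega), if_neg (by omega), hzero _ (by omega)]

theorem Represents.ext_eq_file {m : Params} {P : VParams} {H : ℕ} {st : State} {s : VState}
    (lay : Layout m P H) (h : Represents m P H st s) (ht : ∀ σ, s.tag σ = none) {f i : ℕ}
    (hf : f < 8) (hi : i < P.cap) : st.ext (f * H * m.B + i) = s.file f i := by
  have hb := lay.b_pos
  have hB := lay.b_le
  have hcap := lay.cap_le
  have hpos : 0 < 3 * P.b := by omega
  have hdm := Nat.div_add_mod' i (3 * P.b)
  have hl : (i / (3 * P.b) + 1) * (3 * P.b) ≤ H * m.B := by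
    have h1 : (i / (3 * P.b) + 1) * (3 * P.b) = i / (3 * P.b) * (3 * P.b) + 3 * P.b := by ring
    have h2 : H * 1 ≤ H * m.B := Nat.mul_le_mul_left _ (by omega)
    omega
  have := h.ext f hf (i / (3 * P.b)) hl (fun σ => by simp [ht]) _ (Nat.mod_lt i hpos)
  rwa [hdm] at this

theorem reach_announce {m : Params} {P : VParams} {H : ℕ} {st : State} {s : VState}
    {Q : State → ℕ → Prop} (lay : Layout m P H) (h : Represents m P H st s)
    (hQ : ∀ st', st'.ext = st.ext → st'.reg 0 = 5 * H → st'.reg 1 = 6 * H → st'.reg 2 = 7 * H →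
      st'.reg 3 = s.reg 14 → st'.reg 4 = s.reg 15 → Q st' 0) : Reach m announce Q st := by
  have hH := lay.H_lt
  have h5 := h.r5
  have h14 : st.reg 134 = s.reg 14 := h.var 14
  have h15 : st.reg 135 = s.reg 15 := h.var 15
  have h14W := h.var_lt 14
  have h15W := h.var_lt 15
  refine reach_seq (reach_assign (by simp [h5]; omega) (reach_seq
    (reach_assign (by simp [h5]; omega) (reach_seq
        (reach_assign (by simp [h5]; omega) (reach_seq (reach_assign (by simp [h14, h14W])
      (reach_assign (by simp [h15, h15W]) (hQ _ rfl ?_ ?_ ?_ ?_ ?_))))))))) <;>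
    simp [h5, h14, h15]

end ExtMem

theorem theorem2 :
    ∃ (P : ExtMem.Prog) (K : ℕ) (C : ℝ),
      ∀ (m : ExtMem.Params) (D : XMLDocument),
        1 ≤ m.B → 2 * m.B ≤ m.M →
        K * (D.size + m.M) ≤ m.W →
        (∀ l ∈ D.labels, l + 1 < m.W) →
        ∃ (s : ExtMem.State) (ios : ℕ) (I : OneIndex D.graph),
          ExtMem.Exec m P (ExtMem.initial m D.tags) s ios ∧
          s.StoresOneIndex m I ∧
          (ios : ℝ) ≤ C * ExtMem.sortIOs m D.size := by
  refine ⟨.seq ExtMem.setup (.seq ExtMem.VProg.index.compile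
      (.seq ExtMem.flushAll ExtMem.announce)),
    200, 1300000, fun m D hB hM hW hlab => ?_⟩
  have hN : 1 ≤ D.size := by
    simp only [XMLDocument.size, XMLDocument.toForest, XMLForest.size]; omega
  have hlen : D.tags.length = 2 * D.size := XMLForest.length_tags _
  have htags : ∀ t ∈ D.tags, t < m.W := fun t ht =>
    D.toForest.lt_of_mem_tags (by omega) hlab ht
  suffices h : ExtMem.Reach m (.seq ExtMem.setup (.seq ExtMem.VProg.index.compile
      (.seq ExtMem.flushAll ExtMem.announce)))
      (fun s ios => ∃ I : OneIndex D.graph, s.StoresOneIndex m I ∧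
        (ios : ℝ) ≤ 1300000 * ExtMem.sortIOs m D.size) (ExtMem.initial m D.tags) by
    obtain ⟨s, ios, hexec, I, hI⟩ := h
    exact ⟨s, ios, I, hexec, hI⟩
  refine ExtMem.reach_seq (ExtMem.reach_setup hB hM hlen hW htags fun b S st hg hrep => ?_)
  obtain ⟨hb, hbB, hS, hslots, hBb, hMk⟩ := hg
  have hSle : S * 1 ≤ S * (3 * b + 3) := Nat.mul_le_mul_left _ (by omega)
  have lay : ExtMem.Layout m ⟨m.W, S, b, 3 * D.size + 3⟩ (3 * D.size + 3 + 3 * b) :=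
    ⟨rfl, hb, hbB, by omega, hslots, le_rfl, by omega, by omega⟩
  obtain ⟨e, he, hios⟩ := ExtMem.exists_rounds hB hM hN (k := S / 8) (by omega) hb hBb hMk
  have hwp := ExtMem.wp_index (s := ExtMem.startState D.tags b S)
    (P := ⟨m.W, S, b, 3 * D.size + 3⟩) (K := S / 8) (e := e) D
    ⟨hb, hS, by dsimp only; omega, by dsimp only; omega, by dsimp only; omega⟩
    (by omega) (by dsimp only; omega) le_rfl he (fun σ τ f l h => by simp [ExtMem.startState] at h)
    rfl rfl rfl (by simp [ExtMem.startState, hlen])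
    (fun i hi => by simp [ExtMem.startState, List.getElem?_eq_getElem hi]) htags
    (fun t cl c ne h14 h15 hPI hall hcost =>
      (⟨cl, c, ne, h14, h15, hPI, hall, hcost⟩ : ∃ cl c ne, t.reg 14 = c ∧ t.reg 15 = ne ∧
        PartialIndex D.size D.depth D.labelAt cl (t.file 5) (t.file 6) (t.file 7) D.size c ne ∧
        (∀ v < D.size, Listed (t.file 5) D.size v) ∧
        t.cost ≤ 0 + 8 + D.size / b * (30 * e + 20)))
  refine ExtMem.reach_seq ((ExtMem.reach_compile lay hwp hrep).mono ?_)
  rintro st1 i1 ⟨t, ⟨cl, c, ne, h14, h15, hPI, hall, hcost⟩, hrep1, hi1⟩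
  have hused : (ExtMem.startState D.tags b S).used ⟨m.W, S, b, 3 * D.size + 3⟩ = 0 := by
    simp [ExtMem.VState.used, ExtMem.startState]
  have hcost0 : (ExtMem.startState D.tags b S).cost = 0 := rfl
  refine ExtMem.reach_seq (ExtMem.reach_flushAll lay hrep1 fun st2 i2 hrep2 hi2 => ?_)
  refine ExtMem.reach_announce lay hrep2 fun st3 hext hr0 hr1 hr2 hr3 hr4 => ?_
  obtain ⟨I, hIn, hIk, hIe, hE, hL, hG⟩ := D.exists_oneIndex hPI hall
  have hc := hPI.c_le
  have hne := hPI.ne_le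
  refine ⟨I, ⟨fun i hi => ?_, fun i hi => ?_, fun i hi => ?_, ?_, ?_⟩, ?_⟩
  · rw [hr0, hext, ← hE i hi]
    refine hrep2.ext_eq_file lay (fun _ => rfl) (by omega) ?_
    simp [List.length_flatMap] at hi
    dsimp only
    omega
  · rw [hr1, hext, ← hL i hi]
    refine hrep2.ext_eq_file lay (fun _ => rfl) (by omega) ?_
    simp at hi
    dsimp only
    omega
  · rw [hr2, hext, ← hG i hi]
    refine hrep2.ext_eq_file lay (fun _ => rfl) (by omega) ?_
    simp [List.length_flatMap] at hi
    dsimp only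
    omega
  · rw [hr3, hIk]; exact h14
  · rw [hr4, hIe]; exact h15
  · refine le_trans ?_ hios
    have : 0 + (i1 + (i2 + 0)) ≤ 12 * (8 + D.size / b * (30 * e + 20)) := by
      rw [hused, hcost0] at hi1
      omega
    exact_mod_cast this
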